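/- Let $\mathbb K$ be a field of characteristic $0$. All graded objects are $\mathbb Z$-graded, $(sL)_n=L_{n-1}$, and $\varepsilon$ denotes Koszul signs in $sL$. **$L_\infty$ algebras.** An $L_\infty$ structure on a graded vector space $L$ is a codifferential on $\Lambda^+sL$, i.e. a family of graded symmetric maps $\delta_k\colon (sL)^{\otimes k}\to sL$ ($k\ge 1$) of degree $-1$ with $\sum_{i}\sum_{\sigma\in S(i,n-i)}\varepsilon\,\delta_{n-i+1}(\delta_i(y_{\sigma(1)},\dots,y_{\sigma(i)}),y_{\sigma(i+1)},\dots,y_{\sigma(n)})=0$ for all $n\ge1$ (shuffles). (The brackets $\ell_k$ are the $\delta_k$ up to suspension and sign, normalized so that $s\ell_k(z,\dots,z)=\delta_k(sz,\dots,sz)$ for $|z|=-1$.) An $L_\infty$ morphism $g\colon L\to M$ is a morphism $\Lambda^+sL\to\Lambda^+sM$ of differential graded coalgebras, given by its graded symmetric degree $0$ components $g_k\colon (sL)^{\otimes k}\to sM$, $k\ge1$. **Mildness.** Let $L,M$ be of finite type (every $L_n$, $M_n$ is finite dimensional). $L$ is *mild* if for each $n$ there are only finitely many $(k;p_1,\dots,p_k)$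 for which $\delta_k$ is non-zero on $(sL)_{p_1}\otimes\cdots\otimes(sL)_{p_k}$ with values in $(sL)_n$. A morphism $g\colon L\to M$ is *mild* if the same holds for its components $g_k$ (with values in $(sM)_n$). **Cochains.** Put $V=(sL)^\sharp$ (graded dual). $\mathcal C^\infty(L)$ is the free graded commutative algebra $\Lambda V$ with the derivation $d=\sum_{k\ge1} d_k$ of degree $+1$, $d_kV\subset\Lambda^kV$, determined by $\langle d_kv;y_1\wedge\dots\wedge y_k\rangle=(-1)^{|v|}\langle v;\delta_k(y_1,\dots,y_k)\rangle$. A mild $g$ induces the algebra morphism $\mathcal C^\infty(g)\colon\mathcal C^\infty(M)\to\mathcal C^\infty(L)$ with $\mathcal C^\infty(g)=\sum_{k\ge 1}\mathcal C^\infty(g)_k$ on generators and $\langle\mathcal C^\infty(g)_kw;y_1\wedge\dots\wedge y_k\rangle=\langle w;g_k(y_1,\dots,y_k)\rangle$. A CDGA is *cofibrant* if CDGA morphisms out of it lift along every surjective quasi-isomorphism of ($\mathbb Z$-graded, unital) CDGAs. **Maurer–Cartan elements.** $\mathrm{MC}(L)$ is the set of $z\in L_{-1}$ with $\delta_k(sz,\dots,sz)=0$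 for $k$ large and $\sum_{k\ge1}\frac1{k!}\delta_k(sz,\dots,sz)=0$; and $s\,\mathrm{MC}(g)(z)=\sum_{k\ge1}\frac1{k!}g_k(sz,\dots,sz)$. **Homotopy.** Let $\mathfrak L$ be the Lawrence–Sullivan construction: the complete free graded Lie algebra on $a,b$ of degree $-1$ and $x$ of degree $0$, with the continuous differential $\partial a=-\frac12[a,a]$, $\partial b=-\frac12[b,b]$, $\partial x=[x,b]+\sum_{n\ge0}\frac{B_n}{n!}\mathrm{ad}_x^n(b-a)$ (with $B_1=-\frac12$), regarded as an $L_\infty$ algebra by $\delta_1(su)=s\partial u$, $\delta_2(su,sv)=(-1)^{|u|+1}s[u,v]$, $\delta_k=0$ for $k\ge3$. A morphism $\varphi\colon\mathfrak L\to L$ is *mild* if for each $n$ there is $N$ such that the component of $\varphi_k$ with values in $(sL)_n$ is zero for $k\ge N$, and for every $k$ vanishes whenever one argument is a series of Lie words of length $\ge N$. For $z_0,z_1\in\mathrm{MC}(L)$ write $z_0\sim z_1$ if there is a mild $L_\infty$ morphism $\varphi\colon\mathfrak L\to L$ with $\mathrm{MC}(\varphi)(a)=z_0$ and $\mathrm{MC}(\varphi)(b)=z_1$,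 and let $\widetilde{\mathrm{MC}}(L)$ be the quotient of $\mathrm{MC}(L)$ by the equivalence relation generated by $\sim$. **Proposition.** Let $g\colon L\to M$ be a mild $L_\infty$ morphism between mild $L_\infty$ algebras of finite type such that $\mathcal C^\infty(L)$ and $\mathcal C^\infty(M)$ are cofibrant CDGAs and $\mathcal C^\infty(g)$ is a quasi-isomorphism. Then $\mathrm{MC}(g)$ maps $\mathrm{MC}(L)$ into $\mathrm{MC}(M)$, it sends homotopic elements to homotopic elements, and the induced map $$\widetilde{\mathrm{MC}}(g)\colon\widetilde{\mathrm{MC}}(L)\longrightarrow\widetilde{\mathrm{MC}}(M)$$ is a bijection. -/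

import Mathlib

open scoped BigOperators Nat

universe u v w

namespace MaurerCartan

/-! ### Signs and tuples -/

/-- The Koszul sign of the rearrangement of graded symbols of degrees `q 0, …, q (n-1)` which sorts
them (stably) by increasing label `c`. -/
def koszulSign (K : Type u) [Field K] {n : ℕ} (q : Fin n → ℤ) (c : Fin n → ℕ) : K :=
  (-1) ^ (∑ a, ∑ b, if a < b ∧ c b < c a then q a * q b else 0)

/-- The Koszul sign `∏_{a<b} (-1)^{q_a q_b}` of the evaluation of `v₁ ⋯ v_k` on `x₁ ∧ ⋯ ∧ x_k`,
where `v_a` and `x_a` have the parity of `q_a`. -/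
def pairingSign (K : Type u) [Field K] {n : ℕ} (q : Fin n → ℤ) : K :=
  (-1) ^ (∑ a, ∑ b, if a < b then q a * q b else 0)

/-- The subtuple of `x` indexed by `S`, in increasing order of the indices. -/
def subTuple {E : Type v} {n : ℕ} (x : Fin n → E) (S : Finset (Fin n)) : Fin S.card → E :=
  fun i => x (S.orderEmbOfFin rfl i)

/-! ### `L∞` algebras and their morphisms

Everything is written on the suspension `sL`, `(sL)_n = L_{n-1}`, without a symbol for `s`: an
element of `L_p` is also regarded as an element of degree `p + 1` of `sL`. -/

/-- The data of an `L∞` algebra: homogeneous components `deg p`, and the components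
`br k : (sL)^k → sL` of the codifferential of `Λ⁺ sL`. The (skew-symmetric) brackets `ℓ_k` are
`s ℓ_k(x₁, …, x_k) = ± br k (s x₁, …, s x_k)`; in degree `-1` the sign is `+`.
The components `deg p` need not span the ambient space `E`; only their elements matter. -/
structure GradedBrackets (K : Type u) [Field K] (E : Type v) [AddCommGroup E] [Module K E] where
  deg : ℤ → Submodule K E
  br : (k : ℕ) → MultilinearMap K (fun _ : Fin k => E) E

/-- An `L∞` algebra: the direct sum of its homogeneous components, with graded symmetric
`br k`, `k ≥ 1`, of degree `-1` on `sL` satisfying the generalized Jacobi identities (the sum over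
`(i, n-i)`-shuffles is the sum over the sets `S` of the first `i` indices). -/
structure LInfinityAlgebra (K : Type u) [Field K] (E : Type v) [AddCommGroup E] [Module K E]
    extends GradedBrackets K E where
  internal : DirectSum.IsInternal deg
  br_zero : br 0 = 0
  br_deg : ∀ (k : ℕ) (p : Fin k → ℤ) (x : Fin k → E), (∀ i, x i ∈ deg (p i)) →
    br k x ∈ deg (∑ i, p i + k - 2)
  br_symm : ∀ (k : ℕ) (p : Fin k → ℤ) (x : Fin k → E), (∀ i, x i ∈ deg (p i)) →
    ∀ σ : Equiv.Perm (Fin k),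
      br k (x ∘ σ) = koszulSign K (fun i => p i + 1) (fun i => (σ.symm i : ℕ)) • br k x
  jacobi : ∀ (n : ℕ) (p : Fin n → ℤ) (x : Fin n → E), (∀ i, x i ∈ deg (p i)) →
    ∑ S : Finset (Fin n), koszulSign K (fun i => p i + 1) (fun i => if i ∈ S then 0 else 1) •
      br (Sᶜ.card + 1) (Matrix.vecCons (br S.card (subTuple x S)) (subTuple x Sᶜ)) = 0

/-- An `L∞` morphism, through the components `map k : (sA)^k → sB`, `k ≥ 1`, graded symmetric of
degree `0`, of a morphism of differential graded coalgebras `Λ sA → Λ sB`. In `morphism`,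
a function `c` is the ordered partition of the indices into the blocks `c⁻¹(0), …, c⁻¹(m-1)`;
empty blocks contribute `0`. -/
structure LInfinityMorphism {K : Type u} [Field K] {E : Type v} [AddCommGroup E] [Module K E]
    {F : Type w} [AddCommGroup F] [Module K F]
    (A : GradedBrackets K E) (B : GradedBrackets K F) where
  map : (k : ℕ) → MultilinearMap K (fun _ : Fin k => E) F
  map_arity_zero : map 0 = 0
  map_deg : ∀ (k : ℕ) (p : Fin k → ℤ) (x : Fin k → E), (∀ i, x i ∈ A.deg (p i)) →
    map k x ∈ B.deg (∑ i, p i + k - 1)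
  map_symm : ∀ (k : ℕ) (p : Fin k → ℤ) (x : Fin k → E), (∀ i, x i ∈ A.deg (p i)) →
    ∀ σ : Equiv.Perm (Fin k),
      map k (x ∘ σ) = koszulSign K (fun i => p i + 1) (fun i => (σ.symm i : ℕ)) • map k x
  morphism : ∀ (n : ℕ) (p : Fin n → ℤ) (x : Fin n → E), (∀ i, x i ∈ A.deg (p i)) →
    ∑ S : Finset (Fin n), koszulSign K (fun i => p i + 1) (fun i => if i ∈ S then 0 else 1) •
      map (Sᶜ.card + 1) (Matrix.vecCons (A.br S.card (subTuple x S)) (subTuple x Sᶜ)) =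
    ∑ m ∈ Finset.range (n + 1), ((m ! : ℕ) : K)⁻¹ • ∑ c : Fin n → Fin m,
      koszulSign K (fun i => p i + 1) (fun i => (c i : ℕ)) •
        B.br m (fun j => map _ (subTuple x (Finset.univ.filter fun i => c i = j)))

/-! ### Mildness -/

/-- Local finiteness of a family of multilinear maps `f k : A^k → B`, with respect to a decreasing
family `U` of tails of `A`: for every degree `n` there is `N` such that the values in degree `n`
vanish as soon as there are at least `N` arguments or some argument lies in the tail `U N`.
If `A / U N` is finite dimensional for all `N`, this says that for each linear form
`v` on `(sB)_{n+1}` all but finitely many `v ∘ f k` are zero and each is a finite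
sum of products of linear forms on `sA` that vanish on some tail. -/
def LocallyFinite {K : Type u} [Field K] {E : Type v} [AddCommGroup E] [Module K E]
    {F : Type w} [AddCommGroup F] [Module K F]
    (A : GradedBrackets K E) (U : ℕ → Set E) (B : GradedBrackets K F)
    (f : (k : ℕ) → MultilinearMap K (fun _ : Fin k => E) F) : Prop :=
  ∀ n : ℤ, ∃ N : ℕ, ∀ (k : ℕ) (p : Fin k → ℤ) (x : Fin k → E), (∀ i, x i ∈ A.deg (p i)) →
    f k x ∈ B.deg n → (N ≤ k ∨ ∃ i, x i ∈ U N) → f k x = 0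

/-- The tails used for a graded vector space of finite type: the components of degree at least
`N` in absolute value. -/
def GradedBrackets.tail {K : Type u} [Field K] {E : Type v} [AddCommGroup E] [Module K E]
    (A : GradedBrackets K E) (N : ℕ) : Set E :=
  {x | ∃ p : ℤ, (N : ℤ) ≤ |p| ∧ x ∈ A.deg p}

/-- Mild `L∞` algebras of finite type. -/
structure MildLInfinityAlgebra (K : Type u) [Field K] (E : Type v) [AddCommGroup E] [Module K E]
    extends LInfinityAlgebra K E where
  finite_type : ∀ n, FiniteDimensional K (deg n)
  mild : LocallyFinite toGradedBrackets toGradedBrackets.tail toGradedBrackets br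

/-- Mild morphisms out of an `L∞` algebra of finite type. -/
def LInfinityMorphism.IsMild {K : Type u} [Field K] {E : Type v} [AddCommGroup E] [Module K E]
    {F : Type w} [AddCommGroup F] [Module K F]
    {A : GradedBrackets K E} {B : GradedBrackets K F} (g : LInfinityMorphism A B) : Prop :=
  LocallyFinite A A.tail B g.map

/-! ### Maurer–Cartan elements -/

/-- `z ∈ L_{-1}` with `br k (z, …, z) = 0` for `k` large and `∑ (1/k!) br k (z, …, z) = 0`. -/
def GradedBrackets.MC {K : Type u} [Field K] {E : Type v} [AddCommGroup E] [Module K E]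
    (A : GradedBrackets K E) : Set E :=
  {z | z ∈ A.deg (-1) ∧ {k : ℕ | A.br k (fun _ => z) ≠ 0}.Finite ∧
    ∑ᶠ k : ℕ, ((k ! : ℕ) : K)⁻¹ • A.br k (fun _ => z) = 0}

/-- `MC(g)(z) = ∑ (1/k!) g^(k)(z, …, z)`, a finite sum for mild `g` and `z` of degree `-1`. -/
noncomputable def LInfinityMorphism.mcMap {K : Type u} [Field K]
    {E : Type v} [AddCommGroup E] [Module K E] {F : Type w} [AddCommGroup F] [Module K F]
    {A : GradedBrackets K E} {B : GradedBrackets K F} (g : LInfinityMorphism A B) (z : E) : F :=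
  ∑ᶠ k : ℕ, ((k ! : ℕ) : K)⁻¹ • g.map k (fun _ => z)

/-! ### The Lawrence–Sullivan construction

It lies in the complete tensor algebra on `a`, `b` (degree `-1`) and `x` (degree `0`), whose
elements are written as functions on words. -/

/-- The generators. -/
inductive Letter : Type
  | a
  | b
  | x
  deriving DecidableEq

instance : Fintype Letter := ⟨{.a, .b, .x}, by intro l; cases l <;> simp⟩

/-- The degree of a generator. -/
def Letter.degree : Letter → ℤ
  | .a => -1
  | .b => -1
  | .x => 0

/-- The degree of a word. -/
def wordDegree (W : List Letter) : ℤ := (W.map Letter.degree).sum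

/-- The complete tensor algebra on the generators, as a vector space. -/
abbrev Series (K : Type u) : Type u := List Letter → K

/-- A generator as a series. -/
def letterSeries (K : Type u) [Field K] (l : Letter) : Series K :=
  fun W => if W = [l] then 1 else 0

/-- The bilinear graded commutator `fg - (-1)^{|f||g|} gf`. -/
def commutator {K : Type u} [Field K] (f g : Series K) : Series K := fun W =>
  ∑ i ∈ Finset.range (W.length + 1), (f (W.take i) * g (W.drop i) -
    (-1) ^ (wordDegree (W.take i) * wordDegree (W.drop i)) * (g (W.take i) * f (W.drop i)))

/-- The linear map `f ↦ (-1)^{|f|} f`. -/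
def parity {K : Type u} [Field K] (f : Series K) : Series K := fun W =>
  (-1) ^ wordDegree W * f W

/-- The differential on generators: `∂a = -½[a,a]`, `∂b = -½[b,b]` and
`∂x = [x,b] + ∑ₙ (Bₙ/n!) ad_xⁿ(b-a)`. The last sum is finite on each word, as `ad_xⁿ(b-a)` consists
of words of length `n + 1`. -/
noncomputable def letterDifferential (K : Type u) [Field K] : Letter → Series K
  | .a => -(2 : K)⁻¹ • commutator (letterSeries K .a) (letterSeries K .a)
  | .b => -(2 : K)⁻¹ • commutator (letterSeries K .b) (letterSeries K .b)
  | .x => fun W => commutator (letterSeries K .x) (letterSeries K .b) W +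
      ∑ n ∈ Finset.range W.length, ((bernoulli n : ℚ) : K) * ((n ! : ℕ) : K)⁻¹ *
        ((commutator (letterSeries K .x))^[n] (letterSeries K .b - letterSeries K .a)) W

/-- The continuous derivation of degree `-1` extending `letterDifferential`: the coefficient at `W`
collects all `W = U M V`, where `M` comes from the differential of a letter `l` of `U l V`. -/
noncomputable def seriesDifferential {K : Type u} [Field K] (f : Series K) : Series K := fun W =>
  ∑ i ∈ Finset.range (W.length + 1), ∑ j ∈ Finset.range (W.length - i + 1), ∑ l : Letter,
    (-1) ^ wordDegree (W.take i) *
      (letterDifferential K l ((W.drop i).take j) * f (W.take i ++ l :: W.drop (i + j)))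

/-- Lie monomials of length `n` in the generators. -/
inductive IsLieMonomial (K : Type u) [Field K] : ℕ → Series K → Prop
  | letter (l : Letter) : IsLieMonomial K 1 (letterSeries K l)
  | bracket {m n : ℕ} {f g : Series K} : IsLieMonomial K m f → IsLieMonomial K n g →
      IsLieMonomial K (m + n) (commutator f g)

/-- The component of word length `n`. -/
def lengthPart {K : Type u} [Field K] (n : ℕ) (f : Series K) : Series K :=
  fun W => if W.length = n then f W else 0

/-- The component of degree `p` of the complete free Lie algebra: homogeneous series of degree `p`
all of whose components of fixed word length lie in the free Lie algebra. -/
def completeLie (K : Type u) [Field K] (p : ℤ) : Submodule K (Series K) where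
  carrier := {f | (∀ W, f W ≠ 0 → wordDegree W = p) ∧
    ∀ n, lengthPart n f ∈ Submodule.span K {g | IsLieMonomial K n g}}
  zero_mem' := by
    refine ⟨fun W h => absurd rfl h, fun n => ?_⟩
    have : lengthPart n (0 : Series K) = 0 := by ext W; simp [lengthPart]
    rw [this]; exact Submodule.zero_mem _
  add_mem' := by
    rintro f g ⟨hf, hf'⟩ ⟨hg, hg'⟩
    refine ⟨fun W h => ?_, fun n => ?_⟩
    · by_cases h0 : f W = 0
      · exact hg W (fun h1 => h (by simp [h0, h1]))
      · exact hf W h0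
    · have : lengthPart n (f + g) = lengthPart n f + lengthPart n g := by
        ext W; simp only [lengthPart, Pi.add_apply]; split_ifs <;> simp
      rw [this]; exact Submodule.add_mem _ (hf' n) (hg' n)
  smul_mem' := by
    rintro c f ⟨hf, hf'⟩
    refine ⟨fun W h => hf W (fun h0 => h (by simp [h0])), fun n => ?_⟩
    have : lengthPart n (c • f) = c • lengthPart n f := by
      ext W; simp only [lengthPart, Pi.smul_apply]; split_ifs <;> simp
    rw [this]; exact Submodule.smul_mem _ _ (hf' n)

/-- `s∂s⁻¹` as a multilinear map of one variable. -/
noncomputable def lsUnary (K : Type u) [Field K] :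
    MultilinearMap K (fun _ : Fin 1 => Series K) (Series K) where
  toFun m := seriesDifferential (m 0)
  map_update_add' := by
    intro _ m i f g
    fin_cases i
    ext W
    simp only [seriesDifferential, Fin.zero_eta, Function.update_self, Pi.add_apply, mul_add,
      Finset.sum_add_distrib]
  map_update_smul' := by
    intro _ m i c f
    fin_cases i
    ext W
    simp only [seriesDifferential, Fin.zero_eta, Function.update_self, Pi.smul_apply, smul_eq_mul,
      Finset.mul_sum]
    refine Finset.sum_congr rfl fun i _ => Finset.sum_congr rfl fun j _ =>
      Finset.sum_congr rfl fun l _ => ?_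
    ring

/-- `(sf, sg) ↦ (-1)^{|f|+1} s[f,g]`. -/
def lsBinary (K : Type u) [Field K] :
    MultilinearMap K (fun _ : Fin 2 => Series K) (Series K) where
  toFun m := -commutator (parity (m 0)) (m 1)
  map_update_add' := by
    intro _ m i f g
    fin_cases i <;> ext W <;>
      simp [commutator, parity, add_mul, mul_add, Finset.sum_add_distrib,
        Function.update] <;> ring
  map_update_smul' := by
    intro _ m i c f
    fin_cases i <;> ext W <;>
      simp [commutator, parity, Function.update] <;>
      rw [← Finset.sum_sub_distrib, ← Finset.sum_sub_distrib, Finset.mul_sum] <;>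
      exact Finset.sum_congr rfl fun _ _ => by ring

/-- The Lawrence–Sullivan construction, a complete differential graded Lie algebra, as an `L∞`
algebra. The ambient space is the complete tensor algebra; the components are those of the complete
free Lie algebra, which are preserved by the operations. As multilinear maps extend
from subspaces, an `L∞` morphism from it is the same as one defined on the components only. -/
noncomputable def lawrenceSullivan (K : Type u) [Field K] : GradedBrackets K (Series K) where
  deg := completeLie K
  br
    | 0 => 0
    | 1 => lsUnary K
    | 2 => lsBinary K
    | _ + 3 => 0

/-- The tails of the complete tensor algebra: series whose words all have length at least `N`. -/
def seriesTail (K : Type u) [Field K] (N : ℕ) : Set (Series K) :=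
  {f | ∀ W : List Letter, W.length < N → f W = 0}

/-! ### Homotopy classes of Maurer–Cartan elements -/

/-- `z₀ ∼ z₁` if there is a mild `L∞` morphism from the Lawrence–Sullivan construction
which sends `a` to `z₀` and `b` to `z₁`. -/
def GradedBrackets.Homotopic {K : Type u} [Field K] {E : Type v} [AddCommGroup E] [Module K E]
    (A : GradedBrackets K E) (z₀ z₁ : E) : Prop :=
  ∃ f : LInfinityMorphism (lawrenceSullivan K) A,
    LocallyFinite (lawrenceSullivan K) (seriesTail K) A f.map ∧
    f.mcMap (letterSeries K .a) = z₀ ∧ f.mcMap (letterSeries K .b) = z₁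

/-- The quotient `MC(A)/∼` by the equivalence relation generated by `∼`. -/
def GradedBrackets.MCTilde {K : Type u} [Field K] {E : Type v} [AddCommGroup E] [Module K E]
    (A : GradedBrackets K E) : Type v :=
  Quot fun z₀ z₁ : A.MC => A.Homotopic (z₀ : E) (z₁ : E)

/-! ### Commutative differential graded algebras -/

/-- An algebra with a family of homogeneous components and a linear endomorphism `d`. -/
structure GradedDiffAlgebra (K : Type u) [Field K] where
  carrier : Type u
  [ring : Ring carrier]
  [algebra : Algebra K carrier]
  gr : ℤ → Submodule K carrier
  d : carrier →ₗ[K] carrier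

attribute [instance] GradedDiffAlgebra.ring GradedDiffAlgebra.algebra

/-- `ℤ`-graded unital commutative differential graded algebras, with `d` of degree `+1`. -/
structure GradedDiffAlgebra.IsCDGA {K : Type u} [Field K] (A : GradedDiffAlgebra K) : Prop where
  internal : DirectSum.IsInternal A.gr
  one_mem : (1 : A.carrier) ∈ A.gr 0
  mul_mem : ∀ (m n : ℤ) (a b : A.carrier), a ∈ A.gr m → b ∈ A.gr n → a * b ∈ A.gr (m + n)
  mul_comm : ∀ (m n : ℤ) (a b : A.carrier), a ∈ A.gr m → b ∈ A.gr n →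
    a * b = (-1 : K) ^ (m * n) • (b * a)
  d_mem : ∀ (n : ℤ) (a : A.carrier), a ∈ A.gr n → A.d a ∈ A.gr (n + 1)
  leibniz : ∀ (n : ℤ) (a b : A.carrier), a ∈ A.gr n →
    A.d (a * b) = A.d a * b + (-1 : K) ^ n • (a * A.d b)
  d_d : ∀ a : A.carrier, A.d (A.d a) = 0

/-- Morphisms: algebra maps of degree `0` commuting with `d`. -/
def IsDGMorphism {K : Type u} [Field K] {A B : GradedDiffAlgebra K}
    (f : A.carrier →ₐ[K] B.carrier) : Prop :=
  (∀ (n : ℤ) (a : A.carrier), a ∈ A.gr n → f a ∈ B.gr n) ∧ ∀ a, f (A.d a) = B.d (f a)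

/-- `f` is injective and surjective in cohomology. -/
def IsCohomologyIso {K : Type u} [Field K] {A B : GradedDiffAlgebra K}
    (f : A.carrier →ₐ[K] B.carrier) : Prop :=
  (∀ a, A.d a = 0 → (∃ b, f a = B.d b) → ∃ a', a = A.d a') ∧
    ∀ b, B.d b = 0 → ∃ a, A.d a = 0 ∧ ∃ b', f a - b = B.d b'

/-- Cofibrant objects for the model structure in which the weak equivalences are the
quasi-isomorphisms and the fibrations are the surjections: morphisms from `A` lift along every
surjective quasi-isomorphism of CDGAs. -/
def GradedDiffAlgebra.IsCofibrant {K : Type u} [Field K] (A : GradedDiffAlgebra K) : Prop :=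
  ∀ B C : GradedDiffAlgebra K, B.IsCDGA → C.IsCDGA →
    ∀ (p : B.carrier →ₐ[K] C.carrier) (f : A.carrier →ₐ[K] C.carrier),
      IsDGMorphism p → Function.Surjective p → IsCohomologyIso p → IsDGMorphism f →
        ∃ h : A.carrier →ₐ[K] B.carrier, IsDGMorphism h ∧ p.comp h = f

/-! ### Free graded commutative algebras and their derivations -/

/-- The relations `vᵢ vⱼ = (-1)^{|vᵢ||vⱼ|} vⱼ vᵢ`. -/
inductive FreeCGA.Rel (K : Type u) [Field K] {G : Type} (q : G → ℤ) :
    FreeAlgebra K G → FreeAlgebra K G → Prop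
  | swap (i j : G) : FreeCGA.Rel K q (FreeAlgebra.ι K i * FreeAlgebra.ι K j)
      ((-1 : K) ^ (q i * q j) • (FreeAlgebra.ι K j * FreeAlgebra.ι K i))

/-- The free graded commutative algebra on generators `vᵢ` of degrees `q i`
(in characteristic zero, where the relations force `vᵢ² = 0` for `q i` odd). -/
abbrev FreeCGA (K : Type u) [Field K] {G : Type} (q : G → ℤ) : Type u := RingQuot (FreeCGA.Rel K q)

namespace FreeCGA

variable {K : Type u} [Field K] {G : Type} (q : G → ℤ)

/-- The generators. -/
noncomputable def gen (i : G) : FreeCGA K q := RingQuot.mkAlgHom K (Rel K q) (FreeAlgebra.ι K i)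

/-- The component of degree `n`, spanned by the monomials of degree `n`. -/
def gr (n : ℤ) : Submodule K (FreeCGA K q) :=
  Submodule.span K {a | ∃ l : List G, (l.map q).sum = n ∧ a = (l.map (gen q)).prod}

theorem gen_mul_gen (i j : G) :
    (gen q i * gen q j : FreeCGA K q) = (-1 : K) ^ (q i * q j) • (gen q j * gen q i) := by
  have h := RingQuot.mkAlgHom_rel K (Rel.swap (K := K) (q := q) i j)
  simpa [gen] using h

theorem mul_gen (n : ℤ) (a : FreeCGA K q) (ha : a ∈ gr q n) (j : G) :
    a * gen q j = (-1 : K) ^ (n * q j) • (gen q j * a) := by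
  induction ha using Submodule.span_induction with
  | mem a ha =>
    obtain ⟨l, rfl, rfl⟩ := ha
    induction l with
    | nil => simp
    | cons i l ih =>
      simp only [List.map_cons, List.prod_cons, List.sum_cons]
      rw [mul_assoc, ih, mul_smul_comm, ← mul_assoc, gen_mul_gen, smul_mul_assoc, smul_smul,
        mul_assoc, ← zpow_add₀ (by simp), add_mul, add_comm]
  | zero => simp
  | add a b _ _ ha hb => rw [add_mul, ha, hb, mul_add, smul_add]
  | smul c a _ ha => rw [smul_mul_assoc, ha, mul_smul_comm, smul_comm]

theorem mul_comm_of_mem (m n : ℤ) (a b : FreeCGA K q) (ha : a ∈ gr q m) (hb : b ∈ gr q n) :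
    a * b = (-1 : K) ^ (m * n) • (b * a) := by
  induction hb using Submodule.span_induction with
  | mem b hb =>
    obtain ⟨l, rfl, rfl⟩ := hb
    induction l with
    | nil => simp
    | cons i l ih =>
      simp only [List.map_cons, List.prod_cons, List.sum_cons]
      rw [← mul_assoc, mul_gen q m a ha, smul_mul_assoc, mul_assoc, ih, mul_smul_comm, smul_smul,
        mul_assoc, ← zpow_add₀ (by simp), mul_add]
  | zero => simp
  | add b c _ _ hb hc => rw [mul_add, hb, hc, add_mul, smul_add]
  | smul c b _ hb => rw [mul_smul_comm, hb, smul_mul_assoc, smul_comm]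

/-- The algebra map determined by the images, of the right degrees, of the generators. -/
noncomputable def lift {H : Type} (r : H → ℤ) (u : (i : G) → gr (K := K) r (q i)) :
    FreeCGA K q →ₐ[K] FreeCGA K r :=
  RingQuot.liftAlgHom K ⟨FreeAlgebra.lift K fun i => (u i : FreeCGA K r), by
    rintro _ _ ⟨i, j⟩
    simp only [map_mul, FreeAlgebra.lift_ι_apply, map_smul]
    exact mul_comm_of_mem r _ _ _ _ (u i).2 (u j).2⟩

/-- The algebra map `a ↦ !![(-1)^{|a|} a, d a; 0, a]` attached to the graded derivation `d` with
`d vᵢ = u i`. -/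
noncomputable def derivationMatrix (u : (i : G) → gr (K := K) q (q i + 1)) :
    FreeCGA K q →ₐ[K] Matrix (Fin 2) (Fin 2) (FreeCGA K q) :=
  RingQuot.liftAlgHom K ⟨FreeAlgebra.lift K fun i =>
    !![(-1 : K) ^ q i • gen q i, (u i : FreeCGA K q); 0, gen q i], by
    rintro _ _ ⟨i, j⟩
    have hne : (-1 : K) ≠ 0 := by simp
    have h1 := gen_mul_gen (K := K) q i j
    have h2 := mul_gen q _ _ (u i).2 j
    have h3 := mul_gen q _ _ (u j).2 i
    rw [add_mul, one_mul, zpow_add₀ hne] at h2 h3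
    rw [mul_comm (q j)] at h3
    have hi : (-1 : K) ^ q i * (-1) ^ q i = 1 := by
      rw [← zpow_add₀ hne]; exact Even.neg_one_zpow ⟨_, rfl⟩
    have hs : (-1 : K) ^ (q i * q j) * (-1) ^ (q i * q j) = 1 := by
      rw [← zpow_add₀ hne]; exact Even.neg_one_zpow ⟨_, rfl⟩
    simp only [map_mul, FreeAlgebra.lift_ι_apply, map_smul]
    generalize (-1 : K) ^ (q i * q j) = s at *
    generalize (-1 : K) ^ q i = si at *
    generalize (-1 : K) ^ q j = sj at *
    have h3' : gen q i * (u j : FreeCGA K q) = (s * si) • ((u j : FreeCGA K q) * gen q i) := by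
      rw [h3, smul_smul, show s * si * (s * si) = s * s * (si * si) by ring, hs, hi]; simp
    ext a b
    fin_cases a <;> fin_cases b
    · simp [Matrix.mul_apply, h1, smul_smul, mul_comm, mul_left_comm]
    · simp only [Matrix.mul_apply, Fin.sum_univ_two, Matrix.smul_apply]
      simp [h2, h3', smul_smul, add_comm]
      rw [show si * (s * si) = si * si * s by ring, hi, one_mul]
    · simp [Matrix.mul_apply]
    · simp [Matrix.mul_apply, h1]⟩

/-- The graded derivation of degree `+1` with `d vᵢ = u i`. -/
noncomputable def derivation (u : (i : G) → gr (K := K) q (q i + 1)) :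
    FreeCGA K q →ₗ[K] FreeCGA K q where
  toFun a := derivationMatrix q u a 0 1
  map_add' a b := by simp
  map_smul' c a := by simp

end FreeCGA

/-! ### The cochain functor -/

namespace MildLInfinityAlgebra

variable {K : Type u} [Field K] {E : Type v} [AddCommGroup E] [Module K E]
  (L : MildLInfinityAlgebra K E)

/-- The index set of a homogeneous basis of `L`: `⟨n, j⟩` is the `j`-th vector of degree `n`. -/
abbrev Index : Type := Σ n : ℤ, Fin (Module.finrank K (L.deg n))

/-- A homogeneous basis of `L`. -/
noncomputable def basis : Module.Basis L.Index K E :=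
  haveI := L.finite_type
  L.internal.collectedBasis fun n => Module.finBasis K (L.deg n)

/-- The degree of the element `v_i` of `(sL)^♯` dual to the basis vector `i`. -/
def dualDegree (i : L.Index) : ℤ := i.1 + 1

theorem basis_mem (i : L.Index) : L.basis i ∈ L.deg i.1 := by
  have := L.finite_type
  exact L.internal.collectedBasis_mem _ i

theorem coord_eq_zero {n : ℤ} {y : E} (hy : y ∈ L.deg n) (m : L.Index) (h : m.1 ≠ n) :
    L.basis.coord m y = 0 := by
  have := L.finite_type
  exact L.internal.collectedBasis_repr_of_mem_ne (fun n => Module.finBasis K (L.deg n)) (a := m.2)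
    h.symm hy

/-- The monomial `v_{I(0)} ⋯ v_{I(k-1)}`. -/
noncomputable def monomial {k : ℕ} (I : Fin k → L.Index) : FreeCGA K L.dualDegree :=
  (List.ofFn fun a => FreeCGA.gen L.dualDegree (I a)).prod

/-- The element `d v_m = ∑_k d_k v_m`, where `d_k v_m ∈ Λ^k V` is determined by
`⟨d_k v; sx₁ ∧ ⋯ ∧ sx_k⟩ = (-1)^{|v|} ⟨v; br k (sx₁, …, sx_k)⟩`, the pairing of a product with a
product being the signed sum over all permutations. -/
noncomputable def dGen (m : L.Index) : FreeCGA K L.dualDegree :=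
  ∑ᶠ t : Σ k : ℕ, Fin k → L.Index,
    ((-1) ^ L.dualDegree m * ((t.1 ! : ℕ) : K)⁻¹ * pairingSign K (fun a => L.dualDegree (t.2 a)) *
      L.basis.coord m (L.br t.1 fun a => L.basis (t.2 a))) • L.monomial t.2

theorem dGen_mem (m : L.Index) :
    L.dGen m ∈ FreeCGA.gr (K := K) L.dualDegree (L.dualDegree m + 1) := by
  refine finsum_induction (· ∈ FreeCGA.gr (K := K) L.dualDegree (L.dualDegree m + 1))
    (Submodule.zero_mem _) (fun _ _ => Submodule.add_mem _) ?_
  rintro ⟨k, I⟩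
  by_cases h : m.1 = ∑ i, (I i).1 + k - 2
  · refine Submodule.smul_mem _ _ (Submodule.subset_span ⟨List.ofFn I, ?_, ?_⟩)
    · simp only [List.map_ofFn, List.sum_ofFn, Function.comp, dualDegree, Finset.sum_add_distrib]
      simp [h]
      ring
    · simp [monomial, List.map_ofFn, Function.comp_def]
  · rw [L.coord_eq_zero (L.br_deg k _ _ fun i => L.basis_mem (I i)) m h]
    simp

/-- The cochain algebra `C^∞(L) = (ΛV, d)`, `V = (sL)^♯`. -/
noncomputable def cochains : GradedDiffAlgebra K where
  carrier := FreeCGA K L.dualDegree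
  gr := FreeCGA.gr L.dualDegree
  d := FreeCGA.derivation L.dualDegree fun m => ⟨L.dGen m, L.dGen_mem m⟩

end MildLInfinityAlgebra

/-- The image of the generator `w_m` under `C^∞(g)`, the sum over `k` of the elements of `Λ^k V`
determined by `⟨C^∞(g)_k w; sx₁ ∧ ⋯ ∧ sx_k⟩ = ⟨w; g^(k)(sx₁, …, sx_k)⟩`. -/
noncomputable def LInfinityMorphism.cochainsGen {K : Type u} [Field K]
    {E : Type v} [AddCommGroup E] [Module K E] {F : Type w} [AddCommGroup F] [Module K F]
    {L : MildLInfinityAlgebra K E} {M : MildLInfinityAlgebra K F}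
    (g : LInfinityMorphism L.toGradedBrackets M.toGradedBrackets) (m : M.Index) :
    FreeCGA K L.dualDegree :=
  ∑ᶠ t : Σ k : ℕ, Fin k → L.Index,
    (((t.1 ! : ℕ) : K)⁻¹ * pairingSign K (fun a => L.dualDegree (t.2 a)) *
      M.basis.coord m (g.map t.1 fun a => L.basis (t.2 a))) • L.monomial t.2

theorem LInfinityMorphism.cochainsGen_mem {K : Type u} [Field K]
    {E : Type v} [AddCommGroup E] [Module K E] {F : Type w} [AddCommGroup F] [Module K F]
    {L : MildLInfinityAlgebra K E} {M : MildLInfinityAlgebra K F}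
    (g : LInfinityMorphism L.toGradedBrackets M.toGradedBrackets) (m : M.Index) :
    g.cochainsGen m ∈ FreeCGA.gr (K := K) L.dualDegree (M.dualDegree m) := by
  refine finsum_induction (· ∈ FreeCGA.gr (K := K) L.dualDegree (M.dualDegree m))
    (Submodule.zero_mem _) (fun _ _ => Submodule.add_mem _) ?_
  rintro ⟨k, I⟩
  by_cases h : m.1 = ∑ i, (I i).1 + k - 1
  · refine Submodule.smul_mem _ _ (Submodule.subset_span ⟨List.ofFn I, ?_, ?_⟩)
    · simp only [List.map_ofFn, List.sum_ofFn, Function.comp, MildLInfinityAlgebra.dualDegree,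
        Finset.sum_add_distrib]
      simp [h]
    · simp [MildLInfinityAlgebra.monomial, List.map_ofFn, Function.comp_def]
  · rw [M.coord_eq_zero (g.map_deg k _ _ fun i => L.basis_mem (I i)) m h]
    simp

/-- `C^∞(g) : C^∞(M) → C^∞(L)`. -/
noncomputable def LInfinityMorphism.cochainsMap {K : Type u} [Field K]
    {E : Type v} [AddCommGroup E] [Module K E] {F : Type w} [AddCommGroup F] [Module K F]
    {L : MildLInfinityAlgebra K E} {M : MildLInfinityAlgebra K F}
    (g : LInfinityMorphism L.toGradedBrackets M.toGradedBrackets) :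
    M.cochains.carrier →ₐ[K] L.cochains.carrier :=
  FreeCGA.lift M.dualDegree L.dualDegree fun m => ⟨g.cochainsGen m, g.cochainsGen_mem m⟩

end MaurerCartan

namespace MaurerCartan

/-! The proof replaces Maurer–Cartan elements by augmentations of cochain algebras and homotopies by
maps into polynomial forms on the interval; the statement then becomes a standard fact about
quasi-isomorphisms of cofibrant CDGAs.

An element `z` of `L_{-1}` is the same as a degree-preserving algebra map `C^∞(L) → K`, and this map
kills the image of `d` exactly when `z` satisfies the Maurer–Cartan equation (`isAugmentation_iff`,
`exists_augmentation_eq`). Under this dictionary `MC(g)` is precomposition with `C^∞(g)`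
(`augmentation_comp`). The signs are handled once and for all by evaluating cochains on lists of
homogeneous elements. This evaluation is an algebra map to a shuffle algebra, it is faithful in
characteristic zero, and it turns `d` into the insertion of brackets (`evaluation_injective`,
`evaluation_derivation`). Thus `d² = 0` is the Jacobi identity and `C^∞(g) d = d C^∞(g)` is the
morphism equation.

The core is `homotopic_iff`: if `C^∞(L)` is cofibrant, then `z₀ ∼ z₁` if and only if the two
augmentations are joined by a CDGA morphism `C^∞(L) → Λ(t, dt)`.

From left to right, the Lawrence–Sullivan algebra carries a path `z(τ)` of flat elements from `a` to
`b`, the solution of `z' = ∂x - [x, z]`. It reaches `b` at time one because `(1 - e^{-u})/u` is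
inverse to `u + ∑ Bₙ uⁿ/n!` (`pathSeries_mul_bernoulli`), and it is flat because its curvature
satisfies a linear equation and vanishes at both ends (`d_dLetter_x`, `d_path`). A mild morphism `f`
turns the path into polynomials: the generator `v` goes to `W(t) + Y(t) dt`, where `W(τ)` is the
`v`-coordinate of `∑ f(z(τ), …, z(τ))/j!` and `Y(τ)` is that of `∑ f(x, z(τ), …, z(τ))/j!`.
Compatibility with `d` is tested at each `τ` (`augmentationHomotopic_of_homotopic`).

From right to left, an `L∞` morphism out of the Lawrence–Sullivan algebra has no component of arity
zero, so the right target is not the interval but the interval with a disjoint base point, `K × Λ(t,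
dt)`. The free algebra `Λ(e, w, t, dt)` with `dw = ½(e - e²)` maps onto it by a quasi-isomorphism
(`modelProj_isCohomologyIso`). Its four generators are realized by explicit linear forms on series,
compatibly with the differentials (`seriesEval_cylGen`). By cofibrancy a homotopy, paired with the
augmentation of the Maurer–Cartan element `0`, lifts to this model; the coefficients of the lift are
the components of the required mild morphism (`homotopic_of_augmentationHomotopic`).

Finally, let `f : A' → A` be a quasi-isomorphism with `A` cofibrant. Adjoining contractible pairs to
`A'` makes `f` surjective, and a section yields a quasi-isomorphism `h : A → A'` with `e ∘ f ∘ h`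
homotopic to `e` for every augmentation `e` (`exists_homotopy_inverse`). Applying this to `C^∞(g)`
and then to its inverse `h` shows that the induced map on classes is bijective
(`pullbackClass_bijective`). Only the generators of the equivalence relation are ever compared, so
transitivity of homotopy plays no role. -/

theorem neg_one_zpow_add {K : Type u} [Field K] (a b : ℤ) :
    (-1 : K) ^ (a + b) = (-1) ^ a * (-1) ^ b :=
  zpow_add₀ (by simp) a b

theorem neg_one_zpow_mul_self {K : Type u} [Field K] (a : ℤ) :
    (-1 : K) ^ a * (-1) ^ a = 1 := by
  rw [← neg_one_zpow_add]; exact Even.neg_one_zpow ⟨_, rfl⟩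

theorem neg_one_zpow_sub {K : Type u} [Field K] (a b : ℤ) :
    (-1 : K) ^ (a - b) = (-1) ^ a * (-1) ^ b := by
  rw [show a - b = a + b - (b + b) by ring, zpow_sub₀ (by simp), neg_one_zpow_add,
    neg_one_zpow_add b b, neg_one_zpow_mul_self, div_one]

theorem neg_one_zpow_ne_zero {K : Type u} [Field K] (a : ℤ) : (-1 : K) ^ a ≠ 0 :=
  zpow_ne_zero _ (by simp)

/-! ### Free graded commutative algebras: induction, grading, derivations -/

namespace FreeCGA

section Basic

variable {K : Type u} [Field K] {G : Type} {q : G → ℤ}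

/-- The property "`P y` implies `P (y * x)` for all `y`" is stable under sums and products in `x`,
so it passes from the generators to all of the free algebra. -/
theorem induction {P : FreeCGA K q → Prop} (one : P 1) (add : ∀ a b, P a → P b → P (a + b))
    (smul : ∀ (c : K) a, P a → P (c • a)) (mul_gen : ∀ a i, P a → P (a * gen q i))
    (a : FreeCGA K q) : P a := by
  obtain ⟨x, rfl⟩ := RingQuot.mkAlgHom_surjective K (Rel K q) a
  suffices h : ∀ y, P y → P (y * RingQuot.mkAlgHom K (Rel K q) x) by simpa using h 1 one
  induction x using FreeAlgebra.induction with
  | grade0 r =>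
    intro y hy
    rw [AlgHom.commutes, ← Algebra.commutes, ← Algebra.smul_def]
    exact smul r y hy
  | grade1 i => exact fun y hy => mul_gen y i hy
  | mul a b ha hb =>
    intro y hy
    rw [map_mul, ← mul_assoc]
    exact hb _ (ha _ hy)
  | add a b ha hb =>
    intro y hy
    rw [map_add, mul_add]
    exact add _ _ (ha _ hy) (hb _ hy)

theorem algHom_ext {R : Type*} [Ring R] [Algebra K R] {f f' : FreeCGA K q →ₐ[K] R}
    (h : ∀ i, f (gen q i) = f' (gen q i)) : f = f' := by
  refine AlgHom.ext fun a => ?_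
  induction a using induction with
  | one => simp
  | add a b ha hb => simp [ha, hb]
  | smul c a ha => simp [ha]
  | mul_gen a i ha => simp [ha, h]

variable (q) in
/-- The algebra map determined by the images of the generators. -/
noncomputable def liftOf {R : Type*} [Ring R] [Algebra K R] (x : G → R)
    (h : ∀ i j, x i * x j = (-1 : K) ^ (q i * q j) • (x j * x i)) : FreeCGA K q →ₐ[K] R :=
  RingQuot.liftAlgHom K ⟨FreeAlgebra.lift K x, by
    rintro _ _ ⟨i, j⟩
    simpa using h i j⟩

@[simp]
theorem liftOf_gen {R : Type*} [Ring R] [Algebra K R] (x : G → R)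
    (h : ∀ i j, x i * x j = (-1 : K) ^ (q i * q j) • (x j * x i)) (i : G) :
    liftOf q x h (gen q i) = x i := by
  simp [liftOf, gen]

@[simp]
theorem lift_gen {H : Type} (r : H → ℤ) (u : (i : G) → gr (K := K) r (q i)) (i : G) :
    lift q r u (gen q i) = u i := by
  simp [lift, gen]

theorem gen_mem (i : G) : gen q i ∈ gr (K := K) q (q i) :=
  Submodule.subset_span ⟨[i], by simp, by simp⟩

theorem one_mem : (1 : FreeCGA K q) ∈ gr (K := K) q 0 :=
  Submodule.subset_span ⟨[], by simp, by simp⟩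

theorem mul_mem {m n : ℤ} {a b : FreeCGA K q} (ha : a ∈ gr q m) (hb : b ∈ gr q n) :
    a * b ∈ gr q (m + n) := by
  induction ha using Submodule.span_induction with
  | mem a ha =>
    induction hb using Submodule.span_induction with
    | mem b hb =>
      obtain ⟨l, rfl, rfl⟩ := ha
      obtain ⟨l', rfl, rfl⟩ := hb
      exact Submodule.subset_span ⟨l ++ l', by simp, by simp⟩
    | zero => simp
    | add b c _ _ hb hc => rw [mul_add]; exact Submodule.add_mem _ hb hc
    | smul c b _ hb => rw [mul_smul_comm]; exact Submodule.smul_mem _ _ hb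
  | zero => simp
  | add a c _ _ ha hc => rw [add_mul]; exact Submodule.add_mem _ ha hc
  | smul c a _ ha => rw [smul_mul_assoc]; exact Submodule.smul_mem _ _ ha

/-- Induction on elements of a homogeneous component. -/
theorem gr_induction {P : ∀ (n : ℤ) (a : FreeCGA K q), a ∈ gr q n → Prop}
    (one : P 0 1 one_mem) (zero : ∀ n, P n 0 (Submodule.zero_mem _))
    (add : ∀ n a b ha hb, P n a ha → P n b hb → P n (a + b) (Submodule.add_mem _ ha hb))
    (smul : ∀ n (c : K) a ha, P n a ha → P n (c • a) (Submodule.smul_mem _ c ha))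
    (mul_gen : ∀ n a i ha, P n a ha → P (n + q i) (a * gen q i) (mul_mem ha (gen_mem i)))
    {n : ℤ} {a : FreeCGA K q} (ha : a ∈ gr q n) : P n a ha := by
  induction ha using Submodule.span_induction with
  | mem a ha =>
    obtain ⟨l, rfl, rfl⟩ := ha
    induction l using List.reverseRecOn with
    | nil => simpa using one
    | append_singleton l i ih =>
      simp only [List.map_append, List.map_cons, List.map_nil, List.sum_append, List.prod_append,
        List.sum_singleton, List.prod_singleton]
      exact mul_gen _ _ _ (Submodule.subset_span ⟨l, rfl, rfl⟩) ih
  | zero => exact zero _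
  | add a b _ _ ha hb => exact add _ _ _ _ _ ha hb
  | smul c a _ ha => exact smul _ _ _ _ ha

theorem monomial_induction {P : FreeCGA K q → Prop} (monomial : ∀ l : List G, P (l.map (gen q)).prod)
    (add : ∀ a b, P a → P b → P (a + b)) (smul : ∀ (c : K) a, P a → P (c • a))
    (a : FreeCGA K q) : P a := by
  have : a ∈ Submodule.span K (Set.range fun l : List G => (l.map (gen (K := K) q)).prod) := by
    induction a using induction with
    | one => exact Submodule.subset_span ⟨[], by simp⟩
    | add a b ha hb => exact Submodule.add_mem _ ha hb
    | smul c a ha => exact Submodule.smul_mem _ _ ha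
    | mul_gen a i ha =>
      induction ha using Submodule.span_induction with
      | mem a ha => obtain ⟨l, rfl⟩ := ha; exact Submodule.subset_span ⟨l ++ [i], by simp⟩
      | zero => simp
      | add a b _ _ ha hb => rw [add_mul]; exact Submodule.add_mem _ ha hb
      | smul c a _ ha => rw [smul_mul_assoc]; exact Submodule.smul_mem _ _ ha
  induction this using Submodule.span_induction with
  | mem a ha => obtain ⟨l, rfl⟩ := ha; exact monomial l
  | zero => simpa using smul 0 _ (monomial [])
  | add a b _ _ ha hb => exact add _ _ ha hb
  | smul c a _ ha => exact smul _ _ ha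

theorem iSup_gr : ⨆ n, gr (K := K) q n = ⊤ := by
  rw [eq_top_iff]
  rintro a -
  induction a using monomial_induction with
  | monomial l => exact Submodule.mem_iSup_of_mem _ (Submodule.subset_span ⟨l, rfl, rfl⟩)
  | add a b ha hb => exact Submodule.add_mem _ ha hb
  | smul c a ha => exact Submodule.smul_mem _ _ ha

/-- Two linear maps agree if they agree on homogeneous elements. -/
theorem linearMap_ext_gr {R : Type*} [AddCommGroup R] [Module K R] {f f' : FreeCGA K q →ₗ[K] R}
    (h : ∀ n, ∀ a ∈ gr q n, f a = f' a) : f = f' := by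
  ext a
  have ha : a ∈ ⨆ n, gr (K := K) q n := by rw [iSup_gr]; trivial
  induction ha using Submodule.iSup_induction' with
  | mem n a ha => exact h n a ha
  | zero => simp
  | add a b _ _ ha hb => simp [ha, hb]

/-! ### Weight derivations -/

variable (K q) in
/-- The algebra map `a ↦ !![a, N a; 0, a]` attached to the derivation `N vᵢ = wᵢ vᵢ`. -/
noncomputable def weightMatrix (wt : G → ℤ) :
    FreeCGA K q →ₐ[K] Matrix (Fin 2) (Fin 2) (FreeCGA K q) :=
  liftOf q (fun i => !![gen q i, (wt i : K) • gen q i; 0, gen q i]) fun i j => by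
    have h1 := gen_mul_gen (K := K) q i j
    ext a b
    fin_cases a <;> fin_cases b
    · simp [Matrix.mul_apply, h1]
    · simp only [Matrix.mul_apply, Fin.sum_univ_two, Matrix.smul_apply]
      simp [h1]
      simp only [smul_smul, ← add_smul]
      congr 1
      ring
    · simp [Matrix.mul_apply]
    · simp [Matrix.mul_apply, h1]

variable (K q) in
/-- The derivation of degree zero with `N vᵢ = wᵢ vᵢ`. -/
noncomputable def weightDerivation (wt : G → ℤ) : FreeCGA K q →ₗ[K] FreeCGA K q where
  toFun a := weightMatrix K q wt a 0 1
  map_add' a b := by simp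
  map_smul' c a := by simp

theorem weightMatrix_diag (wt : G → ℤ) (a : FreeCGA K q) :
    weightMatrix K q wt a 0 0 = a ∧ weightMatrix K q wt a 1 1 = a ∧
      weightMatrix K q wt a 1 0 = 0 := by
  induction a using induction with
  | one => simp
  | add a b ha hb => simp [ha, hb]
  | smul c a ha => simp [ha]
  | mul_gen a i ha => 
    have h : weightMatrix K q wt (gen q i) = !![gen q i, (wt i : K) • gen q i; 0, gen q i] :=
      liftOf_gen _ _ i
    simp [ha, Matrix.mul_apply, h]

theorem weightDerivation_mul (wt : G → ℤ) (a b : FreeCGA K q) :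
    weightDerivation K q wt (a * b) =
      weightDerivation K q wt a * b + a * weightDerivation K q wt b := by
  have ha := weightMatrix_diag wt a
  have hb := weightMatrix_diag wt b
  simp [weightDerivation, Matrix.mul_apply, ha, hb, add_comm]

@[simp]
theorem weightDerivation_gen (wt : G → ℤ) (i : G) :
    weightDerivation K q wt (gen q i) = (wt i : K) • gen q i := by
  simp [weightDerivation, weightMatrix]

@[simp]
theorem weightDerivation_one (wt : G → ℤ) : weightDerivation K q wt 1 = 0 := by
  simp [weightDerivation]

theorem weightDerivation_monomial (wt : G → ℤ) (l : List G) :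
    weightDerivation K q wt (l.map (gen q)).prod =
      (((l.map wt).sum : ℤ) : K) • (l.map (gen q)).prod := by
  induction l with
  | nil => simp
  | cons i l ih =>
    simp only [List.map_cons, List.prod_cons, List.sum_cons]
    rw [weightDerivation_mul, ih, weightDerivation_gen]
    simp [add_smul]

theorem gr_le_eigenspace (n : ℤ) :
    gr (K := K) q n ≤ Module.End.eigenspace (weightDerivation K q q) (n : K) := by
  refine Submodule.span_le.2 ?_
  rintro _ ⟨l, rfl, rfl⟩
  exact Module.End.mem_eigenspace_iff.2 (weightDerivation_monomial q l)

/-- The component of degree `n` lies in the eigenspace for `n` of the derivation which multiplies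
each generator by its degree. In characteristic zero distinct integers are distinct eigenvalues, so
the components are independent. -/
theorem isInternal_gr [CharZero K] : DirectSum.IsInternal (gr (K := K) q) := by
  rw [DirectSum.isInternal_submodule_iff_iSupIndep_and_iSup_eq_top]
  exact ⟨((Module.End.eigenspaces_iSupIndep (weightDerivation K q q)).comp
    (Int.cast_injective (α := K))).mono gr_le_eigenspace, iSup_gr⟩

/-! ### The derivation of degree one -/

theorem derivationMatrix_lower (u : (i : G) → gr (K := K) q (q i + 1)) (a : FreeCGA K q) :
    derivationMatrix q u a 1 1 = a ∧ derivationMatrix q u a 1 0 = 0 := by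
  induction a using induction with
  | one => simp
  | add a b ha hb => simp [ha, hb]
  | smul c a ha => simp [ha]
  | mul_gen a i ha => 
    have h : derivationMatrix q u (gen q i) =
        !![(-1 : K) ^ q i • gen q i, (u i : FreeCGA K q); 0, gen q i] := by
      simp [derivationMatrix, gen]
    simp [ha, Matrix.mul_apply, h]

theorem derivationMatrix_upper (u : (i : G) → gr (K := K) q (q i + 1)) {n : ℤ} {a : FreeCGA K q}
    (ha : a ∈ gr q n) : derivationMatrix q u a 0 0 = (-1 : K) ^ n • a := by
  induction ha using gr_induction with
  | one => simp
  | zero => simp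
  | add n a b _ _ ha hb => simp [ha, hb]
  | smul n c a _ ha => rw [map_smul, Matrix.smul_apply, ha, smul_comm]
  | mul_gen n a i _ ha =>
    have h0 : derivationMatrix q u (gen q i) 1 0 = 0 := (derivationMatrix_lower u _).2
    have h1 : derivationMatrix q u (gen q i) 0 0 = (-1 : K) ^ q i • gen q i := by
      simp [derivationMatrix, gen]
    rw [map_mul, Matrix.mul_apply, Fin.sum_univ_two, ha, h0, h1, neg_one_zpow_add]
    simp [smul_smul, mul_comm]

@[simp]
theorem derivation_gen (u : (i : G) → gr (K := K) q (q i + 1)) (i : G) :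
    derivation q u (gen q i) = u i := by
  simp [derivation, derivationMatrix, gen]

@[simp]
theorem derivation_one (u : (i : G) → gr (K := K) q (q i + 1)) : derivation q u 1 = 0 := by
  simp [derivation]

/-- This is the upper right entry of a product of triangular matrices whose diagonal entries are
`(-1)^{|a|} a` and `a`. -/
theorem derivation_mul (u : (i : G) → gr (K := K) q (q i + 1)) {n : ℤ} {a : FreeCGA K q}
    (ha : a ∈ gr q n) (b : FreeCGA K q) :
    derivation q u (a * b) = derivation q u a * b + (-1 : K) ^ n • (a * derivation q u b) := by
  have h1 := derivationMatrix_lower u b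
  simp [derivation, Matrix.mul_apply, derivationMatrix_upper u ha, h1, add_comm]

theorem derivation_mem (u : (i : G) → gr (K := K) q (q i + 1)) {n : ℤ} {a : FreeCGA K q}
    (ha : a ∈ gr q n) : derivation q u a ∈ gr q (n + 1) := by
  induction ha using gr_induction with
  | one => simp
  | zero => simp
  | add n a b _ _ ha hb => simpa using Submodule.add_mem _ ha hb
  | smul n c a _ ha => simpa using Submodule.smul_mem _ _ ha
  | mul_gen n a i h ha =>
    rw [derivation_mul u h, derivation_gen]
    refine Submodule.add_mem _ ?_ (Submodule.smul_mem _ _ ?_)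
    · rw [show n + q i + 1 = n + 1 + q i by ring]
      exact mul_mem ha (gen_mem i)
    · rw [add_assoc]; exact mul_mem h (u i).2

end Basic

end FreeCGA

/-! ### Free differential algebras and morphisms out of them -/

open FreeCGA

/-- The free graded commutative algebra with the derivation `d vᵢ = u i`. -/
noncomputable abbrev freeDGA {K : Type u} [Field K] {G : Type} (q : G → ℤ)
    (u : (i : G) → gr (K := K) q (q i + 1)) : GradedDiffAlgebra K where
  carrier := FreeCGA K q
  gr := FreeCGA.gr q
  d := FreeCGA.derivation q u

section FreeDGA

variable {K : Type u} [Field K] {G : Type} {q : G → ℤ} {u : (i : G) → gr (K := K) q (q i + 1)}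

/-- The square of an odd derivation is again a derivation, the two mixed terms having opposite
signs; hence it vanishes once it vanishes on the generators. -/
theorem derivation_derivation (h : ∀ i, derivation q u (u i) = 0) (a : FreeCGA K q) :
    derivation q u (derivation q u a) = 0 := by
  have : (derivation q u).comp (derivation q u) = 0 := by
    refine linearMap_ext_gr fun n a ha => ?_
    induction ha using gr_induction with
    | one => simp
    | zero => simp
    | add n a b _ _ ha hb =>
      rw [map_add, ha, hb]; simp
    | smul n c a _ ha => rw [map_smul, ha]; simp
    | mul_gen n a i hn ha =>
      simp only [LinearMap.comp_apply, LinearMap.zero_apply] at ha ⊢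
      rw [derivation_mul u hn, map_add, map_smul, derivation_mul u (derivation_mem u hn),
        derivation_mul u hn, ha, derivation_gen, h, neg_one_zpow_add]
      simp only [zero_mul, mul_zero, smul_zero, add_zero, zpow_one]
      module
  exact LinearMap.congr_fun this a

theorem freeDGA_isCDGA [CharZero K] (h : ∀ i, derivation q u (u i) = 0) :
    (freeDGA q u).IsCDGA where
  internal := isInternal_gr
  one_mem := FreeCGA.one_mem
  mul_mem _ _ _ _ := FreeCGA.mul_mem
  mul_comm := mul_comm_of_mem q
  d_mem _ _ := derivation_mem u
  leibniz _ _ b ha := derivation_mul u ha b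
  d_d := derivation_derivation h

theorem GradedDiffAlgebra.IsCDGA.d_one {C : GradedDiffAlgebra K} (hC : C.IsCDGA) :
    C.d 1 = 0 := by
  have := hC.leibniz 0 1 1 hC.one_mem
  simpa using this

/-- The algebra map from a free graded commutative algebra to a CDGA. -/
noncomputable def liftDGA {C : GradedDiffAlgebra K} (hC : C.IsCDGA) (q : G → ℤ) (x : G → C.carrier)
    (hx : ∀ i, x i ∈ C.gr (q i)) : FreeCGA K q →ₐ[K] C.carrier :=
  liftOf q x fun i j => hC.mul_comm _ _ _ _ (hx i) (hx j)

@[simp]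
theorem liftDGA_gen {C : GradedDiffAlgebra K} (hC : C.IsCDGA) (x : G → C.carrier)
    (hx : ∀ i, x i ∈ C.gr (q i)) (i : G) : liftDGA hC q x hx (gen q i) = x i :=
  liftOf_gen _ _ i

/-- Both `f ∘ d` and `d ∘ f` are derivations along `f`, so they agree everywhere as soon as they
agree on generators. -/
theorem isDGMorphism_of_gen {C : GradedDiffAlgebra K} (hC : C.IsCDGA)
    (f : FreeCGA K q →ₐ[K] C.carrier) (h : ∀ i, f (gen q i) ∈ C.gr (q i))
    (hd : ∀ i, f (u i) = C.d (f (gen q i))) : IsDGMorphism (A := freeDGA q u) (B := C) f := by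
  have h1 : ∀ (n : ℤ) (a : FreeCGA K q), a ∈ gr q n → f a ∈ C.gr n := by
    intro n a ha
    induction ha using gr_induction with
    | one => simpa using hC.one_mem
    | zero => simp
    | add n a b _ _ ha hb => simpa using Submodule.add_mem _ ha hb
    | smul n c a _ ha => simpa using Submodule.smul_mem _ _ ha
    | mul_gen n a i _ ha => rw [map_mul]; exact hC.mul_mem _ _ _ _ ha (h i)
  refine ⟨h1, fun a => ?_⟩
  have : f.toLinearMap.comp (derivation q u) = C.d.comp f.toLinearMap := by
    refine linearMap_ext_gr fun n a ha => ?_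
    induction ha using gr_induction with
    | one => simp [hC.d_one]
    | zero => simp
    | add n a b _ _ ha hb => rw [map_add, map_add, ha, hb]
    | smul n c a _ ha => rw [map_smul, map_smul, ha]
    | mul_gen n a i hn ha =>
      simp only [LinearMap.comp_apply, AlgHom.toLinearMap_apply] at ha ⊢
      rw [derivation_mul u hn, map_mul, hC.leibniz _ _ _ (h1 _ _ hn), map_add, map_smul, map_mul,
        map_mul, ha, derivation_gen, hd]
  exact LinearMap.congr_fun this a

end FreeDGA

theorem IsDGMorphism.comp {K : Type u} [Field K] {A B C : GradedDiffAlgebra K}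
    {f : A.carrier →ₐ[K] B.carrier} {g : B.carrier →ₐ[K] C.carrier}
    (hg : IsDGMorphism g) (hf : IsDGMorphism f) : IsDGMorphism (A := A) (B := C) (g.comp f) :=
  ⟨fun n a ha => hg.1 n _ (hf.1 n a ha), fun a => by simp [hf.2, hg.2]⟩

/-! ### Graded derivations of degree -1 -/

namespace FreeCGA

section Antiderivation

variable {K : Type u} [Field K] {G : Type} {q : G → ℤ}

variable (q) in
/-- The algebra map `a ↦ !![(-1)^{|a|} a, ι a; 0, a]` attached to the graded derivation `ι` of
degree `-1` with `ι vᵢ = u i`. -/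
noncomputable def antiderivationMatrix (u : (i : G) → gr (K := K) q (q i - 1)) :
    FreeCGA K q →ₐ[K] Matrix (Fin 2) (Fin 2) (FreeCGA K q) :=
  liftOf q (fun i => !![(-1 : K) ^ q i • gen q i, (u i : FreeCGA K q); 0, gen q i]) fun i j => by
    have h1 := gen_mul_gen (K := K) q i j
    have h2 := mul_gen q _ _ (u i).2 j
    have h3 := mul_gen q _ _ (u j).2 i
    rw [sub_mul, one_mul, neg_one_zpow_sub] at h2 h3
    rw [mul_comm (q j)] at h3
    have hi : (-1 : K) ^ q i * (-1) ^ q i = 1 := neg_one_zpow_mul_self _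
    have hs : (-1 : K) ^ (q i * q j) * (-1) ^ (q i * q j) = 1 := neg_one_zpow_mul_self _
    generalize (-1 : K) ^ (q i * q j) = s at *
    generalize (-1 : K) ^ q i = si at *
    generalize (-1 : K) ^ q j = sj at *
    have h3' : gen q i * (u j : FreeCGA K q) = (s * si) • ((u j : FreeCGA K q) * gen q i) := by
      rw [h3, smul_smul, show s * si * (s * si) = s * s * (si * si) by ring, hs, hi]; simp
    ext a b
    fin_cases a <;> fin_cases b
    · simp [Matrix.mul_apply, h1, smul_smul, mul_comm, mul_left_comm]
    · simp only [Matrix.mul_apply, Fin.sum_univ_two, Matrix.smul_apply]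
      simp [h2, h3', smul_smul, add_comm]
      rw [show si * (s * si) = si * si * s by ring, hi, one_mul]
    · simp [Matrix.mul_apply]
    · simp [Matrix.mul_apply, h1]

variable (q) in
/-- The graded derivation of degree `-1` with `ι vᵢ = u i`. -/
noncomputable def antiderivation (u : (i : G) → gr (K := K) q (q i - 1)) :
    FreeCGA K q →ₗ[K] FreeCGA K q where
  toFun a := antiderivationMatrix q u a 0 1
  map_add' a b := by simp
  map_smul' c a := by simp

variable (u : (i : G) → gr (K := K) q (q i - 1))

theorem antiderivationMatrix_gen (i : G) : antiderivationMatrix q u (gen q i) =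
    !![(-1 : K) ^ q i • gen q i, (u i : FreeCGA K q); 0, gen q i] :=
  liftOf_gen _ _ i

theorem antiderivationMatrix_lower (a : FreeCGA K q) :
    antiderivationMatrix q u a 1 1 = a ∧ antiderivationMatrix q u a 1 0 = 0 := by
  induction a using induction with
  | one => simp
  | add a b ha hb => simp [ha, hb]
  | smul c a ha => simp [ha]
  | mul_gen a i ha => simp [ha, Matrix.mul_apply, antiderivationMatrix_gen]

theorem antiderivationMatrix_upper {n : ℤ} {a : FreeCGA K q}
    (ha : a ∈ gr q n) : antiderivationMatrix q u a 0 0 = (-1 : K) ^ n • a := by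
  induction ha using gr_induction with
  | one => simp
  | zero => simp
  | add n a b _ _ ha hb => simp [ha, hb]
  | smul n c a _ ha => rw [map_smul, Matrix.smul_apply, ha, smul_comm]
  | mul_gen n a i _ ha =>
    rw [map_mul, Matrix.mul_apply, Fin.sum_univ_two, ha, antiderivationMatrix_gen,
      neg_one_zpow_add]
    simp [smul_smul, mul_comm]

@[simp]
theorem antiderivation_gen (i : G) : antiderivation q u (gen q i) = u i := by
  simp [antiderivation, antiderivationMatrix_gen]

@[simp]
theorem antiderivation_one : antiderivation q u 1 = 0 := by
  simp [antiderivation]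

theorem antiderivation_mul {n : ℤ} {a : FreeCGA K q} (ha : a ∈ gr q n) (b : FreeCGA K q) :
    antiderivation q u (a * b) =
      antiderivation q u a * b + (-1 : K) ^ n • (a * antiderivation q u b) := by
  have h1 := antiderivationMatrix_lower u b
  simp [antiderivation, Matrix.mul_apply, antiderivationMatrix_upper u ha, h1, add_comm]

theorem antiderivation_mem {n : ℤ} {a : FreeCGA K q}
    (ha : a ∈ gr q n) : antiderivation q u a ∈ gr q (n - 1) := by
  induction ha using gr_induction with
  | one => simp
  | zero => simp
  | add n a b _ _ ha hb => simpa using Submodule.add_mem _ ha hb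
  | smul n c a _ ha => simpa using Submodule.smul_mem _ _ ha
  | mul_gen n a i h ha =>
    rw [antiderivation_mul u h, antiderivation_gen]
    refine Submodule.add_mem _ ?_ (Submodule.smul_mem _ _ ?_)
    · rw [show n + q i - 1 = n - 1 + q i by ring]
      exact mul_mem ha (gen_mem i)
    · rw [add_sub_assoc]; exact mul_mem h (u i).2

end Antiderivation

end FreeCGA

/-! ### Adjoining contractible pairs of generators -/

section Cylinder

variable {K : Type u} [Field K] {G V : Type} {q : G → ℤ} {r : V → ℤ}

variable (q r) in
/-- The degrees of generators `g`, `v`, `dv`. -/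
def cylDegree : G ⊕ (V ⊕ V) → ℤ := Sum.elim q (Sum.elim r fun v => r v + 1)

variable (K q r) in
/-- The inclusion of the algebra generated by `G`. -/
noncomputable def cylIncl : FreeCGA K q →ₐ[K] FreeCGA K (cylDegree q r) :=
  liftOf q (fun g => gen (cylDegree q r) (.inl g)) fun i j => gen_mul_gen (cylDegree q r) _ _

@[simp]
theorem cylIncl_gen (g : G) : cylIncl K q r (gen q g) = gen (cylDegree q r) (.inl g) :=
  liftOf_gen _ _ g

theorem cylIncl_mem {n : ℤ} {a : FreeCGA K q} (ha : a ∈ gr q n) :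
    cylIncl K q r a ∈ gr (cylDegree q r) n := by
  induction ha using gr_induction with
  | one => simpa using FreeCGA.one_mem
  | zero => simp
  | add n a b _ _ ha hb => simpa using Submodule.add_mem _ ha hb
  | smul n c a _ ha => simpa using Submodule.smul_mem _ _ ha
  | mul_gen n a i _ ha =>
    rw [map_mul, cylIncl_gen]
    exact FreeCGA.mul_mem ha (gen_mem (q := cylDegree q r) (.inl i))

variable (K q r) in
/-- The projection which kills `v` and `dv`. -/
noncomputable def cylProj : FreeCGA K (cylDegree q r) →ₐ[K] FreeCGA K q :=
  liftOf (cylDegree q r) (Sum.elim (gen q) fun _ => 0) fun i j => by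
    rcases i with i | i <;> rcases j with j | j <;> simp [cylDegree, ← gen_mul_gen]

@[simp]
theorem cylProj_inl (g : G) : cylProj K q r (gen (cylDegree q r) (.inl g)) = gen q g :=
  liftOf_gen _ _ _

@[simp]
theorem cylProj_inr (v : V ⊕ V) : cylProj K q r (gen (cylDegree q r) (.inr v)) = 0 :=
  liftOf_gen _ _ _

@[simp]
theorem cylProj_cylIncl (a : FreeCGA K q) : cylProj K q r (cylIncl K q r a) = a := by
  have : (cylProj K q r).comp (cylIncl K q r) = AlgHom.id K _ := algHom_ext fun i => by simp
  exact DFunLike.congr_fun this a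

variable (r) in
/-- The derivation with `d v = dv`, on the generators. -/
noncomputable def cylGen (u : (i : G) → gr (K := K) q (q i + 1)) :
    (i : G ⊕ (V ⊕ V)) → gr (K := K) (cylDegree q r) (cylDegree q r i + 1)
  | .inl g => ⟨cylIncl K q r (u g), cylIncl_mem (u g).2⟩
  | .inr (.inl v) => ⟨gen _ (.inr (.inr v)), gen_mem (q := cylDegree q r) (.inr (.inr v))⟩
  | .inr (.inr _) => 0

variable {u : (i : G) → gr (K := K) q (q i + 1)}

theorem derivation_cylIncl (a : FreeCGA K q) :
    derivation (cylDegree q r) (cylGen r u) (cylIncl K q r a) =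
      cylIncl K q r (derivation q u a) := by
  have : (derivation (cylDegree q r) (cylGen r u)).comp (cylIncl K q r).toLinearMap =
      (cylIncl K q r).toLinearMap.comp (derivation q u) := by
    refine linearMap_ext_gr fun n a ha => ?_
    induction ha using gr_induction with
    | one => simp
    | zero => simp
    | add n a b _ _ ha hb => rw [map_add, map_add, ha, hb]
    | smul n c a _ ha => rw [map_smul, map_smul, ha]
    | mul_gen n a i hn ha =>
      simp only [LinearMap.comp_apply, AlgHom.toLinearMap_apply] at ha ⊢
      rw [derivation_mul u hn, map_mul, derivation_mul _ (cylIncl_mem hn), map_add, map_smul,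
        map_mul, map_mul, ha, derivation_gen, cylIncl_gen, derivation_gen]
      rfl
  exact LinearMap.congr_fun this a

theorem derivation_cylGen (h : ∀ i, derivation q u (u i) = 0) (i : G ⊕ (V ⊕ V)) :
    derivation (cylDegree q r) (cylGen r u) (cylGen r u i) = 0 := by
  rcases i with i | i | i
  · simp [cylGen, derivation_cylIncl, h]
  · simp [cylGen]
  · simp [cylGen]

variable (r u) in
/-- The algebra generated by `G` and the pairs `v`, `dv`. -/
noncomputable abbrev cylDGA : GradedDiffAlgebra K := freeDGA (cylDegree q r) (cylGen r u)

theorem cylDGA_isCDGA [CharZero K] (h : ∀ i, derivation q u (u i) = 0) :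
    (cylDGA r u).IsCDGA :=
  freeDGA_isCDGA (derivation_cylGen h)

theorem cylProj_isDGMorphism [CharZero K] (h : ∀ i, derivation q u (u i) = 0) :
    IsDGMorphism (A := cylDGA r u) (B := freeDGA q u) (cylProj K q r) := by
  refine isDGMorphism_of_gen (freeDGA_isCDGA h) _ ?_ ?_
  · rintro (i | i | i)
    · rw [cylProj_inl]; exact gen_mem i
    · rw [cylProj_inr]; exact Submodule.zero_mem _
    · rw [cylProj_inr]; exact Submodule.zero_mem _
  · rintro (i | i | i)
    · simp [cylGen]
    · simp [cylGen]
    · simp [cylGen]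

/-- The weight counting the generators `v` and `dv`. -/
def cylWeight : G ⊕ (V ⊕ V) → ℤ := Sum.elim (fun _ => 0) fun _ => 1

variable (K q r) in
/-- The contraction `ι dv = v`. -/
noncomputable def cylContraction : FreeCGA K (cylDegree q r) →ₗ[K] FreeCGA K (cylDegree q r) :=
  antiderivation (cylDegree q r) fun
    | .inl _ => 0
    | .inr (.inl _) => 0
    | .inr (.inr v) => ⟨gen (cylDegree q r) (.inr (.inl v)), by
        have := gen_mem (K := K) (q := cylDegree q r) (.inr (.inl v))
        simpa [cylDegree] using this⟩

theorem cylContraction_cylIncl (a : FreeCGA K q) :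
    cylContraction K q r (cylIncl K q r a) = 0 := by
  have : (cylContraction K q r).comp (cylIncl K q r).toLinearMap = 0 := by
    refine linearMap_ext_gr fun n a ha => ?_
    induction ha using gr_induction with
    | one => simp [cylContraction]
    | zero => simp
    | add n a b _ _ ha hb => rw [map_add, ha, hb]; simp
    | smul n c a _ ha => rw [map_smul, ha]; simp
    | mul_gen n a i hn ha =>
      simp only [LinearMap.comp_apply, AlgHom.toLinearMap_apply, LinearMap.zero_apply] at ha ⊢
      simp only [cylContraction] at ha ⊢
      rw [map_mul, antiderivation_mul _ (cylIncl_mem hn), ha, cylIncl_gen, antiderivation_gen]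
      simp
  exact LinearMap.congr_fun this a

/-- Cartan's formula: the graded commutator of `d` and `ι` is a derivation of degree zero, so it is
known from its values on generators, where it counts `v` and `dv`. It makes every part of non-zero
weight acyclic. -/
theorem derivation_cylContraction (a : FreeCGA K (cylDegree q r)) :
    derivation (cylDegree q r) (cylGen r u) (cylContraction K q r a) +
      cylContraction K q r (derivation (cylDegree q r) (cylGen r u) a) =
      weightDerivation K (cylDegree q r) cylWeight a := by
  have : (derivation (cylDegree q r) (cylGen r u)).comp (cylContraction K q r) +
      (cylContraction K q r).comp (derivation (cylDegree q r) (cylGen r u)) =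
      weightDerivation K (cylDegree q r) cylWeight := by
    refine linearMap_ext_gr fun n a ha => ?_
    induction ha using gr_induction with
    | one => simp [cylContraction]
    | zero => simp
    | add n a b _ _ ha hb => rw [map_add, map_add, ha, hb]
    | smul n c a _ ha => rw [map_smul, map_smul, ha]
    | mul_gen n a i hn ha =>
      have hgen : derivation (cylDegree q r) (cylGen r u)
          (cylContraction K q r (gen (cylDegree q r) i)) +
          cylContraction K q r (derivation (cylDegree q r) (cylGen r u) (gen (cylDegree q r) i)) =
          weightDerivation K (cylDegree q r) cylWeight (gen (cylDegree q r) i) := by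
        rcases i with i | i | i
        · rw [derivation_gen]
          simp only [cylGen, cylContraction_cylIncl, weightDerivation_gen]
          simp [cylContraction, cylWeight]
        · rw [derivation_gen]
          simp [cylContraction, cylWeight, cylGen]
        · rw [derivation_gen]
          simp [cylContraction, cylWeight, cylGen]
      simp only [LinearMap.comp_apply, LinearMap.add_apply] at ha ⊢
      rw [weightDerivation_mul, ← ha, ← hgen]
      simp only [cylContraction] at ha ⊢
      rw [derivation_mul _ hn, antiderivation_mul _ hn, map_add, map_add, map_smul, map_smul,
        derivation_mul _ hn, derivation_mul _ (antiderivation_mem _ hn), antiderivation_mul _ hn,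
        antiderivation_mul _ (derivation_mem _ hn), neg_one_zpow_add, neg_one_zpow_sub]
      have hs : (-1 : K) ^ n * (-1) ^ n = 1 := neg_one_zpow_mul_self _
      simp only [smul_add, smul_smul, hs, zpow_one, add_mul, mul_add, one_smul]
      module
  exact LinearMap.congr_fun this a

/-- The composite keeps the monomials free of `v` and `dv`. The bound on the weight is carried along
because it guarantees that a monomial with at least one such generator has non-zero weight. -/
theorem cylIncl_cylProj_monomial (l : List (G ⊕ (V ⊕ V))) :
    0 ≤ (l.map cylWeight).sum ∧
      cylIncl K q r (cylProj K q r (l.map (gen (cylDegree q r))).prod) =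
        if (l.map cylWeight).sum = 0 then (l.map (gen (cylDegree q r))).prod else 0 := by
  induction l with
  | nil => simp
  | cons i l ih =>
    obtain ⟨h1, h2⟩ := ih
    simp only [List.map_cons, List.sum_cons, List.prod_cons, map_mul, h2]
    rcases i with i | i
    · have h0 : cylWeight (Sum.inl i : G ⊕ (V ⊕ V)) = 0 := rfl
      rw [h0, zero_add, cylProj_inl, cylIncl_gen, mul_ite, mul_zero]
      exact ⟨h1, rfl⟩
    · have h0 : cylWeight (Sum.inr i : G ⊕ (V ⊕ V)) = 1 := rfl
      have hne : 1 + (l.map (cylWeight : G ⊕ (V ⊕ V) → ℤ)).sum ≠ 0 := by omega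
      rw [h0, if_neg hne, cylProj_inr, map_zero, zero_mul]
      exact ⟨by omega, rfl⟩

/-- On a monomial of non-zero weight one divides by the weight. The position of `y` in the sum of
the non-zero eigenspaces is recorded because the weight derivation is injective there. -/
theorem exists_weightDerivation_eq [CharZero K] (a : FreeCGA K (cylDegree q r)) :
    ∃ y ∈ ⨆ (μ : K) (_ : μ ≠ 0),
      Module.End.eigenspace (weightDerivation K (cylDegree q r) cylWeight) μ,
      a - cylIncl K q r (cylProj K q r a) = weightDerivation K (cylDegree q r) cylWeight y := by
  induction a using monomial_induction with
  | monomial l =>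
    obtain ⟨-, h⟩ := cylIncl_cylProj_monomial (K := K) (q := q) (r := r) l
    rw [h]
    split_ifs with h0
    · exact ⟨0, Submodule.zero_mem _, by simp⟩
    · have h0' : (((l.map cylWeight).sum : ℤ) : K) ≠ 0 := by exact_mod_cast h0
      refine ⟨(((l.map cylWeight).sum : ℤ) : K)⁻¹ • (l.map (gen (cylDegree q r))).prod,
        Submodule.smul_mem _ _ (Submodule.mem_iSup_of_mem _ (Submodule.mem_iSup_of_mem h0'
          (Module.End.mem_eigenspace_iff.2 (weightDerivation_monomial cylWeight l)))), ?_⟩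
      rw [map_smul, weightDerivation_monomial, smul_smul, inv_mul_cancel₀ h0']
      simp
  | add a b ha hb =>
    obtain ⟨y, hy, h⟩ := ha
    obtain ⟨y', hy', h'⟩ := hb
    refine ⟨y + y', Submodule.add_mem _ hy hy', ?_⟩
    rw [map_add (weightDerivation _ _ _), ← h, ← h', map_add, map_add]; abel
  | smul c a ha =>
    obtain ⟨y, hy, h⟩ := ha
    refine ⟨c • y, Submodule.smul_mem _ _ hy, ?_⟩
    rw [map_smul (weightDerivation _ _ _), ← h, map_smul, map_smul, smul_sub]

/-- Cocycles are cohomologous to cocycles of the algebra generated by `G`. -/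
theorem exists_sub_eq_derivation [CharZero K] (h : ∀ i, derivation q u (u i) = 0)
    (c : FreeCGA K (cylDegree q r)) (hc : derivation (cylDegree q r) (cylGen r u) c = 0) :
    ∃ y, c - cylIncl K q r (cylProj K q r c) = derivation (cylDegree q r) (cylGen r u) y := by
  obtain ⟨y, hy, hcy⟩ := exists_weightDerivation_eq c
  set d := derivation (cylDegree q r) (cylGen r u) with hd
  set N := weightDerivation K (cylDegree q r) cylWeight with hN
  have hdd : ∀ a, d (d a) = 0 := derivation_derivation (derivation_cylGen h)
  have hcomm : ∀ a, N (d a) = d (N a) := by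
    intro a
    rw [hN, ← derivation_cylContraction (u := u), ← derivation_cylContraction (u := u), ← hd,
      map_add, hdd, hdd, map_zero]
    simp
  -- The primitive `y` for `N` need not be a cocycle a priori, but `N` commutes with `d` and `N y`
  -- is a difference of cocycles.
  have h1 : N (d y) = 0 := by
    have := (cylProj_isDGMorphism (r := r) h).2 c
    change cylProj K q r (d c) = derivation q u (cylProj K q r c) at this
    rw [hcomm, ← hcy, map_sub, hc, hd, derivation_cylIncl, ← this, hc]
    simp
  have h2 : d y ∈ ⨆ (μ : K) (_ : μ ≠ 0), Module.End.eigenspace N μ := by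
    have h3 : (⨆ (μ : K) (_ : μ ≠ 0), Module.End.eigenspace N μ) ≤
        (⨆ (μ : K) (_ : μ ≠ 0), Module.End.eigenspace N μ).comap d := by
      refine iSup₂_le fun μ hμ a ha => ?_
      refine Submodule.mem_iSup_of_mem μ (Submodule.mem_iSup_of_mem hμ ?_)
      rw [Module.End.mem_eigenspace_iff] at ha ⊢
      rw [hcomm, ha, map_smul]
    exact h3 hy
  -- `d y` lies in the kernel of `N` and in the sum of its other eigenspaces. Then `N y = d (ι y)`
  -- by Cartan's formula.
  have h4 : d y = 0 := by
    have := Module.End.eigenspaces_iSupIndep N 0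
    refine (Submodule.disjoint_def.1 this) _ ?_ h2
    rw [Module.End.mem_eigenspace_iff, h1, zero_smul]
  refine ⟨cylContraction K q r y, ?_⟩
  rw [hcy, hN, ← derivation_cylContraction (u := u), ← hd, h4]
  simp

end Cylinder

/-! ### Augmentations and their homotopies -/

section Homotopy

variable {K : Type u} [Field K]

/-- Morphisms to the ground field, which is concentrated in degree zero. -/
def IsAugmentation {A : GradedDiffAlgebra K} (e : A.carrier →ₐ[K] K) : Prop :=
  (∀ n ≠ 0, ∀ a ∈ A.gr n, e a = 0) ∧ ∀ a, e (A.d a) = 0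

theorem IsAugmentation.comp {A B : GradedDiffAlgebra K} {e : B.carrier →ₐ[K] K}
    (he : IsAugmentation e) {f : A.carrier →ₐ[K] B.carrier} (hf : IsDGMorphism f) :
    IsAugmentation (A := A) (e.comp f) :=
  ⟨fun n hn a ha => he.1 n hn _ (hf.1 n a ha), fun a => by simp [hf.2, he.2]⟩

theorem isAugmentation_of_gen {G : Type} {q : G → ℤ} {u : (i : G) → gr (K := K) q (q i + 1)}
    (e : FreeCGA K q →ₐ[K] K) (h : ∀ i, q i ≠ 0 → e (gen q i) = 0) (hd : ∀ i, e (u i) = 0) :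
    IsAugmentation (A := freeDGA q u) e := by
  have h1 : ∀ n : ℤ, ∀ a ∈ gr q n, n ≠ 0 → e a = 0 := by
    intro n a ha
    induction ha using gr_induction with
    | one => simp
    | zero => simp
    | add n a b _ _ ha hb => intro hn; rw [map_add, ha hn, hb hn, add_zero]
    | smul n c a _ ha => intro hn; rw [map_smul, ha hn, smul_zero]
    | mul_gen n a i _ ha =>
      intro hn
      rw [map_mul]
      by_cases h0 : n = 0
      · rw [h i (by omega), mul_zero]
      · rw [ha h0, zero_mul]
  refine ⟨fun n hn a ha => h1 n a ha hn, fun a => ?_⟩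
  have : e.toLinearMap.comp (derivation q u) = 0 := by
    refine linearMap_ext_gr fun n a ha => ?_
    induction ha using gr_induction with
    | one => simp
    | zero => simp
    | add n a b _ _ ha hb => rw [map_add, ha, hb]; simp
    | smul n c a _ ha => rw [map_smul, ha]; simp
    | mul_gen n a i hn ha =>
      simp only [LinearMap.comp_apply, AlgHom.toLinearMap_apply, LinearMap.zero_apply] at ha ⊢
      rw [derivation_mul u hn, map_add, map_smul, map_mul, map_mul, ha, derivation_gen, hd]
      simp
  exact LinearMap.congr_fun this a

variable (K) in
/-- The algebra `Λ(t, dt)` of polynomial forms on the interval. -/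
noncomputable abbrev intervalDGA : GradedDiffAlgebra K :=
  cylDGA (K := K) (V := Unit) (q := (Empty.elim : Empty → ℤ)) (fun _ => 0) (fun i => i.elim)

theorem intervalDGA_isCDGA [CharZero K] : (intervalDGA K).IsCDGA :=
  cylDGA_isCDGA fun i => i.elim

variable (K) in
/-- The generator `t`. -/
noncomputable def intervalT : (intervalDGA K).carrier :=
  gen (cylDegree (V := Unit) (Empty.elim : Empty → ℤ) fun _ => 0) (.inr (.inl ()))

variable (K) in
/-- The generator `dt`. -/
noncomputable def intervalDT : (intervalDGA K).carrier :=
  gen (cylDegree (V := Unit) (Empty.elim : Empty → ℤ) fun _ => 0) (.inr (.inr ()))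

theorem intervalT_mem : intervalT K ∈ (intervalDGA K).gr 0 :=
  gen_mem (q := cylDegree (V := Unit) (Empty.elim : Empty → ℤ) fun _ => 0) (.inr (.inl ()))

theorem intervalDT_mem : intervalDT K ∈ (intervalDGA K).gr 1 :=
  gen_mem (q := cylDegree (V := Unit) (Empty.elim : Empty → ℤ) fun _ => 0) (.inr (.inr ()))

@[simp]
theorem d_intervalT : (intervalDGA K).d (intervalT K) = intervalDT K :=
  derivation_gen _ _

@[simp]
theorem d_intervalDT : (intervalDGA K).d (intervalDT K) = 0 :=
  derivation_gen _ _

/-- Evaluation at `t = τ`. -/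
noncomputable def intervalEval (τ : K) : (intervalDGA K).carrier →ₐ[K] K :=
  liftOf _ (Sum.elim Empty.elim (Sum.elim (fun _ => τ) fun _ => 0)) fun i j => by
    rcases i with i | i | i
    · exact i.elim
    · rcases j with j | j | j
      · exact j.elim
      · simp [cylDegree]
      · simp [cylDegree]
    · rcases j with j | j | j
      · exact j.elim
      · simp [cylDegree]
      · simp [cylDegree]

@[simp]
theorem intervalEval_T (τ : K) : intervalEval τ (intervalT K) = τ := liftOf_gen _ _ _

@[simp]
theorem intervalEval_DT (τ : K) : intervalEval τ (intervalDT K) = 0 := liftOf_gen _ _ _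

theorem intervalEval_isAugmentation (τ : K) :
    IsAugmentation (A := intervalDGA K) (intervalEval τ) := by
  refine isAugmentation_of_gen _ ?_ ?_
  · rintro (i | i | i) h
    · exact i.elim
    · exact absurd rfl h
    · exact intervalEval_DT τ
  · rintro (i | i | i)
    · exact i.elim
    · exact intervalEval_DT τ
    · exact map_zero _

/-- Homotopies of augmentations. -/
def AugmentationHomotopic {A : GradedDiffAlgebra K} (e₀ e₁ : A.carrier →ₐ[K] K) : Prop :=
  ∃ H : A.carrier →ₐ[K] (intervalDGA K).carrier, IsDGMorphism H ∧
    (intervalEval 0).comp H = e₀ ∧ (intervalEval 1).comp H = e₁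

theorem AugmentationHomotopic.comp {A B : GradedDiffAlgebra K} {e₀ e₁ : B.carrier →ₐ[K] K}
    (h : AugmentationHomotopic e₀ e₁) {f : A.carrier →ₐ[K] B.carrier} (hf : IsDGMorphism f) :
    AugmentationHomotopic (A := A) (e₀.comp f) (e₁.comp f) := by
  obtain ⟨H, hH, rfl, rfl⟩ := h
  exact ⟨H.comp f, hH.comp hf, rfl, rfl⟩

/-- A quasi-isomorphism to a cofibrant free algebra has a right inverse up to homotopy. -/
theorem exists_homotopy_inverse [CharZero K] {G G' : Type} {q : G → ℤ} {q' : G' → ℤ}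
    {u : (i : G) → gr (K := K) q (q i + 1)} {u' : (i : G') → gr (K := K) q' (q' i + 1)}
    (hu : ∀ i, derivation q u (u i) = 0) (hu' : ∀ i, derivation q' u' (u' i) = 0)
    (hcof : (freeDGA q u).IsCofibrant)
    (f : FreeCGA K q' →ₐ[K] FreeCGA K q)
    (hf : IsDGMorphism (A := freeDGA q' u') (B := freeDGA q u) f)
    (hq : IsCohomologyIso (A := freeDGA q' u') (B := freeDGA q u) f) :
    ∃ h : FreeCGA K q →ₐ[K] FreeCGA K q',
      IsDGMorphism (A := freeDGA q u) (B := freeDGA q' u') h ∧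
      IsCohomologyIso (A := freeDGA q u) (B := freeDGA q' u') h ∧
      ∀ e : FreeCGA K q →ₐ[K] K, IsAugmentation (A := freeDGA q u) e →
        AugmentationHomotopic (A := freeDGA q u) ((e.comp f).comp h) e := by
  have hA := freeDGA_isCDGA hu
  have hX := cylDGA_isCDGA (r := q) hu'
  -- The morphism `f` is made surjective: a contractible pair is adjoined to its source for each
  -- generator of the target and is sent to that generator and its differential.
  have pmem : ∀ i, (Sum.elim (fun i => f (gen q' i)) (Sum.elim (gen q) fun i => (u i).1) :
      G' ⊕ (G ⊕ G) → FreeCGA K q) i ∈ gr (K := K) q (cylDegree q' q i) := by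
    rintro (i | i | i)
    · exact hf.1 _ _ (gen_mem i)
    · exact gen_mem i
    · exact (u i).2
  let p : FreeCGA K (cylDegree q' q) →ₐ[K] FreeCGA K q :=
    liftDGA hA (cylDegree q' q) _ pmem
  have p1 : ∀ i, p (gen _ (.inl i)) = f (gen q' i) := fun i => liftDGA_gen hA _ pmem _
  have p2 : ∀ i, p (gen _ (.inr (.inl i))) = gen q i := fun i => liftDGA_gen hA _ pmem _
  have p3 : ∀ i, p (gen _ (.inr (.inr i))) = u i := fun i => liftDGA_gen hA _ pmem _
  have pincl : ∀ a, p (cylIncl K q' q a) = f a := by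
    intro a
    have : p.comp (cylIncl K q' q) = f := algHom_ext fun i => by simp [p1]
    exact DFunLike.congr_fun this a
  have hp : IsDGMorphism (A := cylDGA q u') (B := freeDGA q u) p := by
    refine isDGMorphism_of_gen hA _ (fun i => ?_) ?_
    · exact (liftDGA_gen hA _ pmem i).symm ▸ pmem i
    · rintro (i | i | i)
      · change p (cylIncl K q' q (u' i)) = derivation q u (p (gen _ (.inl i)))
        rw [pincl, p1]
        have := hf.2 (gen q' i)
        change f (derivation q' u' _) = derivation q u _ at this
        rw [← this, derivation_gen]
      · change p (gen _ (.inr (.inr i))) = derivation q u (p (gen _ (.inr (.inl i))))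
        rw [p2, p3, derivation_gen]
      · change p 0 = derivation q u (p (gen _ (.inr (.inr i))))
        rw [p3, hu, map_zero]
  have psurj : Function.Surjective p := by
    intro a
    induction a using induction with
    | one => exact ⟨1, map_one _⟩
    | add a b ha hb =>
      obtain ⟨x, rfl⟩ := ha; obtain ⟨y, rfl⟩ := hb; exact ⟨x + y, map_add _ _ _⟩
    | smul c a ha => obtain ⟨x, rfl⟩ := ha; exact ⟨c • x, map_smul _ _ _⟩
    | mul_gen a i ha => obtain ⟨x, rfl⟩ := ha; exact ⟨x * gen _ (.inr (.inl i)), by rw [map_mul, p2]⟩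
  have hr := cylProj_isDGMorphism (r := q) hu'
  have hpd : ∀ c, p (derivation (cylDegree q' q) (cylGen q u') c) = derivation q u (p c) := hp.2
  have hrd : ∀ c, cylProj K q' q (derivation (cylDegree q' q) (cylGen q u') c) =
    derivation q' u' (cylProj K q' q c) := hr.2
  -- Modulo coboundaries a cocycle comes from the original source, so injectivity in cohomology is
  -- inherited from `f`.
  have pinj : ∀ c, derivation (cylDegree q' q) (cylGen q u') c = 0 →
      (∃ b, p c = derivation q u b) → ∃ a', c = derivation (cylDegree q' q) (cylGen q u') a' := by
    rintro c hc ⟨a, ha⟩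
    obtain ⟨y, hy⟩ := exists_sub_eq_derivation hu' c hc
    obtain ⟨b, hb⟩ := hq.1 (cylProj K q' q c)
      (by change derivation q' u' _ = 0; rw [← hrd, hc, map_zero])
      ⟨a - p y, by
        change _ = derivation q u _
        rw [map_sub, ← ha, ← hpd, ← hy, map_sub, pincl]; abel⟩
    change _ = derivation q' u' b at hb
    refine ⟨y + cylIncl K q' q b, ?_⟩
    rw [map_add, ← hy, derivation_cylIncl, ← hb]; abel
  have pqi : IsCohomologyIso (A := cylDGA q u') (B := freeDGA q u) p := by
    refine ⟨pinj, fun a ha => ?_⟩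
    obtain ⟨b, hb, a', ha'⟩ := hq.2 a ha
    refine ⟨cylIncl K q' q b, ?_, a', ?_⟩
    · change derivation _ _ _ = 0
      rw [derivation_cylIncl]
      change derivation q' u' b = 0 at hb
      rw [hb, map_zero]
    · rw [pincl]; exact ha'
  -- Lifting the identity gives a section `s` of `p`; the homotopy inverse is `s` followed by the
  -- projection which kills the contractible pairs.
  obtain ⟨s, hs, hps⟩ := hcof (cylDGA q u') (freeDGA q u) hX hA p (AlgHom.id K _) hp psurj pqi
    ⟨fun _ _ h => h, fun _ => rfl⟩
  have hps' : ∀ a, p (s a) = a := fun a => DFunLike.congr_fun hps a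
  have hsd : ∀ a, s (derivation q u a) = derivation (cylDegree q' q) (cylGen q u') (s a) := hs.2
  refine ⟨(cylProj K q' q).comp s, hr.comp hs, ⟨?_, ?_⟩, ?_⟩
  -- If the projection of `s a` is a coboundary, then so is `s a`, and applying `p` recovers `a`.
  · rintro a ha ⟨b, hb⟩
    change derivation q u a = 0 at ha
    change cylProj K q' q (s a) = derivation q' u' b at hb
    have hc : derivation (cylDegree q' q) (cylGen q u') (s a) = 0 := by rw [← hsd, ha, map_zero]
    obtain ⟨y, hy⟩ := exists_sub_eq_derivation hu' (s a) hc
    refine ⟨p (y + cylIncl K q' q b), ?_⟩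
    change a = derivation q u _
    rw [← hpd, map_add, ← hy, derivation_cylIncl, ← hb, sub_add_cancel, hps']
  -- The class of `b` is hit by `f b`: the map `p` kills the difference of `s (f b)` and `b`, which
  -- is therefore a coboundary.
  · intro b hb
    change derivation q' u' b = 0 at hb
    have hfd : derivation q u (f b) = 0 := by
      have := hf.2 b
      change f (derivation q' u' b) = derivation q u (f b) at this
      rw [← this, hb, map_zero]
    obtain ⟨x, hx⟩ := pinj (s (f b) - cylIncl K q' q b)
      (by rw [map_sub, ← hsd, hfd, derivation_cylIncl, hb]; simp)
      ⟨0, by rw [map_sub, hps', pincl]; simp⟩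
    refine ⟨f b, hfd, cylProj K q' q x, ?_⟩
    change cylProj K q' q (s (f b)) - b = derivation q' u' _
    rw [← hrd, ← hx, map_sub, cylProj_cylIncl]
  · intro e he
    have hefa := he.comp hf
    -- The homotopy `T` scales the contractible pairs by `t`. At `t = 0` they disappear and `e ∘ f`
    -- composed with the projection remains; at `t = 1` one finds `e ∘ p`, which becomes `e` after
    -- composition with the section.
    have tmem : ∀ i, (Sum.elim (fun i => algebraMap K _ (e (f (gen q' i))))
        (Sum.elim (fun i => e (gen q i) • intervalT K) fun i => e (gen q i) • intervalDT K) :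
        G' ⊕ (G ⊕ G) → (intervalDGA K).carrier) i ∈ (intervalDGA K).gr (cylDegree q' q i) := by
      rintro (i | i | i)
      · by_cases h : q' i = 0
        · change algebraMap K (intervalDGA K).carrier (e (f (gen q' i))) ∈
            (intervalDGA K).gr (q' i)
          rw [h, Algebra.algebraMap_eq_smul_one]
          exact Submodule.smul_mem _ _ (intervalDGA_isCDGA (K := K)).one_mem
        · have : e (f (gen q' i)) = 0 := hefa.1 _ h _ (gen_mem i)
          simp [this]
      · by_cases h : q i = 0
        · simp only [Sum.elim_inl, Sum.elim_inr, cylDegree, h]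
          exact Submodule.smul_mem _ _ intervalT_mem
        · have : e (gen q i) = 0 := he.1 _ h _ (gen_mem i)
          simp [this]
      · by_cases h : q i = 0
        · simp only [Sum.elim_inr, cylDegree, h]
          exact Submodule.smul_mem _ _ intervalDT_mem
        · have : e (gen q i) = 0 := he.1 _ h _ (gen_mem i)
          simp [this]
    let T : FreeCGA K (cylDegree q' q) →ₐ[K] (intervalDGA K).carrier :=
      liftDGA intervalDGA_isCDGA (cylDegree q' q) _ tmem
    have t1 : ∀ i, T (gen _ (.inl i)) = algebraMap K _ (e (f (gen q' i))) :=
      fun i => liftDGA_gen intervalDGA_isCDGA _ tmem _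
    have t2 : ∀ i, T (gen _ (.inr (.inl i))) = e (gen q i) • intervalT K :=
      fun i => liftDGA_gen intervalDGA_isCDGA _ tmem _
    have t3 : ∀ i, T (gen _ (.inr (.inr i))) = e (gen q i) • intervalDT K :=
      fun i => liftDGA_gen intervalDGA_isCDGA _ tmem _
    have tincl : ∀ a, T (cylIncl K q' q a) = algebraMap K _ (e (f a)) := by
      intro a
      have : T.comp (cylIncl K q' q) = (Algebra.ofId K (intervalDGA K).carrier).comp (e.comp f) :=
        algHom_ext fun i => by simp [t1, Algebra.ofId_apply]
      exact DFunLike.congr_fun this a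
    have hd1 : ∀ c : K, (intervalDGA K).d (algebraMap K _ c) = 0 := by
      intro c
      rw [Algebra.algebraMap_eq_smul_one, map_smul, intervalDGA_isCDGA.d_one, smul_zero]
    have hT : IsDGMorphism (A := cylDGA q u') (B := intervalDGA K) T := by
      refine isDGMorphism_of_gen intervalDGA_isCDGA _ (fun i => ?_) ?_
      · exact (liftDGA_gen intervalDGA_isCDGA _ tmem i).symm ▸ tmem i
      · rintro (i | i | i)
        · rw [t1, hd1]
          change T (cylIncl K q' q (u' i)) = 0
          rw [tincl]
          have := hefa.2 (gen q' i)
          change e (f (derivation q' u' _)) = 0 at this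
          rw [derivation_gen] at this
          rw [this, map_zero]
        · rw [t2, map_smul, d_intervalT]
          exact t3 i
        · rw [t3, map_smul, d_intervalDT, smul_zero]
          exact map_zero _
    refine ⟨T.comp s, hT.comp hs, ?_, ?_⟩
    · have : (intervalEval 0).comp T = (e.comp f).comp (cylProj K q' q) := by
        refine algHom_ext fun i => ?_
        rcases i with i | i | i
        · simp [t1]
        · rw [AlgHom.comp_apply, t2, map_smul, intervalEval_T]; simp
        · rw [AlgHom.comp_apply, t3, map_smul, intervalEval_DT]; simp
      calc ((intervalEval 0).comp (T.comp s)) = ((intervalEval 0).comp T).comp s := rfl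
        _ = _ := by rw [this]; rfl
    · have : (intervalEval 1).comp T = e.comp p := by
        refine algHom_ext fun i => ?_
        rcases i with i | i | i
        · simp [t1, p1]
        · rw [AlgHom.comp_apply, t2, map_smul, intervalEval_T]; simp [p2]
        · have : e (u i) = 0 := by
            have := he.2 (gen q i)
            change e (derivation q u _) = 0 at this
            rwa [derivation_gen] at this
          rw [AlgHom.comp_apply, t3, map_smul, intervalEval_DT]; simp [p3, this]
      calc ((intervalEval 1).comp (T.comp s)) = ((intervalEval 1).comp T).comp s := rfl
        _ = e.comp (p.comp s) := by rw [this]; rfl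
        _ = e := by rw [hps]; rfl

end Homotopy

/-! ### Signed sums over unshuffles -/

section Shuffle

variable {K : Type u} [Field K] {X : Type w} (deg : X → ℤ)

/-- The degree of a list. -/
def listDegree (l : List X) : ℤ := (l.map deg).sum

@[simp]
theorem listDegree_nil : listDegree deg [] = 0 := rfl

@[simp]
theorem listDegree_cons (x : X) (l : List X) :
    listDegree deg (x :: l) = deg x + listDegree deg l := by
  simp [listDegree]

/-- The sum of `H s r`, with Koszul signs, over all ways to distribute a list to complementary
sublists `s` and `r`. -/
def shuffleSum : List X → (List X → List X → K) → K
  | [], H => H [] []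
  | x :: l, H => shuffleSum l (fun s r => H (x :: s) r) +
      shuffleSum l (fun s r => (-1) ^ (deg x * listDegree deg s) * H s (x :: r))

theorem shuffleSum_congr (l : List X) {H H' : List X → List X → K}
    (h : ∀ s r, (s ++ r).Perm l → H s r = H' s r) :
    shuffleSum deg l H = shuffleSum deg l H' := by
  induction l generalizing H H' with
  | nil => exact h _ _ (by simp)
  | cons x l ih =>
    simp only [shuffleSum]
    congr 1
    · exact ih fun s r hp => h _ _ (by simpa using hp)
    · exact ih fun s r hp => by
        rw [h s (x :: r) (List.perm_middle.trans (hp.cons x))]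

theorem listDegree_perm {l l' : List X} (h : l.Perm l') : listDegree deg l = listDegree deg l' :=
  (h.map deg).sum_eq

@[simp]
theorem listDegree_append (l l' : List X) :
    listDegree deg (l ++ l') = listDegree deg l + listDegree deg l' := by
  simp [listDegree]

theorem shuffleSum_add (l : List X) (H H' : List X → List X → K) :
    shuffleSum deg l (fun s r => H s r + H' s r) = shuffleSum deg l H + shuffleSum deg l H' := by
  induction l generalizing H H' with
  | nil => rfl
  | cons x l ih => simp only [shuffleSum, mul_add, ih]; ring

theorem shuffleSum_mul_left (l : List X) (c : K) (H : List X → List X → K) :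
    shuffleSum deg l (fun s r => c * H s r) = c * shuffleSum deg l H := by
  induction l generalizing H with
  | nil => rfl
  | cons x l ih =>
    simp only [shuffleSum, mul_add, ih]
    congr 1
    rw [← ih]
    exact shuffleSum_congr deg l fun s r _ => by ring

theorem shuffleSum_mul_right (l : List X) (c : K) (H : List X → List X → K) :
    shuffleSum deg l (fun s r => H s r * c) = shuffleSum deg l H * c := by
  simp only [mul_comm _ c, shuffleSum_mul_left]

@[simp]
theorem shuffleSum_zero (l : List X) : shuffleSum (K := K) deg l (fun _ _ => 0) = 0 := by
  simpa using shuffleSum_mul_left deg l (0 : K) fun _ _ => 0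

theorem shuffleSum_eq_zero (l : List X) {H : List X → List X → K}
    (h : ∀ s r, (s ++ r).Perm l → H s r = 0) : shuffleSum deg l H = 0 := by
  rw [shuffleSum_congr deg l h, shuffleSum_zero]

/-- Coassociativity of unshuffling, from which the shuffle algebra is associative: a letter sent to
the last of three sublists passes over both of the others, whichever way the splitting is organized.
-/
theorem shuffleSum_assoc (l : List X) (H : List X → List X → List X → K) :
    shuffleSum deg l (fun s r => shuffleSum deg r fun s' r' => H s s' r') =
      shuffleSum deg l (fun t r' => shuffleSum deg t fun s s' => H s s' r') := by
  induction l generalizing H with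
  | nil => rfl
  | cons x l ih =>
    simp only [shuffleSum, mul_add, shuffleSum_add, ← shuffleSum_mul_left]
    rw [ih, ih, ih, add_assoc]
    congr 2
    refine shuffleSum_congr deg l fun t r' _ => shuffleSum_congr deg t fun s s' hp => ?_
    rw [← listDegree_perm deg hp, listDegree_append, mul_add, neg_one_zpow_add]
    ring

/-- Graded cocommutativity of unshuffling, from which homogeneous elements of the shuffle algebra
commute up to the Koszul sign. -/
theorem shuffleSum_comm (l : List X) (H : List X → List X → K) :
    shuffleSum deg l H =
      shuffleSum deg l (fun s r => (-1) ^ (listDegree deg s * listDegree deg r) * H r s) := by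
  induction l generalizing H with
  | nil => simp [shuffleSum]
  | cons x l ih =>
    simp only [shuffleSum]
    rw [ih, add_comm, ih]
    congr 1
    · refine shuffleSum_congr deg l fun s r _ => ?_
      rw [listDegree_cons, add_mul, neg_one_zpow_add]
      ring
    · refine shuffleSum_congr deg l fun s r _ => ?_
      rw [listDegree_cons, mul_add, neg_one_zpow_add, mul_comm (deg x), ← mul_assoc,
        ← mul_assoc, neg_one_zpow_mul_self, one_mul]

/-- The terms with an empty first sublist. -/
theorem shuffleSum_left_nil (l : List X) (H : List X → List X → K)
    (h : ∀ s r, s ≠ [] → H s r = 0) : shuffleSum deg l H = H [] l := by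
  induction l generalizing H with
  | nil => rfl
  | cons x l ih =>
    simp only [shuffleSum]
    rw [shuffleSum_eq_zero deg l fun s r _ => h _ _ (by simp), zero_add,
      ih _ fun s r hs => by rw [h _ _ hs, mul_zero]]
    simp

/-- The terms with an empty second sublist. -/
theorem shuffleSum_right_nil (l : List X) (H : List X → List X → K)
    (h : ∀ s r, r ≠ [] → H s r = 0) : shuffleSum deg l H = H l [] := by
  induction l generalizing H with
  | nil => rfl
  | cons x l ih =>
    simp only [shuffleSum]
    rw [ih _ fun s r hr => h _ _ hr, shuffleSum_eq_zero, add_zero]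
    intro s r _
    rw [h _ _ (by simp), mul_zero]

/-! ### The shuffle algebra -/

variable (K) in
/-- The algebra of functions on lists with the product dual to unshuffling. -/
def ShuffleAlgebra (_ : X → ℤ) : Type (max u w) := List X → K

namespace ShuffleAlgebra

variable {deg}

instance : AddCommGroup (ShuffleAlgebra K deg) := inferInstanceAs (AddCommGroup (List X → K))
instance : Module K (ShuffleAlgebra K deg) := inferInstanceAs (Module K (List X → K))

@[ext]
theorem ext {F F' : ShuffleAlgebra K deg} (h : ∀ l, F l = F' l) : F = F' := funext h

/-- The first sublist is fed to the right factor. With this order the evaluation of a reversed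
monomial carries no sign beyond those of the unshuffles, and reversing a monomial produces exactly
`pairingSign`. -/
instance : Mul (ShuffleAlgebra K deg) := ⟨fun F F' l => shuffleSum deg l fun s r => F' s * F r⟩
instance : One (ShuffleAlgebra K deg) := ⟨fun | [] => 1 | _ :: _ => 0⟩

theorem mul_apply (F F' : ShuffleAlgebra K deg) (l : List X) :
    (F * F') l = shuffleSum deg l fun s r => F' s * F r := rfl

@[simp] theorem one_nil : (1 : ShuffleAlgebra K deg) [] = 1 := rfl
@[simp] theorem one_cons (x : X) (l : List X) : (1 : ShuffleAlgebra K deg) (x :: l) = 0 := rfl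
theorem one_of_ne_nil {l : List X} (h : l ≠ []) : (1 : ShuffleAlgebra K deg) l = 0 := by
  cases l with
  | nil => exact absurd rfl h
  | cons x l => rfl
@[simp] theorem add_apply (F F' : ShuffleAlgebra K deg) (l : List X) :
    (F + F') l = F l + F' l := rfl
@[simp] theorem zero_apply (l : List X) : (0 : ShuffleAlgebra K deg) l = 0 := rfl
@[simp] theorem smul_apply (c : K) (F : ShuffleAlgebra K deg) (l : List X) :
    (c • F) l = c * F l := rfl

theorem mul_nil (F F' : ShuffleAlgebra K deg) : (F * F') [] = F [] * F' [] :=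
  mul_comm _ _

theorem mul_cons (F F' : ShuffleAlgebra K deg) (x : X) (l : List X) :
    (F * F') (x :: l) = shuffleSum deg l (fun s r => F' (x :: s) * F r) +
      shuffleSum deg l (fun s r => (-1) ^ (deg x * listDegree deg s) * (F' s * F (x :: r))) := rfl

instance : Ring (ShuffleAlgebra K deg) where
  __ := (inferInstance : AddCommGroup (ShuffleAlgebra K deg))
  left_distrib F F' F'' := by
    ext l
    simp only [mul_apply, add_apply, ← shuffleSum_add]
    exact shuffleSum_congr deg l fun s r _ => by ring
  right_distrib F F' F'' := by
    ext l
    simp only [mul_apply, add_apply, ← shuffleSum_add]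
    exact shuffleSum_congr deg l fun s r _ => by ring
  zero_mul F := by ext l; simp [mul_apply]
  mul_zero F := by ext l; simp [mul_apply]
  mul_assoc F F' F'' := by
    ext l
    simp only [mul_apply, ← shuffleSum_mul_left, ← shuffleSum_mul_right]
    rw [shuffleSum_assoc]
    exact shuffleSum_congr deg l fun s r _ => shuffleSum_congr deg s fun _ _ _ => by ring
  one_mul F := by
    ext l
    rw [mul_apply, shuffleSum_right_nil]
    · simp
    · intro s r hr; rw [one_of_ne_nil hr, mul_zero]
  mul_one F := by
    ext l
    rw [mul_apply, shuffleSum_left_nil]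
    · simp
    · intro s r hr; rw [one_of_ne_nil hr, zero_mul]

instance : Algebra K (ShuffleAlgebra K deg) :=
  Algebra.ofModule
    (fun c F F' => by
      ext l
      simp only [mul_apply, smul_apply, ← shuffleSum_mul_left]
      exact shuffleSum_congr deg l fun s r _ => by ring)
    (fun c F F' => by
      ext l
      simp only [mul_apply, smul_apply, ← shuffleSum_mul_left]
      exact shuffleSum_congr deg l fun s r _ => by ring)

/-- Functions supported on lists of degree `n`. -/
def IsHomogeneous (n : ℤ) (F : ShuffleAlgebra K deg) : Prop :=
  ∀ l, F l ≠ 0 → listDegree deg l = n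

theorem IsHomogeneous.mul_comm {m n : ℤ} {F F' : ShuffleAlgebra K deg} (hF : F.IsHomogeneous m)
    (hF' : F'.IsHomogeneous n) : F * F' = (-1 : K) ^ (m * n) • (F' * F) := by
  ext l
  rw [smul_apply, mul_apply, mul_apply, ← shuffleSum_mul_left, shuffleSum_comm]
  refine shuffleSum_congr deg l fun s r _ => ?_
  by_cases h : F s = 0
  · simp [h]
  by_cases h' : F' r = 0
  · simp [h']
  rw [hF s h, hF' r h']
  ring

/-- The transpose of the operation which inserts the value of `b` in front. -/
def insertion (b : List X → X) (F : ShuffleAlgebra K deg) : ShuffleAlgebra K deg :=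
  fun l => shuffleSum deg l fun s r => F (b s :: r)

theorem insertion_add (b : List X → X) (F F' : ShuffleAlgebra K deg) :
    insertion b (F + F') = insertion b F + insertion b F' := by
  ext l; exact shuffleSum_add deg l _ _

theorem insertion_smul (b : List X → X) (c : K) (F : ShuffleAlgebra K deg) :
    insertion b (c • F) = c • insertion b F := by
  ext l; exact shuffleSum_mul_left deg l c _

theorem insertion_one (b : List X → X) : insertion b (1 : ShuffleAlgebra K deg) = 0 := by
  ext l; exact shuffleSum_eq_zero deg l fun _ _ _ => rfl

/-- The inserted value is handed to one of the two factors. If it goes to `F` while `s'` goes to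
`F'`, its passage over `s'` costs `(-1)^((|s|-1)|s'|)` and the exchange of `s` and `s'` costs
`(-1)^(|s||s'|)`; together they give `(-1)^|s'|`, and `|s'| = n` wherever `F'` does not vanish. -/
theorem insertion_mul {b : List X → X} (hb : ∀ l, deg (b l) = listDegree deg l - 1) {n : ℤ}
    (F F' : ShuffleAlgebra K deg) (hF' : F'.IsHomogeneous n) :
    insertion b (F * F') = (-1 : K) ^ n • (insertion b F * F') + F * insertion b F' := by
  ext l
  have h1 : insertion b (F * F') l =
      shuffleSum deg l (fun s r => shuffleSum deg r fun s' r' => F' (b s :: s') * F r') +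
      shuffleSum deg l (fun s r => shuffleSum deg r fun s' r' =>
        (-1) ^ (deg (b s) * listDegree deg s') * (F' s' * F (b s :: r'))) :=
    shuffleSum_add deg l _ _
  have h2 : (insertion b F * F') l =
      shuffleSum deg l (fun s r => shuffleSum deg r fun s' r' => F' s * F (b s' :: r')) := by
    simp only [shuffleSum_mul_left]; rfl
  have h3 : (F * insertion b F') l =
      shuffleSum deg l (fun t r => shuffleSum deg t fun s s' => F' (b s :: s') * F r) := by
    simp only [shuffleSum_mul_right]; rfl
  rw [add_apply, smul_apply, h1, h2, h3, shuffleSum_assoc, add_comm]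
  congr 1
  rw [shuffleSum_assoc, shuffleSum_assoc, ← shuffleSum_mul_left]
  refine shuffleSum_congr deg l fun t r _ => ?_
  rw [shuffleSum_comm, ← shuffleSum_mul_left]
  refine shuffleSum_congr deg t fun s s' _ => ?_
  by_cases h : F' s = 0
  · simp [h]
  rw [hb, sub_mul, one_mul, neg_one_zpow_sub, mul_comm (listDegree deg s'), ← hF' s h]
  have := neg_one_zpow_mul_self (K := K) (listDegree deg s * listDegree deg s')
  linear_combination ((-1) ^ listDegree deg s * (F' s * F (b s' :: r))) * this

theorem one_isHomogeneous : (1 : ShuffleAlgebra K deg).IsHomogeneous 0 := by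
  intro l hl
  by_cases h : l = []
  · simp [h]
  · exact absurd (one_of_ne_nil h) hl

theorem IsHomogeneous.mul {m n : ℤ} {F F' : ShuffleAlgebra K deg} (hF : F.IsHomogeneous m)
    (hF' : F'.IsHomogeneous n) : (F * F').IsHomogeneous (m + n) := by
  intro l hl
  by_contra hne
  refine hl (shuffleSum_eq_zero deg l fun s r hp => ?_)
  by_cases h : F' s = 0
  · simp [h]
  by_cases h' : F r = 0
  · simp [h']
  exfalso
  rw [← listDegree_perm deg hp, listDegree_append, hF' s h, hF r h'] at hne
  omega

/-- The function on lists of length one given by `c`. -/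
def ofLetters (c : X → K) : ShuffleAlgebra K deg
  | [x] => c x
  | _ => 0

@[simp] theorem ofLetters_nil (c : X → K) : (ofLetters c : ShuffleAlgebra K deg) [] = 0 := rfl
@[simp] theorem ofLetters_singleton (c : X → K) (x : X) :
    (ofLetters c : ShuffleAlgebra K deg) [x] = c x := rfl
@[simp] theorem ofLetters_cons_cons (c : X → K) (x y : X) (l : List X) :
    (ofLetters c : ShuffleAlgebra K deg) (x :: y :: l) = 0 := rfl

theorem ofLetters_isHomogeneous {c : X → K} {n : ℤ} (h : ∀ x, c x ≠ 0 → deg x = n) :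
    (ofLetters c : ShuffleAlgebra K deg).IsHomogeneous n := by
  rintro (_ | ⟨x, _ | ⟨y, l⟩⟩) hl
  · exact absurd rfl hl
  · simpa using h x hl
  · exact absurd rfl hl

theorem insertion_ofLetters (b : List X → X) (c : X → K) (l : List X) :
    insertion b (ofLetters c : ShuffleAlgebra K deg) l = c (b l) := by
  refine shuffleSum_right_nil deg l (fun s r => (ofLetters c : ShuffleAlgebra K deg) (b s :: r)) ?_
  rintro s (_ | ⟨x, r⟩) h
  · exact absurd rfl h
  · rfl

end ShuffleAlgebra

open ShuffleAlgebra

variable {deg}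
variable {G : Type} {q : G → ℤ}

/-- The algebra map to a shuffle algebra determined by homogeneous functions. -/
noncomputable def toShuffle (F : G → ShuffleAlgebra K deg) (hF : ∀ i, (F i).IsHomogeneous (q i)) :
    FreeCGA K q →ₐ[K] ShuffleAlgebra K deg :=
  liftOf q F fun i j => (hF i).mul_comm (hF j)

@[simp]
theorem toShuffle_gen (F : G → ShuffleAlgebra K deg) (hF : ∀ i, (F i).IsHomogeneous (q i)) (i : G) :
    toShuffle F hF (gen q i) = F i :=
  liftOf_gen _ _ i

/-- Compatibility of an algebra map with differentials can be checked on generators. -/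
theorem map_derivation_eq_insertion {u : (i : G) → gr (K := K) q (q i + 1)} {b : List X → X}
    (hb : ∀ l, deg (b l) = listDegree deg l - 1) (f : FreeCGA K q →ₐ[K] ShuffleAlgebra K deg)
    (hf : ∀ i, (f (gen q i)).IsHomogeneous (q i))
    (h : ∀ i, f (u i) = (-1 : K) ^ q i • insertion b (f (gen q i))) {n : ℤ} {a : FreeCGA K q}
    (ha : a ∈ gr q n) : f (derivation q u a) = (-1 : K) ^ n • insertion b (f a) := by
  induction ha using gr_induction with
  | one => simp [insertion_one]
  | zero =>
    have := insertion_smul b (0 : K) (f 0)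
    rw [zero_smul, zero_smul] at this
    rw [map_zero, map_zero, this, smul_zero]
  | add n a b _ _ ha hb => rw [map_add, map_add, ha, hb, map_add, insertion_add, smul_add]
  | smul n c a _ ha => rw [map_smul, map_smul, ha, map_smul, insertion_smul, smul_comm]
  | mul_gen n a i hn ha =>
    rw [derivation_mul u hn, map_add, map_smul, map_mul, map_mul, ha, derivation_gen, h,
      map_mul, insertion_mul hb _ _ (hf i), neg_one_zpow_add, smul_add, smul_smul, smul_mul_assoc,
      mul_smul_comm, smul_smul]
    congr 2
    have := neg_one_zpow_mul_self (K := K) (q i)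
    linear_combination -((-1) ^ n) * this

/-- Prescribing the first letter of a list acts on a monomial as a partial derivative `w i`, and
Euler's formula recovers the monomial from its partial derivatives. Together they allow an induction
on length in the proof of injectivity. -/
theorem exists_letter_derivatives {e : G → X} {c : G → X → K}
    (hc : ∀ i x, c i x ≠ 0 → deg x = q i) [DecidableEq G]
    (hce : ∀ i j, c i (e j) = if i = j then 1 else 0) (l : List G) :
    ∃ w : G → FreeCGA K q, (Function.support w).Finite ∧
      (∀ i, w i ∈ Submodule.span K {a | ∃ l' : List G, l'.length + 1 = l.length ∧
        a = (l'.map (gen q)).prod}) ∧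
      (∀ i r, toShuffle (fun i => ofLetters (c i)) (fun i => ofLetters_isHomogeneous (hc i))
          (l.map (gen q)).prod (e i :: r) =
        toShuffle (fun i => ofLetters (c i)) (fun i => ofLetters_isHomogeneous (hc i)) (w i) r) ∧
      ∑ᶠ i, w i * gen q i = (l.length : K) • (l.map (gen q)).prod := by
  set Ψ := toShuffle (q := q) (fun i => (ofLetters (c i) : ShuffleAlgebra K deg))
    (fun i => ofLetters_isHomogeneous (hc i)) with hΨ
  have hdeg : ∀ i, deg (e i) = q i := fun i => hc i _ (by simp [hce])
  induction l using List.reverseRecOn with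
  | nil =>
    refine ⟨fun _ => 0, by simp [Function.support_fun_zero], by simp, ?_, by simp⟩
    intro i r
    simp
  | append_singleton l j ih =>
    obtain ⟨w, hw1, hw2, hw3, hw4⟩ := ih
    set a := (l.map (gen (K := K) q)).prod with ha
    have hprod : ((l ++ [j]).map (gen (K := K) q)).prod = a * gen q j := by simp [ha]
    have hs1 : (Function.support fun i => (-1 : K) ^ (q i * q j) • (w i * gen q j)).Finite :=
      hw1.subset fun i hi h0 => hi (by simp [h0])
    have hs2 : (Function.support fun i => if i = j then a else 0).Finite :=
      (Set.finite_singleton j).subset fun i hi => by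
        by_contra h; exact hi (if_neg h)
    -- Leibniz rule for the derivative along `vᵢ`: either the letter passes over the new last
    -- factor, which costs a sign, or it is consumed by it.
    refine ⟨fun i => (-1 : K) ^ (q i * q j) • (w i * gen q j) + if i = j then a else 0,
      (hs1.union hs2).subset (Function.support_add _ _), ?_, ?_, ?_⟩
    · intro i
      refine Submodule.add_mem _ (Submodule.smul_mem _ _ ?_) ?_
      · have := hw2 i
        generalize w i = b at this ⊢
        induction this using Submodule.span_induction with
        | mem b hb =>
          obtain ⟨l', hl', rfl⟩ := hb
          exact Submodule.subset_span ⟨l' ++ [j], by simp [← hl'], by simp⟩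
        | zero => simp
        | add b b' _ _ hb hb' => rw [add_mul]; exact Submodule.add_mem _ hb hb'
        | smul s b _ hb => rw [smul_mul_assoc]; exact Submodule.smul_mem _ _ hb
      · split_ifs
        · exact Submodule.subset_span ⟨l, by simp, rfl⟩
        · simp
    · intro i r
      rw [hprod, map_mul, map_add, map_smul, map_mul, ShuffleAlgebra.add_apply,
        ShuffleAlgebra.smul_apply, ShuffleAlgebra.mul_cons, add_comm]
      congr 1
      · rw [ShuffleAlgebra.mul_apply, ← shuffleSum_mul_left]
        refine shuffleSum_congr deg r fun s r' _ => ?_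
        rw [hw3]
        by_cases h : Ψ (gen q j) s = 0
        · simp [h]
        · have : listDegree deg s = q j := by
            refine ofLetters_isHomogeneous (hc j) s ?_
            rwa [hΨ, toShuffle_gen] at h
          rw [this, hdeg]
      · rw [shuffleSum_left_nil]
        · rw [hΨ, toShuffle_gen, ofLetters_singleton, hce, ← hΨ]
          by_cases h : i = j
          · subst h; simp
          · rw [if_neg (Ne.symm h), if_neg h]; simp
        · rintro (_ | ⟨x, s⟩) r' h
          · exact absurd rfl h
          · rw [hΨ, toShuffle_gen, ofLetters_cons_cons, zero_mul]
    · simp only [add_mul]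
      rw [finsum_add_distrib, hprod]
      · have h1 : ∀ i, ((-1 : K) ^ (q i * q j) • (w i * gen q j)) * gen q i =
            (w i * gen q i) * gen q j := by
          intro i
          rw [smul_mul_assoc, mul_assoc, ← mul_smul_comm, mul_assoc, gen_mul_gen q i j]
        have h2 : ∀ i, (if i = j then a else 0) * gen q i = if i = j then a * gen q j else 0 := by
          intro i; split_ifs with h
          · rw [h]
          · simp
        simp only [h1, h2]
        rw [← finsum_mul', hw4, finsum_eq_single _ j (fun i hi => if_neg hi), if_pos rfl]
        · simp [add_smul]
        · exact hw1.subset fun i hi h0 => hi (by simp [h0])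
      · exact hs1.subset fun i hi h0 => hi (by simp only [h0, zero_mul])
      · exact hs2.subset fun i hi h0 => hi (by simp only [h0, zero_mul])

end Shuffle

/-! ### Faithfulness of the evaluation on lists -/

section Injectivity

variable {K : Type u} [Field K] {X : Type w} {deg : X → ℤ} {G : Type} {q : G → ℤ}

variable (K q) in
/-- The span of the monomials of length `n`. -/
def lengthSpan (n : ℕ) : Submodule K (FreeCGA K q) :=
  Submodule.span K {a | ∃ l : List G, l.length = n ∧ a = (l.map (gen q)).prod}

theorem toShuffle_apply_eq_zero {c : G → X → K} (hc : ∀ i x, c i x ≠ 0 → deg x = q i) {n : ℕ}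
    {a : FreeCGA K q} (ha : a ∈ lengthSpan K q n) (l : List X) (hl : l.length ≠ n) :
    toShuffle (fun i => (ShuffleAlgebra.ofLetters (c i) : ShuffleAlgebra K deg))
      (fun i => ShuffleAlgebra.ofLetters_isHomogeneous (hc i)) a l = 0 := by
  induction ha using Submodule.span_induction with
  | mem a ha =>
    obtain ⟨L, rfl, rfl⟩ := ha
    induction L using List.reverseRecOn generalizing l with
    | nil =>
      simp only [List.map_nil, List.prod_nil, map_one]
      exact ShuffleAlgebra.one_of_ne_nil (by rintro rfl; exact hl rfl)
    | append_singleton L j ih =>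
      simp only [List.map_append, List.map_cons, List.map_nil, List.prod_append,
        List.prod_singleton, map_mul, toShuffle_gen]
      refine shuffleSum_eq_zero deg l ?_
      rintro (_ | ⟨x, _ | ⟨y, s⟩⟩) r hp
      · simp
      · rw [ih r, mul_zero]
        intro h
        apply hl
        rw [← hp.length_eq]
        simp [h]
      · simp
  | zero => simp
  | add a b _ _ ha hb => rw [map_add, ShuffleAlgebra.add_apply, ha, hb, add_zero]
  | smul s a _ ha => rw [map_smul, ShuffleAlgebra.smul_apply, ha, mul_zero]

/-- Induction on the length: if `a` vanishes on all lists, so do its partial derivatives, which are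
then zero, and Euler's formula shows that a non-zero integer multiple of `a` is zero. -/
theorem eq_zero_of_toShuffle_eq_zero [CharZero K] {e : G → X} {c : G → X → K}
    (hc : ∀ i x, c i x ≠ 0 → deg x = q i) [DecidableEq G]
    (hce : ∀ i j, c i (e j) = if i = j then 1 else 0) {n : ℕ} {a : FreeCGA K q}
    (ha : a ∈ lengthSpan K q n)
    (h0 : ∀ l, l.length = n → toShuffle (fun i => (ShuffleAlgebra.ofLetters (c i) :
      ShuffleAlgebra K deg)) (fun i => ShuffleAlgebra.ofLetters_isHomogeneous (hc i)) a l = 0) :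
    a = 0 := by
  induction n generalizing a with
  | zero =>
    have : ∃ s : K, a = s • 1 := by
      clear h0
      induction ha using Submodule.span_induction with
      | mem a ha =>
        obtain ⟨L, hL, rfl⟩ := ha
        rw [List.length_eq_zero_iff] at hL
        subst hL
        exact ⟨1, by simp⟩
      | zero => exact ⟨0, by simp⟩
      | add a b _ _ ha hb =>
        obtain ⟨s, rfl⟩ := ha; obtain ⟨t, rfl⟩ := hb; exact ⟨s + t, by rw [add_smul]⟩
      | smul s a _ ha => obtain ⟨t, rfl⟩ := ha; exact ⟨s * t, by rw [smul_smul]⟩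
    obtain ⟨s, rfl⟩ := this
    have := h0 [] rfl
    rw [map_smul, map_one, ShuffleAlgebra.smul_apply, ShuffleAlgebra.one_nil, mul_one] at this
    rw [this, zero_smul]
  | succ n ih =>
    have key : ∃ w : G → FreeCGA K q, (Function.support w).Finite ∧
        (∀ i, w i ∈ lengthSpan K q n) ∧
        (∀ i r, toShuffle (fun i => (ShuffleAlgebra.ofLetters (c i) : ShuffleAlgebra K deg))
          (fun i => ShuffleAlgebra.ofLetters_isHomogeneous (hc i)) a (e i :: r) =
          toShuffle (fun i => ShuffleAlgebra.ofLetters (c i))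
            (fun i => ShuffleAlgebra.ofLetters_isHomogeneous (hc i)) (w i) r) ∧
        ∑ᶠ i, w i * gen q i = ((n + 1 : ℕ) : K) • a := by
      clear h0 ih
      induction ha using Submodule.span_induction with
      | mem a ha =>
        obtain ⟨L, hL, rfl⟩ := ha
        obtain ⟨w, h1, h2, h3, h4⟩ := exists_letter_derivatives (K := K) hc hce L
        refine ⟨w, h1, fun i => ?_, h3, by rw [h4, hL]⟩
        have := h2 i
        rw [hL] at this
        simpa [lengthSpan] using this
      | zero => exact ⟨0, by simp, by simp, by simp, by simp⟩
      | add a b _ _ ha hb =>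
        obtain ⟨w, h1, h2, h3, h4⟩ := ha
        obtain ⟨w', h1', h2', h3', h4'⟩ := hb
        refine ⟨w + w', (h1.union h1').subset (Function.support_add _ _),
          fun i => Submodule.add_mem _ (h2 i) (h2' i), fun i r => ?_, ?_⟩
        · rw [map_add, ShuffleAlgebra.add_apply, h3, h3', Pi.add_apply, map_add,
            ShuffleAlgebra.add_apply]
        · simp only [Pi.add_apply, add_mul]
          rw [finsum_add_distrib, h4, h4', smul_add]
          · exact h1.subset fun i hi h0 => hi (by simp [h0])
          · exact h1'.subset fun i hi h0 => hi (by simp [h0])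
      | smul s a _ ha =>
        obtain ⟨w, h1, h2, h3, h4⟩ := ha
        refine ⟨s • w, h1.subset (Function.support_const_smul_subset _ _),
          fun i => Submodule.smul_mem _ _ (h2 i), fun i r => ?_, ?_⟩
        · rw [map_smul, ShuffleAlgebra.smul_apply, h3, Pi.smul_apply, map_smul,
            ShuffleAlgebra.smul_apply]
        · simp only [Pi.smul_apply, smul_mul_assoc]
          rw [← smul_finsum' _ (h1.subset fun i hi h0 => hi (by simp [h0])), h4, smul_comm]
    obtain ⟨w, -, h2, h3, h4⟩ := key
    have hw : ∀ i, w i = 0 := fun i => ih (h2 i) fun l hl => by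
      rw [← h3]; exact h0 _ (by simp [hl])
    simp only [hw, zero_mul, finsum_zero] at h4
    exact (smul_eq_zero.1 h4.symm).resolve_left (by exact_mod_cast n.succ_ne_zero)

/-- Lists of length `n` detect only the part spanned by monomials of length `n`, so each such part
of an element of the kernel is treated separately. -/
theorem toShuffle_injective [CharZero K] {e : G → X} {c : G → X → K}
    (hc : ∀ i x, c i x ≠ 0 → deg x = q i) [DecidableEq G]
    (hce : ∀ i j, c i (e j) = if i = j then 1 else 0) :
    Function.Injective (toShuffle (fun i => (ShuffleAlgebra.ofLetters (c i) :
      ShuffleAlgebra K deg)) (fun i => ShuffleAlgebra.ofLetters_isHomogeneous (hc i))) := by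
  rw [injective_iff_map_eq_zero]
  intro a ha
  have hmem : a ∈ ⨆ n, lengthSpan K q n := by
    clear ha
    induction a using monomial_induction with
    | monomial l => exact Submodule.mem_iSup_of_mem l.length (Submodule.subset_span ⟨l, rfl, rfl⟩)
    | add a b ha hb => exact Submodule.add_mem _ ha hb
    | smul s a ha => exact Submodule.smul_mem _ _ ha
  obtain ⟨f, hf, hfa⟩ := (Submodule.mem_iSup_iff_exists_finsupp _ _).1 hmem
  have : ∀ n, f n = 0 := by
    intro n
    refine eq_zero_of_toShuffle_eq_zero hc hce (hf n) fun l hl => ?_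
    have h1 := congrArg (fun F : ShuffleAlgebra K deg => F l) ha
    simp only [← hfa, Finsupp.sum, map_sum] at h1
    have h2 : ∀ (s : Finset ℕ) (F : ℕ → ShuffleAlgebra K deg),
        (∑ i ∈ s, F i) l = ∑ i ∈ s, F i l := fun s F => by
      induction s using Finset.induction_on with
      | empty => rfl
      | insert i s hi ih =>
        rw [Finset.sum_insert hi, Finset.sum_insert hi, ShuffleAlgebra.add_apply, ih]
    rw [h2] at h1
    by_cases hn : n ∈ f.support
    · rw [Finset.sum_eq_single_of_mem n hn] at h1
      · exact h1
      · intro m _ hm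
        exact toShuffle_apply_eq_zero hc (hf m) l (by rw [hl]; exact hm.symm)
    · rw [Finsupp.notMem_support_iff.1 hn]; simp
  rw [← hfa, Finsupp.sum]
  exact Finset.sum_eq_zero fun n _ => this n

end Injectivity

/-! ### Sums over ordered partitions -/

section MultiShuffle

variable {K : Type u} [Field K] {X : Type w} (deg : X → ℤ)

/-- The sum of `H s`, with Koszul signs, over all ways to distribute a list to `k` sublists. -/
def multiShuffle (k : ℕ) : List X → ((Fin k → List X) → K) → K
  | [], H => H fun _ => []
  | x :: l, H => ∑ j : Fin k, multiShuffle k l fun s =>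
      (∏ i, if i < j then (-1 : K) ^ (deg x * listDegree deg (s i)) else 1) *
        H (Function.update s j (x :: s j))

theorem multiShuffle_congr {k : ℕ} (l : List X) {H H' : (Fin k → List X) → K}
    (h : ∀ s, (∀ j, (s j).Sublist l) → ∑ j, (s j).length = l.length → H s = H' s) :
    multiShuffle deg k l H = multiShuffle deg k l H' := by
  induction l generalizing H H' with
  | nil => exact h _ (fun _ => .slnil) (by simp)
  | cons x l ih =>
    simp only [multiShuffle]
    refine Finset.sum_congr rfl fun j _ => ih fun s hs hl => ?_
    rw [h]
    · intro i
      by_cases hi : i = j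
      · subst hi; simpa using hs i
      · simpa [hi] using (hs i).cons x
    · rw [← Finset.add_sum_erase _ _ (Finset.mem_univ j)] at hl ⊢
      rw [Finset.sum_congr rfl fun i hi => by
        rw [Function.update_of_ne (Finset.ne_of_mem_erase hi)]]
      simp only [Function.update_self, List.length_cons]
      omega

theorem multiShuffle_mul_left {k : ℕ} (l : List X) (c : K) (H : (Fin k → List X) → K) :
    multiShuffle deg k l (fun s => c * H s) = c * multiShuffle deg k l H := by
  induction l generalizing H with
  | nil => rfl
  | cons x l ih =>
    simp only [multiShuffle, Finset.mul_sum, ← ih]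
    exact Finset.sum_congr rfl fun j _ => multiShuffle_congr deg l fun s _ _ => by ring

theorem multiShuffle_sum {k : ℕ} {ι : Type*} (D : Finset ι) (l : List X)
    (H : ι → (Fin k → List X) → K) :
    multiShuffle deg k l (fun s => ∑ i ∈ D, H i s) = ∑ i ∈ D, multiShuffle deg k l (H i) := by
  induction l generalizing H with
  | nil => rfl
  | cons x l ih =>
    simp only [multiShuffle, Finset.mul_sum, ih]
    exact Finset.sum_comm

theorem multiShuffle_eq_zero {k : ℕ} (l : List X) {H : (Fin k → List X) → K}
    (h : ∀ s, (∀ j, (s j).Sublist l) → ∑ j, (s j).length = l.length → H s = 0) :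
    multiShuffle deg k l H = 0 := by
  have := multiShuffle_mul_left deg l (0 : K) H
  rw [zero_mul] at this
  rw [← this]
  exact multiShuffle_congr deg l fun s hs hl => by rw [h s hs hl, zero_mul]

theorem multiShuffle_succ {k : ℕ} (l : List X) (H : (Fin (k + 1) → List X) → K) :
    multiShuffle deg (k + 1) l H =
      shuffleSum deg l fun s r => multiShuffle deg k r fun t => H (Fin.cons s t) := by
  induction l generalizing H with
  | nil =>
    simp only [multiShuffle, shuffleSum]
    congr 1
    ext i : 1
    refine Fin.cases rfl (fun _ => rfl) i
  | cons x l ih =>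
    simp only [multiShuffle, shuffleSum, ih, Fin.sum_univ_succ]
    congr 1
    · refine shuffleSum_congr deg l fun s r _ => multiShuffle_congr deg r fun t _ _ => ?_
      simp [Fin.update_cons_zero]
    · have hsum : ∀ (D : Finset (Fin k)) (H' : Fin k → List X → List X → K),
          ∑ j ∈ D, shuffleSum deg l (H' j) = shuffleSum deg l fun s r => ∑ j ∈ D, H' j s r := by
        intro D H'
        induction D using Finset.induction_on with
        | empty => simp
        | insert j D hj ihD => simp only [Finset.sum_insert hj, shuffleSum_add, ihD]
      rw [hsum]
      refine shuffleSum_congr deg l fun s r _ => ?_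
      rw [Finset.mul_sum]
      refine Finset.sum_congr rfl fun j _ => ?_
      rw [← multiShuffle_mul_left]
      refine multiShuffle_congr deg r fun t _ _ => ?_
      rw [Fin.prod_univ_succ, ← Fin.cons_update]
      simp [Fin.succ_lt_succ_iff, Fin.succ_pos, mul_assoc]

theorem multiShuffle_zero (l : List X) (hl : l ≠ []) (H : (Fin 0 → List X) → K) :
    multiShuffle deg 0 l H = 0 := by
  cases l with
  | nil => exact absurd rfl hl
  | cons x l => simp [multiShuffle]

theorem multiShuffle_one (l : List X) (H : (Fin 1 → List X) → K) :
    multiShuffle deg 1 l H = H fun _ => l := by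
  rw [multiShuffle_succ, shuffleSum_right_nil _ _ _ fun s r hr => multiShuffle_zero deg r hr _]
  simp only [multiShuffle]
  congr 1
  ext i : 1
  exact Fin.cases rfl (fun i => i.elim0) i

theorem multiShuffle_two (l : List X) (H : (Fin 2 → List X) → K) :
    multiShuffle deg 2 l H = shuffleSum deg l fun s r => H ![s, r] := by
  rw [multiShuffle_succ]
  refine shuffleSum_congr deg l fun s r _ => ?_
  rw [multiShuffle_one]
  congr 1
  ext i : 1
  fin_cases i <;> rfl

/-- The reversal appears because multiplication hands the first sublist to the last factor. -/
theorem prod_reverse_apply {k : ℕ} (F : Fin k → ShuffleAlgebra K deg) (l : List X) :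
    (List.ofFn F).reverse.prod l = multiShuffle deg k l fun s => ∏ j, F j (s j) := by
  induction k generalizing l with
  | zero =>
    cases l with
    | nil => simp [multiShuffle]
    | cons x l => simp [multiShuffle]
  | succ k ih =>
    rw [List.ofFn_succ, List.reverse_cons, List.prod_append, List.prod_singleton,
      ShuffleAlgebra.mul_apply, multiShuffle_succ]
    refine shuffleSum_congr deg l fun s r _ => ?_
    rw [ih, ← multiShuffle_mul_left]
    refine multiShuffle_congr deg r fun t _ _ => ?_
    simp [Fin.prod_univ_succ]

/-- The sublist with indices in `S`. -/
theorem ofFn_subTuple {n : ℕ} (x : Fin n → X) (S : Finset (Fin n)) :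
    List.ofFn (subTuple x S) = ((List.finRange n).filter (· ∈ S)).map x := by
  have h1 : List.ofFn (subTuple x S) = (List.ofFn (S.orderEmbOfFin rfl)).map x := by
    rw [List.map_ofFn]; rfl
  rw [h1]
  congr 1
  refine List.Perm.eq_of_pairwise' (r := (· < ·)) ?_ ?_ ?_
  · rw [List.pairwise_ofFn]
    exact fun i j h => (S.orderEmbOfFin rfl).strictMono h
  · exact (List.pairwise_lt_finRange n).filter _
  · refine (List.perm_ext_iff_of_nodup ?_ ((List.nodup_finRange n).filter _)).2 fun a => ?_
    · exact List.nodup_ofFn.2 (S.orderEmbOfFin rfl).injective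
    · simp only [List.mem_ofFn, List.mem_filter, List.mem_finRange, true_and, decide_eq_true_eq]
      have := Set.ext_iff.1 (S.range_orderEmbOfFin rfl) a
      exact this

theorem koszulSign_cons {n : ℕ} (q : Fin (n + 1) → ℤ) (c : Fin (n + 1) → ℕ) :
    koszulSign K q c = (∏ b : Fin n, if c b.succ < c 0 then (-1 : K) ^ (q 0 * q b.succ) else 1) *
      koszulSign K (q ∘ Fin.succ) (c ∘ Fin.succ) := by
  have hprod : ∀ (D : Finset (Fin n)) (g : Fin n → ℤ),
      (-1 : K) ^ (∑ b ∈ D, g b) = ∏ b ∈ D, (-1 : K) ^ g b := by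
    intro D g
    induction D using Finset.induction_on with
    | empty => simp
    | insert j D hj ih => rw [Finset.sum_insert hj, Finset.prod_insert hj, neg_one_zpow_add, ih]
  simp only [koszulSign, Fin.sum_univ_succ (n := n), neg_one_zpow_add]
  congr 1
  · simp only [lt_irrefl, false_and, if_false, zpow_zero, one_mul, Fin.succ_pos, true_and]
    rw [hprod]
    refine Finset.prod_congr rfl fun b _ => ?_
    split_ifs <;> simp
  · congr 1
    refine Finset.sum_congr rfl fun a _ => ?_
    simp [Fin.succ_lt_succ_iff]

/-- Converts the sums over block functions in the definition of a morphism into recursive sums.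
Splitting off the first letter, its label chooses the block, and the sign is that of passing over
all letters with smaller labels. -/
theorem sum_koszulSign_mul {k n : ℕ} (x : Fin n → X) (H : (Fin k → List X) → K) :
    ∑ c : Fin n → Fin k, koszulSign K (fun i => deg (x i)) (fun i => (c i : ℕ)) *
      H (fun j => List.ofFn (subTuple x (Finset.univ.filter fun i => c i = j))) =
      multiShuffle deg k (List.ofFn x) H := by
  simp only [ofFn_subTuple, Finset.mem_filter, Finset.mem_univ, true_and]
  induction n generalizing H with
  | zero => simp [multiShuffle, koszulSign]
  | succ n ih =>
    rw [List.ofFn_succ]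
    simp only [multiShuffle]
    rw [← (Fin.consEquiv fun _ => Fin k).sum_comp, Fintype.sum_prod_type]
    refine Finset.sum_congr rfl fun j _ => ?_
    rw [← ih]
    refine Finset.sum_congr rfl fun c _ => ?_
    rw [koszulSign_cons]
    have hb : ∀ i, (List.map x ((List.finRange (n + 1)).filter fun a =>
        ((Fin.consEquiv fun _ => Fin k) (j, c) : Fin (n + 1) → Fin k) a = i)) =
        Function.update (fun i => List.map (fun a => x a.succ)
          ((List.finRange n).filter fun a => c a = i)) j
          (x 0 :: List.map (fun a => x a.succ) ((List.finRange n).filter fun a => c a = j)) i := by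
      intro i
      rw [List.finRange_succ]
      have h2 : List.filter (fun a => decide (((Fin.consEquiv fun _ => Fin k) (j, c) :
          Fin (n + 1) → Fin k) a = i)) ((List.finRange n).map Fin.succ) =
          ((List.finRange n).filter fun a => c a = i).map Fin.succ := by
        rw [List.filter_map]; rfl
      by_cases hi : i = j
      · subst hi
        rw [List.filter_cons_of_pos (by simp [Fin.consEquiv]), h2]
        simp
      · rw [List.filter_cons_of_neg (by simpa [Fin.consEquiv] using Ne.symm hi), h2]
        simp [hi]
    simp only [hb]
    have hs : (∏ b : Fin n, if (((Fin.consEquiv fun _ => Fin k) (j, c) : Fin (n + 1) → Fin k)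
        b.succ : ℕ) < (((Fin.consEquiv fun _ => Fin k) (j, c) : Fin (n + 1) → Fin k) 0 : ℕ) then
        (-1 : K) ^ (deg (x 0) * deg (x b.succ)) else 1) =
        ∏ i : Fin k, if i < j then (-1 : K) ^ (deg (x 0) * listDegree deg
          (List.map (fun a => x a.succ) ((List.finRange n).filter fun a => c a = i))) else 1 := by
      have h3 : ∀ i, (-1 : K) ^ (deg (x 0) * listDegree deg
          (List.map (fun a => x a.succ) ((List.finRange n).filter fun a => c a = i))) =
          ∏ b : Fin n, if c b = i then (-1 : K) ^ (deg (x 0) * deg (x b.succ)) else 1 := by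
        intro i
        have h4 : ∀ L : List (Fin n), (-1 : K) ^ (deg (x 0) * listDegree deg
            (List.map (fun a => x a.succ) (L.filter fun a => c a = i))) =
            (L.map fun b => if c b = i then (-1 : K) ^ (deg (x 0) * deg (x b.succ)) else 1).prod := by
          intro L
          induction L with
          | nil => simp
          | cons b L ihL =>
            by_cases hb : c b = i
            · rw [List.filter_cons_of_pos (by simpa using hb)]
              simp only [List.map_cons, listDegree_cons, mul_add, neg_one_zpow_add, ihL,
                List.prod_cons, hb, if_true]
            · rw [List.filter_cons_of_neg (by simpa using hb)]
              simp only [List.map_cons, ihL, List.prod_cons, hb, if_false, one_mul]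
        rw [h4, ← List.ofFn_eq_map, List.prod_ofFn]
      simp only [h3]
      have h5 : ∀ i : Fin k, (if i < j then ∏ b : Fin n, (if c b = i then
          (-1 : K) ^ (deg (x 0) * deg (x b.succ)) else 1) else 1) =
          ∏ b : Fin n, if c b = i then (if i < j then
            (-1 : K) ^ (deg (x 0) * deg (x b.succ)) else 1) else 1 := by
        intro i; split_ifs <;> simp
      simp only [h5]
      rw [Finset.prod_comm]
      refine Finset.prod_congr rfl fun b _ => ?_
      rw [Finset.prod_ite_eq]
      simp [Fin.consEquiv]
    rw [hs]
    change _ * koszulSign K (fun i => deg (x i.succ)) (fun i => (c i : ℕ)) * _ = _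
    ring

/-- The case of two blocks, a subset being the block with label `0`; this is the shape of the Jacobi
sums. -/
theorem sum_finset_koszulSign_mul {n : ℕ} (x : Fin n → X) (H : List X → List X → K) :
    ∑ S : Finset (Fin n), koszulSign K (fun i => deg (x i)) (fun i => if i ∈ S then 0 else 1) *
      H (List.ofFn (subTuple x S)) (List.ofFn (subTuple x Sᶜ)) =
      shuffleSum deg (List.ofFn x) H := by
  have h := sum_koszulSign_mul (K := K) deg (k := 2) x fun s => H (s 0) (s 1)
  rw [multiShuffle_two] at h
  simp only [Matrix.cons_val_zero, Matrix.cons_val_one] at h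
  rw [← h]
  let E : Finset (Fin n) ≃ (Fin n → Fin 2) :=
    { toFun := fun S i => if i ∈ S then 0 else 1
      invFun := fun c => Finset.univ.filter fun i => c i = 0
      left_inv := fun S => by
        ext i
        by_cases hi : i ∈ S <;> simp [hi]
      right_inv := fun c => by
        ext i : 1
        by_cases hi : c i = 0
        · simp [hi]
        · have : c i = 1 := by omega
          simp [this] }
  refine Fintype.sum_equiv E _ _ fun S => ?_
  have h1 : (Finset.univ.filter fun i => E S i = 0) = S := E.left_inv S
  have h2 : (Finset.univ.filter fun i => E S i = 1) = Sᶜ := by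
    ext i
    by_cases hi : i ∈ S <;> simp [E, hi]
  rw [h1, h2]
  congr 2
  ext i
  by_cases hi : i ∈ S <;> simp [E, hi]

end MultiShuffle

/-! ### Families of multilinear maps on lists -/

section EvalList

variable {K : Type u} [Field K] {E : Type v} [AddCommGroup E] [Module K E]
  {F : Type w} [AddCommGroup F] [Module K F]

/-- The value of a family of multilinear maps on a list. -/
def evalList (f : (k : ℕ) → MultilinearMap K (fun _ : Fin k => E) F) (l : List E) : F :=
  f l.length l.get

theorem evalList_ofFn (f : (k : ℕ) → MultilinearMap K (fun _ : Fin k => E) F) {n : ℕ}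
    (x : Fin n → E) : evalList f (List.ofFn x) = f n x := by
  have : ∀ (m n : ℕ) (h : m = n) (y : Fin m → E) (z : Fin n → E),
      (∀ i, y i = z (Fin.cast h i)) → f m y = f n z := by
    rintro m n rfl y z h
    congr 1
    exact funext h
  exact this _ _ List.length_ofFn _ _ fun i => by simp; rfl

theorem evalList_cons_ofFn (f : (k : ℕ) → MultilinearMap K (fun _ : Fin k => E) F) {n : ℕ}
    (y : E) (x : Fin n → E) :
    evalList f (y :: List.ofFn x) = f (n + 1) (Matrix.vecCons y x) := by
  rw [← evalList_ofFn, List.ofFn_succ]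
  rfl

end EvalList

/-! ### Generators of cochain algebras -/

section FormGen

variable {K : Type u} [Field K] {ι : Type} {E : Type v} [AddCommGroup E] [Module K E] (q : ι → ℤ)
  (e : Module.Basis ι K E)

/-- The element of the free graded commutative algebra with prescribed graded symmetric multilinear
forms as components. -/
noncomputable def formGen (f : (k : ℕ) → MultilinearMap K (fun _ : Fin k => E) K) : FreeCGA K q :=
  ∑ᶠ t : Σ k : ℕ, Fin k → ι,
    (((t.1 ! : ℕ) : K)⁻¹ * pairingSign K (fun a => q (t.2 a)) * f t.1 fun a => e (t.2 a)) •
      (List.ofFn fun a => gen q (t.2 a)).prod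

variable {q}

theorem pairingSign_succ {k : ℕ} (p : Fin (k + 1) → ℤ) :
    pairingSign K p = (-1) ^ (p 0 * ∑ i : Fin k, p i.succ) *
      pairingSign K (fun i : Fin k => p i.succ) := by
  simp only [pairingSign, Fin.sum_univ_succ (n := k), neg_one_zpow_add]
  congr 1
  · simp [Fin.succ_pos, Finset.mul_sum]
  · congr 1
    refine Finset.sum_congr rfl fun a _ => ?_
    simp [Fin.succ_lt_succ_iff]

/-- Reversing the order of the factors exchanges each pair of generators exactly once. -/
theorem pairingSign_smul_prod {k : ℕ} (I : Fin k → ι) :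
    pairingSign K (fun a => q (I a)) • (List.ofFn fun a => gen (K := K) q (I a)).prod =
      (List.ofFn fun a => gen q (I a)).reverse.prod := by
  induction k with
  | zero => simp [pairingSign]
  | succ k ih =>
    have hmem : (List.ofFn fun a : Fin k => gen (K := K) q (I a.succ)).prod ∈
        gr (K := K) q (∑ a : Fin k, q (I a.succ)) :=
      Submodule.subset_span ⟨List.ofFn fun a : Fin k => I a.succ, by
        rw [List.map_ofFn, List.sum_ofFn]; rfl, by rw [List.map_ofFn]; rfl⟩
    rw [List.ofFn_succ, List.reverse_cons, List.prod_append, List.prod_singleton, ← ih,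
      pairingSign_succ, List.prod_cons, smul_mul_assoc, mul_gen q _ _ hmem, smul_smul,
      mul_comm (q (I 0)), mul_comm]

variable {X : Type*} {deg : X → ℤ}

theorem toShuffle_pairingSign_smul (Ψ : FreeCGA K q →ₐ[K] ShuffleAlgebra K deg) {k : ℕ}
    (I : Fin k → ι) (T : List X) :
    Ψ (pairingSign K (fun a => q (I a)) • (List.ofFn fun a => gen (K := K) q (I a)).prod) T =
      multiShuffle deg k T fun s => ∏ j, Ψ (gen q (I j)) (s j) := by
  rw [pairingSign_smul_prod, ← prod_reverse_apply, map_list_prod, List.map_reverse, List.map_ofFn]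
  rfl

/-- Applying `Ψ` amounts to substituting in `f` the vector-valued function `y` whose coordinates are
the images of the generators. If `y` reads single letters, this returns `f` itself; if `y` is the
family of components of an `L∞` morphism, it is the sum over ordered partitions in the morphism
equation. -/
theorem map_formGen (f : (k : ℕ) → MultilinearMap K (fun _ : Fin k => E) K)
    (hfin : {t : Σ k : ℕ, Fin k → ι | f t.1 (fun a => e (t.2 a)) ≠ 0}.Finite)
    (Ψ : FreeCGA K q →ₐ[K] ShuffleAlgebra K deg) (h0 : ∀ i, Ψ (gen q i) [] = 0)
    (y : List X → E) (hy : ∀ i l, e.coord i (y l) = Ψ (gen q i) l) (T : List X) :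
    Ψ (formGen q e f) T = ∑ k ∈ Finset.range (T.length + 1), ((k ! : ℕ) : K)⁻¹ *
      multiShuffle deg k T fun s => f k fun j => y (s j) := by
  classical
  let ev : ShuffleAlgebra K deg →ₗ[K] K :=
    { toFun := fun F => F T, map_add' := fun _ _ => rfl, map_smul' := fun _ _ => rfl }
  -- Only finitely many basis vectors occur in the values of `y` on sublists of `T`; all sums are
  -- restricted to them.
  let D : Finset ι := T.sublists.toFinset.biUnion fun s => (e.repr (y s)).support
  have hD : ∀ s i, s.Sublist T → i ∉ D → e.coord i (y s) = 0 := by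
    intro s i hs hi
    by_contra h
    exact hi (Finset.mem_biUnion.2 ⟨s, by simpa using hs, by simpa using h⟩)
  have h1 : Ψ (formGen q e f) T = ∑ᶠ t : Σ k : ℕ, Fin k → ι, ((t.1 ! : ℕ) : K)⁻¹ *
      (f t.1 (fun a => e (t.2 a)) *
        multiShuffle deg t.1 T fun s => ∏ j, Ψ (gen q (t.2 j)) (s j)) := by
    change (ev.comp Ψ.toLinearMap).toAddMonoidHom (formGen q e f) = _
    rw [formGen, AddMonoidHom.map_finsum]
    · refine finsum_congr fun t => ?_
      rw [← toShuffle_pairingSign_smul, mul_right_comm, mul_smul]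
      change ev (Ψ _) = _
      rw [map_smul, map_smul, smul_eq_mul, mul_assoc]
      rfl
    · refine hfin.subset fun t ht hzero => ht ?_
      simp only [hzero, mul_zero, zero_smul]
  have h2 : ∀ t : Σ k : ℕ, Fin k → ι, (((t.1 ! : ℕ) : K)⁻¹ *
      (f t.1 (fun a => e (t.2 a)) *
        multiShuffle deg t.1 T fun s => ∏ j, Ψ (gen q (t.2 j)) (s j))) ≠ 0 →
      t ∈ (Finset.range (T.length + 1)).sigma fun k => Fintype.piFinset fun _ : Fin k => D := by
    intro t ht
    rw [Finset.mem_sigma, Finset.mem_range, Fintype.mem_piFinset]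
    by_contra hcon
    refine ht ?_
    rw [multiShuffle_eq_zero, mul_zero, mul_zero]
    intro s hs hl
    by_contra hne
    rw [← ne_eq, Finset.prod_ne_zero_iff] at hne
    refine hcon ⟨?_, fun j => ?_⟩
    -- By `h0` an empty block contributes zero, so there are at most `T.length` blocks.
    · have : ∀ j : Fin t.1, 1 ≤ (s j).length := fun j => by
        rw [Nat.one_le_iff_ne_zero, ne_eq, List.length_eq_zero_iff]
        intro h
        have := hne j (Finset.mem_univ j)
        rw [h, h0] at this
        exact this rfl
      have h3 := Finset.sum_le_sum fun j (_ : j ∈ Finset.univ) => this j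
      simp [hl] at h3
      omega
    · by_contra hj
      have := hne j (Finset.mem_univ j)
      rw [← hy] at this
      exact this (hD _ _ (hs j) hj)
  rw [h1, finsum_eq_sum_of_support_subset _ (s := (Finset.range (T.length + 1)).sigma
    fun k => Fintype.piFinset fun _ : Fin k => D) (fun t ht => h2 t ht), Finset.sum_sigma]
  refine Finset.sum_congr rfl fun k _ => ?_
  dsimp only
  rw [← Finset.mul_sum]
  congr 1
  rw [multiShuffle_congr deg T (H' := fun s => ∑ I ∈ Fintype.piFinset fun _ : Fin k => D,
    f k (fun a => e (I a)) * ∏ j, Ψ (gen q (I j)) (s j)), multiShuffle_sum]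
  · simp only [multiShuffle_mul_left]
  · intro s hs _
    have h4 : ∀ j, y (s j) = ∑ i ∈ D, e.coord i (y (s j)) • e i := by
      intro j
      conv_lhs => rw [← e.linearCombination_repr (y (s j)), Finsupp.linearCombination_apply,
        Finsupp.sum]
      refine Finset.sum_subset (fun i hi => ?_) fun i _ hi => ?_
      · by_contra h
        exact (Finsupp.mem_support_iff.1 hi) (hD _ _ (hs j) h)
      · rw [Finsupp.notMem_support_iff.1 hi, zero_smul]
    have h5 : (fun j => y (s j)) = fun j => ∑ i ∈ D, e.coord i (y (s j)) • e i := funext h4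
    rw [h5, MultilinearMap.map_sum_finset]
    refine Finset.sum_congr rfl fun I _ => ?_
    rw [MultilinearMap.map_smul_univ, smul_eq_mul, mul_comm]
    simp only [hy]

/-- Only partitions into singletons contribute. They are the permutations of the letters, each gives
the same value by graded symmetry, and their number cancels the factor `1/n!`. -/
theorem map_formGen_ofLetters [CharZero K] (f : (k : ℕ) → MultilinearMap K (fun _ : Fin k => E) K)
    (hfin : {t : Σ k : ℕ, Fin k → ι | f t.1 (fun a => e (t.2 a)) ≠ 0}.Finite)
    (val : X → E) (hval : ∀ i x, e.coord i (val x) ≠ 0 → deg x = q i)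
    (hsymm : ∀ (n : ℕ) (x : Fin n → X) (σ : Equiv.Perm (Fin n)), f n (fun i => val (x (σ i))) =
      koszulSign K (fun i => deg (x i)) (fun i => (σ.symm i : ℕ)) * f n fun i => val (x i))
    (T : List X) :
    toShuffle (fun i => ShuffleAlgebra.ofLetters fun x => e.coord i (val x))
      (fun i => ShuffleAlgebra.ofLetters_isHomogeneous (hval i)) (formGen q e f) T =
      evalList f (T.map val) := by
  let y : List X → E
    | [x] => val x
    | _ => 0
  have hy0 : ∀ l, l.length ≠ 1 → y l = 0 := by
    rintro (_ | ⟨x, _ | ⟨x', l⟩⟩) h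
    · rfl
    · exact absurd rfl h
    · rfl
  rw [map_formGen e f hfin _ (fun i => by rw [toShuffle_gen]; rfl) y (fun i l => by
    rw [toShuffle_gen]
    rcases l with (_ | ⟨x, _ | ⟨x', l⟩⟩)
    · simp [y]
    · simp [y]
    · simp [y])]
  obtain ⟨n, x, rfl⟩ : ∃ n, ∃ x : Fin n → X, T = List.ofFn x := ⟨_, T.get, (List.ofFn_get T).symm⟩
  simp only [← sum_koszulSign_mul]
  rw [List.map_ofFn, evalList_ofFn, List.length_ofFn]
  -- A block which is not a singleton puts a zero in some argument, so every value has exactly one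
  -- preimage.
  have key : ∀ (k : ℕ) (c : Fin n → Fin k), f k (fun j => y (List.ofFn (subTuple x
      (Finset.univ.filter fun i => c i = j)))) ≠ 0 → Function.Bijective c := by
    intro k c hne
    have h1 : ∀ j, (Finset.univ.filter fun i => c i = j).card = 1 := by
      intro j
      by_contra h
      refine hne (MultilinearMap.map_coord_zero _ j (hy0 _ (by simpa using h)))
    refine (Function.bijective_iff_existsUnique c).2 fun j => ?_
    obtain ⟨i, hi⟩ := Finset.card_eq_one.1 (h1 j)
    refine ⟨i, ?_, fun i' hi' => ?_⟩
    · have : i ∈ Finset.univ.filter fun i => c i = j := by rw [hi]; simp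
      simpa using this
    · have : i' ∈ Finset.univ.filter fun i => c i = j := by simpa using hi'
      rw [hi] at this
      simpa using this
  rw [Finset.sum_eq_single_of_mem n (by simp)]
  · have h2 : ∀ σ : Equiv.Perm (Fin n), koszulSign K (fun i => deg (x i)) (fun i => (σ i : ℕ)) *
        f n (fun j => y (List.ofFn (subTuple x (Finset.univ.filter fun i => σ i = j)))) =
        f n fun i => val (x i) := by
      intro σ
      have h3 : ∀ j, y (List.ofFn (subTuple x (Finset.univ.filter fun i => σ i = j))) =
          val (x (σ.symm j)) := by
        intro j
        have : (Finset.univ.filter fun i => σ i = j) = {σ.symm j} := by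
          ext i; simp [Equiv.eq_symm_apply]
        have h4 : List.ofFn (subTuple x (Finset.univ.filter fun i => σ i = j)) =
            [x (σ.symm j)] := by
          have h5 : (List.ofFn (subTuple x {σ.symm j})).length = 1 := by simp
          obtain ⟨z, hz⟩ := List.length_eq_one_iff.1 h5
          have h6 : x (σ.symm j) ∈ List.ofFn (subTuple x {σ.symm j}) := by
            rw [List.mem_ofFn']
            refine ⟨⟨0, by simp⟩, congrArg x ?_⟩
            exact Finset.mem_singleton.1 (Finset.orderEmbOfFin_mem _ _ _)
          rw [this]
          rw [hz, List.mem_singleton] at h6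
          rw [hz, h6]
        rw [h4]
      simp only [h3]
      rw [hsymm, Equiv.symm_symm, ← mul_assoc]
      have : ∀ p c, koszulSign K (n := n) p c * koszulSign K p c = 1 :=
        fun p c => neg_one_zpow_mul_self _
      rw [this, one_mul]
    rw [← Fintype.sum_of_injective (fun σ : Equiv.Perm (Fin n) => (σ : Fin n → Fin n))
      (fun σ τ h => Equiv.ext fun i => congrFun h i) _ _ ?_ fun σ => (h2 σ).symm]
    · rw [Finset.sum_const, Finset.card_univ, Fintype.card_perm, Fintype.card_fin, nsmul_eq_mul,
        ← mul_assoc, inv_mul_cancel₀ (by exact_mod_cast n.factorial_ne_zero), one_mul]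
      rfl
    · intro c hc
      by_contra h
      exact hc ⟨Equiv.ofBijective c (key n c (right_ne_zero_of_mul h)), rfl⟩
  · intro k _ hk
    rw [Finset.sum_eq_zero, mul_zero]
    intro c _
    by_contra h
    have := Fintype.card_of_bijective (key k c (right_ne_zero_of_mul h))
    simp at this
    exact hk this.symm

end FormGen

/-! ### Homogeneous elements -/

section Homogeneous

variable {K : Type u} [Field K] {E : Type v} [AddCommGroup E] [Module K E]
  {F : Type w} [AddCommGroup F] [Module K F]

/-- Homogeneous elements, with their degrees. -/
abbrev GradedBrackets.Homog (A : GradedBrackets K E) : Type v := Σ p : ℤ, A.deg p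

/-- The degree in the suspension. -/
def GradedBrackets.sdeg (A : GradedBrackets K E) (x : A.Homog) : ℤ := x.1 + 1

/-- The underlying vector. -/
def GradedBrackets.vec (A : GradedBrackets K E) (x : A.Homog) : E := x.2

/-- The brackets have degree `-1` on the suspension. -/
def GradedBrackets.HasDegree (A : GradedBrackets K E) : Prop :=
  ∀ (k : ℕ) (p : Fin k → ℤ) (x : Fin k → E), (∀ i, x i ∈ A.deg (p i)) →
    A.br k x ∈ A.deg (∑ i, p i + k - 2)

theorem GradedBrackets.HasDegree.evalList_mem {A : GradedBrackets K E} (hA : A.HasDegree)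
    (l : List A.Homog) : evalList A.br (l.map A.vec) ∈ A.deg (listDegree A.sdeg l - 2) := by
  obtain ⟨n, x, rfl⟩ : ∃ n, ∃ x : Fin n → A.Homog, l = List.ofFn x :=
    ⟨_, l.get, (List.ofFn_get l).symm⟩
  rw [List.map_ofFn, evalList_ofFn]
  have := hA n (fun i => (x i).1) (fun i => (x i).2) fun i => (x i).2.2
  convert this using 2
  swap
  · rfl
  simp only [listDegree, List.map_ofFn, List.sum_ofFn, Function.comp_apply, GradedBrackets.sdeg,
    Finset.sum_add_distrib]
  simp

/-- The bracket of a list of homogeneous elements. -/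
def GradedBrackets.HasDegree.bracket {A : GradedBrackets K E} (hA : A.HasDegree)
    (l : List A.Homog) : A.Homog :=
  ⟨listDegree A.sdeg l - 2, evalList A.br (l.map A.vec), hA.evalList_mem l⟩

theorem GradedBrackets.HasDegree.sdeg_bracket {A : GradedBrackets K E} (hA : A.HasDegree)
    (l : List A.Homog) : A.sdeg (hA.bracket l) = listDegree A.sdeg l - 1 := by
  simp only [GradedBrackets.sdeg, bracket]; ring

/-- The common form of the Jacobi sum (`f = br`) and of the left side of the morphism equation (`f =
map`). The type of letters is left free so that the same vectors can be read with different
certificates of homogeneity. -/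
theorem sum_finset_bracket (A : GradedBrackets K E)
    (f : (k : ℕ) → MultilinearMap K (fun _ : Fin k => E) F) (μ : F →ₗ[K] K) {n : ℕ} (p : Fin n → ℤ)
    {X : Type*} {deg : X → ℤ} {val : X → E} (x : Fin n → X) (hp : ∀ i, deg (x i) = p i + 1) :
    μ (∑ S : Finset (Fin n), koszulSign K (fun i => p i + 1) (fun i => if i ∈ S then 0 else 1) •
      f (Sᶜ.card + 1) (Matrix.vecCons (A.br S.card (subTuple (fun i => val (x i)) S))
        (subTuple (fun i => val (x i)) Sᶜ))) =
      shuffleSum deg (List.ofFn x) fun s r =>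
        μ (evalList f (evalList A.br (s.map val) :: r.map val)) := by
  rw [← sum_finset_koszulSign_mul, map_sum]
  refine Finset.sum_congr rfl fun S _ => ?_
  rw [map_smul, smul_eq_mul, List.map_ofFn, List.map_ofFn, evalList_ofFn, evalList_cons_ofFn]
  simp only [hp]
  rfl

theorem sum_partitions_bracket (B : GradedBrackets K F)
    (f : (k : ℕ) → MultilinearMap K (fun _ : Fin k => E) F) (μ : F →ₗ[K] K) {n : ℕ} (p : Fin n → ℤ)
    {X : Type*} {deg : X → ℤ} {val : X → E} (x : Fin n → X) (hp : ∀ i, deg (x i) = p i + 1) :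
    μ (∑ m ∈ Finset.range (n + 1), ((m ! : ℕ) : K)⁻¹ • ∑ c : Fin n → Fin m,
      koszulSign K (fun i => p i + 1) (fun i => (c i : ℕ)) •
        B.br m (fun j => f _ (subTuple (fun i => val (x i))
          (Finset.univ.filter fun i => c i = j)))) =
      ∑ m ∈ Finset.range ((List.ofFn x).length + 1), ((m ! : ℕ) : K)⁻¹ *
        multiShuffle deg m (List.ofFn x) fun s =>
          μ (B.br m fun j => evalList f ((s j).map val)) := by
  rw [map_sum, List.length_ofFn]
  refine Finset.sum_congr rfl fun m _ => ?_
  rw [map_smul, smul_eq_mul, map_sum, ← sum_koszulSign_mul]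
  congr 1
  refine Finset.sum_congr rfl fun c _ => ?_
  simp only [hp, map_smul, smul_eq_mul, List.map_ofFn, evalList_ofFn]
  rfl

end Homogeneous

/-! ### The cochain algebras are CDGAs -/

section Cochains

variable {K : Type u} [Field K] {E : Type v} [AddCommGroup E] [Module K E]
  {F : Type w} [AddCommGroup F] [Module K F]

/-- The bound `N` for the degree of the generator limits both the arity and the degrees of the
arguments, since a basis vector of degree at least `N` in absolute value lies in the tail. Finite
type leaves finitely many tuples. -/
theorem finite_support_of_locallyFinite (L : MildLInfinityAlgebra K E)
    (M : MildLInfinityAlgebra K F) (f : (k : ℕ) → MultilinearMap K (fun _ : Fin k => E) F) (c : ℤ)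
    (hdeg : ∀ (k : ℕ) (p : Fin k → ℤ) (x : Fin k → E), (∀ i, x i ∈ L.deg (p i)) →
      f k x ∈ M.deg (∑ i, p i + k - c))
    (hf : LocallyFinite L.toGradedBrackets L.tail M.toGradedBrackets f) (m : M.Index) :
    {t : Σ k : ℕ, Fin k → L.Index |
      (M.basis.coord m).compMultilinearMap (f t.1) (fun a => L.basis (t.2 a)) ≠ 0}.Finite := by
  obtain ⟨N, hN⟩ := hf m.1
  let D : Finset L.Index := (Finset.Ioo (-(N : ℤ)) N).sigma fun n => Finset.univ
  refine ((Finset.range N).sigma fun k => Fintype.piFinset fun _ : Fin k => D).finite_toSet.subset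
    ?_
  rintro ⟨k, I⟩ ht
  simp only [Set.mem_ofPred_eq, LinearMap.compMultilinearMap_apply] at ht
  have hmem := hdeg k (fun a => (I a).1) (fun a => L.basis (I a)) fun i => L.basis_mem (I i)
  have hm : m.1 = ∑ i, (I i).1 + k - c := by
    by_contra h
    exact ht (M.coord_eq_zero hmem m h)
  rw [← hm] at hmem
  have h1 : ¬ (N ≤ k ∨ ∃ i, L.basis (I i) ∈ L.tail N) := fun h => ht (by
    rw [hN k (fun a => (I a).1) _ (fun i => L.basis_mem (I i)) hmem h, map_zero])
  push Not at h1
  simp only [Finset.coe_sigma, Set.mem_sigma_iff, Finset.mem_coe, Finset.mem_range,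
    Fintype.mem_piFinset]
  refine ⟨h1.1, fun a => ?_⟩
  have h2 : ¬ ((N : ℤ) ≤ |(I a).1|) := fun h => h1.2 a ⟨(I a).1, h, L.basis_mem (I a)⟩
  rw [not_le, abs_lt] at h2
  simp only [D, Finset.mem_sigma, Finset.mem_Ioo, Finset.mem_univ, and_true]
  exact h2

theorem MildLInfinityAlgebra.dGen_eq (L : MildLInfinityAlgebra K E) (m : L.Index) :
    L.dGen m = (-1 : K) ^ L.dualDegree m • formGen L.dualDegree L.basis
      (fun k => (L.basis.coord m).compMultilinearMap (L.br k)) := by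
  rw [formGen, smul_finsum' _
    ((finite_support_of_locallyFinite L L L.br 2 L.br_deg L.mild m).subset fun t ht h0 => ht (by
      simp only [h0, mul_zero, zero_smul]))]
  refine finsum_congr fun t => ?_
  rw [smul_smul, ← mul_assoc, ← mul_assoc]
  rfl

theorem LInfinityMorphism.cochainsGen_eq {L : MildLInfinityAlgebra K E}
    {M : MildLInfinityAlgebra K F} (g : LInfinityMorphism L.toGradedBrackets M.toGradedBrackets)
    (m : M.Index) :
    g.cochainsGen m = formGen L.dualDegree L.basis
      (fun k => (M.basis.coord m).compMultilinearMap (g.map k)) := rfl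

theorem LInfinityMorphism.evalList_nil {A : GradedBrackets K E} {B : GradedBrackets K F}
    (g : LInfinityMorphism A B) : evalList g.map [] = 0 := by
  change g.map 0 _ = 0
  rw [g.map_arity_zero]; rfl

theorem MildLInfinityAlgebra.hasDegree (L : MildLInfinityAlgebra K E) :
    L.toGradedBrackets.HasDegree := L.br_deg

theorem MildLInfinityAlgebra.dualDegree_of_coord_ne_zero (L : MildLInfinityAlgebra K E)
    (i : L.Index) (x : L.Homog) (h : L.basis.coord i (L.vec x) ≠ 0) :
    L.sdeg x = L.dualDegree i := by
  by_contra hne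
  refine h (L.coord_eq_zero x.2.2 i fun h1 => hne ?_)
  simp [GradedBrackets.sdeg, dualDegree, h1]

/-- The evaluation of cochains on lists of homogeneous elements. -/
noncomputable def MildLInfinityAlgebra.evaluation (L : MildLInfinityAlgebra K E) :
    FreeCGA K L.dualDegree →ₐ[K] ShuffleAlgebra K L.sdeg :=
  toShuffle (fun i => ShuffleAlgebra.ofLetters fun x => L.basis.coord i (L.vec x))
    fun i => ShuffleAlgebra.ofLetters_isHomogeneous (L.dualDegree_of_coord_ne_zero i)

theorem MildLInfinityAlgebra.evaluation_gen (L : MildLInfinityAlgebra K E) (i : L.Index) :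
    L.evaluation (gen L.dualDegree i) =
      ShuffleAlgebra.ofLetters fun x => L.basis.coord i (L.vec x) :=
  toShuffle_gen _ _ _

theorem MildLInfinityAlgebra.evaluation_injective [CharZero K] (L : MildLInfinityAlgebra K E) :
    Function.Injective L.evaluation := by
  classical
  refine toShuffle_injective (e := fun i => (⟨i.1, L.basis i, L.basis_mem i⟩ : L.Homog))
    L.dualDegree_of_coord_ne_zero fun i j => ?_
  change L.basis.coord i (L.basis j) = _
  rw [Module.Basis.coord_apply, Module.Basis.repr_self, Finsupp.single_apply]
  simp [eq_comm]

/-- The map of free graded commutative algebras underlying `cochainsMap`. -/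
noncomputable def LInfinityMorphism.cochainsHom {L : MildLInfinityAlgebra K E}
    {M : MildLInfinityAlgebra K F} (g : LInfinityMorphism L.toGradedBrackets M.toGradedBrackets) :
    FreeCGA K M.dualDegree →ₐ[K] FreeCGA K L.dualDegree :=
  g.cochainsMap

theorem LInfinityMorphism.cochainsHom_gen {L : MildLInfinityAlgebra K E}
    {M : MildLInfinityAlgebra K F} (g : LInfinityMorphism L.toGradedBrackets M.toGradedBrackets)
    (m : M.Index) : g.cochainsHom (gen M.dualDegree m) = g.cochainsGen m :=
  lift_gen (q := M.dualDegree) L.dualDegree _ m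

variable [CharZero K]

theorem MildLInfinityAlgebra.evaluation_dGen (L : MildLInfinityAlgebra K E) (m : L.Index)
    (T : List L.Homog) : L.evaluation (L.dGen m) T =
      (-1 : K) ^ L.dualDegree m * L.basis.coord m (evalList L.br (T.map L.vec)) := by
  rw [L.dGen_eq, map_smul, ShuffleAlgebra.smul_apply, evaluation,
    map_formGen_ofLetters _ _ (finite_support_of_locallyFinite L L L.br 2 L.br_deg L.mild m)
    _ L.dualDegree_of_coord_ne_zero]
  · rfl
  · intro n x σ
    have := L.br_symm n (fun i => (x i).1) (fun i => L.vec (x i)) (fun i => (x i).2.2) σ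
    simp only [LinearMap.compMultilinearMap_apply]
    rw [← smul_eq_mul, ← map_smul]
    exact congrArg _ this

theorem MildLInfinityAlgebra.evaluation_derivation (L : MildLInfinityAlgebra K E) {n : ℤ}
    {a : FreeCGA K L.dualDegree} (ha : a ∈ gr L.dualDegree n) :
    L.evaluation (derivation L.dualDegree (fun m => ⟨L.dGen m, L.dGen_mem m⟩) a) =
      (-1 : K) ^ n • ShuffleAlgebra.insertion
        (L.hasDegree.bracket)
        (L.evaluation a) := by
  refine map_derivation_eq_insertion (L.hasDegree.sdeg_bracket) _ ?_ ?_ ha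
  · intro i
    rw [evaluation_gen]
    exact ShuffleAlgebra.ofLetters_isHomogeneous (L.dualDegree_of_coord_ne_zero i)
  · intro i
    ext T
    rw [evaluation_dGen, ShuffleAlgebra.smul_apply, evaluation_gen,
      ShuffleAlgebra.insertion_ofLetters]
    rfl

/-- After the injective evaluation `d` is the insertion of brackets, and inserting twice into a
coordinate function gives the coordinate of the Jacobi sum. -/
theorem MildLInfinityAlgebra.derivation_dGen (L : MildLInfinityAlgebra K E) (m : L.Index) :
    derivation L.dualDegree (fun m => ⟨L.dGen m, L.dGen_mem m⟩) (L.dGen m) = 0 := by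
  refine L.evaluation_injective ?_
  rw [evaluation_derivation _ (L.dGen_mem m), map_zero]
  ext T
  rw [ShuffleAlgebra.smul_apply, ShuffleAlgebra.zero_apply]
  obtain ⟨n, x, rfl⟩ : ∃ n, ∃ x : Fin n → L.Homog, T = List.ofFn x :=
    ⟨_, T.get, (List.ofFn_get T).symm⟩
  have h := sum_finset_bracket L.toGradedBrackets L.br (L.basis.coord m) (fun i => (x i).1)
    (deg := L.sdeg) (val := L.vec) x fun i => rfl
  rw [show (∑ S : Finset (Fin n), _) = (0 : E) from
    L.jacobi n (fun i => (x i).1) (fun i => L.vec (x i)) fun i => (x i).2.2, map_zero] at h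
  simp only [ShuffleAlgebra.insertion, evaluation_dGen, shuffleSum_mul_left]
  have h' : (shuffleSum L.sdeg (List.ofFn x) fun s r =>
      L.basis.coord m (evalList L.br ((L.hasDegree.bracket s :: r).map L.vec))) = 0 := h.symm
  rw [h', mul_zero, mul_zero]

theorem MildLInfinityAlgebra.cochains_isCDGA (L : MildLInfinityAlgebra K E) :
    L.cochains.IsCDGA :=
  freeDGA_isCDGA L.derivation_dGen

theorem LInfinityMorphism.evaluation_cochainsGen {L : MildLInfinityAlgebra K E}
    {M : MildLInfinityAlgebra K F} (g : LInfinityMorphism L.toGradedBrackets M.toGradedBrackets)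
    (hg : g.IsMild) (m : M.Index) (T : List L.Homog) :
    L.evaluation (g.cochainsGen m) T = M.basis.coord m (evalList g.map (T.map L.vec)) := by
  rw [g.cochainsGen_eq, MildLInfinityAlgebra.evaluation,
    map_formGen_ofLetters _ _ (finite_support_of_locallyFinite L M g.map 1 g.map_deg hg m)
    _ L.dualDegree_of_coord_ne_zero]
  · rfl
  · intro n x σ
    have := g.map_symm n (fun i => (x i).1) (fun i => L.vec (x i)) (fun i => (x i).2.2) σ
    simp only [LinearMap.compMultilinearMap_apply]
    rw [← smul_eq_mul, ← map_smul]
    exact congrArg _ this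

omit [CharZero K] in
theorem LInfinityMorphism.coord_evalList_isHomogeneous {A : GradedBrackets K E}
    {M : MildLInfinityAlgebra K F} (g : LInfinityMorphism A M.toGradedBrackets) (m : M.Index) :
    ShuffleAlgebra.IsHomogeneous (deg := A.sdeg) (M.dualDegree m)
      fun T => M.basis.coord m (evalList g.map (T.map A.vec)) := by
  intro T hT
  obtain ⟨n, x, rfl⟩ : ∃ n, ∃ x : Fin n → A.Homog, T = List.ofFn x :=
    ⟨_, T.get, (List.ofFn_get T).symm⟩
  dsimp only at hT
  rw [List.map_ofFn, evalList_ofFn] at hT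
  have h1 := g.map_deg n (fun i => (x i).1) (fun i => A.vec (x i)) fun i => (x i).2.2
  have h2 : m.1 = ∑ i, (x i).1 + n - 1 := by
    by_contra h
    exact hT (M.coord_eq_zero h1 m h)
  simp only [listDegree, List.map_ofFn, List.sum_ofFn, Function.comp_apply, GradedBrackets.sdeg,
    Finset.sum_add_distrib, MildLInfinityAlgebra.dualDegree, h2]
  simp

/-- The evaluation of cochains on lists of homogeneous elements, through an `L∞` morphism. -/
noncomputable def LInfinityMorphism.pullback {A : GradedBrackets K E}
    {M : MildLInfinityAlgebra K F} (g : LInfinityMorphism A M.toGradedBrackets) :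
    FreeCGA K M.dualDegree →ₐ[K] ShuffleAlgebra K A.sdeg :=
  toShuffle (fun m T => M.basis.coord m (evalList g.map (T.map A.vec)))
    g.coord_evalList_isHomogeneous

omit [CharZero K] in
theorem LInfinityMorphism.pullback_gen {A : GradedBrackets K E}
    {M : MildLInfinityAlgebra K F} (g : LInfinityMorphism A M.toGradedBrackets) (m : M.Index)
    (T : List A.Homog) :
    g.pullback (gen M.dualDegree m) T = M.basis.coord m (evalList g.map (T.map A.vec)) :=
  congrFun (toShuffle_gen _ g.coord_evalList_isHomogeneous m) T

-- The substitution formula produces the sum over ordered partitions with the brackets of `M`; the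
-- morphism equation exchanges it for the sum with one bracket of `A` inserted.
omit [CharZero K] in
theorem LInfinityMorphism.pullback_dGen {A : GradedBrackets K E}
    {M : MildLInfinityAlgebra K F} (g : LInfinityMorphism A M.toGradedBrackets)
    (m : M.Index) (T : List A.Homog) :
    g.pullback (M.dGen m) T = (-1 : K) ^ M.dualDegree m *
      shuffleSum A.sdeg T fun s r =>
        M.basis.coord m (evalList g.map (evalList A.br (s.map A.vec) :: r.map A.vec)) := by
  obtain ⟨n, x, rfl⟩ : ∃ n, ∃ x : Fin n → A.Homog, T = List.ofFn x :=
    ⟨_, T.get, (List.ofFn_get T).symm⟩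
  have h2 := map_formGen M.basis (fun k => (M.basis.coord m).compMultilinearMap (M.br k))
    (finite_support_of_locallyFinite M M M.br 2 M.br_deg M.mild m)
    g.pullback (fun i => by
      rw [g.pullback_gen]; simp [g.evalList_nil])
    (fun T => evalList g.map (T.map A.vec)) (fun i l => by rw [g.pullback_gen]) (List.ofFn x)
  rw [M.dGen_eq, map_smul, ShuffleAlgebra.smul_apply]
  congr 1
  refine h2.trans ?_
  simp only [LinearMap.compMultilinearMap_apply]
  have h3 := g.morphism n (fun i => (x i).1) (fun i => A.vec (x i)) fun i => (x i).2.2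
  have h4 := sum_finset_bracket A g.map (M.basis.coord m) (fun i => (x i).1)
    (deg := A.sdeg) (val := A.vec) x fun i => rfl
  have h5 := sum_partitions_bracket M.toGradedBrackets g.map (M.basis.coord m) (fun i => (x i).1)
    (deg := A.sdeg) (val := A.vec) x fun i => rfl
  rw [← h5, ← h3]
  exact h4

/-- `pullback` makes sense for any source, in particular for the Lawrence–Sullivan construction,
which is not of finite type. For mild `L` it is `C^∞(g)` followed by evaluation. -/
theorem LInfinityMorphism.evaluation_cochainsHom {L : MildLInfinityAlgebra K E}
    {M : MildLInfinityAlgebra K F} (g : LInfinityMorphism L.toGradedBrackets M.toGradedBrackets)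
    (hg : g.IsMild) (a : FreeCGA K M.dualDegree) :
    L.evaluation (g.cochainsHom a) = g.pullback a := by
  have : L.evaluation.comp g.cochainsHom = g.pullback := algHom_ext fun i => by
    ext T
    rw [AlgHom.comp_apply, g.cochainsHom_gen, g.evaluation_cochainsGen hg, g.pullback_gen]
  exact DFunLike.congr_fun this a

/-- On a generator, after the injective evaluation, one side is the pullback of `d w` and the other
the insertion of brackets into the components of `g`; they agree by the morphism equation. -/
theorem LInfinityMorphism.cochainsMap_isDGMorphism {L : MildLInfinityAlgebra K E}
    {M : MildLInfinityAlgebra K F} (g : LInfinityMorphism L.toGradedBrackets M.toGradedBrackets)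
    (hg : g.IsMild) : IsDGMorphism g.cochainsMap := by
  refine isDGMorphism_of_gen (q := M.dualDegree) L.cochains_isCDGA g.cochainsMap ?_ ?_
  · intro m
    exact (g.cochainsHom_gen m).symm ▸ g.cochainsGen_mem m
  · intro m
    refine Eq.trans ?_ (congrArg L.cochains.d (g.cochainsHom_gen m)).symm
    refine L.evaluation_injective ?_
    change L.evaluation (g.cochainsHom (M.dGen m)) =
      L.evaluation (derivation L.dualDegree (fun m => ⟨L.dGen m, L.dGen_mem m⟩) _)
    rw [L.evaluation_derivation (g.cochainsGen_mem m)]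
    ext T
    rw [g.evaluation_cochainsHom hg, g.pullback_dGen, ShuffleAlgebra.smul_apply]
    simp only [ShuffleAlgebra.insertion, g.evaluation_cochainsGen hg]
    rfl

end Cochains

/-! ### Exponential generating functions -/

section Egf

variable {K : Type u} [Field K] {X : Type*} {deg : X → ℤ}

theorem listDegree_replicate {z : X} (hz : deg z = 0) (n : ℕ) :
    listDegree deg (List.replicate n z) = 0 := by
  simp [listDegree, hz]

/-- A sublist of a constant list is determined by its length, and a letter of degree zero creates no
signs; binomial coefficients remain. -/
theorem shuffleSum_replicate {z : X} (hz : deg z = 0) (n : ℕ) (H : List X → List X → K) :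
    shuffleSum deg (List.replicate n z) H = ∑ ij ∈ Finset.HasAntidiagonal.antidiagonal n,
      (n.choose ij.1 : K) * H (List.replicate ij.1 z) (List.replicate ij.2 z) := by
  induction n generalizing H with
  | zero => simp [shuffleSum]
  | succ n ih =>
    rw [Finset.sum_antidiagonal_choose_succ_mul
      (fun i j => H (List.replicate i z) (List.replicate j z)), List.replicate_succ, shuffleSum,
      ih, ih, add_comm]
    congr 1
    · simp [hz, List.replicate_succ]
    · refine Finset.sum_congr rfl fun ij hij => ?_
      rw [Finset.HasAntidiagonal.mem_antidiagonal] at hij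
      rw [← Nat.choose_symm_of_eq_add hij.symm, List.replicate_succ]

variable [CharZero K]

/-- The exponential generating function of the values on the powers of a letter of degree zero. -/
noncomputable def egf {z : X} (hz : deg z = 0) : ShuffleAlgebra K deg →ₐ[K] PowerSeries K :=
  AlgHom.ofLinearMap
    { toFun := fun F => PowerSeries.mk fun n => ((n ! : ℕ) : K)⁻¹ * F (List.replicate n z)
      map_add' := fun F F' => by ext n; simp [mul_add]
      map_smul' := fun c F => by ext n; simp [mul_left_comm] }
    (by
      ext n
      cases n with
      | zero => simp; rfl
      | succ n => simp [PowerSeries.coeff_one, ShuffleAlgebra.one_of_ne_nil])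
    (fun F F' => by
      ext n
      simp only [LinearMap.coe_mk, AddHom.coe_mk, PowerSeries.coeff_mk, PowerSeries.coeff_mul,
        ShuffleAlgebra.mul_apply, shuffleSum_replicate hz, Finset.mul_sum]
      rw [← Finset.Nat.sum_antidiagonal_swap]
      refine Finset.sum_congr rfl fun ij hij => ?_
      rw [Finset.HasAntidiagonal.mem_antidiagonal] at hij
      simp only [Prod.fst_swap, Prod.snd_swap]
      have h := Nat.add_choose_mul_factorial_mul_factorial ij.2 ij.1
      rw [add_comm ij.2, hij, Nat.choose_symm_of_eq_add hij.symm] at h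
      have h' : ((n.choose ij.2 : ℕ) : K) * (ij.2 ! : ℕ) * (ij.1 ! : ℕ) = (n ! : ℕ) := by
        exact_mod_cast h
      rw [← h']
      have h1 : ((ij.1 ! : ℕ) : K) ≠ 0 := by exact_mod_cast ij.1.factorial_ne_zero
      have h2 : ((ij.2 ! : ℕ) : K) ≠ 0 := by exact_mod_cast ij.2.factorial_ne_zero
      have h3 : ((n.choose ij.2 : ℕ) : K) ≠ 0 := by
        exact_mod_cast (Nat.choose_pos (by omega)).ne'
      field_simp)

theorem coeff_egf {z : X} (hz : deg z = 0) (F : ShuffleAlgebra K deg) (n : ℕ) :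
    PowerSeries.coeff n (egf hz F) = ((n ! : ℕ) : K)⁻¹ * F (List.replicate n z) := by
  simp [egf]

theorem egf_ofLetters {z : X} (hz : deg z = 0) (c : X → K) :
    egf hz (ShuffleAlgebra.ofLetters c : ShuffleAlgebra K deg) =
      ((Polynomial.C (c z) * Polynomial.X : Polynomial K) : PowerSeries K) := by
  ext n
  rw [coeff_egf, Polynomial.coeff_coe, Polynomial.coeff_C_mul, Polynomial.coeff_X]
  rcases n with _ | _ | n <;> simp [List.replicate_succ]

theorem eval_eq_finsum_egf {z : X} (hz : deg z = 0) {F : ShuffleAlgebra K deg} {P : Polynomial K}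
    (h : (P : PowerSeries K) = egf hz F) (τ : K) :
    P.eval τ = ∑ᶠ n : ℕ, ((n ! : ℕ) : K)⁻¹ * F (List.replicate n z) * τ ^ n := by
  have h1 : ∀ n, ((n ! : ℕ) : K)⁻¹ * F (List.replicate n z) = P.coeff n := fun n => by
    rw [← coeff_egf hz, ← h, Polynomial.coeff_coe]
  simp only [h1]
  rw [Polynomial.eval_eq_sum, Polynomial.sum, finsum_eq_sum_of_support_subset]
  intro n hn
  rw [Finset.mem_coe, Polynomial.mem_support_iff]
  exact left_ne_zero_of_mul hn

/-- Since the images of the generators have polynomial generating functions, so do the images of all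
elements. The formal series can therefore be evaluated at numbers. -/
theorem egf_eq_of_gen {z : X} (hz : deg z = 0) {G : Type} {q : G → ℤ}
    {f : FreeCGA K q →ₐ[K] ShuffleAlgebra K deg} {P : FreeCGA K q →ₐ[K] Polynomial K}
    (h : ∀ i, (P (gen q i) : PowerSeries K) = egf hz (f (gen q i))) (a : FreeCGA K q) :
    (P a : PowerSeries K) = egf hz (f a) := by
  have : (Polynomial.coeToPowerSeries.algHom K).comp P = (egf hz).comp f :=
    algHom_ext fun i => by simpa [Polynomial.coeToPowerSeries.algHom_apply] using h i
  simpa [Polynomial.coeToPowerSeries.algHom_apply] using DFunLike.congr_fun this a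

/-- Algebra maps to commutative algebras which kill the generators of non-zero degree. -/
noncomputable def liftComm {R : Type*} [CommRing R] [Algebra K R] {G : Type} (q : G → ℤ) (x : G → R)
    (hx : ∀ i, q i ≠ 0 → x i = 0) : FreeCGA K q →ₐ[K] R :=
  liftOf q x fun i j => by
    by_cases hi : q i = 0
    · rw [hi, zero_mul, zpow_zero, one_smul, mul_comm]
    · rw [hx i hi]; simp

omit [CharZero K] in
@[simp]
theorem liftComm_gen {R : Type*} [CommRing R] [Algebra K R] {G : Type} (q : G → ℤ) (x : G → R)
    (hx : ∀ i, q i ≠ 0 → x i = 0) (i : G) : liftComm q x hx (gen (K := K) q i) = x i :=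
  liftOf_gen _ _ i

end Egf

/-! ### Maurer–Cartan elements as augmentations -/

section Augmentation

variable {K : Type u} [Field K] [CharZero K] {E : Type v} [AddCommGroup E] [Module K E]
  {F : Type w} [AddCommGroup F] [Module K F]

omit [CharZero K] in
theorem evalList_replicate (f : (k : ℕ) → MultilinearMap K (fun _ : Fin k => E) F) (n : ℕ) (z : E) :
    evalList f (List.replicate n z) = f n fun _ => z := by
  rw [← List.ofFn_const, evalList_ofFn]

namespace MildLInfinityAlgebra

variable (L : MildLInfinityAlgebra K E) (M : MildLInfinityAlgebra K F)

omit [CharZero K] in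
theorem coord_eq_zero_of_dualDegree_ne_zero {z : E} (hz : z ∈ L.deg (-1)) (i : L.Index)
    (hi : L.dualDegree i ≠ 0) : L.basis.coord i z = 0 :=
  L.coord_eq_zero hz i fun h => hi (by simp [dualDegree, h])

/-- The algebra map `C^∞(L) → K` determined by an element of degree `-1`. -/
noncomputable def augmentation {z : E} (hz : z ∈ L.deg (-1)) : FreeCGA K L.dualDegree →ₐ[K] K :=
  liftComm _ (fun i => L.basis.coord i z) (L.coord_eq_zero_of_dualDegree_ne_zero hz)

theorem augmentation_gen {z : E} (hz : z ∈ L.deg (-1)) (i : L.Index) :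
    L.augmentation hz (gen L.dualDegree i) = L.basis.coord i z :=
  liftComm_gen _ _ _ i

/-- The right side is the value at `1` of the exponential generating function of `a` on the powers
of `z`. That function is polynomial and multiplicative in `a`, and on a generator it is the
coordinate of `z` times the variable. -/
theorem augmentation_apply {z : E} (hz : z ∈ L.deg (-1)) (a : FreeCGA K L.dualDegree) :
    L.augmentation hz a = ∑ᶠ n : ℕ, ((n ! : ℕ) : K)⁻¹ *
      L.evaluation a (List.replicate n (⟨-1, z, hz⟩ : L.Homog)) := by
  have h0 : L.sdeg (⟨-1, z, hz⟩ : L.Homog) = 0 := by simp [GradedBrackets.sdeg]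
  let P : FreeCGA K L.dualDegree →ₐ[K] Polynomial K :=
    liftComm _ (fun i => Polynomial.C (L.basis.coord i z) * Polynomial.X) fun i hi => by
      rw [L.coord_eq_zero_of_dualDegree_ne_zero hz i hi]; simp
  have hP : ∀ i, P (gen L.dualDegree i) = Polynomial.C (L.basis.coord i z) * Polynomial.X :=
    fun i => liftComm_gen _ _ _ i
  have h1 := egf_eq_of_gen h0 (f := L.evaluation) (P := P) (fun i => by
    rw [L.evaluation_gen, egf_ofLetters, hP]; rfl) a
  have h2 : (Polynomial.aeval (1 : K)).comp P = L.augmentation hz :=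
    algHom_ext fun i => by
      rw [AlgHom.comp_apply, hP, augmentation_gen]; simp
  rw [← h2, AlgHom.comp_apply, Polynomial.coe_aeval_eq_eval, eval_eq_finsum_egf h0 h1]
  simp

variable {L}

omit [CharZero K] in
theorem finite_support_apply_const {M : MildLInfinityAlgebra K F}
    {f : (k : ℕ) → MultilinearMap K (fun _ : Fin k => E) F}
    {c : ℤ} (hdeg : ∀ (k : ℕ) (p : Fin k → ℤ) (x : Fin k → E), (∀ i, x i ∈ L.deg (p i)) →
      f k x ∈ M.deg (∑ i, p i + k - c))
    (hf : LocallyFinite L.toGradedBrackets L.tail M.toGradedBrackets f) {z : E}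
    (hz : z ∈ L.deg (-1)) : {k : ℕ | f k (fun _ => z) ≠ 0}.Finite := by
  obtain ⟨N, hN⟩ := hf (-c)
  refine (Set.finite_lt_nat N).subset fun k hk => ?_
  by_contra h
  refine hk (hN k (fun _ => -1) _ (fun _ => hz) ?_ (Or.inl (not_lt.1 h)))
  simpa using hdeg k (fun _ => -1) (fun _ => z) fun _ => hz

omit [CharZero K] in
theorem coord_finsum {f : (k : ℕ) → MultilinearMap K (fun _ : Fin k => E) F} {z : E}
    (hf : {k : ℕ | f k (fun _ => z) ≠ 0}.Finite) (μ : F →ₗ[K] K) :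
    μ (∑ᶠ k : ℕ, ((k ! : ℕ) : K)⁻¹ • f k (fun _ => z)) =
      ∑ᶠ k : ℕ, ((k ! : ℕ) : K)⁻¹ * μ (f k fun _ => z) := by
  change μ.toAddMonoidHom _ = _
  rw [AddMonoidHom.map_finsum]
  · exact finsum_congr fun k => map_smul μ _ _
  · exact hf.subset fun k hk h => hk (by simp only [h, smul_zero])

theorem augmentation_dGen {z : E} (hz : z ∈ L.deg (-1)) (m : L.Index) :
    L.augmentation hz (L.dGen m) = (-1 : K) ^ L.dualDegree m *
      L.basis.coord m (∑ᶠ k : ℕ, ((k ! : ℕ) : K)⁻¹ • L.br k (fun _ => z)) := by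
  rw [augmentation_apply, coord_finsum (finite_support_apply_const L.br_deg L.mild hz)]
  rw [← smul_eq_mul, smul_finsum]
  refine finsum_congr fun k => ?_
  rw [evaluation_dGen, List.map_replicate, evalList_replicate, smul_eq_mul, mul_left_comm]
  rfl

/-- By the formula for `d` on generators, compatibility with `d` says that every coordinate of `∑
(1/k!) br k (z, …, z)` is zero; mildness makes this sum finite. -/
theorem isAugmentation_iff {z : E} (hz : z ∈ L.deg (-1)) :
    IsAugmentation (A := L.cochains) (L.augmentation hz) ↔ z ∈ L.MC := by
  constructor
  · intro h
    refine ⟨hz, finite_support_apply_const L.br_deg L.mild hz, ?_⟩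
    refine L.basis.ext_elem fun m => ?_
    have h1 : L.augmentation hz (L.dGen m) = 0 := by
      have := h.2 (gen L.dualDegree m)
      change L.augmentation hz (derivation L.dualDegree _ _) = 0 at this
      rwa [derivation_gen] at this
    rw [augmentation_dGen] at h1
    simpa [neg_one_zpow_ne_zero] using h1
  · intro h
    refine isAugmentation_of_gen (q := L.dualDegree)
      (u := fun m => ⟨L.dGen m, L.dGen_mem m⟩) _ (fun i hi => ?_) fun i => ?_
    · rw [augmentation_gen, L.coord_eq_zero_of_dualDegree_ne_zero hz i hi]
    · change L.augmentation hz (L.dGen i) = 0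
      rw [augmentation_dGen, h.2.2, map_zero, mul_zero]

theorem augmentation_injective {z z' : E} {hz : z ∈ L.deg (-1)} {hz' : z' ∈ L.deg (-1)}
    (h : L.augmentation hz = L.augmentation hz') : z = z' :=
  L.basis.ext_elem fun m => by
    have := DFunLike.congr_fun h (gen L.dualDegree m)
    rwa [augmentation_gen, augmentation_gen] at this

/-- Only generators dual to `L_{-1}` can have non-zero values, and `L_{-1}` is finite dimensional,
so these values are the coordinates of a vector. -/
theorem exists_augmentation_eq {e : FreeCGA K L.dualDegree →ₐ[K] K}
    (he : IsAugmentation (A := L.cochains) e) :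
    ∃ (z : E) (hz : z ∈ L.deg (-1)), z ∈ L.MC ∧ L.augmentation hz = e := by
  classical
  let z : E := ∑ j : Fin (Module.finrank K (L.deg (-1))),
    e (gen L.dualDegree ⟨-1, j⟩) • L.basis ⟨-1, j⟩
  have hz : z ∈ L.deg (-1) :=
    Submodule.sum_mem _ fun j _ => Submodule.smul_mem _ _ (L.basis_mem ⟨-1, j⟩)
  have h : L.augmentation hz = e := by
    refine algHom_ext fun m => ?_
    rw [augmentation_gen]
    by_cases hm : m.1 = -1
    · obtain ⟨_, j⟩ := m
      obtain rfl : _ = -1 := hm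
      rw [map_sum, Finset.sum_eq_single j]
      · simp
      · intro i _ hij
        rw [map_smul, Module.Basis.coord_apply, Module.Basis.repr_self,
          Finsupp.single_eq_of_ne (by simpa using Ne.symm hij), smul_zero]
      · simp
    · rw [L.coord_eq_zero hz m hm]
      have : L.dualDegree m ≠ 0 := fun h => hm (by simp only [dualDegree] at h; omega)
      exact (he.1 _ this _ (gen_mem m)).symm
  exact ⟨z, hz, (isAugmentation_iff hz).1 (h ▸ he), h⟩

end MildLInfinityAlgebra

open MildLInfinityAlgebra

omit [CharZero K] in
theorem LInfinityMorphism.mcMap_mem_deg {A : GradedBrackets K E} {B : GradedBrackets K F}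
    (g : LInfinityMorphism A B) {z : E} (hz : z ∈ A.deg (-1)) : g.mcMap z ∈ B.deg (-1) := by
  refine finsum_induction (· ∈ B.deg (-1)) (Submodule.zero_mem _)
    (fun _ _ => Submodule.add_mem _) fun k => Submodule.smul_mem _ _ ?_
  simpa using g.map_deg k (fun _ => -1) (fun _ => z) fun _ => hz

theorem LInfinityMorphism.augmentation_cochainsGen {L : MildLInfinityAlgebra K E}
    {M : MildLInfinityAlgebra K F} (g : LInfinityMorphism L.toGradedBrackets M.toGradedBrackets)
    (hg : g.IsMild) {z : E} (hz : z ∈ L.deg (-1)) (m : M.Index) :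
    L.augmentation hz (g.cochainsGen m) = M.basis.coord m (g.mcMap z) := by
  rw [augmentation_apply, mcMap, coord_finsum (finite_support_apply_const g.map_deg hg hz)]
  refine finsum_congr fun k => ?_
  rw [evaluation_cochainsGen g hg, List.map_replicate, evalList_replicate]
  rfl

/-- This is the dictionary between `MC(g)` and `C^∞(g)`; it yields at once that Maurer–Cartan
elements go to Maurer–Cartan elements and homotopies to homotopies. -/
theorem LInfinityMorphism.augmentation_comp {L : MildLInfinityAlgebra K E}
    {M : MildLInfinityAlgebra K F} (g : LInfinityMorphism L.toGradedBrackets M.toGradedBrackets)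
    (hg : g.IsMild) {z : E} (hz : z ∈ L.deg (-1)) :
    (L.augmentation hz).comp g.cochainsHom = M.augmentation (g.mcMap_mem_deg hz) :=
  algHom_ext fun m => by
    rw [AlgHom.comp_apply, g.cochainsHom_gen, g.augmentation_cochainsGen hg, augmentation_gen]

theorem LInfinityMorphism.mcMap_mem {L : MildLInfinityAlgebra K E}
    {M : MildLInfinityAlgebra K F} (g : LInfinityMorphism L.toGradedBrackets M.toGradedBrackets)
    (hg : g.IsMild) {z : E} (hz : z ∈ L.MC) : g.mcMap z ∈ M.MC := by
  rw [← isAugmentation_iff (g.mcMap_mem_deg hz.1), ← g.augmentation_comp hg hz.1]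
  exact ((isAugmentation_iff hz.1).2 hz).comp (g.cochainsMap_isDGMorphism hg)

end Augmentation

/-! ### The complete tensor algebra as a ring -/

section TensorSeries

variable {K : Type u} [Field K]

/-- The complete tensor algebra, with the concatenation product. -/
def TensorSeries (K : Type u) : Type u := Series K

namespace TensorSeries

instance : AddCommGroup (TensorSeries K) := inferInstanceAs (AddCommGroup (Series K))
noncomputable instance : Module K (TensorSeries K) := inferInstanceAs (Module K (Series K))

@[ext]
theorem ext {f g : TensorSeries K} (h : ∀ W, f W = g W) : f = g := funext h

instance : Mul (TensorSeries K) :=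
  ⟨fun f g W => ∑ i ∈ Finset.range (W.length + 1), f (W.take i) * g (W.drop i)⟩
instance : One (TensorSeries K) := ⟨fun | [] => 1 | _ :: _ => 0⟩

@[simp] theorem add_apply (f g : TensorSeries K) (W : List Letter) : (f + g) W = f W + g W := rfl
@[simp] theorem sub_apply (f g : TensorSeries K) (W : List Letter) : (f - g) W = f W - g W := rfl
@[simp] theorem neg_apply (f : TensorSeries K) (W : List Letter) : (-f) W = -f W := rfl
@[simp] theorem zero_apply (W : List Letter) : (0 : TensorSeries K) W = 0 := rfl
@[simp] theorem smul_apply (c : K) (f : TensorSeries K) (W : List Letter) :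
    (c • f) W = c * f W := rfl
@[simp] theorem one_nil : (1 : TensorSeries K) [] = 1 := rfl
@[simp] theorem one_cons (l : Letter) (W : List Letter) : (1 : TensorSeries K) (l :: W) = 0 := rfl

theorem mul_apply (f g : TensorSeries K) (W : List Letter) :
    (f * g) W = ∑ i ∈ Finset.range (W.length + 1), f (W.take i) * g (W.drop i) := rfl

@[simp] theorem mul_nil (f g : TensorSeries K) : (f * g) [] = f [] * g [] := by simp [mul_apply]

/-- The series of the words following a given letter. -/
def after (l : Letter) (f : TensorSeries K) : TensorSeries K := fun W => f (l :: W)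

theorem mul_cons (f g : TensorSeries K) (l : Letter) (W : List Letter) :
    (f * g) (l :: W) = f [] * g (l :: W) + (after l f * g) W := by
  rw [mul_apply, List.length_cons, Finset.sum_range_succ', add_comm]
  rfl

theorem add_mul' (f g h : TensorSeries K) : (f + g) * h = f * h + g * h := by
  ext W; simp [mul_apply, add_mul, Finset.sum_add_distrib]

theorem mul_add' (f g h : TensorSeries K) : f * (g + h) = f * g + f * h := by
  ext W; simp [mul_apply, mul_add, Finset.sum_add_distrib]

theorem smul_mul' (c : K) (f g : TensorSeries K) : (c • f) * g = c • (f * g) := by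
  ext W; simp [mul_apply, mul_assoc, Finset.mul_sum]

theorem mul_smul' (c : K) (f g : TensorSeries K) : f * (c • g) = c • (f * g) := by
  ext W; simp [mul_apply, mul_left_comm, Finset.mul_sum]

theorem after_mul (l : Letter) (f g : TensorSeries K) :
    after l (f * g) = f [] • after l g + after l f * g := by
  ext W; exact mul_cons f g l W

theorem mul_assoc' (f g h : TensorSeries K) : f * g * h = f * (g * h) := by
  ext W
  induction W generalizing f g h with
  | nil => simp [mul_assoc]
  | cons l W ih =>
    rw [mul_cons, mul_cons, mul_cons, after_mul, add_mul', smul_mul', add_apply, smul_apply, ih,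
      mul_nil]
    ring

theorem zero_mul' (f : TensorSeries K) : 0 * f = 0 := by
  ext W; simp [mul_apply]

theorem one_mul' (f : TensorSeries K) : 1 * f = f := by
  ext W
  cases W with
  | nil => simp
  | cons l W =>
    have : after l (1 : TensorSeries K) = 0 := rfl
    rw [mul_cons, this, zero_mul']
    simp

theorem mul_one' (f : TensorSeries K) : f * 1 = f := by
  ext W
  induction W generalizing f with
  | nil => simp
  | cons l W ih => rw [mul_cons, ih]; simp [after]

noncomputable instance : Ring (TensorSeries K) where
  __ := (inferInstance : AddCommGroup (TensorSeries K))
  left_distrib := mul_add'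
  right_distrib := add_mul'
  zero_mul := zero_mul'
  mul_zero f := by ext W; simp [mul_apply]
  mul_assoc := mul_assoc'
  one_mul := one_mul'
  mul_one := mul_one'

noncomputable instance : Algebra K (TensorSeries K) := Algebra.ofModule smul_mul' mul_smul'

variable (K) in
/-- The series of words of length at least `N`. -/
def tail (N : ℕ) : Submodule K (TensorSeries K) where
  carrier := seriesTail K N
  zero_mem' _ _ := rfl
  add_mem' {f g} hf hg W hW := by
    change f W + g W = 0
    rw [hf W hW, hg W hW, add_zero]
  smul_mem' c f hf W hW := by
    change c * f W = 0
    rw [hf W hW, mul_zero]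

theorem mem_tail_zero (f : TensorSeries K) : f ∈ tail K 0 := fun _ h => absurd h (Nat.not_lt_zero _)

theorem tail_anti {M N : ℕ} (h : M ≤ N) : tail K N ≤ tail K M :=
  fun _ hf W hW => hf W (hW.trans_le h)

theorem mul_mem_tail {M N : ℕ} {f g : TensorSeries K} (hf : f ∈ tail K M) (hg : g ∈ tail K N) :
    f * g ∈ tail K (M + N) := by
  intro W hW
  rw [mul_apply]
  refine Finset.sum_eq_zero fun i hi => ?_
  rw [Finset.mem_range] at hi
  by_cases h : i < M
  · rw [hf _ (by rw [List.length_take]; omega), zero_mul]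
  · rw [hg _ (by rw [List.length_drop]; omega), mul_zero]

theorem mul_mem_tail_left {N : ℕ} {f : TensorSeries K} (g : TensorSeries K) (hf : f ∈ tail K N) :
    f * g ∈ tail K N := mul_mem_tail hf (mem_tail_zero g)

theorem mul_mem_tail_right {N : ℕ} {f : TensorSeries K} (g : TensorSeries K) (hf : f ∈ tail K N) :
    g * f ∈ tail K N := by
  have := mul_mem_tail (mem_tail_zero g) hf
  rwa [zero_add] at this

theorem eq_zero_of_forall_mem_tail {f : TensorSeries K} (h : ∀ N, f ∈ tail K N) : f = 0 :=
  ext fun W => h (W.length + 1) W (Nat.lt_succ_self _)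

/-- The products of terms of a double series whose total index is large lie in a tail. -/
theorem sum_mul_sum_sub_mem_tail {c : ℕ → TensorSeries K} (hc : ∀ n, c n ∈ tail K n) (N : ℕ) :
    (∑ i ∈ Finset.range N, c i) * (∑ j ∈ Finset.range N, c j) -
      ∑ n ∈ Finset.range N, ∑ ij ∈ Finset.HasAntidiagonal.antidiagonal n, c ij.1 * c ij.2 ∈
        tail K N := by
  classical
  have h : ∑ n ∈ Finset.range N, ∑ ij ∈ Finset.HasAntidiagonal.antidiagonal n, c ij.1 * c ij.2 =
      ∑ ij ∈ (Finset.range N ×ˢ Finset.range N).filter (fun ij => ij.1 + ij.2 < N),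
        c ij.1 * c ij.2 := by
    rw [Finset.sum_sigma']
    refine Finset.sum_nbij' (fun s => s.2) (fun ij => ⟨ij.1 + ij.2, ij⟩) ?_ ?_ ?_ ?_ ?_
    · rintro ⟨n, i, j⟩ h
      simp only [Finset.mem_sigma, Finset.mem_range, Finset.HasAntidiagonal.mem_antidiagonal] at h
      simp only [Finset.mem_filter, Finset.mem_product, Finset.mem_range]
      omega
    · rintro ⟨i, j⟩ h
      simp only [Finset.mem_filter, Finset.mem_product, Finset.mem_range] at h
      simp only [Finset.mem_sigma, Finset.mem_range, Finset.HasAntidiagonal.mem_antidiagonal,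
        and_true]
      omega
    · rintro ⟨n, i, j⟩ h
      simp only [Finset.mem_sigma, Finset.mem_range, Finset.HasAntidiagonal.mem_antidiagonal] at h
      obtain ⟨-, rfl⟩ := h
      rfl
    · rintro ⟨i, j⟩ _; rfl
    · rintro ⟨n, i, j⟩ _; rfl
  rw [h, Finset.sum_mul_sum, ← Finset.sum_product',
    ← Finset.sum_filter_add_sum_filter_not (Finset.range N ×ˢ Finset.range N)
      (fun ij => ij.1 + ij.2 < N), add_sub_cancel_left]
  refine Submodule.sum_mem _ fun ij hij => ?_
  rw [Finset.mem_filter, not_lt] at hij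
  exact tail_anti hij.2 (mul_mem_tail (hc _) (hc _))

variable (K) in
/-- A generator. -/
def letter (l : Letter) : TensorSeries K := letterSeries K l

theorem letter_apply (l : Letter) (W : List Letter) : letter K l W = if W = [l] then 1 else 0 := rfl

theorem letter_mem_tail (l : Letter) : letter K l ∈ tail K 1 := by
  intro W hW
  rw [letter_apply, if_neg]
  rintro rfl
  simp at hW

variable (K) in
/-- The linear map `f ↦ (-1)^{|f|} f`. -/
def par : TensorSeries K →ₗ[K] TensorSeries K where
  toFun f := parity f
  map_add' f g := by ext W; exact mul_add _ _ _
  map_smul' c f := by ext W; exact mul_left_comm _ _ _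

theorem par_apply (f : TensorSeries K) (W : List Letter) : par K f W = (-1) ^ wordDegree W * f W :=
  rfl

theorem after_par (l : Letter) (f : TensorSeries K) :
    after l (par K f) = (-1 : K) ^ l.degree • par K (after l f) := by
  ext W
  simp only [after, par_apply, smul_apply, wordDegree, List.map_cons, List.sum_cons,
    neg_one_zpow_add, mul_assoc]

variable (K) in
/-- The differential. -/
noncomputable def d : TensorSeries K →ₗ[K] TensorSeries K where
  toFun f := seriesDifferential f
  map_add' f g := by
    ext W
    change seriesDifferential (fun W => f W + g W) W = seriesDifferential f W + seriesDifferential g W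
    simp only [seriesDifferential, mul_add, Finset.sum_add_distrib]
  map_smul' c f := by
    ext W
    change seriesDifferential (fun W => c * f W) W = c * seriesDifferential f W
    simp only [seriesDifferential, Finset.mul_sum]
    refine Finset.sum_congr rfl fun i _ => Finset.sum_congr rfl fun j _ =>
      Finset.sum_congr rfl fun l _ => ?_
    ring

theorem d_apply (f : TensorSeries K) (W : List Letter) : d K f W =
    ∑ i ∈ Finset.range (W.length + 1), ∑ j ∈ Finset.range (W.length - i + 1), ∑ l : Letter,
      (-1) ^ wordDegree (W.take i) *
        (letterDifferential K l ((W.drop i).take j) * f (W.take i ++ l :: W.drop (i + j))) := rfl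

variable (K) in
/-- The differential of a letter. -/
noncomputable def dLetter (l : Letter) : TensorSeries K := letterDifferential K l

/-- The terms of `d f` at a word with first letter `y` are split according to whether the block
coming from a differentiated letter starts at the beginning of the word or after `y`. -/
theorem after_d (y : Letter) (f : TensorSeries K) : after y (d K f) =
    after y (∑ l, dLetter K l * after l f) + (-1 : K) ^ y.degree • d K (after y f) := by
  ext W
  have h : ∀ V, (∑ l, dLetter K l * after l f) V = ∑ l, (dLetter K l * after l f) V := by
    intro V
    induction (Finset.univ : Finset Letter) using Finset.cons_induction with
    | empty => rfl
    | cons l s hl ih => rw [Finset.sum_cons, Finset.sum_cons, add_apply, ih]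
  simp only [after, add_apply, smul_apply, d_apply, h]
  rw [List.length_cons, Finset.sum_range_succ', add_comm]
  congr 1
  · rw [Finset.sum_comm]
    refine Finset.sum_congr rfl fun l _ => ?_
    rw [mul_apply]
    refine Finset.sum_congr rfl fun j _ => ?_
    simp [wordDegree, dLetter, after]
  · rw [Finset.mul_sum]
    refine Finset.sum_congr rfl fun i _ => ?_
    rw [Finset.mul_sum, Nat.add_sub_add_right]
    refine Finset.sum_congr rfl fun j _ => ?_
    rw [Finset.mul_sum]
    refine Finset.sum_congr rfl fun l _ => ?_
    rw [show i + 1 + j = i + j + 1 by ring]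
    simp only [List.take_succ_cons, List.drop_succ_cons, wordDegree, List.map_cons, List.sum_cons,
      neg_one_zpow_add, List.cons_append]
    ring

theorem d_nil (f : TensorSeries K) : d K f [] = ∑ l, dLetter K l [] * f [l] := by
  simp [d_apply, wordDegree, dLetter]

/-- Induction on the word, by stripping its first letter from both sides with `after_d` and
`after_mul`. -/
theorem d_mul (f g : TensorSeries K) : d K (f * g) = d K f * g + par K f * d K g := by
  have hsum : ∀ (F : Letter → TensorSeries K) V, (∑ l, F l) V = ∑ l, F l V := by
    intro F V
    induction (Finset.univ : Finset Letter) using Finset.cons_induction with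
    | empty => rfl
    | cons l s hl ih => rw [Finset.sum_cons, Finset.sum_cons, add_apply, ih]
  have hafter : ∀ (y : Letter) (f g : TensorSeries K), after y (f + g) = after y f + after y g :=
    fun _ _ _ => rfl
  ext W
  induction W generalizing f with
  | nil =>
    rw [add_apply, mul_nil, mul_nil, d_nil, d_nil, d_nil, par_apply, Finset.sum_mul,
      show ((-1 : K) ^ wordDegree [] * f []) = f [] by simp [wordDegree], Finset.mul_sum,
      ← Finset.sum_add_distrib]
    refine Finset.sum_congr rfl fun l _ => ?_
    rw [mul_cons, mul_nil]
    simp only [after]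
    ring
  | cons y W ih =>
    have h1 : (∑ l, dLetter K l * after l (f * g)) =
        f [] • (∑ l, dLetter K l * after l g) + (∑ l, dLetter K l * after l f) * g := by
      rw [Finset.smul_sum, Finset.sum_mul, ← Finset.sum_add_distrib]
      refine Finset.sum_congr rfl fun l _ => ?_
      rw [after_mul, mul_add, mul_smul_comm, mul_assoc]
    have h2 : d K (f * g) (y :: W) = after y (d K (f * g)) W := rfl
    have h3 : (∑ l, dLetter K l * after l f) [] = d K f [] := by
      rw [d_nil, hsum]; exact Finset.sum_congr rfl fun l _ => mul_nil _ _
    have h4 : d K g (y :: W) = after y (d K g) W := rfl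
    rw [h2, after_d, h1, hafter, after_mul y _ g, after_mul, map_add, map_smul,
      add_apply (d K f * g), mul_cons (d K f) g, mul_cons (par K f), h4, h3]
    simp only [after_d, after_par, add_apply, smul_apply, ih, add_mul', smul_mul', par_apply]
    have h5 : after y (f [] • ∑ l, dLetter K l * after l g) W =
        f [] * after y (∑ l, dLetter K l * after l g) W := rfl
    rw [h5]
    simp only [after, wordDegree, List.map_nil, List.sum_nil, zpow_zero]
    ring

end TensorSeries

end TensorSeries

/-! ### The path of Maurer–Cartan elements in the Lawrence–Sullivan construction -/

section Path

variable {K : Type u} [Field K]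

namespace TensorSeries

/-- Series of words of a fixed degree. -/
def IsHomogeneous (p : ℤ) (f : TensorSeries K) : Prop := ∀ W, f W ≠ 0 → wordDegree W = p

theorem wordDegree_take_add_drop (W : List Letter) (i : ℕ) :
    wordDegree (W.take i) + wordDegree (W.drop i) = wordDegree W := by
  rw [wordDegree, wordDegree, ← List.sum_append, ← List.map_append, List.take_append_drop]
  rfl

theorem IsHomogeneous.mul {p q : ℤ} {f g : TensorSeries K} (hf : f.IsHomogeneous p)
    (hg : g.IsHomogeneous q) : (f * g).IsHomogeneous (p + q) := by
  intro W hW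
  rw [mul_apply] at hW
  obtain ⟨i, -, hi⟩ := Finset.exists_ne_zero_of_sum_ne_zero hW
  rw [← hf _ (left_ne_zero_of_mul hi), ← hg _ (right_ne_zero_of_mul hi), wordDegree_take_add_drop]

theorem IsHomogeneous.add {p : ℤ} {f g : TensorSeries K} (hf : f.IsHomogeneous p)
    (hg : g.IsHomogeneous p) : (f + g).IsHomogeneous p := by
  intro W hW
  by_cases h : f W = 0
  · exact hg W fun h' => hW (by rw [add_apply, h, h', add_zero])
  · exact hf W h

theorem IsHomogeneous.smul {p : ℤ} {f : TensorSeries K} (c : K) (hf : f.IsHomogeneous p) :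
    (c • f).IsHomogeneous p :=
  fun W hW => hf W (right_ne_zero_of_mul hW)

theorem IsHomogeneous.sub {p : ℤ} {f g : TensorSeries K} (hf : f.IsHomogeneous p)
    (hg : g.IsHomogeneous p) : (f - g).IsHomogeneous p := by
  rw [sub_eq_add_neg, ← neg_one_smul K g]
  exact hf.add (hg.smul _)

theorem IsHomogeneous.par_eq {p : ℤ} {f : TensorSeries K} (hf : f.IsHomogeneous p) :
    par K f = (-1 : K) ^ p • f := by
  ext W
  rw [par_apply, smul_apply]
  by_cases h : f W = 0
  · rw [h, mul_zero, mul_zero]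
  · rw [hf W h]

theorem letter_isHomogeneous (l : Letter) : (letter K l).IsHomogeneous l.degree := by
  intro W hW
  rw [letter_apply] at hW
  obtain rfl : W = [l] := by
    by_contra h
    exact hW (if_neg h)
  simp [wordDegree]

theorem commutator_of_isHomogeneous {p q : ℤ} {f g : TensorSeries K} (hf : f.IsHomogeneous p)
    (hg : g.IsHomogeneous q) :
    (commutator f g : TensorSeries K) = f * g - (-1 : K) ^ (p * q) • (g * f) := by
  ext W
  rw [sub_apply, smul_apply, mul_apply, mul_apply, Finset.mul_sum, ← Finset.sum_sub_distrib]
  refine Finset.sum_congr rfl fun i _ => ?_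
  congr 1
  by_cases h : g (W.take i) * f (W.drop i) = 0
  · rw [h, mul_zero, mul_zero]
  · rw [hf _ (right_ne_zero_of_mul h), hg _ (left_ne_zero_of_mul h), mul_comm p]

/-- The commutator with the generator `x`. -/
noncomputable def ad (K : Type u) [Field K] : Module.End K (TensorSeries K) :=
  LinearMap.mulLeft K (letter K .x) - LinearMap.mulRight K (letter K .x)

theorem ad_apply (f : TensorSeries K) : ad K f = letter K .x * f - f * letter K .x := rfl

theorem commutator_x (f : TensorSeries K) :
    (commutator (letterSeries K .x) f : TensorSeries K) = ad K f := by
  ext W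
  rw [ad_apply, sub_apply, mul_apply, mul_apply, ← Finset.sum_sub_distrib]
  refine Finset.sum_congr rfl fun i _ => ?_
  congr 1
  change (-1) ^ _ * (f (W.take i) * letter K .x (W.drop i)) = _
  by_cases h : letter K .x (W.drop i) = 0
  · rw [h, mul_zero, mul_zero]
  · rw [letter_isHomogeneous .x _ h]
    simp [Letter.degree]

theorem ad_mem_tail {N : ℕ} {f : TensorSeries K} (hf : f ∈ tail K N) : ad K f ∈ tail K (N + 1) := by
  rw [ad_apply]
  refine Submodule.sub_mem _ ?_ (mul_mem_tail hf (letter_mem_tail .x))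
  rw [add_comm]
  exact mul_mem_tail (letter_mem_tail .x) hf

theorem ad_pow_mem_tail {N : ℕ} {f : TensorSeries K} (hf : f ∈ tail K N) (n : ℕ) :
    (ad K ^ n) f ∈ tail K (N + n) := by
  induction n with
  | zero => exact hf
  | succ n ih => rw [pow_succ', Module.End.mul_apply]; exact ad_mem_tail ih

theorem aeval_ad_mem_tail (P : Polynomial K) {N : ℕ} {f : TensorSeries K} (hf : f ∈ tail K N) :
    Polynomial.aeval (ad K) P f ∈ tail K N := by
  rw [Polynomial.aeval_eq_sum_range, LinearMap.sum_apply]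
  refine Submodule.sum_mem _ fun n _ => Submodule.smul_mem _ _ ?_
  exact tail_anti (Nat.le_add_right _ _) (ad_pow_mem_tail hf n)

theorem aeval_ad_mem_tail_of_dvd {P : Polynomial K} {N : ℕ} (h : Polynomial.X ^ N ∣ P)
    (f : TensorSeries K) : Polynomial.aeval (ad K) P f ∈ tail K N := by
  obtain ⟨Q, rfl⟩ := h
  rw [map_mul, Polynomial.aeval_X_pow, Module.End.mul_apply]
  have := ad_pow_mem_tail (mem_tail_zero (Polynomial.aeval (ad K) Q f)) N
  rwa [zero_add] at this

theorem IsHomogeneous.ad {p : ℤ} {f : TensorSeries K} (hf : f.IsHomogeneous p) :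
    (ad K f).IsHomogeneous p := by
  have h := letter_isHomogeneous (K := K) .x
  refine IsHomogeneous.sub ?_ ?_
  · have := h.mul hf
    rwa [show Letter.x.degree = 0 from rfl, zero_add] at this
  · have := hf.mul h
    rwa [show Letter.x.degree = 0 from rfl, add_zero] at this

/-- The component of a fixed word length. -/
def part (n : ℕ) (f : TensorSeries K) : TensorSeries K := lengthPart n f

theorem part_apply (n : ℕ) (f : TensorSeries K) (W : List Letter) :
    part n f W = if W.length = n then f W else 0 := rfl

theorem part_ad (n : ℕ) (f : TensorSeries K) :
    part (n + 1) (ad K f) = ad K (part n f) := by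
  ext W
  rw [part_apply]
  simp only [ad_apply, sub_apply, mul_apply]
  rw [← Finset.sum_sub_distrib, ← Finset.sum_sub_distrib]
  split_ifs with h
  · refine Finset.sum_congr rfl fun i hi => ?_
    rw [Finset.mem_range] at hi
    congr 1
    · by_cases h0 : letter K .x (W.take i) = 0
      · rw [h0, zero_mul, zero_mul]
      · have : W.take i = [.x] := by by_contra hc; exact h0 (if_neg hc)
        have h1 := congrArg List.length this
        have h2 : (W.drop i).length = n := by
          rw [List.length_take] at h1; simp at h1; rw [List.length_drop]; omega
        rw [part_apply, if_pos h2]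
    · by_cases h0 : letter K .x (W.drop i) = 0
      · rw [h0, mul_zero, mul_zero]
      · have : W.drop i = [.x] := by by_contra hc; exact h0 (if_neg hc)
        have h1 := congrArg List.length this
        have h2 : (W.take i).length = n := by
          rw [List.length_drop] at h1; simp at h1; rw [List.length_take]; omega
        rw [part_apply, if_pos h2]
  · symm
    refine Finset.sum_eq_zero fun i hi => ?_
    rw [Finset.mem_range] at hi
    have h3 : letter K .x (W.take i) * (part n f) (W.drop i) = 0 := by
      by_cases h0 : letter K .x (W.take i) = 0
      · rw [h0, zero_mul]
      · have : W.take i = [.x] := by by_contra hc; exact h0 (if_neg hc)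
        have h1 := congrArg List.length this
        rw [part_apply, if_neg, mul_zero]
        rw [List.length_take] at h1; simp at h1; rw [List.length_drop]; omega
    have h4 : (part n f) (W.take i) * letter K .x (W.drop i) = 0 := by
      by_cases h0 : letter K .x (W.drop i) = 0
      · rw [h0, mul_zero]
      · have : W.drop i = [.x] := by by_contra hc; exact h0 (if_neg hc)
        have h1 := congrArg List.length this
        rw [part_apply, if_neg, zero_mul]
        rw [List.length_drop] at h1; simp at h1; rw [List.length_take]; omega
    rw [h3, h4, sub_zero]

variable (K) in
/-- The complete free Lie algebra. -/
def lie (p : ℤ) : Submodule K (TensorSeries K) := completeLie K p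

theorem mem_lie {p : ℤ} {f : TensorSeries K} : f ∈ lie K p ↔ f.IsHomogeneous p ∧
    ∀ n, part n f ∈ Submodule.span K {g : TensorSeries K | IsLieMonomial K n g} := Iff.rfl

theorem ad_mem_lie {p : ℤ} {f : TensorSeries K} (hf : f ∈ lie K p) : ad K f ∈ lie K p := by
  rw [mem_lie] at hf ⊢
  refine ⟨hf.1.ad, fun n => ?_⟩
  rcases n with _ | n
  · have : part 0 (ad K f) = 0 := by
      ext W
      rw [part_apply]
      split_ifs with h
      · exact ad_mem_tail (mem_tail_zero f) W (by omega)
      · rfl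
    rw [this]; exact Submodule.zero_mem _
  · have h1 : ∀ g : TensorSeries K, g ∈ Submodule.span K {g : TensorSeries K | IsLieMonomial K n g} →
        ad K g ∈ Submodule.span K {g : TensorSeries K | IsLieMonomial K (n + 1) g} := by
      intro g hg
      induction hg using Submodule.span_induction with
      | mem g hg =>
        refine Submodule.subset_span ?_
        rw [← commutator_x, add_comm]
        exact (IsLieMonomial.letter .x).bracket hg
      | zero =>
        change ad K 0 ∈ _
        rw [map_zero]; exact Submodule.zero_mem _
      | add g g' _ _ hg hg' =>
        exact (map_add (ad K) g g') ▸ Submodule.add_mem _ hg hg'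
      | smul c g _ hg => exact (map_smul (ad K) c g) ▸ Submodule.smul_mem _ c hg
    exact (part_ad n f) ▸ h1 _ (hf.2 n)

theorem ad_pow_mem_lie {p : ℤ} {f : TensorSeries K} (hf : f ∈ lie K p) (n : ℕ) :
    (ad K ^ n) f ∈ lie K p := by
  induction n with
  | zero => exact hf
  | succ n ih => rw [pow_succ', Module.End.mul_apply]; exact ad_mem_lie ih

theorem letter_mem_lie (l : Letter) : letter K l ∈ lie K l.degree := by
  refine mem_lie.2 ⟨letter_isHomogeneous l, fun n => ?_⟩
  by_cases hn : n = 1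
  · subst hn
    refine Submodule.subset_span ?_
    have : part 1 (letter K l) = letter K l := by
      ext W
      rw [part_apply]
      split_ifs with h
      · rfl
      · rw [letter_apply, if_neg]
        rintro rfl
        exact h rfl
    rw [this]
    exact IsLieMonomial.letter l
  · have : part n (letter K l) = 0 := by
      ext W
      rw [part_apply]
      split_ifs with h
      · rw [letter_apply, if_neg]
        · rfl
        · rintro rfl
          exact hn h.symm
      · rfl
    rw [this]; exact Submodule.zero_mem _

/-- The sum of a series whose terms lie in smaller and smaller tails. -/
def summation (c : ℕ → TensorSeries K) : TensorSeries K :=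
  fun W => ∑ n ∈ Finset.range (W.length + 1), c n W

theorem sum_apply' {ι : Type*} (s : Finset ι) (c : ι → TensorSeries K) (W : List Letter) :
    (∑ i ∈ s, c i) W = ∑ i ∈ s, c i W := by
  induction s using Finset.cons_induction with
  | empty => rfl
  | cons i s hi ih => rw [Finset.sum_cons, Finset.sum_cons, add_apply, ih]

theorem summation_sub_mem_tail {c : ℕ → TensorSeries K} (hc : ∀ n, c n ∈ tail K n) (N : ℕ) :
    summation c - ∑ n ∈ Finset.range N, c n ∈ tail K N := by
  intro W hW
  rw [sub_apply, sum_apply', sub_eq_zero]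
  refine Finset.sum_subset (fun n hn => ?_) fun n _ hn => ?_
  · rw [Finset.mem_range] at hn ⊢; omega
  · rw [Finset.mem_range] at hn
    exact hc n W (by omega)

theorem summation_mem_lie {p : ℤ} {c : ℕ → TensorSeries K} (hc : ∀ n, c n ∈ lie K p) :
    summation c ∈ lie K p := by
  refine mem_lie.2 ⟨fun W hW => ?_, fun n => ?_⟩
  · obtain ⟨n, -, hn⟩ := Finset.exists_ne_zero_of_sum_ne_zero hW
    exact (mem_lie.1 (hc n)).1 W hn
  · have : part n (summation c) =
        ∑ k ∈ Finset.range (n + 1), part n (c k) := by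
      ext W
      rw [sum_apply']
      simp only [part_apply]
      split_ifs with h
      · subst h; rfl
      · simp
    rw [this]
    exact Submodule.sum_mem _ fun k _ => (mem_lie.1 (hc k)).2 n

theorem d_one : d K 1 = 0 := by
  have h : par K 1 = 1 := by
    ext W
    rw [par_apply]
    cases W <;> simp [wordDegree]
  have := d_mul (1 : TensorSeries K) 1
  rw [h, one_mul, one_mul, mul_one] at this
  simpa using this

theorem d_letter (l : Letter) : d K (letter K l) = dLetter K l := by
  have h1 : ∀ y, after y (letter K l) = if y = l then 1 else 0 := by
    intro y
    ext W
    simp only [after, letter_apply]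
    by_cases hy : y = l
    · subst hy
      cases W <;> simp
    · simp [hy]
  ext W
  cases W with
  | nil => rw [d_nil]; simp [letter_apply]
  | cons y W =>
    change after y (d K (letter K l)) W = _
    rw [after_d]
    simp only [h1, mul_ite, mul_one, mul_zero, Finset.sum_ite_eq', Finset.mem_univ, if_true]
    split_ifs <;> simp [d_one, after]

/-- Replacing a letter by a series without constant term never shortens a word. -/
theorem d_mem_tail {N : ℕ} {f : TensorSeries K} (hf : f ∈ tail K N) (h0 : ∀ l, dLetter K l [] = 0) :
    d K f ∈ tail K N := by
  intro W hW
  rw [d_apply]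
  refine Finset.sum_eq_zero fun i hi => Finset.sum_eq_zero fun j hj =>
    Finset.sum_eq_zero fun l _ => ?_
  rw [Finset.mem_range] at hi hj
  rcases Nat.eq_zero_or_pos j with rfl | hj0
  · rw [List.take_zero]
    change _ * (dLetter K l [] * _) = _
    rw [h0, zero_mul, mul_zero]
  · have : f (W.take i ++ l :: W.drop (i + j)) = 0 := by
      refine hf _ ?_
      rw [List.length_append, List.length_cons, List.length_take, List.length_drop]
      omega
    rw [this, mul_zero, mul_zero]

end TensorSeries

end Path

/-! ### Bernoulli numbers and the flat path from `a` to `b` -/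

section BernoulliPath

variable {K : Type u} [Field K] [CharZero K]

/-- The power series `(1 - e^{-u}) / u`. -/
noncomputable def pathSeries (K : Type u) [Field K] : PowerSeries K :=
  PowerSeries.mk fun n => ((((n + 1) ! : ℕ) : K))⁻¹ * (-1) ^ n

theorem pathSeries_mul_X : pathSeries K * PowerSeries.X =
    1 - PowerSeries.evalNegHom (PowerSeries.exp K) := by
  ext n
  rcases n with _ | n
  · rw [map_sub, PowerSeries.evalNegHom, PowerSeries.coeff_rescale]
    simp
  · rw [PowerSeries.coeff_succ_mul_X, pathSeries, PowerSeries.coeff_mk, map_sub,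
      PowerSeries.coeff_one, if_neg (Nat.succ_ne_zero n), PowerSeries.evalNegHom,
      PowerSeries.coeff_rescale, PowerSeries.coeff_exp]
    simp [pow_succ, mul_comm]

theorem succ_mul_coeff_pathSeries (n : ℕ) : ((n + 1 + 1 : ℕ) : K) *
    PowerSeries.coeff (n + 1) (pathSeries K) = -PowerSeries.coeff n (pathSeries K) := by
  have h : ((n + 1 + 1 : ℕ) : K) ≠ 0 := by exact_mod_cast Nat.succ_ne_zero (n + 1)
  rw [pathSeries, PowerSeries.coeff_mk, PowerSeries.coeff_mk, Nat.factorial_succ (n + 1),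
    Nat.cast_mul, mul_inv, pow_succ, ← mul_assoc, ← mul_assoc, ← mul_assoc, mul_inv_cancel₀ h]
  ring

/-- Since `u + u/(e^u - 1) = u e^u/(e^u - 1)`, the product with `(1 - e^{-u})/u` is `1`. This
identity is the reason for the Bernoulli numbers in `∂x`: it makes the path end at `b`. -/
theorem pathSeries_mul_bernoulli :
    pathSeries K * (PowerSeries.X + bernoulliPowerSeries K) = 1 := by
  have h1 := pathSeries_mul_X (K := K)
  have h2 := bernoulliPowerSeries_mul_exp_sub_one K
  have h3 := PowerSeries.exp_mul_exp_neg_eq_one (A := K)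
  have h4 : PowerSeries.exp K - 1 ≠ 0 := by
    intro h
    have := congrArg (PowerSeries.coeff 1) h
    simp at this
  -- Denominators are cleared by multiplying with `u (e^u - 1)`.
  refine mul_left_cancel₀ (mul_ne_zero (PowerSeries.X_ne_zero (R := K)) h4) ?_
  calc PowerSeries.X * (PowerSeries.exp K - 1) *
        (pathSeries K * (PowerSeries.X + bernoulliPowerSeries K))
      = (pathSeries K * PowerSeries.X) * (PowerSeries.X * (PowerSeries.exp K - 1) +
          bernoulliPowerSeries K * (PowerSeries.exp K - 1)) := by ring
    _ = (1 - PowerSeries.evalNegHom (PowerSeries.exp K)) *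
          (PowerSeries.X * PowerSeries.exp K) := by rw [h1, h2]; ring
    _ = PowerSeries.X * PowerSeries.exp K - PowerSeries.X *
          (PowerSeries.exp K * PowerSeries.evalNegHom (PowerSeries.exp K)) := by ring
    _ = _ := by rw [h3]; ring

/-- Polynomial truncations are used because polynomials can be applied to `ad K` as to any
endomorphism; powers of `X` then become membership in tails. -/
theorem X_pow_dvd_trunc_pathSeries (N : ℕ) :
    Polynomial.X ^ N ∣ PowerSeries.trunc N (pathSeries K) *
      (Polynomial.X + PowerSeries.trunc N (bernoulliPowerSeries K)) - 1 := by
  rw [Polynomial.X_pow_dvd_iff]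
  intro n hn
  have h := congrArg (PowerSeries.coeff n) (pathSeries_mul_bernoulli (K := K))
  rw [Polynomial.coeff_sub, sub_eq_zero, ← Polynomial.coeff_coe 1, Polynomial.coe_one, ← h,
    Polynomial.coeff_mul, PowerSeries.coeff_mul]
  refine Finset.sum_congr rfl fun ij hij => ?_
  rw [Finset.HasAntidiagonal.mem_antidiagonal] at hij
  rw [Polynomial.coeff_add, PowerSeries.coeff_trunc, PowerSeries.coeff_trunc,
    if_pos (by omega), if_pos (by omega), map_add, ← Polynomial.coeff_coe, Polynomial.coe_X]

namespace TensorSeries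

omit [CharZero K] in
theorem aeval_trunc_ad (p : PowerSeries K) (N : ℕ) (f : TensorSeries K) :
    Polynomial.aeval (ad K) (PowerSeries.trunc N p) f =
      ∑ n ∈ Finset.range N, PowerSeries.coeff n p • (ad K ^ n) f := by
  have h : PowerSeries.trunc N p =
      ∑ n ∈ Finset.range N, Polynomial.C (PowerSeries.coeff n p) * Polynomial.X ^ n := by
    ext m
    simp only [PowerSeries.coeff_trunc, Polynomial.finsetSum_coeff, Polynomial.coeff_C_mul,
      Polynomial.coeff_X_pow, mul_ite, mul_one, mul_zero, Finset.sum_ite_eq, Finset.mem_range]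
  rw [h, map_sum, LinearMap.sum_apply]
  refine Finset.sum_congr rfl fun n _ => ?_
  rw [map_mul, Polynomial.aeval_C, Polynomial.aeval_X_pow, Module.End.mul_apply,
    Module.algebraMap_end_apply]

/-- The difference of the endpoints. -/
noncomputable def endDiff (K : Type u) [Field K] : TensorSeries K := letter K .b - letter K .a

omit [CharZero K] in
theorem endDiff_mem_lie : endDiff K ∈ lie K (-1) :=
  Submodule.sub_mem _ (letter_mem_lie .b) (letter_mem_lie .a)

omit [CharZero K] in
theorem endDiff_mem_tail : endDiff K ∈ tail K 1 :=
  Submodule.sub_mem _ (letter_mem_tail .b) (letter_mem_tail .a)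

theorem dLetter_x : dLetter K .x = ad K (letter K .b) +
    summation fun n => PowerSeries.coeff n (bernoulliPowerSeries K) • (ad K ^ n) (endDiff K) := by
  have h : ∀ n, ((commutator (letterSeries K .x))^[n] (letterSeries K .b - letterSeries K .a) :
      TensorSeries K) = (ad K ^ n) (endDiff K) := by
    intro n
    induction n with
    | zero => rfl
    | succ n ih =>
      rw [Function.iterate_succ_apply', pow_succ', Module.End.mul_apply, ← ih]
      exact commutator_x _
  ext W
  change commutator (letterSeries K .x) (letterSeries K .b) W +
      ∑ n ∈ Finset.range W.length, ((bernoulli n : ℚ) : K) * ((n ! : ℕ) : K)⁻¹ *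
        ((commutator (letterSeries K .x))^[n] (letterSeries K .b - letterSeries K .a)) W = _
  rw [add_apply]
  congr 1
  · exact congrFun (commutator_x (letter K .b)) W
  · rw [summation, Finset.sum_range_succ]
    have h0 : (ad K ^ W.length) (endDiff K) W = 0 :=
      ad_pow_mem_tail endDiff_mem_tail W.length W (by omega)
    rw [smul_apply, h0, mul_zero, add_zero]
    refine Finset.sum_congr rfl fun n _ => ?_
    rw [smul_apply, bernoulliPowerSeries, PowerSeries.coeff_mk]
    congr 1
    · simp [div_eq_mul_inv]
    · exact congrFun (h n) W

theorem dLetter_x_mem_lie : dLetter K .x ∈ lie K (-1) := by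
  rw [dLetter_x]
  exact Submodule.add_mem _ (ad_mem_lie (letter_mem_lie .b))
    (summation_mem_lie fun n => Submodule.smul_mem _ _ (ad_pow_mem_lie endDiff_mem_lie n))

theorem dLetter_x_sub_mem_tail (N : ℕ) : dLetter K .x - (ad K (letter K .b) +
    Polynomial.aeval (ad K) (PowerSeries.trunc N (bernoulliPowerSeries K)) (endDiff K)) ∈
      tail K N := by
  rw [dLetter_x, add_sub_add_left_eq_sub, aeval_trunc_ad]
  refine summation_sub_mem_tail (fun n => Submodule.smul_mem _ _ ?_) N
  have := ad_pow_mem_tail (endDiff_mem_tail (K := K)) n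
  exact tail_anti (Nat.le_add_left n 1) this

theorem dLetter_a : dLetter K .a = -(letter K .a * letter K .a) := by
  have h : dLetter K .a = -(2 : K)⁻¹ • (letter K .a * letter K .a -
      (-1 : K) ^ (Letter.a.degree * Letter.a.degree) • (letter K .a * letter K .a)) := by
    rw [← commutator_of_isHomogeneous (letter_isHomogeneous .a) (letter_isHomogeneous .a)]
    rfl
  rw [h]
  simp only [Letter.degree, mul_neg, mul_one, neg_neg, zpow_one, neg_smul, one_smul, sub_neg_eq_add]
  rw [← two_smul K, smul_smul, inv_mul_cancel₀ two_ne_zero, one_smul]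

theorem dLetter_b : dLetter K .b = -(letter K .b * letter K .b) := by
  have h : dLetter K .b = -(2 : K)⁻¹ • (letter K .b * letter K .b -
      (-1 : K) ^ (Letter.b.degree * Letter.b.degree) • (letter K .b * letter K .b)) := by
    rw [← commutator_of_isHomogeneous (letter_isHomogeneous .b) (letter_isHomogeneous .b)]
    rfl
  rw [h]
  simp only [Letter.degree, mul_neg, mul_one, neg_neg, zpow_one, neg_smul, one_smul, sub_neg_eq_add]
  rw [← two_smul K, smul_smul, inv_mul_cancel₀ two_ne_zero, one_smul]

theorem dLetter_x_mem_tail : dLetter K .x ∈ tail K 1 := by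
  have h := dLetter_x_sub_mem_tail (K := K) 1
  have h2 : ad K (letter K .b) ∈ tail K 1 :=
    tail_anti (by omega) (ad_mem_tail (letter_mem_tail .b))
  have := Submodule.add_mem _ h (Submodule.add_mem _ h2 (aeval_ad_mem_tail
    (PowerSeries.trunc 1 (bernoulliPowerSeries K)) endDiff_mem_tail))
  rwa [sub_add_cancel] at this

theorem dLetter_nil (l : Letter) : dLetter K l [] = 0 := by
  have h0 : ∀ l, letter K l [] = 0 := fun l => letter_mem_tail l [] (by simp)
  rcases l
  · rw [dLetter_a, neg_apply, mul_nil, h0]; simp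
  · rw [dLetter_b, neg_apply, mul_nil, h0]; simp
  · exact dLetter_x_mem_tail [] (by simp)

/-- The initial velocity of the path. -/
noncomputable def velocity (K : Type u) [Field K] : TensorSeries K :=
  dLetter K .x - ad K (letter K .a)

/-- The Taylor coefficients of the path. -/
noncomputable def pathCoeff (K : Type u) [Field K] : ℕ → TensorSeries K
  | 0 => letter K .a
  | n + 1 => PowerSeries.coeff n (pathSeries K) • (ad K ^ n) (velocity K)

/-- The differential equation `z' = ∂x - [x, z]`, coefficient by coefficient. -/
theorem succ_smul_pathCoeff_succ (n : ℕ) : ((n + 1 : ℕ) : K) • pathCoeff K (n + 1) =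
    (if n = 0 then dLetter K .x else 0) - ad K (pathCoeff K n) := by
  rcases n with _ | n
  · simp [pathCoeff, pathSeries, velocity]
  · simp only [pathCoeff, Nat.succ_ne_zero, if_false, zero_sub,
      map_smul]
    rw [smul_smul, pow_succ' (ad K) n, Module.End.mul_apply, ← neg_smul, succ_mul_coeff_pathSeries]

theorem velocity_mem_lie : velocity K ∈ lie K (-1) :=
  Submodule.sub_mem _ dLetter_x_mem_lie (ad_mem_lie (letter_mem_lie .a))

theorem velocity_mem_tail : velocity K ∈ tail K 1 :=
  Submodule.sub_mem _ dLetter_x_mem_tail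
    (tail_anti (by omega) (ad_mem_tail (letter_mem_tail .a)))

theorem pathCoeff_mem_lie (n : ℕ) : pathCoeff K n ∈ lie K (-1) := by
  rcases n with _ | n
  · exact letter_mem_lie .a
  · exact Submodule.smul_mem _ _ (ad_pow_mem_lie velocity_mem_lie n)

theorem pathCoeff_mem_tail (n : ℕ) : pathCoeff K n ∈ tail K n := by
  rcases n with _ | n
  · exact mem_tail_zero _
  · refine Submodule.smul_mem _ _ ?_
    rw [add_comm]
    exact ad_pow_mem_tail velocity_mem_tail n

/-- The path ends at `b`: the initial velocity is `(u + B(u))(b - a)` at `u = ad x`, where `B` is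
the Bernoulli series, and integrating over the unit interval applies `(1 - e^{-u})/u`, which is the
inverse. -/
theorem sum_pathCoeff_sub_mem_tail (N : ℕ) :
    ∑ n ∈ Finset.range (N + 1), pathCoeff K n - letter K .b ∈ tail K N := by
  rw [Finset.sum_range_succ']
  simp only [pathCoeff]
  rw [← aeval_trunc_ad]
  have h1 := aeval_ad_mem_tail (PowerSeries.trunc N (pathSeries K)) (dLetter_x_sub_mem_tail (K := K) N)
  have h2 := aeval_ad_mem_tail_of_dvd (X_pow_dvd_trunc_pathSeries (K := K) N) (endDiff K)
  have h3 := Submodule.add_mem _ h1 h2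
  convert h3 using 1
  simp only [map_sub, map_add, map_mul, Polynomial.aeval_X, map_one, velocity, endDiff,
    LinearMap.sub_apply, LinearMap.add_apply, Module.End.mul_apply, Module.End.one_apply]
  abel

/-- The curvature of the path, as a formal power series. -/
noncomputable def curvCoeff (K : Type u) [Field K] (n : ℕ) : TensorSeries K :=
  d K (pathCoeff K n) +
    ∑ ij ∈ Finset.HasAntidiagonal.antidiagonal n, pathCoeff K ij.1 * pathCoeff K ij.2

omit [CharZero K] in
theorem d_ad {f : TensorSeries K} (hf : f.IsHomogeneous (-1)) :
    d K (ad K f) = dLetter K .x * f + f * dLetter K .x + ad K (d K f) := by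
  rw [ad_apply, ad_apply, map_sub, d_mul, d_mul, hf.par_eq, (letter_isHomogeneous .x).par_eq,
    d_letter]
  simp only [Letter.degree, zpow_zero, one_smul, zpow_neg, zpow_one, inv_neg, inv_one, neg_smul,
    neg_mul]
  abel

omit [CharZero K] in
theorem ad_mul (f g : TensorSeries K) : ad K (f * g) = ad K f * g + f * ad K g := by
  simp only [ad_apply]; noncomm_ring

/-- Differentiating `F = ∂z + z²` along `z' = ∂x - [x, z]`, the terms `∂x z + z ∂x` cancel and `F' =
∂²x - [x, F]` remains. -/
theorem succ_smul_curvCoeff_succ (n : ℕ) : ((n + 1 : ℕ) : K) • curvCoeff K (n + 1) =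
    (if n = 0 then d K (dLetter K .x) else 0) - ad K (curvCoeff K n) := by
  have h1 : ((n + 1 : ℕ) : K) • d K (pathCoeff K (n + 1)) =
      (if n = 0 then d K (dLetter K .x) else 0) - (dLetter K .x * pathCoeff K n +
        pathCoeff K n * dLetter K .x + ad K (d K (pathCoeff K n))) := by
    rw [← map_smul, succ_smul_pathCoeff_succ, map_sub, d_ad (mem_lie.1 (pathCoeff_mem_lie n)).1]
    split_ifs <;> simp
  have h2 : ((n + 1 : ℕ) : K) • ∑ ij ∈ Finset.HasAntidiagonal.antidiagonal (n + 1),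
      pathCoeff K ij.1 * pathCoeff K ij.2 =
      ∑ ij ∈ Finset.HasAntidiagonal.antidiagonal (n + 1),
        ((ij.1 : K) • pathCoeff K ij.1) * pathCoeff K ij.2 +
      ∑ ij ∈ Finset.HasAntidiagonal.antidiagonal (n + 1),
        pathCoeff K ij.1 * ((ij.2 : K) • pathCoeff K ij.2) := by
    rw [Finset.smul_sum, ← Finset.sum_add_distrib]
    refine Finset.sum_congr rfl fun ij hij => ?_
    rw [Finset.HasAntidiagonal.mem_antidiagonal] at hij
    rw [← hij, Nat.cast_add, add_smul, smul_mul_assoc, mul_smul_comm]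
  have h3 : ∑ ij ∈ Finset.HasAntidiagonal.antidiagonal (n + 1),
        ((ij.1 : K) • pathCoeff K ij.1) * pathCoeff K ij.2 = dLetter K .x * pathCoeff K n -
      ∑ ij ∈ Finset.HasAntidiagonal.antidiagonal n, ad K (pathCoeff K ij.1) * pathCoeff K ij.2 := by
    rw [Finset.Nat.sum_antidiagonal_succ]
    simp only [Nat.cast_zero, zero_smul, zero_mul, zero_add, succ_smul_pathCoeff_succ, sub_mul,
      Finset.sum_sub_distrib]
    congr 1
    rw [Finset.sum_eq_single (0, n)]
    · simp
    · rintro ⟨i, j⟩ hij hne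
      rw [Finset.HasAntidiagonal.mem_antidiagonal] at hij
      rw [if_neg, zero_mul]
      rintro rfl
      exact hne (by simp at hij; rw [hij])
    · simp
  have h4 : ∑ ij ∈ Finset.HasAntidiagonal.antidiagonal (n + 1),
        pathCoeff K ij.1 * ((ij.2 : K) • pathCoeff K ij.2) = pathCoeff K n * dLetter K .x -
      ∑ ij ∈ Finset.HasAntidiagonal.antidiagonal n, pathCoeff K ij.1 * ad K (pathCoeff K ij.2) := by
    rw [Finset.Nat.sum_antidiagonal_succ']
    simp only [Nat.cast_zero, zero_smul, mul_zero, zero_add, succ_smul_pathCoeff_succ, mul_sub,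
      Finset.sum_sub_distrib]
    congr 1
    rw [Finset.sum_eq_single (n, 0)]
    · simp
    · rintro ⟨i, j⟩ hij hne
      rw [Finset.HasAntidiagonal.mem_antidiagonal] at hij
      rw [if_neg, mul_zero]
      rintro rfl
      exact hne (by simp at hij; rw [hij])
    · simp
  rw [curvCoeff, smul_add, h1, h2, h3, h4, curvCoeff, map_add, map_sum]
  simp only [ad_mul, Finset.sum_add_distrib]
  abel

theorem curvCoeff_zero : curvCoeff K 0 = 0 := by
  simp [curvCoeff, pathCoeff, d_letter, dLetter_a]

/-- The solution of the linear equation for the curvature which starts at `0`, since `a` is flat. -/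
theorem curvCoeff_succ (n : ℕ) : curvCoeff K (n + 1) =
    PowerSeries.coeff n (pathSeries K) • (ad K ^ n) (d K (dLetter K .x)) := by
  induction n with
  | zero =>
    have := succ_smul_curvCoeff_succ (K := K) 0
    simpa [curvCoeff_zero, pathSeries] using this
  | succ n ih =>
    have h := succ_smul_curvCoeff_succ (K := K) (n + 1)
    have h0 : ((n + 1 + 1 : ℕ) : K) ≠ 0 := by exact_mod_cast Nat.succ_ne_zero (n + 1)
    rw [if_neg (Nat.succ_ne_zero n), zero_sub, ih, map_smul, ← Module.End.mul_apply,
      ← pow_succ'] at h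
    refine smul_right_injective _ h0 ?_
    simp only
    rw [h, smul_smul, succ_mul_coeff_pathSeries, neg_smul]

/-- That `∂²x = 0` follows from the other endpoint: `b` is flat, so the total curvature at time one,
which is `(1 - e^{-u})/u` at `u = ad x` applied to `∂²x`, vanishes. The constant coefficient of that
series is `1`, so it has no kernel. -/
theorem d_dLetter_x : d K (dLetter K .x) = 0 := by
  have h1 : ∀ N, Polynomial.aeval (ad K) (PowerSeries.trunc N (pathSeries K))
      (d K (dLetter K .x)) ∈ tail K N := by
    intro N
    set z := ∑ n ∈ Finset.range (N + 1), pathCoeff K n with hz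
    have h2 : z - letter K .b ∈ tail K N := sum_pathCoeff_sub_mem_tail N
    have h3 : d K z + z * z ∈ tail K N := by
      have h4 := d_mem_tail h2 dLetter_nil
      have h5 := Submodule.add_mem _ (mul_mem_tail_left z h2)
        (mul_mem_tail_right (letter K .b) h2)
      convert Submodule.add_mem _ h4 h5 using 1
      rw [map_sub, d_letter, dLetter_b]
      noncomm_ring
    have h6 := sum_mul_sum_sub_mem_tail (pathCoeff_mem_tail (K := K)) (N + 1)
    have h7 : ∑ n ∈ Finset.range (N + 1), curvCoeff K n ∈ tail K N := by
      convert Submodule.sub_mem _ h3 (tail_anti (Nat.le_succ N) h6) using 1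
      simp only [curvCoeff, Finset.sum_add_distrib, hz, map_sum]
      abel
    rw [Finset.sum_range_succ', curvCoeff_zero, add_zero] at h7
    simpa only [curvCoeff_succ, ← aeval_trunc_ad] using h7
  refine eq_zero_of_forall_mem_tail fun N => ?_
  induction N with
  | zero => exact mem_tail_zero _
  | succ N ih =>
    have h2 := h1 (N + 1)
    -- The term with constant coefficient `1` is isolated. The remaining ones contain at least one
    -- `ad`, so they lie one step deeper than `∂²x` is known to lie.
    rw [aeval_trunc_ad, Finset.sum_range_succ'] at h2
    have h3 : ∑ n ∈ Finset.range N, PowerSeries.coeff (n + 1) (pathSeries K) •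
        (ad K ^ (n + 1)) (d K (dLetter K .x)) ∈ tail K (N + 1) :=
      Submodule.sum_mem _ fun n _ => Submodule.smul_mem _ _
        (tail_anti (by omega) (ad_pow_mem_tail ih (n + 1)))
    simpa [pathSeries] using (Submodule.add_mem_iff_right _ h3).1 h2

theorem curvCoeff_eq_zero (n : ℕ) : curvCoeff K n = 0 := by
  rcases n with _ | n
  · exact curvCoeff_zero
  · rw [curvCoeff_succ, d_dLetter_x, map_zero, smul_zero]

/-- A path of Maurer–Cartan elements from `a` to `b`. -/
noncomputable def path (τ : K) : TensorSeries K := summation fun n => τ ^ n • pathCoeff K n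

theorem path_mem_lie (τ : K) : path τ ∈ lie K (-1) :=
  summation_mem_lie fun n => Submodule.smul_mem _ _ (pathCoeff_mem_lie n)

theorem path_sub_mem_tail (τ : K) (N : ℕ) :
    path τ - ∑ n ∈ Finset.range N, τ ^ n • pathCoeff K n ∈ tail K N :=
  summation_sub_mem_tail (fun n => Submodule.smul_mem _ _ (pathCoeff_mem_tail n)) N

theorem path_zero : path (0 : K) = letter K .a := by
  refine sub_eq_zero.1 (eq_zero_of_forall_mem_tail fun N => tail_anti (Nat.le_succ N) ?_)
  have := path_sub_mem_tail (0 : K) (N + 1)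
  rw [Finset.sum_range_succ'] at this
  simpa [pathCoeff] using this

theorem path_one : path (1 : K) = letter K .b := by
  refine sub_eq_zero.1 (eq_zero_of_forall_mem_tail fun N => ?_)
  have h1 := tail_anti (Nat.le_succ N) (path_sub_mem_tail (1 : K) (N + 1))
  simp only [one_pow, one_smul] at h1
  simpa using Submodule.add_mem _ h1 (sum_pathCoeff_sub_mem_tail (K := K) N)

/-- The Taylor coefficients of the curvature all vanish, and truncating the path at order `N`
changes each side only in the tail `N`. -/
theorem d_path (τ : K) : d K (path τ) = -(path τ * path τ) := by
  refine eq_neg_of_add_eq_zero_left (eq_zero_of_forall_mem_tail fun N => ?_)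
  have hc : ∀ n, τ ^ n • pathCoeff K n ∈ tail K n :=
    fun n => Submodule.smul_mem _ _ (pathCoeff_mem_tail n)
  set z := ∑ n ∈ Finset.range N, τ ^ n • pathCoeff K n with hz
  have h2 : path τ - z ∈ tail K N := path_sub_mem_tail τ N
  have h6 := sum_mul_sum_sub_mem_tail hc N
  have h7 : d K z + ∑ n ∈ Finset.range N, ∑ ij ∈ Finset.HasAntidiagonal.antidiagonal n,
      (τ ^ ij.1 • pathCoeff K ij.1) * (τ ^ ij.2 • pathCoeff K ij.2) = 0 := by
    rw [hz, map_sum, ← Finset.sum_add_distrib]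
    refine Finset.sum_eq_zero fun n _ => ?_
    have : ∑ ij ∈ Finset.HasAntidiagonal.antidiagonal n,
        (τ ^ ij.1 • pathCoeff K ij.1) * (τ ^ ij.2 • pathCoeff K ij.2) =
        τ ^ n • ∑ ij ∈ Finset.HasAntidiagonal.antidiagonal n,
          pathCoeff K ij.1 * pathCoeff K ij.2 := by
      rw [Finset.smul_sum]
      refine Finset.sum_congr rfl fun ij hij => ?_
      rw [Finset.HasAntidiagonal.mem_antidiagonal] at hij
      rw [smul_mul_smul_comm, ← pow_add, hij]
    rw [this, map_smul, ← smul_add]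
    change τ ^ n • curvCoeff K n = 0
    rw [curvCoeff_eq_zero, smul_zero]
  have h4 := d_mem_tail h2 dLetter_nil
  have h5 := Submodule.add_mem _ (mul_mem_tail_left (path τ) h2) (mul_mem_tail_right z h2)
  convert Submodule.add_mem _ (Submodule.add_mem _ h4 h5) h6 using 1
  rw [eq_neg_of_add_eq_zero_right h7, map_sub]
  noncomm_ring

variable (K) in
/-- The differential, twisted by the path, of `x`: the velocity of the path. -/
noncomputable def pathVelocity (τ : K) : TensorSeries K := dLetter K .x - ad K (path τ)

theorem pathVelocity_mem_lie (τ : K) : pathVelocity K τ ∈ lie K (-1) :=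
  Submodule.sub_mem _ dLetter_x_mem_lie (ad_mem_lie (path_mem_lie τ))

/-- Says that `pathVelocity` is the derivative of the path, by the differential equation. The
truncation at `N + 2` is more than enough here; it allows a common polynomial curve to approximate
the path and its derivative. -/
theorem pathVelocity_sub_mem_tail (τ : K) (N : ℕ) :
    pathVelocity K τ - ∑ n ∈ Finset.range (N + 2), ((n : K) * τ ^ (n - 1)) • pathCoeff K n ∈
      tail K N := by
  rw [Finset.sum_range_succ']
  have h1 : ∀ n ∈ Finset.range (N + 1),
      (((n + 1 : ℕ) : K) * τ ^ (n + 1 - 1)) • pathCoeff K (n + 1) =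
        (if n = 0 then dLetter K .x else 0) - ad K (τ ^ n • pathCoeff K n) := by
    intro n _
    rw [mul_comm, mul_smul, succ_smul_pathCoeff_succ, smul_sub, map_smul, Nat.add_sub_cancel]
    congr 1
    split_ifs with h
    · rw [h, pow_zero, one_smul]
    · rw [smul_zero]
  rw [Finset.sum_congr rfl h1, Finset.sum_sub_distrib, Finset.sum_ite_eq', if_pos (by simp),
    ← map_sum]
  have h2 := tail_anti (by omega : N ≤ N + 1 + 1) (ad_mem_tail (path_sub_mem_tail τ (N + 1)))
  convert Submodule.neg_mem _ h2 using 1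
  rw [map_sub, pathVelocity]
  simp only [Nat.cast_zero, zero_mul, zero_smul]
  abel

end TensorSeries

end BernoulliPath

/-! ### Values at `1` of power series which are polynomials -/

section HasEval

variable {K : Type u} [Field K]

/-- `S` is a polynomial with value `c` at `1`. -/
def HasEval (S : PowerSeries K) (c : K) : Prop :=
  ∃ P : Polynomial K, (P : PowerSeries K) = S ∧ P.eval 1 = c

theorem HasEval.unique {S : PowerSeries K} {c c' : K} (h : HasEval S c) (h' : HasEval S c') :
    c = c' := by
  obtain ⟨P, rfl, rfl⟩ := h
  obtain ⟨P', h, rfl⟩ := h'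
  rw [Polynomial.coe_injective K h]

theorem HasEval.add {S S' : PowerSeries K} {c c' : K} (h : HasEval S c) (h' : HasEval S' c') :
    HasEval (S + S') (c + c') := by
  obtain ⟨P, rfl, rfl⟩ := h
  obtain ⟨P', rfl, rfl⟩ := h'
  exact ⟨P + P', by simp, by simp⟩

theorem HasEval.mul {S S' : PowerSeries K} {c c' : K} (h : HasEval S c) (h' : HasEval S' c') :
    HasEval (S * S') (c * c') := by
  obtain ⟨P, rfl, rfl⟩ := h
  obtain ⟨P', rfl, rfl⟩ := h'
  exact ⟨P * P', by simp, by simp⟩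

theorem HasEval.smul {S : PowerSeries K} {c : K} (a : K) (h : HasEval S c) :
    HasEval (a • S) (a * c) := by
  obtain ⟨P, rfl, rfl⟩ := h
  exact ⟨a • P, by rw [Polynomial.coe_smul], by simp⟩

theorem hasEval_X : HasEval (PowerSeries.X : PowerSeries K) 1 :=
  ⟨Polynomial.X, by simp, by simp⟩

theorem hasEval_zero : HasEval (0 : PowerSeries K) 0 := ⟨0, by simp, by simp⟩

theorem hasEval_one : HasEval (1 : PowerSeries K) 1 := ⟨1, by simp, by simp⟩

theorem hasEval_mk {c : ℕ → K} {N : ℕ} (h : ∀ n, N ≤ n → c n = 0) :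
    HasEval (PowerSeries.mk c) (∑ n ∈ Finset.range N, c n) := by
  refine ⟨∑ n ∈ Finset.range N, Polynomial.monomial n (c n), ?_, ?_⟩
  · ext m
    rw [Polynomial.coeff_coe, Polynomial.finsetSum_coeff, PowerSeries.coeff_mk]
    simp only [Polynomial.coeff_monomial, Finset.sum_ite_eq', Finset.mem_range]
    split_ifs with hm
    · rfl
    · exact (h m (not_lt.1 hm)).symm
  · rw [Polynomial.eval_finsetSum]
    simp

/-- The index `i` will count copies of the path inside one bracket. As brackets of arity three and
more vanish, only three rows of the double series survive. -/
theorem mk_sum_antidiagonal (c : ℕ → ℕ → K) (h : ∀ i j, 3 ≤ i → c i j = 0) :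
    PowerSeries.mk (fun n => ∑ ij ∈ Finset.HasAntidiagonal.antidiagonal n, c ij.1 ij.2) =
      PowerSeries.mk (c 0) + (PowerSeries.X * PowerSeries.mk (c 1) +
        PowerSeries.X * (PowerSeries.X * PowerSeries.mk (c 2))) := by
  ext n
  rw [map_add, map_add, PowerSeries.coeff_mk]
  rcases n with _ | _ | n
  · simp
  · rw [PowerSeries.coeff_succ_X_mul, PowerSeries.coeff_succ_X_mul, Finset.Nat.sum_antidiagonal_succ]
    simp
  · rw [PowerSeries.coeff_succ_X_mul, PowerSeries.coeff_succ_X_mul, PowerSeries.coeff_succ_X_mul,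
      Finset.Nat.sum_antidiagonal_succ, Finset.Nat.sum_antidiagonal_succ,
      PowerSeries.coeff_mk, PowerSeries.coeff_mk, PowerSeries.coeff_mk]
    congr 2
    rcases n with _ | n
    · simp
    · rw [Finset.Nat.sum_antidiagonal_succ, Finset.sum_eq_zero, add_zero]
      intro ij _
      exact h _ _ (by omega)

end HasEval

/-! ### Generating functions with one distinguished first letter -/

section EgfAfter

variable {K : Type u} [Field K] {X : Type*} {deg : X → ℤ}

/-- Removal of a first letter. -/
def ShuffleAlgebra.after (y : X) : ShuffleAlgebra K deg →ₗ[K] ShuffleAlgebra K deg where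
  toFun F l := F (y :: l)
  map_add' _ _ := rfl
  map_smul' _ _ := rfl

theorem ShuffleAlgebra.after_apply (y : X) (F : ShuffleAlgebra K deg) (l : List X) :
    ShuffleAlgebra.after y F l = F (y :: l) := rfl

variable [CharZero K]

theorem inv_factorial_mul_shuffleSum {z : X} (hz : deg z = 0) (n : ℕ) (H : List X → List X → K) :
    ((n ! : ℕ) : K)⁻¹ * shuffleSum deg (List.replicate n z) H =
      ∑ ij ∈ Finset.HasAntidiagonal.antidiagonal n, ((ij.1 ! : ℕ) : K)⁻¹ * (((ij.2 ! : ℕ) : K)⁻¹ *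
        H (List.replicate ij.1 z) (List.replicate ij.2 z)) := by
  rw [shuffleSum_replicate hz, Finset.mul_sum]
  refine Finset.sum_congr rfl fun ij hij => ?_
  rw [Finset.HasAntidiagonal.mem_antidiagonal] at hij
  have h := Nat.add_choose_mul_factorial_mul_factorial ij.1 ij.2
  rw [hij, ← Nat.choose_symm_of_eq_add hij.symm] at h
  have h' : ((n.choose ij.1 : ℕ) : K) * (ij.1 ! : ℕ) * (ij.2 ! : ℕ) = (n ! : ℕ) := by
    exact_mod_cast h
  rw [← h']
  have h1 : ((ij.1 ! : ℕ) : K) ≠ 0 := by exact_mod_cast ij.1.factorial_ne_zero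
  have h2 : ((ij.2 ! : ℕ) : K) ≠ 0 := by exact_mod_cast ij.2.factorial_ne_zero
  have h3 : ((n.choose ij.1 : ℕ) : K) ≠ 0 := by
    exact_mod_cast (Nat.choose_pos (by omega)).ne'
  field_simp

/-- The distinguished letter goes to one of the two factors, and passing over letters of degree zero
is free of signs. Hence the pair formed by the generating functions without and with `y` multiplies
like a dual number. -/
theorem egf_after_mul {z : X} (hz : deg z = 0) (y : X) (F F' : ShuffleAlgebra K deg) :
    egf hz (ShuffleAlgebra.after y (F * F')) =
      egf hz (ShuffleAlgebra.after y F) * egf hz F' +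
        egf hz F * egf hz (ShuffleAlgebra.after y F') := by
  rw [← map_mul, ← map_mul, add_comm, ← map_add]
  ext n
  rw [coeff_egf, coeff_egf, ShuffleAlgebra.after_apply, ShuffleAlgebra.mul_cons,
    ShuffleAlgebra.add_apply]
  congr 2
  rw [ShuffleAlgebra.mul_apply, shuffleSum_replicate hz, shuffleSum_replicate hz]
  refine Finset.sum_congr rfl fun ij _ => ?_
  rw [listDegree_replicate hz]
  simp [ShuffleAlgebra.after_apply]

end EgfAfter

/-! ### Polynomial curves -/

section Curves

variable {K : Type u} [Field K] {E : Type v} [AddCommGroup E] [Module K E]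

theorem multilinear_apply_sum {n N : ℕ} (f : MultilinearMap K (fun _ : Fin n => E) K) (ζ : ℕ → E)
    (c : Fin n → ℕ → K) :
    (f fun i => ∑ r ∈ Finset.range N, c i r • ζ r) =
      ∑ r ∈ Fintype.piFinset fun _ : Fin n => Finset.range N, (∏ i, c i (r i)) *
        f fun i => ζ (r i) := by
  classical
  rw [MultilinearMap.map_sum_finset]
  exact Finset.sum_congr rfl fun r _ => MultilinearMap.map_smul_univ _ _ _

theorem exists_polynomial_of_curve {n : ℕ} (N : ℕ) (f : MultilinearMap K (fun _ : Fin n => E) K)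
    (ζ : ℕ → E) : ∃ P : Polynomial K, ∀ τ : K,
      P.eval τ = f (fun _ => ∑ r ∈ Finset.range N, τ ^ r • ζ r) ∧
      P.derivative.eval τ = ∑ i, f (Function.update (fun _ => ∑ r ∈ Finset.range N, τ ^ r • ζ r) i
        (∑ r ∈ Finset.range N, ((r : K) * τ ^ (r - 1)) • ζ r)) := by
  classical
  refine ⟨∑ r ∈ Fintype.piFinset fun _ : Fin n => Finset.range N,
    (∏ i, Polynomial.X ^ r i) * Polynomial.C (f fun i => ζ (r i)), fun τ => ⟨?_, ?_⟩⟩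
  · rw [multilinear_apply_sum f ζ fun _ r => τ ^ r, Polynomial.eval_finsetSum]
    refine Finset.sum_congr rfl fun r _ => ?_
    rw [Polynomial.eval_mul, Polynomial.eval_prod, Polynomial.eval_C]
    simp
  · have h : ∀ i : Fin n, (Function.update (fun _ => ∑ r ∈ Finset.range N, τ ^ r • ζ r) i
        (∑ r ∈ Finset.range N, ((r : K) * τ ^ (r - 1)) • ζ r) : Fin n → E) =
        fun j => ∑ r ∈ Finset.range N,
          (Function.update (fun _ r => τ ^ r) i (fun r => (r : K) * τ ^ (r - 1)) :
            Fin n → ℕ → K) j r • ζ r := by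
      intro i
      funext j
      by_cases hj : j = i
      · subst hj; simp
      · simp [Function.update_of_ne hj]
    simp only [h, multilinear_apply_sum]
    rw [Finset.sum_comm, Polynomial.derivative_sum, Polynomial.eval_finsetSum]
    refine Finset.sum_congr rfl fun r _ => ?_
    rw [Polynomial.derivative_mul, Polynomial.derivative_C, mul_zero, add_zero,
      Polynomial.eval_mul, Polynomial.eval_C, Polynomial.derivative_prod_finset, Polynomial.eval_finsetSum,
      Finset.sum_mul]
    refine Finset.sum_congr rfl fun i _ => ?_
    congr 1
    rw [Polynomial.eval_mul, Polynomial.eval_prod, ← Finset.mul_prod_erase _ _ (Finset.mem_univ i),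
      Function.update_self, mul_comm]
    congr 1
    · rw [Polynomial.derivative_X_pow]; simp
    · refine Finset.prod_congr rfl fun j hj => ?_
      rw [Function.update_of_ne (Finset.ne_of_mem_erase hj)]
      simp

end Curves

/-! ### Polynomial forms on the interval -/

section Interval

variable {K : Type u} [Field K]

theorem GradedDiffAlgebra.IsCDGA.mul_self_eq_zero [CharZero K] {C : GradedDiffAlgebra K}
    (hC : C.IsCDGA) {a : C.carrier} (ha : a ∈ C.gr 1) : a * a = 0 := by
  have h := hC.mul_comm 1 1 a a ha ha
  rw [mul_one, zpow_one, neg_one_smul, eq_neg_iff_add_eq_zero, ← two_smul K] at h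
  exact (smul_eq_zero.1 h).resolve_left two_ne_zero

theorem GradedDiffAlgebra.IsCDGA.commute_of_mem_zero {C : GradedDiffAlgebra K}
    (hC : C.IsCDGA) {a b : C.carrier} {n : ℤ} (ha : a ∈ C.gr n) (hb : b ∈ C.gr 0) :
    a * b = b * a := by
  have h := hC.mul_comm n 0 a b ha hb
  rwa [mul_zero, zpow_zero, one_smul] at h

theorem GradedDiffAlgebra.IsCDGA.pow_mem {C : GradedDiffAlgebra K}
    (hC : C.IsCDGA) {t : C.carrier} (ht : t ∈ C.gr 0) (n : ℕ) : t ^ n ∈ C.gr 0 := by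
  induction n with
  | zero => rw [pow_zero]; exact hC.one_mem
  | succ n ih => rw [pow_succ]; simpa using hC.mul_mem _ _ _ _ ih ht

theorem GradedDiffAlgebra.IsCDGA.aeval_mem {C : GradedDiffAlgebra K}
    (hC : C.IsCDGA) {t : C.carrier} (ht : t ∈ C.gr 0) (P : Polynomial K) :
    Polynomial.aeval t P ∈ C.gr 0 := by
  rw [Polynomial.aeval_eq_sum_range]
  exact Submodule.sum_mem _ fun n _ => Submodule.smul_mem _ _ (hC.pow_mem ht n)

theorem GradedDiffAlgebra.IsCDGA.d_pow {C : GradedDiffAlgebra K}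
    (hC : C.IsCDGA) {t : C.carrier} (ht : t ∈ C.gr 0) (n : ℕ) :
    C.d (t ^ n) = (n : K) • (t ^ (n - 1) * C.d t) := by
  induction n with
  | zero => simp [hC.d_one]
  | succ n ih =>
    rw [pow_succ, hC.leibniz 0 _ _ (hC.pow_mem ht n), ih, smul_mul_assoc, mul_assoc,
      hC.commute_of_mem_zero (hC.d_mem 0 t ht) ht, ← mul_assoc, zpow_zero, one_smul,
      Nat.add_sub_cancel]
    rcases n with _ | n
    · simp
    · rw [Nat.add_sub_cancel, ← pow_succ, Nat.cast_succ (n + 1), add_smul, one_smul]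

theorem GradedDiffAlgebra.IsCDGA.d_aeval {C : GradedDiffAlgebra K}
    (hC : C.IsCDGA) {t : C.carrier} (ht : t ∈ C.gr 0) (P : Polynomial K) :
    C.d (Polynomial.aeval t P) = Polynomial.aeval t P.derivative * C.d t := by
  induction P using Polynomial.induction_on' with
  | add P Q hP hQ => rw [map_add, map_add, hP, hQ, Polynomial.derivative_add, map_add, add_mul]
  | monomial n a =>
    rw [Polynomial.derivative_monomial, Polynomial.aeval_monomial, Polynomial.aeval_monomial,
      ← Algebra.smul_def, ← Algebra.smul_def, map_smul, hC.d_pow ht, mul_smul, smul_mul_assoc,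
      smul_mul_assoc]

theorem exists_interval_form [CharZero K] (c : (intervalDGA K).carrier) :
    ∃ P Q : Polynomial K, c = Polynomial.aeval (intervalT K) P +
      Polynomial.aeval (intervalT K) Q * intervalDT K := by
  induction c using induction with
  | one => exact ⟨1, 0, by simp⟩
  | add a b ha hb =>
    obtain ⟨P, Q, rfl⟩ := ha
    obtain ⟨P', Q', rfl⟩ := hb
    exact ⟨P + P', Q + Q', by rw [map_add, map_add, add_mul]; abel⟩
  | smul c a ha =>
    obtain ⟨P, Q, rfl⟩ := ha
    exact ⟨c • P, c • Q, by rw [map_smul, map_smul, smul_add, smul_mul_assoc]⟩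
  | mul_gen a i ha =>
    obtain ⟨P, Q, rfl⟩ := ha
    rcases i with i | i | i
    · exact i.elim
    · refine ⟨P * Polynomial.X, Q * Polynomial.X, ?_⟩
      change _ * intervalT K = _
      rw [map_mul, map_mul, Polynomial.aeval_X, add_mul, mul_assoc, mul_assoc,
        intervalDGA_isCDGA.commute_of_mem_zero intervalDT_mem intervalT_mem]
    · refine ⟨0, P, ?_⟩
      change _ * intervalDT K = _
      rw [add_mul, mul_assoc _ _ (intervalDT K),
        intervalDGA_isCDGA.mul_self_eq_zero intervalDT_mem, mul_zero, add_zero, map_zero,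
        zero_add]

/-- Evaluation of a form at a point. -/
noncomputable def formEval (τ : K) : (intervalDGA K).carrier →ₐ[K] DualNumber K :=
  liftOf _ (Sum.elim Empty.elim (Sum.elim (fun _ => TrivSqZeroExt.inl τ) fun _ => DualNumber.eps))
    fun i j => by
      rcases i with i | i | i
      · exact i.elim
      · rcases j with j | j | j
        · exact j.elim
        · simp [cylDegree]
        · simp [cylDegree, mul_comm]
      · rcases j with j | j | j
        · exact j.elim
        · simp [cylDegree, mul_comm]
        · simp [cylDegree]

theorem formEval_T (τ : K) : formEval τ (intervalT K) = TrivSqZeroExt.inl τ := liftOf_gen _ _ _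

theorem formEval_DT (τ : K) : formEval τ (intervalDT K) = DualNumber.eps := liftOf_gen _ _ _

theorem formEval_aeval (τ : K) (P : Polynomial K) :
    formEval τ (Polynomial.aeval (intervalT K) P) = TrivSqZeroExt.inl (P.eval τ) := by
  rw [← Polynomial.aeval_algHom_apply, formEval_T]
  have : (TrivSqZeroExt.inl τ : DualNumber K) = algebraMap K (DualNumber K) τ := rfl
  rw [this, Polynomial.aeval_algebraMap_apply, Polynomial.coe_aeval_eq_eval]
  rfl

theorem intervalEval_aeval (τ : K) (P : Polynomial K) :
    intervalEval τ (Polynomial.aeval (intervalT K) P) = P.eval τ := by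
  rw [← Polynomial.aeval_algHom_apply, intervalEval_T, Polynomial.coe_aeval_eq_eval]

/-- A form `P + Q dt` is determined by the numbers `P(τ)` and `Q(τ)`, as the field is infinite.
Identities between forms can therefore be checked at one point of the path at a time. -/
theorem ext_formEval [CharZero K] {c c' : (intervalDGA K).carrier}
    (h : ∀ τ, formEval τ c = formEval τ c') : c = c' := by
  rw [← sub_eq_zero]
  have h' : ∀ τ, formEval τ (c - c') = 0 := fun τ => by rw [map_sub, h, sub_self]
  obtain ⟨P, Q, hPQ⟩ := exists_interval_form (c - c')
  rw [hPQ] at h' ⊢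
  have hP : P = 0 := Polynomial.funext fun τ => by
    have := congrArg TrivSqZeroExt.fst (h' τ)
    rw [map_add, map_mul, formEval_aeval, formEval_aeval, formEval_DT] at this
    simpa using this
  have hQ : Q = 0 := Polynomial.funext fun τ => by
    have := congrArg TrivSqZeroExt.snd (h' τ)
    rw [map_add, map_mul, formEval_aeval, formEval_aeval, formEval_DT] at this
    simpa using this
  simp [hP, hQ]

theorem d_aeval_intervalT [CharZero K] (P : Polynomial K) :
    (intervalDGA K).d (Polynomial.aeval (intervalT K) P) =
      Polynomial.aeval (intervalT K) P.derivative * intervalDT K := by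
  rw [intervalDGA_isCDGA.d_aeval intervalT_mem, d_intervalT]

end Interval

/-! ### Commutators in the complete free Lie algebra -/

section Commutator

variable {K : Type u} [Field K]

namespace TensorSeries

variable (K) in
/-- The graded commutator as a bilinear map. -/
noncomputable def commBilin : TensorSeries K →ₗ[K] TensorSeries K →ₗ[K] TensorSeries K :=
  LinearMap.mk₂ K (fun f g => commutator f g)
    (fun f f' g => by
      ext W
      change commutator (fun W => f W + f' W) g W = commutator f g W + commutator f' g W
      simp only [commutator]
      rw [← Finset.sum_add_distrib]
      exact Finset.sum_congr rfl fun _ _ => by ring)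
    (fun c f g => by
      ext W
      change commutator (fun W => c * f W) g W = c * commutator f g W
      simp only [commutator]
      rw [Finset.mul_sum]
      exact Finset.sum_congr rfl fun _ _ => by ring)
    (fun f g g' => by
      ext W
      change commutator f (fun W => g W + g' W) W = commutator f g W + commutator f g' W
      simp only [commutator]
      rw [← Finset.sum_add_distrib]
      exact Finset.sum_congr rfl fun _ _ => by ring)
    (fun c f g => by
      ext W
      change commutator f (fun W => c * g W) W = c * commutator f g W
      simp only [commutator]
      rw [Finset.mul_sum]
      exact Finset.sum_congr rfl fun _ _ => by ring)

theorem commBilin_apply (f g : TensorSeries K) (W : List Letter) : commBilin K f g W =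
    ∑ i ∈ Finset.range (W.length + 1), (f (W.take i) * g (W.drop i) -
      (-1) ^ (wordDegree (W.take i) * wordDegree (W.drop i)) * (g (W.take i) * f (W.drop i))) := rfl

theorem sum_antidiagonal_ite (n k : ℕ) (a : K) : ∑ ij ∈ Finset.HasAntidiagonal.antidiagonal n,
    (if k = ij.1 then (if n - k = ij.2 then a else 0) else 0) = if k ≤ n then a else 0 := by
  split_ifs with hk
  · rw [Finset.sum_eq_single (k, n - k)]
    · simp
    · rintro ⟨i, j⟩ _ hne
      by_cases h : k = i
      · rw [if_pos h, if_neg]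
        intro h'
        subst h
        exact hne (Prod.ext rfl h'.symm)
      · rw [if_neg h]
    · intro h
      exact absurd (Finset.HasAntidiagonal.mem_antidiagonal.2 (by simp; omega)) h
  · refine Finset.sum_eq_zero fun ij hij => ?_
    rw [Finset.HasAntidiagonal.mem_antidiagonal] at hij
    rw [if_neg (by omega)]

theorem part_commBilin (n : ℕ) (f g : TensorSeries K) :
    part n (commBilin K f g) = ∑ ij ∈ Finset.HasAntidiagonal.antidiagonal n,
      commBilin K (part ij.1 f) (part ij.2 g) := by
  ext W
  rw [part_apply, sum_apply']
  simp only [commBilin_apply]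
  rw [Finset.sum_comm]
  split_ifs with h
  · refine Finset.sum_congr rfl fun k hk => ?_
    rw [Finset.mem_range] at hk
    have hk' : k ≤ n := by omega
    rw [Finset.sum_sub_distrib]
    have h1 : (W.take k).length = k := by rw [List.length_take]; omega
    have h2 : (W.drop k).length = n - k := by rw [List.length_drop, h]
    congr 1
    · have := sum_antidiagonal_ite n k (f (W.take k) * g (W.drop k))
      rw [if_pos hk'] at this
      rw [← this]
      refine Finset.sum_congr rfl fun ij _ => ?_
      rw [part_apply, part_apply, h1, h2]
      split_ifs <;> simp
    · have := sum_antidiagonal_ite n (n - k) ((-1) ^ (wordDegree (W.take k) *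
        wordDegree (W.drop k)) * (g (W.take k) * f (W.drop k)))
      rw [if_pos (Nat.sub_le n k), Nat.sub_sub_self hk'] at this
      rw [← this]
      refine Finset.sum_congr rfl fun ij _ => ?_
      rw [part_apply, part_apply, h1, h2]
      split_ifs <;> simp
  · symm
    refine Finset.sum_eq_zero fun k hk => Finset.sum_eq_zero fun ij hij => ?_
    rw [Finset.HasAntidiagonal.mem_antidiagonal] at hij
    rw [Finset.mem_range] at hk
    have h1 : (W.take k).length + (W.drop k).length = W.length := by
      rw [← List.length_append, List.take_append_drop]
    simp only [part_apply]
    split_ifs <;> first | omega | simp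

theorem commBilin_mem_lie {p q : ℤ} {f g : TensorSeries K} (hf : f ∈ lie K p) (hg : g ∈ lie K q) :
    commBilin K f g ∈ lie K (p + q) := by
  rw [mem_lie] at hf hg ⊢
  refine ⟨?_, fun n => ?_⟩
  · have h : commBilin K f g = f * g - (-1 : K) ^ (p * q) • (g * f) :=
      commutator_of_isHomogeneous hf.1 hg.1
    rw [h]
    refine (hf.1.mul hg.1).sub (IsHomogeneous.smul _ ?_)
    rw [add_comm]
    exact hg.1.mul hf.1
  · rw [part_commBilin]
    refine Submodule.sum_mem _ fun ij hij => ?_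
    rw [Finset.HasAntidiagonal.mem_antidiagonal] at hij
    have h := Submodule.apply_mem_map₂ (commBilin K) (hf.2 ij.1) (hg.2 ij.2)
    rw [Submodule.map₂_span_span] at h
    refine Submodule.span_mono ?_ h
    rintro _ ⟨f', hf', g', hg', rfl⟩
    exact hij ▸ IsLieMonomial.bracket hf' hg'

/-- By flatness `∂z = -½[z, z]`, which is visibly a Lie series; no general statement about the
differential of Lie series is needed. -/
theorem d_path_mem_lie [CharZero K] (τ : K) : d K (path τ) ∈ lie K (-2) := by
  have h1 := commBilin_mem_lie (path_mem_lie τ) (path_mem_lie τ)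
  have h2 : commBilin K (path τ) (path τ) = -((2 : K) • d K (path τ)) := by
    refine (commutator_of_isHomogeneous (mem_lie.1 (path_mem_lie τ)).1
      (mem_lie.1 (path_mem_lie τ)).1).trans ?_
    rw [d_path, smul_neg, neg_neg, two_smul]
    simp
    rfl
  rw [h2] at h1
  have h3 := Submodule.smul_mem _ (-(2 : K)⁻¹) h1
  rw [smul_neg, neg_smul, neg_neg, smul_smul, inv_mul_cancel₀ two_ne_zero, one_smul] at h3
  exact h3

end TensorSeries

end Commutator

/-! ### Morphisms from the Lawrence–Sullivan construction -/

section FromLawrenceSullivan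

open TensorSeries

variable {K : Type u} [Field K] {E : Type v} [AddCommGroup E] [Module K E]

/-- Vanishing of a morphism on many arguments and on tails, for values of degree between `-2`
and `0`. -/
def VanishesBeyond {L : MildLInfinityAlgebra K E}
    (f : LInfinityMorphism (lawrenceSullivan K) L.toGradedBrackets) (N : ℕ) : Prop :=
  ∀ (k : ℕ) (p : Fin k → ℤ) (x : Fin k → TensorSeries K), (∀ i, x i ∈ lie K (p i)) →
    -2 ≤ ∑ i, p i + k - 1 → ∑ i, p i + k - 1 ≤ 0 → (N ≤ k ∨ ∃ i, x i ∈ tail K N) → f.map k x = 0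

variable {L : MildLInfinityAlgebra K E}
  {f : LInfinityMorphism (lawrenceSullivan K) L.toGradedBrackets}

/-- Mildness gives one bound for each degree of the values. The homotopy involves only the degree
`-1` of Maurer–Cartan elements, the degree `-2` of curvatures, and the degree `0` reached with `x`
as an argument, so a maximum of three bounds is uniform. -/
theorem exists_vanishesBeyond
    (hf : LocallyFinite (lawrenceSullivan K) (seriesTail K) L.toGradedBrackets f.map) :
    ∃ N, VanishesBeyond f N := by
  choose N hN using hf
  refine ⟨max (N (-2)) (max (N (-1)) (N 0)), fun k p x hx h1 h2 h => ?_⟩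
  have hdeg := f.map_deg k p x hx
  set n := ∑ i, p i + (k : ℤ) - 1 with hn
  have hle : N n ≤ max (N (-2)) (max (N (-1)) (N 0)) := by
    obtain h | h | h : n = -2 ∨ n = -1 ∨ n = 0 := by omega
    all_goals rw [h]; simp
  refine hN n k p x hx hdeg ?_
  rcases h with h | ⟨i, hi⟩
  · exact Or.inl (hle.trans h)
  · exact Or.inr ⟨i, tail_anti hle hi⟩

/-- The arguments are replaced one at a time, each difference lying in the tail. In this way series
are exchanged for finite truncations. -/
theorem VanishesBeyond.congr {N : ℕ} (hN : VanishesBeyond f N) {k : ℕ} {p : Fin k → ℤ}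
    {x y : Fin k → TensorSeries K} (hx : ∀ i, x i ∈ lie K (p i)) (hy : ∀ i, y i ∈ lie K (p i))
    (h1 : -2 ≤ ∑ i, p i + k - 1) (h2 : ∑ i, p i + k - 1 ≤ 0) (h : ∀ i, x i - y i ∈ tail K N) :
    f.map k x = f.map k y := by
  classical
  let F : MultilinearMap K (fun _ : Fin k => TensorSeries K) E := f.map k
  have key : ∀ s : Finset (Fin k), F (s.piecewise x y) = F y := by
    intro s
    induction s using Finset.induction_on with
    | empty => simp
    | insert j s hj ih =>
      have hmem : ∀ i, s.piecewise x y i ∈ lie K (p i) := fun i => by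
        by_cases hi : i ∈ s
        · rw [Finset.piecewise_eq_of_mem _ _ _ hi]; exact hx i
        · rw [Finset.piecewise_eq_of_notMem _ _ _ hi]; exact hy i
      rw [Finset.piecewise_insert, ← ih, ← sub_eq_zero]
      have h3 : s.piecewise x y = Function.update (s.piecewise x y) j (y j) := by
        rw [← Finset.piecewise_eq_of_notMem s x y hj, Function.update_eq_self]
      conv_lhs => rw [h3]
      rw [Function.update_idem, ← MultilinearMap.map_update_sub]
      refine hN k p _ (fun i => ?_) h1 h2 (Or.inr ⟨j, ?_⟩)
      · by_cases hi : i = j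
        · subst hi
          rw [Function.update_self]
          exact Submodule.sub_mem _ (hx i) (hy i)
        · rw [Function.update_of_ne hi]; exact hmem i
      · rw [Function.update_self]; exact h j
  have := key Finset.univ
  rwa [Finset.piecewise_univ] at this

theorem evalList_cons_eq {F : Type w} [AddCommGroup F] [Module K F]
    (g : (k : ℕ) → MultilinearMap K (fun _ : Fin k => E) F) (y : E) (l : List E) :
    evalList g (y :: l) = (g (l.length + 1)).curryLeft y l.get := by
  have : evalList g (y :: List.ofFn l.get) = (g (l.length + 1)).curryLeft y l.get := by
    rw [evalList_cons_ofFn]; rfl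
  rwa [List.ofFn_get] at this

theorem VanishesBeyond.evalList {N : ℕ} (hN : VanishesBeyond f N)
    (l : List (lawrenceSullivan K).Homog) (h1 : -1 ≤ listDegree (lawrenceSullivan K).sdeg l)
    (h2 : listDegree (lawrenceSullivan K).sdeg l ≤ 1) (hl : N ≤ l.length) :
    evalList f.map (l.map (lawrenceSullivan K).vec) = 0 := by
  obtain ⟨n, x, rfl⟩ : ∃ n, ∃ x : Fin n → (lawrenceSullivan K).Homog, l = List.ofFn x :=
    ⟨_, l.get, (List.ofFn_get l).symm⟩
  rw [List.map_ofFn, evalList_ofFn]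
  rw [List.length_ofFn] at hl
  have h3 : listDegree (lawrenceSullivan K).sdeg (List.ofFn x) = ∑ i, (x i).1 + n := by
    simp only [listDegree, List.map_ofFn, List.sum_ofFn, Function.comp_apply, GradedBrackets.sdeg,
      Finset.sum_add_distrib]
    simp
  rw [h3] at h1 h2
  exact hN n (fun i => (x i).1) (fun i => (lawrenceSullivan K).vec (x i)) (fun i => (x i).2.2) (by omega) (by omega)
    (Or.inl hl)

end FromLawrenceSullivan

/-! ### Twisting by the path -/

section Twist

open TensorSeries

/-- The underlying function on words. -/
def TensorSeries.toSeries {K : Type u} (f : TensorSeries K) : Series K := f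

variable {K : Type u} [Field K] {E : Type v} [AddCommGroup E] [Module K E]
  {L : MildLInfinityAlgebra K E}
  (f : LInfinityMorphism (lawrenceSullivan K) L.toGradedBrackets) (m : L.Index)

theorem evalList_lawrenceSullivan_one (y : TensorSeries K) :
    evalList (lawrenceSullivan K).br [y.toSeries] = (d K y).toSeries := rfl

theorem evalList_lawrenceSullivan_two (y z : Series K) :
    evalList (lawrenceSullivan K).br [y, z] = -commutator (parity y) z := rfl

theorem evalList_lawrenceSullivan_three (x y z : Series K) (l : List (Series K)) :
    evalList (lawrenceSullivan K).br (x :: y :: z :: l) = 0 := rfl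

theorem evalList_lawrenceSullivan_nil : evalList (lawrenceSullivan K).br [] = 0 := rfl

/-- The exponential generating series of the values `f (w, z, …, z)`. -/
noncomputable def twistSeries (z : Series K) (w : List (Series K)) : PowerSeries K :=
  PowerSeries.mk fun j => ((j ! : ℕ) : K)⁻¹ *
    L.basis.coord m (evalList f.map (w ++ List.replicate j z))

/-- The value `∑ (1/j!) f (w, z, …, z)`. -/
noncomputable def twistValue (N : ℕ) (z : Series K) (w : List (Series K)) : K :=
  ∑ j ∈ Finset.range N, ((j ! : ℕ) : K)⁻¹ *
    L.basis.coord m (evalList f.map (w ++ List.replicate j z))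

variable {f}

theorem VanishesBeyond.hasEval_twistSeries {N : ℕ} (hN : VanishesBeyond f N)
    (z : (lawrenceSullivan K).Homog) (hz : (lawrenceSullivan K).sdeg z = 0)
    (w : List (lawrenceSullivan K).Homog) (h1 : -1 ≤ listDegree (lawrenceSullivan K).sdeg w)
    (h2 : listDegree (lawrenceSullivan K).sdeg w ≤ 1) :
    HasEval (twistSeries f m ((lawrenceSullivan K).vec z) (w.map (lawrenceSullivan K).vec))
      (twistValue f m N ((lawrenceSullivan K).vec z) (w.map (lawrenceSullivan K).vec)) := by
  refine hasEval_mk fun n hn => ?_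
  rw [← List.map_replicate, ← List.map_append, hN.evalList, map_zero, mul_zero]
  · rw [listDegree_append, listDegree_replicate hz, add_zero]; exact h1
  · rw [listDegree_append, listDegree_replicate hz, add_zero]; exact h2
  · simp; omega

variable (f)

theorem coord_evalList_zero_cons (l : List (Series K)) :
    L.basis.coord m (evalList f.map (0 :: l)) = 0 := by
  rw [evalList_cons_eq, map_zero]; simp

theorem coord_evalList_neg_cons (y : Series K) (l : List (Series K)) :
    L.basis.coord m (evalList f.map (-y :: l)) = -L.basis.coord m (evalList f.map (y :: l)) := by
  rw [evalList_cons_eq, evalList_cons_eq, map_neg, _root_.neg_apply, map_neg]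

theorem coord_evalList_smul_cons (c : K) (y : Series K) (l : List (Series K)) :
    L.basis.coord m (evalList f.map (c • y :: l)) =
      c * L.basis.coord m (evalList f.map (y :: l)) := by
  rw [evalList_cons_eq, evalList_cons_eq, map_smul, _root_.smul_apply, map_smul,
    smul_eq_mul]

theorem coord_evalList_sub_cons (y y' : Series K) (l : List (Series K)) :
    L.basis.coord m (evalList f.map ((y - y') :: l)) =
      L.basis.coord m (evalList f.map (y :: l)) - L.basis.coord m (evalList f.map (y' :: l)) := by
  rw [evalList_cons_eq, evalList_cons_eq, evalList_cons_eq, map_sub, _root_.sub_apply,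
    map_sub]

theorem twistValue_sub (N : ℕ) (z y y' : Series K) :
    twistValue f m N z [y - y'] = twistValue f m N z [y] - twistValue f m N z [y'] := by
  simp only [twistValue, ← Finset.sum_sub_distrib]
  refine Finset.sum_congr rfl fun j _ => ?_
  rw [List.singleton_append, coord_evalList_sub_cons, mul_sub]
  rfl

variable [CharZero K]

/-- A point of the path as a letter. -/
noncomputable def pathLetter (τ : K) : (lawrenceSullivan K).Homog := ⟨-1, path τ, path_mem_lie τ⟩

variable (K) in
/-- The generator `x` as a letter. -/
noncomputable def xLetter : (lawrenceSullivan K).Homog := ⟨0, letter K .x, letter_mem_lie .x⟩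

theorem sdeg_pathLetter (τ : K) : (lawrenceSullivan K).sdeg (pathLetter τ) = 0 := rfl

omit [CharZero K] in
theorem sdeg_xLetter : (lawrenceSullivan K).sdeg (xLetter K) = 1 := rfl

/-- On the suspension this bracket is `2 z²`, and `z² = -∂z` by flatness. -/
theorem bracket_path_path (τ : K) :
    evalList (lawrenceSullivan K).br [(path τ).toSeries, (path τ).toSeries] =
      -((2 : K) • (d K (path τ)).toSeries) := by
  have hh := (mem_lie.1 (path_mem_lie τ)).1
  have h1 : parity (path τ).toSeries = (-path τ).toSeries := by
    refine hh.par_eq.trans ?_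
    rw [zpow_neg_one, inv_neg_one, neg_one_smul]
    rfl
  rw [evalList_lawrenceSullivan_two, h1]
  have h2 := commutator_of_isHomogeneous (IsHomogeneous.smul (-1 : K) hh) hh
  rw [neg_one_smul] at h2
  refine (congrArg Neg.neg h2).trans ?_
  have h3 : -(-path τ * path τ - (-1 : K) ^ (-1 * -1 : ℤ) • (path τ * -path τ)) =
      -((2 : K) • d K (path τ)) := by
    rw [show (-1 * -1 : ℤ) = 1 from rfl, zpow_one, neg_one_smul, d_path, two_smul, neg_mul,
      mul_neg]
    abel
  exact h3

omit [CharZero K] in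
theorem bracket_x_path (τ : K) : evalList (lawrenceSullivan K).br [(letter K .x).toSeries, (path τ).toSeries] =
    -(ad K (path τ)).toSeries := by
  have h1 : parity (letter K .x).toSeries = (letter K .x).toSeries := by
    refine (letter_isHomogeneous Letter.x).par_eq.trans ?_
    rw [Letter.degree, zpow_zero, one_smul]
    rfl
  rw [evalList_lawrenceSullivan_two, h1]
  exact congrArg Neg.neg (commutator_x (path τ))

theorem egf_pullback_gen (τ : K) :
    egf (sdeg_pathLetter τ) (f.pullback (gen L.dualDegree m)) = twistSeries f m (path τ).toSeries [] := by
  ext n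
  rw [coeff_egf, f.pullback_gen, List.map_replicate, twistSeries, PowerSeries.coeff_mk]
  rfl

theorem egf_after_pullback_gen (τ : K) :
    egf (sdeg_pathLetter τ) (ShuffleAlgebra.after (xLetter K) (f.pullback (gen L.dualDegree m))) =
      twistSeries f m (path τ).toSeries [(letter K .x).toSeries] := by
  ext n
  rw [coeff_egf, ShuffleAlgebra.after_apply, f.pullback_gen, List.map_cons, List.map_replicate,
    twistSeries, PowerSeries.coeff_mk]
  rfl

/-- The contribution of the curvature `∂z + ½[z,z]` of the path. -/
theorem mk_sum_bracket_path (τ : K) (w : List (Series K)) :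
    PowerSeries.mk (fun n => ∑ ij ∈ Finset.HasAntidiagonal.antidiagonal n,
      ((ij.1 ! : ℕ) : K)⁻¹ * (((ij.2 ! : ℕ) : K)⁻¹ * L.basis.coord m (evalList f.map
        (evalList (lawrenceSullivan K).br (List.replicate ij.1 (path τ).toSeries) ::
          (w ++ List.replicate ij.2 (path τ).toSeries))))) =
      PowerSeries.X * twistSeries f m (path τ).toSeries ((d K (path τ)).toSeries :: w) -
        PowerSeries.X * (PowerSeries.X * twistSeries f m (path τ).toSeries ((d K (path τ)).toSeries :: w)) := by
  rw [mk_sum_antidiagonal fun i j => ((i ! : ℕ) : K)⁻¹ * (((j ! : ℕ) : K)⁻¹ *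
    L.basis.coord m (evalList f.map
        (evalList (lawrenceSullivan K).br (List.replicate i (path τ).toSeries) ::
          (w ++ List.replicate j (path τ).toSeries))))]
  · have h0 : PowerSeries.mk (fun j => (((0 : ℕ) ! : ℕ) : K)⁻¹ * (((j ! : ℕ) : K)⁻¹ *
        L.basis.coord m (evalList f.map
        (evalList (lawrenceSullivan K).br (List.replicate 0 (path τ).toSeries) ::
          (w ++ List.replicate j (path τ).toSeries))))) = 0 := by
      ext j
      rw [PowerSeries.coeff_mk, List.replicate_zero, evalList_lawrenceSullivan_nil,
        coord_evalList_zero_cons]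
      simp
    have h1 : PowerSeries.mk (fun j => (((1 : ℕ) ! : ℕ) : K)⁻¹ * (((j ! : ℕ) : K)⁻¹ *
        L.basis.coord m (evalList f.map
        (evalList (lawrenceSullivan K).br (List.replicate 1 (path τ).toSeries) ::
          (w ++ List.replicate j (path τ).toSeries))))) =
        twistSeries f m (path τ).toSeries ((d K (path τ)).toSeries :: w) := by
      ext j
      rw [PowerSeries.coeff_mk, List.replicate_one, evalList_lawrenceSullivan_one, twistSeries,
        PowerSeries.coeff_mk, Nat.factorial_one, Nat.cast_one, inv_one, one_mul]
      rfl
    have h2 : PowerSeries.mk (fun j => (((2 : ℕ) ! : ℕ) : K)⁻¹ * (((j ! : ℕ) : K)⁻¹ *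
        L.basis.coord m (evalList f.map
        (evalList (lawrenceSullivan K).br (List.replicate 2 (path τ).toSeries) ::
          (w ++ List.replicate j (path τ).toSeries))))) =
        -twistSeries f m (path τ).toSeries ((d K (path τ)).toSeries :: w) := by
      ext j
      rw [PowerSeries.coeff_mk, List.replicate_succ, List.replicate_one, bracket_path_path,
        map_neg, twistSeries, PowerSeries.coeff_mk, Nat.factorial_two]
      refine (congrArg _ (congrArg _ ((coord_evalList_neg_cons f m _ _).trans (congrArg _
        (coord_evalList_smul_cons f m _ _ _))))).trans ?_
      have : ((2 : ℕ) : K) ≠ 0 := by norm_num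
      push_cast at this ⊢
      field_simp
      rfl
    rw [h0, h1, h2]
    ring
  · intro i j hi
    obtain ⟨i, rfl⟩ := Nat.exists_eq_add_of_le' hi
    rw [List.replicate_succ, List.replicate_succ, List.replicate_succ,
      evalList_lawrenceSullivan_three, coord_evalList_zero_cons]
    simp

/-- Here `x` is inside the inserted bracket: alone it gives `∂x`, with one copy of the path `-[x,
z]`, and with more copies nothing. -/
theorem mk_sum_bracket_x (τ : K) :
    PowerSeries.mk (fun n => ∑ ij ∈ Finset.HasAntidiagonal.antidiagonal n,
      ((ij.1 ! : ℕ) : K)⁻¹ * (((ij.2 ! : ℕ) : K)⁻¹ * L.basis.coord m (evalList f.map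
        (evalList (lawrenceSullivan K).br ((letter K .x).toSeries :: List.replicate ij.1 (path τ).toSeries) ::
          List.replicate ij.2 (path τ).toSeries)))) =
      twistSeries f m (path τ).toSeries [(dLetter K .x).toSeries] -
        PowerSeries.X * twistSeries f m (path τ).toSeries [(ad K (path τ)).toSeries] := by
  rw [mk_sum_antidiagonal fun i j => ((i ! : ℕ) : K)⁻¹ * (((j ! : ℕ) : K)⁻¹ *
    L.basis.coord m (evalList f.map
        (evalList (lawrenceSullivan K).br ((letter K .x).toSeries :: List.replicate i (path τ).toSeries) ::
          List.replicate j (path τ).toSeries)))]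
  · have h0 : PowerSeries.mk (fun j => (((0 : ℕ) ! : ℕ) : K)⁻¹ * (((j ! : ℕ) : K)⁻¹ *
        L.basis.coord m (evalList f.map
        (evalList (lawrenceSullivan K).br ((letter K .x).toSeries :: List.replicate 0 (path τ).toSeries) ::
          List.replicate j (path τ).toSeries)))) = twistSeries f m (path τ).toSeries [(dLetter K .x).toSeries] := by
      ext j
      rw [PowerSeries.coeff_mk, List.replicate_zero, evalList_lawrenceSullivan_one, d_letter,
        twistSeries, PowerSeries.coeff_mk, Nat.factorial_zero, Nat.cast_one, inv_one, one_mul]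
      rfl
    have h1 : PowerSeries.mk (fun j => (((1 : ℕ) ! : ℕ) : K)⁻¹ * (((j ! : ℕ) : K)⁻¹ *
        L.basis.coord m (evalList f.map
        (evalList (lawrenceSullivan K).br ((letter K .x).toSeries :: List.replicate 1 (path τ).toSeries) ::
          List.replicate j (path τ).toSeries)))) =
        -twistSeries f m (path τ).toSeries [(ad K (path τ)).toSeries] := by
      ext j
      rw [PowerSeries.coeff_mk, List.replicate_one, bracket_x_path, map_neg, twistSeries,
        PowerSeries.coeff_mk, Nat.factorial_one, Nat.cast_one, inv_one, one_mul]
      refine (congrArg _ (coord_evalList_neg_cons f m _ _)).trans ?_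
      rw [mul_neg]
      rfl
    have h2 : PowerSeries.mk (fun j => (((2 : ℕ) ! : ℕ) : K)⁻¹ * (((j ! : ℕ) : K)⁻¹ *
        L.basis.coord m (evalList f.map
        (evalList (lawrenceSullivan K).br ((letter K .x).toSeries :: List.replicate 2 (path τ).toSeries) ::
          List.replicate j (path τ).toSeries)))) = 0 := by
      ext j
      rw [PowerSeries.coeff_mk, List.replicate_succ, List.replicate_succ,
        evalList_lawrenceSullivan_three, coord_evalList_zero_cons]
      simp
    rw [h0, h1, h2]
    ring
  · intro i j hi
    obtain ⟨i, rfl⟩ := Nat.exists_eq_add_of_le' hi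
    rw [List.replicate_succ, List.replicate_succ,
      evalList_lawrenceSullivan_three, coord_evalList_zero_cons]
    simp

theorem egf_pullback_dGen (τ : K) :
    egf (sdeg_pathLetter τ) (f.pullback (L.dGen m)) = (-1 : K) ^ L.dualDegree m •
      (PowerSeries.X * twistSeries f m (path τ).toSeries [(d K (path τ)).toSeries] -
        PowerSeries.X * (PowerSeries.X * twistSeries f m (path τ).toSeries [(d K (path τ)).toSeries])) := by
  rw [← mk_sum_bracket_path]
  ext n
  rw [coeff_egf, f.pullback_dGen, mul_left_comm, inv_factorial_mul_shuffleSum (sdeg_pathLetter τ),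
    PowerSeries.coeff_smul, PowerSeries.coeff_mk, smul_eq_mul]
  simp only [List.map_replicate]
  rfl

/-- The two summands correspond to `x` being inside or outside the inserted bracket. In the second
case the bracket contains only copies of the path and contributes its curvature. -/
theorem egf_after_pullback_dGen (τ : K) :
    egf (sdeg_pathLetter τ) (ShuffleAlgebra.after (xLetter K) (f.pullback (L.dGen m))) =
      (-1 : K) ^ L.dualDegree m •
      ((twistSeries f m (path τ).toSeries [(dLetter K .x).toSeries] -
        PowerSeries.X * twistSeries f m (path τ).toSeries [(ad K (path τ)).toSeries]) +
      (PowerSeries.X * twistSeries f m (path τ).toSeries [(d K (path τ)).toSeries, (letter K .x).toSeries] -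
        PowerSeries.X * (PowerSeries.X *
          twistSeries f m (path τ).toSeries [(d K (path τ)).toSeries, (letter K .x).toSeries]))) := by
  rw [← mk_sum_bracket_path, ← mk_sum_bracket_x]
  ext n
  rw [coeff_egf, ShuffleAlgebra.after_apply, f.pullback_dGen, mul_left_comm, shuffleSum, mul_add,
    inv_factorial_mul_shuffleSum (sdeg_pathLetter τ),
    inv_factorial_mul_shuffleSum (sdeg_pathLetter τ),
    PowerSeries.coeff_smul, map_add, PowerSeries.coeff_mk, PowerSeries.coeff_mk, smul_eq_mul]
  simp only [listDegree_replicate (sdeg_pathLetter τ), mul_zero, zpow_zero, one_mul, List.map_cons,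
    List.map_replicate]
  rfl

variable {f}

/-- The generating function is a multiple of `X S - X² S`, where `S` is polynomial: the terms `∂z`
and `½[z, z]` occur in consecutive orders and cancel at `1`. -/
theorem VanishesBeyond.hasEval_pullback_dGen {N : ℕ} (hN : VanishesBeyond f N) (τ : K) :
    HasEval (egf (sdeg_pathLetter τ) (f.pullback (L.dGen m))) 0 := by
  rw [egf_pullback_dGen]
  have h := hN.hasEval_twistSeries m (pathLetter τ) (sdeg_pathLetter τ)
    [⟨-2, d K (path τ), d_path_mem_lie τ⟩] (by simp [listDegree, GradedBrackets.sdeg])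
    (by simp [listDegree, GradedBrackets.sdeg])
  have h1 := (hasEval_X.mul h).add ((hasEval_X.mul (hasEval_X.mul h)).smul (-1))
  have h2 := h1.smul ((-1 : K) ^ L.dualDegree m)
  convert h2 using 1
  · rw [neg_one_smul, ← sub_eq_add_neg]; rfl
  · ring

/-- At `1` the curvature terms cancel, and `∂x - [x, z]`, the velocity of the path, remains. -/
theorem VanishesBeyond.hasEval_after_pullback_dGen {N : ℕ} (hN : VanishesBeyond f N) (τ : K) :
    HasEval (egf (sdeg_pathLetter τ)
      (ShuffleAlgebra.after (xLetter K) (f.pullback (L.dGen m))))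
      ((-1 : K) ^ L.dualDegree m * twistValue f m N (path τ).toSeries [(pathVelocity K τ).toSeries]) := by
  rw [egf_after_pullback_dGen]
  have h := hN.hasEval_twistSeries m (pathLetter τ) (sdeg_pathLetter τ)
    [⟨-2, d K (path τ), d_path_mem_lie τ⟩, xLetter K] (by
      simp [listDegree, GradedBrackets.sdeg, xLetter]) (by
      simp [listDegree, GradedBrackets.sdeg, xLetter])
  have h' := hN.hasEval_twistSeries m (pathLetter τ) (sdeg_pathLetter τ)
    [⟨-1, dLetter K .x, dLetter_x_mem_lie⟩] (by simp [listDegree, GradedBrackets.sdeg])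
    (by simp [listDegree, GradedBrackets.sdeg])
  have h'' := hN.hasEval_twistSeries m (pathLetter τ) (sdeg_pathLetter τ)
    [⟨-1, ad K (path τ), ad_mem_lie (path_mem_lie τ)⟩] (by simp [listDegree, GradedBrackets.sdeg])
    (by simp [listDegree, GradedBrackets.sdeg])
  have h1 := (hasEval_X.mul h).add ((hasEval_X.mul (hasEval_X.mul h)).smul (-1))
  have h2 := ((h'.add ((hasEval_X.mul h'').smul (-1))).add h1).smul ((-1 : K) ^ L.dualDegree m)
  convert h2 using 1
  · rw [neg_one_smul, neg_one_smul, ← sub_eq_add_neg, ← sub_eq_add_neg]; rfl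
  · congr 1
    have h3 : twistValue f m N (path τ).toSeries [(pathVelocity K τ).toSeries] =
      twistValue f m N (path τ).toSeries [(dLetter K .x).toSeries] - twistValue f m N (path τ).toSeries [(ad K (path τ)).toSeries] :=
      twistValue_sub f m N _ _ _
    rw [h3]
    simp only [List.map_cons, List.map_nil]
    ring_nf
    rfl

end Twist

/-! ### Homotopic elements define homotopic augmentations -/

section HomotopyOfMorphism

open TensorSeries

variable {K : Type u} [Field K] {E : Type v} [AddCommGroup E] [Module K E]

theorem evalList_cons_replicate {F : Type w} [AddCommGroup F] [Module K F]
    (g : (k : ℕ) → MultilinearMap K (fun _ : Fin k => E) F) (n : ℕ) (y z : E) :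
    evalList g (y :: List.replicate n z) = g (n + 1) (Matrix.vecCons y fun _ => z) := by
  rw [← List.ofFn_const, evalList_cons_ofFn]

/-- Arguments of degree `-1` have degree zero in the suspension, so exchanging them costs no sign.
-/
theorem LInfinityMorphism.map_update_const {F : Type w} [AddCommGroup F] [Module K F]
    {A : GradedBrackets K E} {B : GradedBrackets K F} (g : LInfinityMorphism A B) {n : ℕ}
    (i : Fin (n + 1)) {z v : E} (hz : z ∈ A.deg (-1)) (hv : v ∈ A.deg (-1)) :
    g.map (n + 1) (Function.update (fun _ => z) i v) =
      g.map (n + 1) (Matrix.vecCons v fun _ => z) := by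
  have h := g.map_symm (n + 1) (fun _ => -1) (Matrix.vecCons v fun _ => z)
    (fun j => by refine Fin.cases ?_ (fun j => ?_) j <;> assumption) (Equiv.swap 0 i)
  have h1 : (Matrix.vecCons v fun _ => z) ∘ Equiv.swap 0 i =
      (Function.update (fun _ => z) i v : Fin (n + 1) → E) := by
    funext j
    by_cases hj : j = i
    · subst hj; simp
    · rw [Function.update_of_ne hj, Function.comp_apply]
      have h2 : Equiv.swap 0 i j ≠ 0 := fun h => hj (by
        rw [← Equiv.swap_apply_left 0 i] at h
        rw [Equiv.swap_apply_left] at h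
        by_cases h0 : j = 0
        · subst h0; rw [Equiv.swap_apply_left] at h; exact h.symm
        · exact absurd (Equiv.swap_apply_of_ne_of_ne h0 hj ▸ h) h0)
      obtain ⟨j', hj'⟩ := Fin.exists_succ_eq.2 h2
      rw [← hj']; rfl
  rw [← h1, h]
  simp [koszulSign]

variable [CharZero K] {L : MildLInfinityAlgebra K E}
  {f : LInfinityMorphism (lawrenceSullivan K) L.toGradedBrackets}

/-- The path is an infinite series in `τ`, but `f` does not see the tail `N`, and modulo that tail
the path and its velocity are given by one polynomial curve and its derivative. The `j + 1`
positions of the velocity give equal terms and lower the factorial by one. -/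
theorem VanishesBeyond.exists_polynomial {N : ℕ} (hN : VanishesBeyond f N) (m : L.Index) :
    ∃ W : Polynomial K, ∀ τ : K,
      W.eval τ = twistValue f m N (path τ).toSeries [] ∧
      W.derivative.eval τ = twistValue f m N (path τ).toSeries [(pathVelocity K τ).toSeries] := by
  let F : (j : ℕ) → MultilinearMap K (fun _ : Fin j => TensorSeries K) K :=
    fun j => (L.basis.coord m).compMultilinearMap (f.map j)
  choose P hP using fun j => exists_polynomial_of_curve (N + 2) (F j) (pathCoeff K)
  have hmem : ∀ τ : K, ∑ r ∈ Finset.range (N + 2), τ ^ r • pathCoeff K r ∈ lie K (-1) := fun τ =>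
    Submodule.sum_mem _ fun r _ => Submodule.smul_mem _ _ (pathCoeff_mem_lie r)
  have hmem' : ∀ τ : K, ∑ r ∈ Finset.range (N + 2), ((r : K) * τ ^ (r - 1)) • pathCoeff K r ∈
      lie K (-1) := fun τ =>
    Submodule.sum_mem _ fun r _ => Submodule.smul_mem _ _ (pathCoeff_mem_lie r)
  have htail : ∀ τ : K, path τ - ∑ r ∈ Finset.range (N + 2), τ ^ r • pathCoeff K r ∈ tail K N :=
    fun τ => tail_anti (by omega) (path_sub_mem_tail τ (N + 2))
  have h1 : ∀ j τ, (P j).eval τ = F j fun _ => path τ := by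
    intro j τ
    rw [(hP j τ).1]
    refine congrArg (L.basis.coord m) (hN.congr (p := fun _ => -1) (fun _ => path_mem_lie τ)
      (fun _ => hmem τ) ?_ ?_ fun _ => htail τ).symm <;> simp
  have h2 : ∀ j τ, (P (j + 1)).derivative.eval τ =
      (j + 1 : ℕ) * F (j + 1) (Matrix.vecCons (pathVelocity K τ) fun _ => path τ) := by
    intro j τ
    rw [(hP (j + 1) τ).2]
    have : ∀ i : Fin (j + 1), F (j + 1) (Function.update
        (fun _ => ∑ r ∈ Finset.range (N + 2), τ ^ r • pathCoeff K r) i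
        (∑ r ∈ Finset.range (N + 2), ((r : K) * τ ^ (r - 1)) • pathCoeff K r)) =
        F (j + 1) (Matrix.vecCons (pathVelocity K τ) fun _ => path τ) := by
      intro i
      refine congrArg (L.basis.coord m) (Eq.trans ?_
        (f.map_update_const i (path_mem_lie τ) (pathVelocity_mem_lie τ)))
      refine (hN.congr (p := fun _ => -1)
        (x := (Function.update (fun _ => path τ) i (pathVelocity K τ) :
          Fin (j + 1) → TensorSeries K)) ?_ ?_ ?_ ?_ ?_).symm
      · intro j
        by_cases hj : j = i
        · subst hj; rw [Function.update_self]; exact pathVelocity_mem_lie τ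
        · rw [Function.update_of_ne hj]; exact path_mem_lie τ
      · intro j
        by_cases hj : j = i
        · subst hj; rw [Function.update_self]; exact hmem' τ
        · rw [Function.update_of_ne hj]; exact hmem τ
      · simp
      · simp
      · intro j
        by_cases hj : j = i
        · subst hj; rw [Function.update_self, Function.update_self]
          exact pathVelocity_sub_mem_tail τ N
        · rw [Function.update_of_ne hj, Function.update_of_ne hj]; exact htail τ
    simp only [this]
    simp
  have h3 : ∀ τ, (P 0).derivative.eval τ = 0 := fun τ => by rw [(hP 0 τ).2]; simp
  -- The summand `j = N` has value zero; it is included so that, after differentiation and a shift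
  -- of the index, exactly `N` terms remain.
  refine ⟨∑ j ∈ Finset.range (N + 1), Polynomial.C ((j ! : ℕ) : K)⁻¹ * P j, fun τ => ⟨?_, ?_⟩⟩
  · rw [Polynomial.eval_finsetSum, Finset.sum_range_succ]
    have h0 : F N (fun _ => path τ) = 0 := by
      refine (congrArg (L.basis.coord m) (hN N (fun _ => -1) _ (fun _ => path_mem_lie τ) ?_ ?_
        (Or.inl le_rfl))).trans (map_zero _) <;> simp
    rw [Polynomial.eval_mul, h1, h0, mul_zero, add_zero]
    refine Finset.sum_congr rfl fun j _ => ?_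
    rw [Polynomial.eval_mul, Polynomial.eval_C, h1, List.nil_append, evalList_replicate]
    rfl
  · rw [Polynomial.derivative_sum, Polynomial.eval_finsetSum, Finset.sum_range_succ']
    simp only [Polynomial.derivative_C_mul, Polynomial.eval_mul, Polynomial.eval_C]
    rw [h3, mul_zero, add_zero]
    refine Finset.sum_congr rfl fun j _ => ?_
    rw [h2, List.singleton_append, evalList_cons_replicate, Nat.factorial_succ, ← mul_assoc]
    have h4 : ((j ! : ℕ) : K) ≠ 0 := by exact_mod_cast j.factorial_ne_zero
    have h5 : ((j + 1 : ℕ) : K) ≠ 0 := by exact_mod_cast j.succ_ne_zero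
    congr 1
    rw [Nat.cast_mul]
    field_simp

theorem VanishesBeyond.exists_polynomial_x {N : ℕ} (hN : VanishesBeyond f N) (m : L.Index) :
    ∃ Y : Polynomial K, ∀ τ : K,
      Y.eval τ = twistValue f m N (path τ).toSeries [(letter K .x).toSeries] := by
  let F : (j : ℕ) → MultilinearMap K (fun _ : Fin j => TensorSeries K) K :=
    fun j => (L.basis.coord m).compMultilinearMap (f.map j)
  choose P hP using fun j =>
    exists_polynomial_of_curve N ((F (j + 1)).curryLeft (letter K .x)) (pathCoeff K)
  refine ⟨∑ j ∈ Finset.range N, Polynomial.C ((j ! : ℕ) : K)⁻¹ * P j, fun τ => ?_⟩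
  rw [Polynomial.eval_finsetSum]
  refine Finset.sum_congr rfl fun j _ => ?_
  rw [Polynomial.eval_mul, Polynomial.eval_C, (hP j τ).1, List.singleton_append,
    evalList_cons_replicate]
  have hmem : ∑ r ∈ Finset.range N, τ ^ r • pathCoeff K r ∈ lie K (-1) :=
    Submodule.sum_mem _ fun r _ => Submodule.smul_mem _ _ (pathCoeff_mem_lie r)
  congr 1
  refine congrArg (L.basis.coord m) (hN.congr (p := Matrix.vecCons 0 fun _ => -1) ?_ ?_ ?_ ?_ ?_)
  · intro i
    refine Fin.cases ?_ (fun i => ?_) i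
    · exact letter_mem_lie .x
    · exact hmem
  · intro i
    refine Fin.cases ?_ (fun i => ?_) i
    · exact letter_mem_lie .x
    · exact path_mem_lie τ
  · simp [Fin.sum_univ_succ]
  · simp [Fin.sum_univ_succ]
  · intro i
    refine Fin.cases ?_ (fun i => ?_) i
    · simp only [Fin.cons_zero, Matrix.cons_val_zero]
      rw [← neg_mem_iff]
      convert Submodule.zero_mem (tail K N)
      exact neg_eq_zero.2 (sub_self _)
    · rw [← neg_mem_iff]
      convert path_sub_mem_tail τ N using 1
      exact neg_sub _ _

theorem twistValue_nil_eq_zero (N : ℕ) (τ : K) {m : L.Index} (hm : L.dualDegree m ≠ 0) :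
    twistValue f m N (path τ).toSeries [] = 0 := by
  refine Finset.sum_eq_zero fun j _ => ?_
  rw [List.nil_append, evalList_replicate,
    L.coord_eq_zero (f.map_deg j (fun _ => -1) (fun _ => (path τ).toSeries) fun _ => path_mem_lie τ) m,
    mul_zero]
  intro h
  exact hm (by rw [MildLInfinityAlgebra.dualDegree, h]; simp)

theorem twistValue_x_eq_zero (N : ℕ) (τ : K) {m : L.Index} (hm : L.dualDegree m ≠ 1) :
    twistValue f m N (path τ).toSeries [(letter K .x).toSeries] = 0 := by
  refine Finset.sum_eq_zero fun j _ => ?_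
  rw [List.singleton_append, evalList_cons_replicate,
    L.coord_eq_zero (f.map_deg (j + 1) (Matrix.vecCons 0 fun _ => -1)
      (Matrix.vecCons (letter K .x).toSeries fun _ => (path τ).toSeries) fun i => by
        refine Fin.cases ?_ (fun i => ?_) i
        · exact letter_mem_lie .x
        · exact path_mem_lie τ) m, mul_zero]
  intro h
  exact hm (by rw [MildLInfinityAlgebra.dualDegree, h]; simp [Fin.sum_univ_succ])

theorem VanishesBeyond.mcMap_eq {N : ℕ} (hN : VanishesBeyond f N) (τ : K) (m : L.Index) :
    L.basis.coord m (f.mcMap (path τ).toSeries) = twistValue f m N (path τ).toSeries [] := by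
  have h : ∀ j, N ≤ j → f.map j (fun _ => (path τ).toSeries) = 0 := fun j hj =>
    hN j (fun _ => -1) _ (fun _ => path_mem_lie τ) (by simp) (by simp) (Or.inl hj)
  rw [LInfinityMorphism.mcMap, finsum_eq_sum_of_support_subset (s := Finset.range N), map_sum]
  · refine Finset.sum_congr rfl fun j _ => ?_
    rw [map_smul, smul_eq_mul, List.nil_append, evalList_replicate]
  · intro j hj
    rw [Finset.coe_range, Set.mem_Iio]
    by_contra hcon
    exact hj (by simp only [h j (not_lt.1 hcon), smul_zero])

/-- The values of a form at a point, read off from functions on lists of letters. -/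
theorem exists_hasEval_formEval {τ : K} {G : Type} {q : G → ℤ}
    {X : Type*} {deg : X → ℤ} {z : X} (hz : deg z = 0) (x : X)
    (Ψ : FreeCGA K q →ₐ[K] ShuffleAlgebra K deg) (H : FreeCGA K q →ₐ[K] (intervalDGA K).carrier)
    (hgen : ∀ i, ∃ e r, HasEval (egf hz (Ψ (gen q i))) e ∧
      HasEval (egf hz (ShuffleAlgebra.after x (Ψ (gen q i)))) r ∧
      formEval τ (H (gen q i)) = TrivSqZeroExt.inl e + TrivSqZeroExt.inr r)
    (a : FreeCGA K q) : ∃ e r, HasEval (egf hz (Ψ a)) e ∧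
      HasEval (egf hz (ShuffleAlgebra.after x (Ψ a))) r ∧
      formEval τ (H a) = TrivSqZeroExt.inl e + TrivSqZeroExt.inr r := by
  induction a using FreeCGA.induction with
  | one =>
    refine ⟨1, 0, ?_, ?_, ?_⟩
    · rw [map_one, map_one]; exact hasEval_one
    · have : ShuffleAlgebra.after x (1 : ShuffleAlgebra K deg) = 0 :=
        ShuffleAlgebra.ext fun l => ShuffleAlgebra.one_of_ne_nil (List.cons_ne_nil x l)
      rw [map_one, this, map_zero]
      exact hasEval_zero
    · rw [map_one, map_one, TrivSqZeroExt.inr_zero, add_zero]; rfl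
  | add a b ha hb =>
    obtain ⟨e, r, h1, h2, h3⟩ := ha
    obtain ⟨e', r', h1', h2', h3'⟩ := hb
    refine ⟨e + e', r + r', ?_, ?_, ?_⟩
    · rw [map_add, map_add]; exact h1.add h1'
    · rw [map_add, map_add, map_add]; exact h2.add h2'
    · rw [map_add, map_add, h3, h3', TrivSqZeroExt.inl_add, TrivSqZeroExt.inr_add]; abel
  | smul c a ha =>
    obtain ⟨e, r, h1, h2, h3⟩ := ha
    refine ⟨c * e, c * r, ?_, ?_, ?_⟩
    · rw [map_smul, map_smul]; exact h1.smul c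
    · rw [map_smul, map_smul, map_smul]; exact h2.smul c
    · rw [map_smul, map_smul, h3, smul_add, ← TrivSqZeroExt.inl_smul,
        ← TrivSqZeroExt.inr_smul]; rfl
  | mul_gen a i ha =>
    obtain ⟨e, r, h1, h2, h3⟩ := ha
    obtain ⟨e', r', h1', h2', h3'⟩ := hgen i
    refine ⟨e * e', r * e' + e * r', ?_, ?_, ?_⟩
    · rw [map_mul, map_mul]; exact h1.mul h1'
    · rw [map_mul, egf_after_mul]; exact (h2.mul h1').add (h1.mul h2')
    · rw [map_mul, map_mul, h3, h3']
      ext <;> simp [mul_comm]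
      ring

/-- The homotopy sends a generator to `W(t) + Y(t) dt`, where `W` and `Y` are its coordinate on the
path pushed forward by `f`, without and with `x` inserted. At each `τ` the image of `d v` is read
off from lists `z, …, z` and `x, z, …, z`: the first value is the curvature, hence zero, and the
second is `W'(τ)`. -/
theorem augmentationHomotopic_of_homotopic {z₀ z₁ : E} (h : L.Homotopic z₀ z₁)
    (h₀ : z₀ ∈ L.deg (-1)) (h₁ : z₁ ∈ L.deg (-1)) :
    AugmentationHomotopic (A := L.cochains) (L.augmentation h₀) (L.augmentation h₁) := by
  obtain ⟨f, hf, ha, hb⟩ := h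
  obtain ⟨N, hN⟩ := exists_vanishesBeyond hf
  choose W hW using hN.exists_polynomial
  choose Y hY using hN.exists_polynomial_x
  have hW0 : ∀ m, L.dualDegree m ≠ 0 → W m = 0 := fun m hm => Polynomial.funext fun τ => by
    rw [(hW m τ).1, twistValue_nil_eq_zero N τ hm, Polynomial.eval_zero]
  have hY0 : ∀ m, L.dualDegree m ≠ 1 → Y m = 0 := fun m hm => Polynomial.funext fun τ => by
    rw [hY m τ, twistValue_x_eq_zero N τ hm, Polynomial.eval_zero]
  have hC := intervalDGA_isCDGA (K := K)
  have hmem : ∀ m, Polynomial.aeval (intervalT K) (W m) +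
      Polynomial.aeval (intervalT K) (Y m) * intervalDT K ∈
        (intervalDGA K).gr (L.dualDegree m) := by
    intro m
    refine Submodule.add_mem _ ?_ ?_
    · by_cases hm : L.dualDegree m = 0
      · rw [hm]; exact hC.aeval_mem intervalT_mem _
      · rw [hW0 m hm, map_zero]; exact Submodule.zero_mem _
    · by_cases hm : L.dualDegree m = 1
      · rw [hm]; simpa using hC.mul_mem _ _ _ _ (hC.aeval_mem intervalT_mem (Y m)) intervalDT_mem
      · rw [hY0 m hm, map_zero, zero_mul]; exact Submodule.zero_mem _
  let H : FreeCGA K L.dualDegree →ₐ[K] (intervalDGA K).carrier := liftDGA hC L.dualDegree _ hmem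
  have hH : ∀ m, H (gen L.dualDegree m) = Polynomial.aeval (intervalT K) (W m) +
      Polynomial.aeval (intervalT K) (Y m) * intervalDT K := fun m => liftDGA_gen hC _ hmem m
  have hform : ∀ (τ : K) (P Q : Polynomial K), formEval τ (Polynomial.aeval (intervalT K) P +
      Polynomial.aeval (intervalT K) Q * intervalDT K) =
      TrivSqZeroExt.inl (P.eval τ) + TrivSqZeroExt.inr (Q.eval τ) := by
    intro τ P Q
    rw [map_add, map_mul, formEval_aeval, formEval_aeval, formEval_DT]
    ext <;> simp
  have hgen : ∀ (τ : K) (m : L.Index), ∃ e r,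
      HasEval (egf (sdeg_pathLetter τ) (f.pullback (gen L.dualDegree m))) e ∧
      HasEval (egf (sdeg_pathLetter τ)
        (ShuffleAlgebra.after (xLetter K) (f.pullback (gen L.dualDegree m)))) r ∧
      formEval τ (H (gen L.dualDegree m)) = TrivSqZeroExt.inl e + TrivSqZeroExt.inr r := by
    intro τ m
    refine ⟨(W m).eval τ, (Y m).eval τ, ?_, ?_, ?_⟩
    · rw [egf_pullback_gen, (hW m τ).1]
      exact hN.hasEval_twistSeries m (pathLetter τ) (sdeg_pathLetter τ) [] (by simp [listDegree])
        (by simp [listDegree])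
    · rw [egf_after_pullback_gen, hY m τ]
      exact hN.hasEval_twistSeries m (pathLetter τ) (sdeg_pathLetter τ) [xLetter K]
        (by simp [listDegree, sdeg_xLetter]) (by simp [listDegree, sdeg_xLetter])
    · rw [hH, hform]
  have hdH : ∀ m, (intervalDGA K).d (H (gen L.dualDegree m)) =
      Polynomial.aeval (intervalT K) (W m).derivative * intervalDT K := by
    intro m
    rw [hH, map_add, d_aeval_intervalT, hC.leibniz 0 _ _ (hC.aeval_mem intervalT_mem _),
      d_aeval_intervalT, d_intervalDT, mul_assoc, hC.mul_self_eq_zero intervalDT_mem]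
    simp
  have hDG : IsDGMorphism (A := L.cochains) (B := intervalDGA K) H := by
    refine isDGMorphism_of_gen (q := L.dualDegree) (u := fun m => ⟨L.dGen m, L.dGen_mem m⟩) hC H
      (fun m => (liftDGA_gen hC _ hmem m).symm ▸ hmem m) fun m => ext_formEval fun τ => ?_
    obtain ⟨e, r, h1, h2, h3⟩ := exists_hasEval_formEval (sdeg_pathLetter τ) (xLetter K)
      f.pullback H (hgen τ) (L.dGen m)
    change formEval τ (H (L.dGen m)) = _
    rw [h3, h1.unique (hN.hasEval_pullback_dGen m τ), h2.unique (hN.hasEval_after_pullback_dGen m τ),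
      hdH, ← (hW m τ).2]
    have h4 := hform τ 0 (W m).derivative
    rw [map_zero, zero_add, Polynomial.eval_zero] at h4
    rw [h4]
    congr 2
    -- The sign of `d` on generators is harmless: `W m` is zero unless the generator has degree
    -- zero.
    by_cases hm : L.dualDegree m = 0
    · rw [hm, zpow_zero, one_mul]
    · rw [hW0 m hm]; simp
  have hend : ∀ (τ : K) (z : E) (hz : z ∈ L.deg (-1)), f.mcMap (path τ).toSeries = z →
      (intervalEval τ).comp H = L.augmentation hz := by
    rintro τ z hz rfl
    refine algHom_ext fun m => ?_
    rw [L.augmentation_gen, hN.mcMap_eq, ← (hW m τ).1, AlgHom.comp_apply, hH, map_add, map_mul,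
      intervalEval_aeval, intervalEval_DT, mul_zero, add_zero]
  refine ⟨H, hDG, hend 0 z₀ h₀ ?_, hend 1 z₁ h₁ ?_⟩
  · rw [← ha, path_zero]; rfl
  · rw [← hb, path_one]; rfl

end HomotopyOfMorphism

/-! ### Products of CDGAs -/

section Product

variable {K : Type u} [Field K]

/-- The product of two algebras. -/
noncomputable abbrev prodDGA (A B : GradedDiffAlgebra K) : GradedDiffAlgebra K where
  carrier := A.carrier × B.carrier
  gr n := (A.gr n).prod (B.gr n)
  d := A.d.prodMap B.d

theorem isInternal_prod {A B : Type u} [AddCommGroup A] [Module K A] [AddCommGroup B] [Module K B]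
    {P : ℤ → Submodule K A} {Q : ℤ → Submodule K B} (hP : DirectSum.IsInternal P)
    (hQ : DirectSum.IsInternal Q) : DirectSum.IsInternal fun n => (P n).prod (Q n) := by
  rw [DirectSum.isInternal_submodule_iff_iSupIndep_and_iSup_eq_top] at hP hQ ⊢
  refine ⟨?_, ?_⟩
  · rw [iSupIndep_def]
    intro n
    rw [Submodule.disjoint_def]
    rintro ⟨a, b⟩ ⟨ha, hb⟩ h
    have h1 : a ∈ ⨆ (j) (_ : j ≠ n), P j := by
      have : (⨆ (j) (_ : j ≠ n), (P j).prod (Q j)) ≤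
          (⨆ (j) (_ : j ≠ n), P j).comap (LinearMap.fst K A B) :=
        iSup₂_le fun j hj x hx => Submodule.mem_iSup_of_mem j (Submodule.mem_iSup_of_mem hj hx.1)
      exact this h
    have h2 : b ∈ ⨆ (j) (_ : j ≠ n), Q j := by
      have : (⨆ (j) (_ : j ≠ n), (P j).prod (Q j)) ≤
          (⨆ (j) (_ : j ≠ n), Q j).comap (LinearMap.snd K A B) :=
        iSup₂_le fun j hj x hx => Submodule.mem_iSup_of_mem j (Submodule.mem_iSup_of_mem hj hx.2)
      exact this h
    rw [Submodule.disjoint_def.1 (iSupIndep_def.1 hP.1 n) a ha h1,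
      Submodule.disjoint_def.1 (iSupIndep_def.1 hQ.1 n) b hb h2]
    rfl
  · rw [eq_top_iff]
    rintro ⟨a, b⟩ -
    have h1 : (⨆ n, P n) ≤ (⨆ n, (P n).prod (Q n)).comap (LinearMap.inl K A B) :=
      iSup_le fun n x hx => Submodule.mem_iSup_of_mem n ⟨hx, Submodule.zero_mem _⟩
    have h2 : (⨆ n, Q n) ≤ (⨆ n, (P n).prod (Q n)).comap (LinearMap.inr K A B) :=
      iSup_le fun n x hx => Submodule.mem_iSup_of_mem n ⟨Submodule.zero_mem _, hx⟩
    have ha : a ∈ ⨆ n, P n := hP.2 ▸ Submodule.mem_top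
    have hb : b ∈ ⨆ n, Q n := hQ.2 ▸ Submodule.mem_top
    have h3 := h1 ha
    have h4 := h2 hb
    rw [Submodule.mem_comap] at h3 h4
    have h5 := Submodule.add_mem _ h3 h4
    simpa using h5

theorem prodDGA_isCDGA {A B : GradedDiffAlgebra K} (hA : A.IsCDGA) (hB : B.IsCDGA) :
    (prodDGA A B).IsCDGA where
  internal := isInternal_prod hA.internal hB.internal
  one_mem := ⟨hA.one_mem, hB.one_mem⟩
  mul_mem m n a b ha hb := ⟨hA.mul_mem m n _ _ ha.1 hb.1, hB.mul_mem m n _ _ ha.2 hb.2⟩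
  mul_comm m n a b ha hb := Prod.ext (hA.mul_comm m n _ _ ha.1 hb.1) (hB.mul_comm m n _ _ ha.2 hb.2)
  d_mem n a ha := ⟨hA.d_mem n _ ha.1, hB.d_mem n _ ha.2⟩
  leibniz n a b ha := Prod.ext (hA.leibniz n _ _ ha.1) (hB.leibniz n _ _ ha.2)
  d_d a := Prod.ext (hA.d_d _) (hB.d_d _)

end Product

/-! ### The ground field as a free algebra -/

section Ground

variable {K : Type u} [Field K]

variable (K) in
/-- The free algebra without generators. -/
noncomputable abbrev groundDGA : GradedDiffAlgebra K :=
  freeDGA (K := K) (Empty.elim : Empty → ℤ) (fun i => i.elim)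

theorem groundDGA_isCDGA [CharZero K] : (groundDGA K).IsCDGA := freeDGA_isCDGA fun i => i.elim

theorem exists_algebraMap_eq (a : FreeCGA K (Empty.elim : Empty → ℤ)) :
    ∃ c : K, algebraMap K _ c = a := by
  induction a using induction with
  | one => exact ⟨1, map_one _⟩
  | add a b ha hb =>
    obtain ⟨c, rfl⟩ := ha
    obtain ⟨c', rfl⟩ := hb
    exact ⟨c + c', map_add _ _ _⟩
  | smul c a ha =>
    obtain ⟨c', rfl⟩ := ha
    exact ⟨c * c', by rw [map_mul, Algebra.smul_def]⟩
  | mul_gen a i ha => exact i.elim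

theorem d_ground (a : (groundDGA K).carrier) : (groundDGA K).d a = 0 := by
  obtain ⟨c, rfl⟩ := exists_algebraMap_eq a
  change derivation (Empty.elim : Empty → ℤ) _ (algebraMap K _ c) = 0
  rw [Algebra.algebraMap_eq_smul_one, map_smul, derivation_one, smul_zero]

theorem groundDGA_algebraMap_injective {c : K}
    (h : algebraMap K (FreeCGA K (Empty.elim : Empty → ℤ)) c = 0) : c = 0 := by
  have := congrArg (liftOf (Empty.elim : Empty → ℤ) (Empty.elim : Empty → K) fun i => i.elim) h
  simpa using this

end Ground

/-! ### A free model of the product of the ground field and the interval -/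

section TwoPoint

variable {K : Type u} [Field K]

/-- The degrees of generators `e` (`true`) and `w` (`false`). -/
def twoPointDegree : Bool → ℤ
  | true => 0
  | false => -1

variable (K) in
/-- The differential `d e = 0`, `d w = ½ (e - e²)`. -/
noncomputable def twoPointGen : (i : Bool) → gr (K := K) twoPointDegree (twoPointDegree i + 1)
  | true => 0
  | false => ⟨(2 : K)⁻¹ • (gen twoPointDegree true - gen twoPointDegree true *
      gen twoPointDegree true), Submodule.smul_mem _ _ (Submodule.sub_mem _
        (gen_mem (q := twoPointDegree) true) (FreeCGA.mul_mem (m := 0) (n := 0)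
          (gen_mem (q := twoPointDegree) true) (gen_mem (q := twoPointDegree) true)))⟩

theorem derivation_twoPointGen (i : Bool) :
    derivation twoPointDegree (twoPointGen K) (twoPointGen K i) = 0 := by
  cases i
  · simp only [twoPointGen]
    rw [map_smul, map_sub, derivation_mul _ (gen_mem (q := twoPointDegree) true), derivation_gen]
    simp [twoPointGen]
  · exact map_zero _

variable (K) in
/-- The algebra `Λ(e, w)`, which is quasi-isomorphic to `K × K`. -/
noncomputable abbrev twoPointDGA : GradedDiffAlgebra K := freeDGA twoPointDegree (twoPointGen K)

theorem twoPointDGA_isCDGA [CharZero K] : (twoPointDGA K).IsCDGA :=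
  freeDGA_isCDGA derivation_twoPointGen

variable (K) in
/-- The generator `e`. -/
noncomputable def twoPointE : (twoPointDGA K).carrier := gen twoPointDegree true

variable (K) in
/-- The generator `w`. -/
noncomputable def twoPointW : (twoPointDGA K).carrier := gen twoPointDegree false

theorem twoPointE_mem : twoPointE K ∈ (twoPointDGA K).gr 0 := gen_mem (q := twoPointDegree) true

theorem twoPointW_mem : twoPointW K ∈ (twoPointDGA K).gr (-1) :=
  gen_mem (q := twoPointDegree) false

theorem d_twoPointE : (twoPointDGA K).d (twoPointE K) = 0 := derivation_gen _ _

theorem d_twoPointW : (twoPointDGA K).d (twoPointW K) =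
    Polynomial.aeval (twoPointE K)
      (Polynomial.C (2 : K)⁻¹ * (Polynomial.X - Polynomial.X * Polynomial.X)) := by
  refine (derivation_gen (q := twoPointDegree) (twoPointGen K) false).trans ?_
  rw [map_mul, map_sub, map_mul, Polynomial.aeval_X, Polynomial.aeval_C, ← Algebra.smul_def]
  rfl

theorem GradedDiffAlgebra.IsCDGA.mul_self_eq_zero_of_neg [CharZero K] {C : GradedDiffAlgebra K}
    (hC : C.IsCDGA) {a : C.carrier} (ha : a ∈ C.gr (-1)) : a * a = 0 := by
  have h := hC.mul_comm (-1) (-1) a a ha ha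
  rw [show (-1 * -1 : ℤ) = 1 from rfl, zpow_one, neg_one_smul, eq_neg_iff_add_eq_zero,
    ← two_smul K] at h
  exact (smul_eq_zero.1 h).resolve_left two_ne_zero

theorem exists_twoPoint_form [CharZero K] (c : (twoPointDGA K).carrier) :
    ∃ P Q : Polynomial K, c = Polynomial.aeval (twoPointE K) P +
      Polynomial.aeval (twoPointE K) Q * twoPointW K := by
  induction c using induction with
  | one => exact ⟨1, 0, by simp⟩
  | add a b ha hb =>
    obtain ⟨P, Q, rfl⟩ := ha
    obtain ⟨P', Q', rfl⟩ := hb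
    exact ⟨P + P', Q + Q', by rw [map_add, map_add, add_mul]; abel⟩
  | smul c a ha =>
    obtain ⟨P, Q, rfl⟩ := ha
    exact ⟨c • P, c • Q, by rw [map_smul, map_smul, smul_add, smul_mul_assoc]⟩
  | mul_gen a i ha =>
    obtain ⟨P, Q, rfl⟩ := ha
    cases i
    · refine ⟨0, P, ?_⟩
      change _ * twoPointW K = _
      rw [add_mul, mul_assoc _ _ (twoPointW K),
        twoPointDGA_isCDGA.mul_self_eq_zero_of_neg twoPointW_mem, mul_zero, add_zero, map_zero,
        zero_add]
    · refine ⟨P * Polynomial.X, Q * Polynomial.X, ?_⟩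
      change _ * twoPointE K = _
      rw [map_mul, map_mul, Polynomial.aeval_X, add_mul, mul_assoc, mul_assoc,
        twoPointDGA_isCDGA.commute_of_mem_zero twoPointW_mem twoPointE_mem]

theorem d_twoPoint_form [CharZero K] (P Q : Polynomial K) :
    (twoPointDGA K).d (Polynomial.aeval (twoPointE K) P +
      Polynomial.aeval (twoPointE K) Q * twoPointW K) = Polynomial.aeval (twoPointE K)
        (Q * (Polynomial.C (2 : K)⁻¹ * (Polynomial.X - Polynomial.X * Polynomial.X))) := by
  have hC := twoPointDGA_isCDGA (K := K)
  rw [map_add, hC.d_aeval twoPointE_mem, d_twoPointE, mul_zero, zero_add,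
    hC.leibniz 0 _ _ (hC.aeval_mem twoPointE_mem _), hC.d_aeval twoPointE_mem, d_twoPointE,
    mul_zero, zero_mul, zero_add, zpow_zero, one_smul, d_twoPointW, ← map_mul]

theorem aeval_twoPointE_injective [CharZero K] {P : Polynomial K}
    (h : Polynomial.aeval (twoPointE K) P = 0) : P = 0 := by
  let Φ : (twoPointDGA K).carrier →ₐ[K] Polynomial K :=
    liftComm twoPointDegree (fun i => cond i Polynomial.X 0) fun i hi => by
      cases i
      · rfl
      · exact absurd rfl hi
  have h1 : Φ (twoPointE K) = Polynomial.X := liftComm_gen _ _ _ _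
  have h2 := congrArg Φ h
  rwa [map_zero, ← Polynomial.aeval_algHom_apply, h1, Polynomial.aeval_X_left_apply] at h2

/-- A cocycle of `Λ(e, w)` is determined up to coboundaries by its values at `e = 0` and `e = 1`. -/
theorem exists_twoPoint_primitive [CharZero K] {c : (twoPointDGA K).carrier}
    (hc : (twoPointDGA K).d c = 0) : ∃ P : Polynomial K, c = Polynomial.aeval (twoPointE K) P ∧
      (P.eval 0 = 0 → P.eval 1 = 0 → ∃ y, c = (twoPointDGA K).d y) := by
  obtain ⟨P, Q, rfl⟩ := exists_twoPoint_form c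
  rw [d_twoPoint_form] at hc
  have h1 := aeval_twoPointE_injective hc
  have h2 : Polynomial.X - Polynomial.X * Polynomial.X ≠ (0 : Polynomial K) := by
    intro h
    have := congrArg (Polynomial.eval (2 : K)) h
    norm_num at this
  have h3 : Polynomial.C (2 : K)⁻¹ ≠ 0 := by simp
  have hQ : Q = 0 := (mul_eq_zero.1 h1).resolve_right (mul_ne_zero h3 h2)
  refine ⟨P, by rw [hQ, map_zero, zero_mul, add_zero], fun h0 h1 => ?_⟩
  -- A polynomial vanishing at `0` and `1` has the form `X (X - 1) S`. Since `dw` is half of `e -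
  -- e²`, a primitive is `-2 S w`.
  obtain ⟨R, hR⟩ := Polynomial.dvd_iff_isRoot.2 h0
  rw [map_zero, sub_zero] at hR
  have hR1 : R.eval 1 = 0 := by rw [hR] at h1; simpa using h1
  obtain ⟨S, hS⟩ := Polynomial.dvd_iff_isRoot.2 hR1
  refine ⟨Polynomial.aeval (twoPointE K) (0 : Polynomial K) +
    Polynomial.aeval (twoPointE K) (-(Polynomial.C 2 * S)) * twoPointW K, ?_⟩
  rw [d_twoPoint_form, hQ, map_zero, zero_mul, add_zero, hR, hS]
  refine congrArg (Polynomial.aeval (R := K) (twoPointE K)) ?_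
  have h4 : (Polynomial.C 2 * Polynomial.C (2 : K)⁻¹ : Polynomial K) = 1 := by
    rw [← map_mul, mul_inv_cancel₀ two_ne_zero, map_one]
  rw [map_one]
  linear_combination (Polynomial.X * (1 - Polynomial.X) * S) * h4

end TwoPoint

/-! ### Lifting homotopies to a free model -/

section Model

variable {K : Type u} [Field K]

/-- The degrees of the generators `e`, `w`, `t`, `dt`. -/
abbrev modelDegree : Bool ⊕ (Unit ⊕ Unit) → ℤ := cylDegree twoPointDegree fun _ => 0

variable (K) in
/-- The algebra `Λ(e, w, t, dt)`. -/
noncomputable abbrev modelDGA : GradedDiffAlgebra K :=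
  cylDGA (V := Unit) (fun _ => 0) (twoPointGen K)

theorem modelDGA_isCDGA [CharZero K] : (modelDGA K).IsCDGA := cylDGA_isCDGA derivation_twoPointGen

variable (K) in
/-- The images of the generators in the product of the ground field and the interval. -/
noncomputable def modelImage : Bool ⊕ (Unit ⊕ Unit) → (groundDGA K).carrier × (intervalDGA K).carrier
  | .inl true => (0, 1)
  | .inl false => (0, 0)
  | .inr (.inl _) => (0, intervalT K)
  | .inr (.inr _) => (0, intervalDT K)

variable [CharZero K]

theorem modelImage_mem (i : Bool ⊕ (Unit ⊕ Unit)) :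
    modelImage K i ∈ (prodDGA (groundDGA K) (intervalDGA K)).gr (modelDegree i) := by
  rcases i with (_ | _) | _ | _
  · exact Submodule.zero_mem _
  · exact ⟨Submodule.zero_mem _, intervalDGA_isCDGA.one_mem⟩
  · exact ⟨Submodule.zero_mem _, intervalT_mem⟩
  · exact ⟨Submodule.zero_mem _, intervalDT_mem⟩

theorem prod_ground_interval_isCDGA : (prodDGA (groundDGA K) (intervalDGA K)).IsCDGA :=
  prodDGA_isCDGA groundDGA_isCDGA intervalDGA_isCDGA

variable (K) in
/-- The projection to the product of the ground field and the interval. -/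
noncomputable def modelProj :
    (modelDGA K).carrier →ₐ[K] (prodDGA (groundDGA K) (intervalDGA K)).carrier :=
  liftDGA prod_ground_interval_isCDGA modelDegree (modelImage K) modelImage_mem

theorem modelProj_gen (i : Bool ⊕ (Unit ⊕ Unit)) :
    modelProj K (gen modelDegree i) = modelImage K i :=
  liftDGA_gen prod_ground_interval_isCDGA _ modelImage_mem i

/-- The generator `e` goes to the idempotent `(0, 1)`, so a polynomial in `e` takes its value at `0`
on the base point and its value at `1` on the interval. -/
theorem modelProj_cylIncl (P : Polynomial K) :
    modelProj K (cylIncl K twoPointDegree (fun _ : Unit => 0)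
      (Polynomial.aeval (R := K) (twoPointE K) P)) =
      (algebraMap K _ (P.eval 0), algebraMap K _ (P.eval 1)) := by
  have h1 : cylIncl K twoPointDegree (fun _ : Unit => 0) (twoPointE K) =
    gen modelDegree (.inl true) := cylIncl_gen _
  rw [← Polynomial.aeval_algHom_apply, h1, ← Polynomial.aeval_algHom_apply, modelProj_gen]
  refine Prod.ext ?_ ?_
  · change AlgHom.fst K _ _ _ = _
    rw [← Polynomial.aeval_algHom_apply]
    change Polynomial.aeval (0 : (groundDGA K).carrier) P = _
    rw [← map_zero (algebraMap K (groundDGA K).carrier), Polynomial.aeval_algebraMap_apply,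
      Polynomial.coe_aeval_eq_eval]
  · change AlgHom.snd K _ _ _ = _
    rw [← Polynomial.aeval_algHom_apply]
    change Polynomial.aeval (1 : (intervalDGA K).carrier) P = _
    rw [← map_one (algebraMap K (intervalDGA K).carrier), Polynomial.aeval_algebraMap_apply,
      Polynomial.coe_aeval_eq_eval]

theorem modelProj_isDGMorphism : IsDGMorphism (A := modelDGA K)
    (B := prodDGA (groundDGA K) (intervalDGA K)) (modelProj K) := by
  refine isDGMorphism_of_gen prod_ground_interval_isCDGA _
    (fun i => (modelProj_gen (K := K) i).symm ▸ modelImage_mem i) ?_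
  rintro ((_ | _) | _ | _)
  · rw [modelProj_gen]
    have h : (((twoPointGen K) false : FreeCGA K twoPointDegree)) =
        Polynomial.aeval (R := K) (twoPointE K)
          (Polynomial.C (2 : K)⁻¹ * (Polynomial.X - Polynomial.X * Polynomial.X)) :=
      (derivation_gen (q := twoPointDegree) (twoPointGen K) false).symm.trans d_twoPointW
    change modelProj K (cylIncl K twoPointDegree (fun _ : Unit => 0) (twoPointGen K false)) = _
    rw [h, modelProj_cylIncl]
    simp [modelImage]
  · rw [modelProj_gen]
    have h : (cylGen (fun _ : Unit => (0 : ℤ)) (twoPointGen K) (.inl true) :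
        FreeCGA K modelDegree) = 0 := map_zero _
    rw [h, map_zero]
    exact (Prod.ext (d_ground _) intervalDGA_isCDGA.d_one).symm
  · rw [modelProj_gen]
    refine (modelProj_gen (.inr (.inr ()))).trans ?_
    exact (Prod.ext (d_ground _) d_intervalT).symm
  · rw [modelProj_gen]
    refine (map_zero (modelProj K)).trans ?_
    exact (Prod.ext (d_ground _) d_intervalDT).symm

theorem modelProj_surjective : Function.Surjective (modelProj K) := by
  have h1 : ∀ b : (intervalDGA K).carrier, ∃ c, modelProj K c = (0, b) := by
    intro b
    induction b using induction with
    | one => exact ⟨_, modelProj_gen (.inl true)⟩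
    | add a b ha hb =>
      obtain ⟨c, hc⟩ := ha
      obtain ⟨c', hc'⟩ := hb
      exact ⟨c + c', by rw [map_add, hc, hc']; exact Prod.ext (add_zero _) rfl⟩
    | smul r a ha =>
      obtain ⟨c, hc⟩ := ha
      exact ⟨r • c, by rw [map_smul, hc]; exact Prod.ext (smul_zero _) rfl⟩
    | mul_gen a i ha =>
      obtain ⟨c, hc⟩ := ha
      rcases i with i | i | i
      · exact i.elim
      · exact ⟨c * gen _ (.inr (.inl i)), by
          rw [map_mul, hc, modelProj_gen]; exact Prod.ext (mul_zero _) rfl⟩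
      · exact ⟨c * gen _ (.inr (.inr i)), by
          rw [map_mul, hc, modelProj_gen]; exact Prod.ext (mul_zero _) rfl⟩
  rintro ⟨a, b⟩
  obtain ⟨r, rfl⟩ := exists_algebraMap_eq a
  obtain ⟨c, hc⟩ := h1 (b - algebraMap K _ r)
  refine ⟨algebraMap K _ r + c, ?_⟩
  rw [map_add, hc, AlgHom.commutes]
  exact Prod.ext (add_zero _) (add_sub_cancel _ _)

/-- Adjoining `t, dt` does not change cohomology, so cocycles on both sides reduce to cocycles
without these generators. A cocycle of `Λ(e, w)` is classified by its values at `e = 0` and `e = 1`,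
a class of the product by one constant on each factor. -/
theorem modelProj_isCohomologyIso : IsCohomologyIso (A := modelDGA K)
    (B := prodDGA (groundDGA K) (intervalDGA K)) (modelProj K) := by
  have hd : ∀ c, modelProj K (derivation modelDegree (cylGen _ (twoPointGen K)) c) =
      (prodDGA (groundDGA K) (intervalDGA K)).d (modelProj K c) := modelProj_isDGMorphism.2
  have hr := (cylProj_isDGMorphism (r := fun _ : Unit => 0)
    (derivation_twoPointGen (K := K))).2
  refine ⟨?_, ?_⟩
  · rintro c hc ⟨b, hb⟩
    obtain ⟨y, hy⟩ := exists_sub_eq_derivation derivation_twoPointGen c hc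
    have hpc : (twoPointDGA K).d (cylProj K twoPointDegree (fun _ : Unit => 0) c) = 0 :=
      (hr c).symm.trans (by rw [hc, map_zero])
    obtain ⟨P, hP, hP'⟩ := exists_twoPoint_primitive hpc
    have h1 : (prodDGA (groundDGA K) (intervalDGA K)).d (b - modelProj K y) =
        (algebraMap K _ (P.eval 0), algebraMap K _ (P.eval 1)) := by
      rw [map_sub, ← hd, ← hy, ← hb, map_sub, sub_sub_cancel, hP, modelProj_cylIncl]
    have h0 : P.eval 0 = 0 := by
      refine groundDGA_algebraMap_injective ?_
      have := congrArg Prod.fst h1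
      exact this.symm.trans (d_ground _)
    have h2 : P.eval 1 = 0 := by
      have := congrArg (fun x => intervalEval 0 x.2) h1
      refine Eq.trans ?_ (this.symm.trans ?_)
      · exact ((intervalEval (0 : K)).commutes _).symm
      · exact (intervalEval_isAugmentation (0 : K)).2 _
    obtain ⟨x, hx⟩ := hP' h0 h2
    refine ⟨y + cylIncl K twoPointDegree (fun _ : Unit => 0) x, ?_⟩
    change c = derivation modelDegree (cylGen _ (twoPointGen K)) _
    rw [map_add, ← hy, derivation_cylIncl, hx]
    exact (sub_add_cancel _ _).symm
  · rintro ⟨a, b⟩ hab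
    have hb : (intervalDGA K).d b = 0 := congrArg Prod.snd hab
    obtain ⟨y, hy⟩ := exists_sub_eq_derivation (fun i => i.elim) b hb
    obtain ⟨r, rfl⟩ := exists_algebraMap_eq a
    obtain ⟨r', hr'⟩ := exists_algebraMap_eq (cylProj K (Empty.elim : Empty → ℤ)
      (fun _ : Unit => 0) b)
    rw [← hr', AlgHom.commutes] at hy
    -- The linear polynomial in `e` which interpolates the constants `r` at `0` and `r'` at `1`.
    refine ⟨cylIncl K twoPointDegree (fun _ : Unit => 0) (Polynomial.aeval (R := K) (twoPointE K)
      (Polynomial.C r + Polynomial.C (r' - r) * Polynomial.X)), ?_, (0, -y), ?_⟩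
    · refine (derivation_cylIncl _).trans ?_
      have := d_twoPoint_form
        (Polynomial.C r + Polynomial.C (r' - r) * Polynomial.X) 0
      rw [map_zero, zero_mul, add_zero, zero_mul, map_zero] at this
      exact (congrArg _ this).trans (map_zero _)
    · rw [modelProj_cylIncl]
      refine Prod.ext ?_ ?_
      · simp
      · refine Eq.trans ?_ (map_neg (intervalDGA K).d y).symm
        change _ = -derivation _ _ y
        rw [← hy, neg_sub]
        simp

/-- The augmentation prescribes the values at the disjoint base point and the homotopy those on the
interval; cofibrancy lifts the pair to the free model. -/
theorem exists_model_lift {A : GradedDiffAlgebra K} (hA : A.IsCofibrant)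
    {e : A.carrier →ₐ[K] K} (he : IsAugmentation e) {H : A.carrier →ₐ[K] (intervalDGA K).carrier}
    (hH : IsDGMorphism H) : ∃ h : A.carrier →ₐ[K] (modelDGA K).carrier,
      IsDGMorphism h ∧ ∀ a, modelProj K (h a) = (algebraMap K _ (e a), H a) := by
  let F : A.carrier →ₐ[K] (prodDGA (groundDGA K) (intervalDGA K)).carrier :=
    ((Algebra.ofId K (groundDGA K).carrier).comp e).prod H
  have hF : IsDGMorphism F := by
    refine ⟨fun n a ha => ⟨?_, hH.1 n a ha⟩, fun a => Prod.ext ?_ (hH.2 a)⟩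
    · change algebraMap K _ (e a) ∈ _
      by_cases hn : n = 0
      · rw [hn, Algebra.algebraMap_eq_smul_one]
        exact Submodule.smul_mem _ _ groundDGA_isCDGA.one_mem
      · rw [he.1 n hn a ha, map_zero]
        exact Submodule.zero_mem _
    · change algebraMap K _ (e (A.d a)) = (groundDGA K).d _
      rw [he.2, map_zero, d_ground]
  obtain ⟨h, hh, hpi⟩ := hA (modelDGA K) (prodDGA (groundDGA K) (intervalDGA K)) modelDGA_isCDGA
    prod_ground_interval_isCDGA (modelProj K) F modelProj_isDGMorphism modelProj_surjective
    modelProj_isCohomologyIso hF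
  exact ⟨h, hh, fun a => DFunLike.congr_fun hpi a⟩

/-- The values of the generators `e`, `w`, `t`, `dt` at the base point (`ε = 0`) and at the points
of the interval (`ε = 1`). -/
def modelValue (ε τ : K) : Bool ⊕ (Unit ⊕ Unit) → K
  | .inl true => ε
  | .inl false => 0
  | .inr (.inl _) => τ
  | .inr (.inr _) => 0

omit [CharZero K] in
theorem modelValue_eq_zero (ε τ : K) (i : Bool ⊕ (Unit ⊕ Unit)) (hi : modelDegree i ≠ 0) :
    modelValue ε τ i = 0 := by
  rcases i with (_ | _) | _ | _
  · rfl
  · exact absurd rfl hi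
  · exact absurd rfl hi
  · rfl

theorem liftComm_modelValue_interval {τ : K} (a : (modelDGA K).carrier) :
    liftComm modelDegree (modelValue 1 τ) (modelValue_eq_zero 1 τ) a =
      intervalEval τ (modelProj K a).2 := by
  have : liftComm modelDegree (modelValue 1 τ) (modelValue_eq_zero 1 τ) =
      ((intervalEval τ).comp (AlgHom.snd K (groundDGA K).carrier (intervalDGA K).carrier)).comp
        (modelProj K) := by
    refine algHom_ext fun i => ?_
    rw [liftComm_gen, AlgHom.comp_apply, modelProj_gen]
    rcases i with (_ | _) | _ | _
    · exact (map_zero _).symm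
    · exact (map_one (intervalEval τ)).symm
    · exact (intervalEval_T τ).symm
    · exact (intervalEval_DT τ).symm
  exact DFunLike.congr_fun this a

theorem algebraMap_liftComm_modelValue (a : (modelDGA K).carrier) :
    algebraMap K _ (liftComm modelDegree (modelValue 0 0) (modelValue_eq_zero (0 : K) 0) a) =
      (modelProj K a).1 := by
  have : (Algebra.ofId K (groundDGA K).carrier).comp
      (liftComm modelDegree (modelValue 0 0) (modelValue_eq_zero 0 0)) =
      (AlgHom.fst K (groundDGA K).carrier (intervalDGA K).carrier).comp (modelProj K) := by
    refine algHom_ext fun i => ?_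
    rw [AlgHom.comp_apply, liftComm_gen, AlgHom.comp_apply, modelProj_gen]
    rcases i with (_ | _) | _ | _ <;> exact map_zero _
  exact DFunLike.congr_fun this a

end Model

/-! ### Graded symmetric functions on lists -/

section Symmetric

variable {K : Type u} [Field K] {X : Type*} {deg : X → ℤ}

namespace ShuffleAlgebra

/-- Graded symmetry under the exchange of adjacent letters. -/
def IsSymmetric (F : ShuffleAlgebra K deg) : Prop :=
  ∀ l x y r, F (l ++ x :: y :: r) = (-1) ^ (deg x * deg y) * F (l ++ y :: x :: r)

/-- The twist by the sign of the exchange with a letter. -/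
def twist (x : X) (F : ShuffleAlgebra K deg) : ShuffleAlgebra K deg :=
  fun l => (-1) ^ (deg x * listDegree deg l) * F l

theorem twist_apply (x : X) (F : ShuffleAlgebra K deg) (l : List X) :
    twist x F l = (-1) ^ (deg x * listDegree deg l) * F l := rfl

/-- Removing the first letter is a twisted derivation: if the letter belongs to `F`, it has to pass
over the arguments of `F'`. -/
theorem after_mul (x : X) (F F' : ShuffleAlgebra K deg) :
    after x (F * F') = F * after x F' + after x F * twist x F' := by
  refine ShuffleAlgebra.ext fun l => ?_
  rw [after_apply, mul_cons, add_apply, mul_apply, mul_apply]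
  congr 1
  refine shuffleSum_congr deg l fun s r _ => ?_
  rw [twist_apply, after_apply]
  ring

theorem IsSymmetric.after {F : ShuffleAlgebra K deg} (hF : F.IsSymmetric) (x : X) :
    (after x F).IsSymmetric := fun l y z r => hF (x :: l) y z r

theorem IsSymmetric.twist {F : ShuffleAlgebra K deg} (hF : F.IsSymmetric) (x : X) :
    (twist x F).IsSymmetric := fun l y z r => by
  rw [twist_apply, twist_apply, hF l y z r,
    listDegree_perm deg ((List.Perm.swap z y r).append_left l)]
  ring

theorem IsSymmetric.add {F F' : ShuffleAlgebra K deg} (hF : F.IsSymmetric) (hF' : F'.IsSymmetric) :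
    (F + F').IsSymmetric := fun l y z r => by
  rw [add_apply, add_apply, hF l y z r, hF' l y z r, mul_add]

theorem IsSymmetric.smul (c : K) {F : ShuffleAlgebra K deg} (hF : F.IsSymmetric) :
    (c • F).IsSymmetric := fun l y z r => by
  rw [smul_apply, smul_apply, hF l y z r, mul_left_comm]

theorem isSymmetric_one : (1 : ShuffleAlgebra K deg).IsSymmetric := fun l y z r => by
  rw [one_of_ne_nil (by simp), one_of_ne_nil (by simp), mul_zero]

theorem isSymmetric_ofLetters (c : X → K) :
    (ofLetters c : ShuffleAlgebra K deg).IsSymmetric := by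
  intro l y z r
  rcases l with _ | ⟨a, _ | ⟨b, l⟩⟩ <;> exact (mul_zero _).symm

theorem IsSymmetric.after_after {F : ShuffleAlgebra K deg} (hF : F.IsSymmetric) (x y : X) :
    ShuffleAlgebra.after y (ShuffleAlgebra.after x F) =
      (-1 : K) ^ (deg x * deg y) • ShuffleAlgebra.after x (ShuffleAlgebra.after y F) :=
  ShuffleAlgebra.ext fun r => hF [] x y r

theorem after_twist (x y : X) (F : ShuffleAlgebra K deg) :
    after y (twist x F) = (-1 : K) ^ (deg x * deg y) • twist x (after y F) :=
  ShuffleAlgebra.ext fun r => by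
    rw [after_apply, twist_apply, smul_apply, twist_apply, after_apply, listDegree_cons, mul_add,
      neg_one_zpow_add]
    ring

theorem twist_twist (x y : X) (F : ShuffleAlgebra K deg) :
    twist y (twist x F) = twist x (twist y F) :=
  ShuffleAlgebra.ext fun r => by
    simp only [twist_apply]
    ring

/-- For the first two letters, removing them in either order is compared by applying the twisted
Leibniz rule twice. Letters in front are stripped by induction, which replaces the factors by other
symmetric functions; hence both are generalized. -/
theorem IsSymmetric.mul {F F' : ShuffleAlgebra K deg} (hF : F.IsSymmetric)
    (hF' : F'.IsSymmetric) : (F * F').IsSymmetric := by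
  intro l
  induction l generalizing F F' with
  | nil =>
    intro x y r
    have h : ShuffleAlgebra.after y (ShuffleAlgebra.after x (F * F')) =
        (-1 : K) ^ (deg x * deg y) •
          ShuffleAlgebra.after x (ShuffleAlgebra.after y (F * F')) := by
      have hs : (-1 : K) ^ (deg x * deg y) * (-1) ^ (deg x * deg y) = 1 := neg_one_zpow_mul_self _
      rw [after_mul, after_mul, map_add, map_add, after_mul, after_mul, after_mul, after_mul,
        hF.after_after, hF'.after_after, after_twist, after_twist, twist_twist x y,
        mul_comm (deg y) (deg x)]
      simp only [mul_smul_comm, smul_mul_assoc, smul_add, smul_smul, hs, one_smul]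
      abel
    exact congrFun h r
  | cons z l ih =>
    intro x y r
    have h : ∀ T, (F * F') (z :: T) =
        (F * ShuffleAlgebra.after z F') T + (ShuffleAlgebra.after z F * ShuffleAlgebra.twist z F') T :=
      fun T => congrFun (after_mul z F F') T
    rw [List.cons_append, List.cons_append, h, h, ih hF (hF'.after z), ih (hF.after z) (hF'.twist z),
      mul_add]

end ShuffleAlgebra

theorem isSymmetric_toShuffle {G : Type} {q : G → ℤ} {F : G → ShuffleAlgebra K deg}
    (hF : ∀ i, (F i).IsHomogeneous (q i)) (hs : ∀ i, (F i).IsSymmetric) (a : FreeCGA K q) :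
    (toShuffle F hF a).IsSymmetric := by
  induction a using induction with
  | one => rw [map_one]; exact ShuffleAlgebra.isSymmetric_one
  | add a b ha hb => rw [map_add]; exact ha.add hb
  | smul c a ha => rw [map_smul]; exact ha.smul c
  | mul_gen a i ha => rw [map_mul, toShuffle_gen]; exact ha.mul (hs i)

/-- The sign of the stable sorting of a list of labelled letters. -/
def sortSign (K : Type u) [Field K] (deg : X → ℤ) : List (ℕ × X) → K
  | [] => 1
  | a :: l => (l.map fun b => if b.1 < a.1 then (-1 : K) ^ (deg a.2 * deg b.2) else 1).prod *
      sortSign K deg l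

theorem sortSign_ofFn {n : ℕ} (c : Fin n → ℕ) (x : Fin n → X) :
    sortSign K deg (List.ofFn fun i => (c i, x i)) = koszulSign K (fun i => deg (x i)) c := by
  induction n with
  | zero => simp [sortSign, koszulSign]
  | succ n ih =>
    rw [List.ofFn_succ, sortSign, koszulSign_cons, ih, List.map_ofFn, List.prod_ofFn]
    rfl

theorem ShuffleAlgebra.IsSymmetric.apply_orderedInsert {F : ShuffleAlgebra K deg}
    (hF : F.IsSymmetric) (a : ℕ × X) (l : List (ℕ × X)) (hl : l.Pairwise fun a b => a.1 ≤ b.1) :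
    F ((l.orderedInsert (fun a b => a.1 ≤ b.1) a).map Prod.snd) =
      (l.map fun b => if b.1 < a.1 then (-1 : K) ^ (deg a.2 * deg b.2) else 1).prod *
        F (a.2 :: l.map Prod.snd) := by
  induction l generalizing F with
  | nil => simp
  | cons b l ih =>
    rw [List.pairwise_cons] at hl
    rw [List.orderedInsert_cons]
    split_ifs with h
    · have h1 : ((b :: l).map fun b => if b.1 < a.1 then (-1 : K) ^ (deg a.2 * deg b.2) else 1) =
          (b :: l).map fun _ => (1 : K) := by
        refine List.map_congr_left fun b' hb' => if_neg ?_
        rcases List.mem_cons.1 hb' with rfl | hb'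
        · omega
        · have := hl.1 b' hb'; omega
      rw [h1]
      simp
    · have h1 := ih (hF.after b.2) hl.2
      rw [ShuffleAlgebra.after_apply, ShuffleAlgebra.after_apply] at h1
      rw [List.map_cons, h1, List.map_cons, List.prod_cons, if_pos (by omega), List.map_cons,
        mul_comm (deg a.2)]
      have h2 := hF [] b.2 a.2 (l.map Prod.snd)
      rw [List.nil_append, List.nil_append] at h2
      rw [h2]
      ring_nf

theorem ShuffleAlgebra.IsSymmetric.apply_insertionSort {F : ShuffleAlgebra K deg}
    (hF : F.IsSymmetric) (l : List (ℕ × X)) :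
    F ((l.insertionSort fun a b => a.1 ≤ b.1).map Prod.snd) =
      sortSign K deg l * F (l.map Prod.snd) := by
  have : Std.Total fun a b : ℕ × X => a.1 ≤ b.1 := ⟨fun a b => le_total a.1 b.1⟩
  have : IsTrans (ℕ × X) fun a b => a.1 ≤ b.1 := ⟨fun a b c => le_trans⟩
  induction l generalizing F with
  | nil => simp [sortSign]
  | cons a l ih =>
    have h1 := ih (hF.after a.2)
    rw [ShuffleAlgebra.after_apply, ShuffleAlgebra.after_apply] at h1
    rw [List.insertionSort_cons, hF.apply_orderedInsert a _ (List.pairwise_insertionSort _ _), h1,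
      sortSign, List.map_cons, mul_assoc,
      ((List.perm_insertionSort (fun a b : ℕ × X => a.1 ≤ b.1) l).map _).prod_eq]

/-- Each letter is labelled with its position after the permutation. Insertion sort by labels uses
only exchanges of adjacent letters, and their signs accumulate to the Koszul sign. -/
theorem ShuffleAlgebra.IsSymmetric.apply_perm {F : ShuffleAlgebra K deg}
    (hF : F.IsSymmetric) {n : ℕ} (x : Fin n → X) (σ : Equiv.Perm (Fin n)) :
    F (List.ofFn (x ∘ σ)) =
      koszulSign K (fun i => deg (x i)) (fun i => (σ.symm i : ℕ)) * F (List.ofFn x) := by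
  have : Std.Total fun a b : ℕ × X => a.1 ≤ b.1 := ⟨fun a b => le_total a.1 b.1⟩
  have : IsTrans (ℕ × X) fun a b => a.1 ≤ b.1 := ⟨fun a b c => le_trans⟩
  let f : Fin n → ℕ × X := fun i => (σ.symm i, x i)
  -- The permuted list carries the labels `0, …, n - 1` in order, and distinct entries have distinct
  -- labels, so it is the sorted list.
  have h1 : (List.ofFn f).insertionSort (fun a b => a.1 ≤ b.1) = List.ofFn (f ∘ σ) := by
    refine List.Perm.eq_of_pairwise (le := fun a b => a.1 ≤ b.1) ?_
      (List.pairwise_insertionSort _ _) ?_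
      ((List.perm_insertionSort _ _).trans (Equiv.Perm.ofFn_comp_perm σ f).symm)
    · intro a b ha hb h h'
      rw [List.mem_insertionSort, List.mem_ofFn] at ha
      rw [List.mem_ofFn] at hb
      obtain ⟨i, rfl⟩ := ha
      obtain ⟨j, rfl⟩ := hb
      have : σ.symm i = σ.symm (σ j) := Fin.ext (le_antisymm h h')
      rw [σ.symm.injective this]
      rfl
    · rw [List.pairwise_ofFn]
      intro i j hij
      simp only [f, Function.comp_apply, Equiv.symm_apply_apply]
      exact_mod_cast hij.le
  have h2 := hF.apply_insertionSort (List.ofFn f)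
  rw [h1, sortSign_ofFn, List.map_ofFn, List.map_ofFn] at h2
  exact h2

end Symmetric

/-! ### Substitution of linear forms for letters -/

section Substitution

variable {K : Type u} [Field K] {X Y : Type*} [Fintype Y] {deg : X → ℤ} {degY : Y → ℤ}
  (c : Y → X → K)

/-- The value on a list of the multilinear function with the given coefficients. -/
def substitute : List X → (List Y → K) → K
  | [], Φ => Φ []
  | x :: l, Φ => ∑ y, c y x * substitute l fun T => Φ (y :: T)

theorem substitute_add (l : List X) (Φ Φ' : List Y → K) :
    substitute c l (fun T => Φ T + Φ' T) = substitute c l Φ + substitute c l Φ' := by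
  induction l generalizing Φ Φ' with
  | nil => rfl
  | cons x l ih =>
    simp only [substitute, ih, mul_add, Finset.sum_add_distrib]

theorem substitute_mul_left (l : List X) (a : K) (Φ : List Y → K) :
    substitute c l (fun T => a * Φ T) = a * substitute c l Φ := by
  induction l generalizing Φ with
  | nil => rfl
  | cons x l ih =>
    simp only [substitute, ih, Finset.mul_sum, mul_left_comm]

theorem substitute_zero (l : List X) : substitute c l (fun _ => 0) = 0 := by
  have := substitute_mul_left c l 0 fun _ => 0
  simpa using this

theorem substitute_sum {ι : Type*} (s : Finset ι) (l : List X) (Φ : ι → List Y → K) :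
    substitute c l (fun T => ∑ i ∈ s, Φ i T) = ∑ i ∈ s, substitute c l (Φ i) := by
  classical
  induction s using Finset.induction_on with
  | empty => simpa using substitute_zero c l
  | insert i s hi ih => simp only [Finset.sum_insert hi, substitute_add, ih]

variable {c}

theorem substitute_congr (hc : ∀ y x, c y x ≠ 0 → deg x = degY y) (l : List X)
    {Φ Φ' : List Y → K} (h : ∀ T, T.length = l.length → listDegree degY T = listDegree deg l →
      Φ T = Φ' T) : substitute c l Φ = substitute c l Φ' := by
  induction l generalizing Φ Φ' with
  | nil => exact h [] rfl rfl
  | cons x l ih =>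
    refine Finset.sum_congr rfl fun y _ => ?_
    by_cases hy : c y x = 0
    · rw [hy, zero_mul, zero_mul]
    · rw [ih fun T h1 h2 => h (y :: T) (by simp [h1]) (by
        rw [listDegree_cons, listDegree_cons, h2, hc y x hy])]

/-- Substituting linear forms commutes with unshuffling because a form is non-zero only on letters
of its own degree, so the Koszul signs on both sides agree. -/
theorem substitute_shuffleSum (hc : ∀ y x, c y x ≠ 0 → deg x = degY y) (l : List X)
    (H : List Y → List Y → K) : substitute c l (fun T => shuffleSum degY T H) =
      shuffleSum deg l fun s r => substitute c s fun S => substitute c r fun R => H S R := by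
  induction l generalizing H with
  | nil => rfl
  | cons x l ih =>
    simp only [substitute, shuffleSum, substitute_add, ih, mul_add, Finset.sum_add_distrib]
    congr 1
    · have : ∀ (s : Finset Y), ∑ y ∈ s, c y x * shuffleSum deg l (fun s r =>
          substitute c s fun S => substitute c r fun R => H (y :: S) R) =
          shuffleSum deg l fun s' r => ∑ y ∈ s, c y x * substitute c s' fun S =>
            substitute c r fun R => H (y :: S) R := by
        classical
        intro s
        induction s using Finset.induction_on with
        | empty => simp [shuffleSum_zero]
        | insert i s hi ih =>
          simp only [Finset.sum_insert hi, shuffleSum_add, ih, shuffleSum_mul_left]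
      exact this _
    · have : ∀ (s : Finset Y), ∑ y ∈ s, c y x * shuffleSum deg l (fun s r =>
          substitute c s fun S => substitute c r fun R =>
            (-1) ^ (degY y * listDegree degY S) * H S (y :: R)) =
          shuffleSum deg l fun s' r => ∑ y ∈ s, c y x * substitute c s' fun S =>
            substitute c r fun R => (-1) ^ (degY y * listDegree degY S) * H S (y :: R) := by
        classical
        intro s
        induction s using Finset.induction_on with
        | empty => simp [shuffleSum_zero]
        | insert i s hi ih =>
          simp only [Finset.sum_insert hi, shuffleSum_add, ih, shuffleSum_mul_left]
      rw [this]
      refine shuffleSum_congr deg l fun s r _ => ?_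
      rw [substitute_sum, Finset.mul_sum]
      refine Finset.sum_congr rfl fun y _ => ?_
      by_cases hy : c y x = 0
      · simp [hy, substitute_zero]
      · rw [substitute_congr (Φ' := fun S => (-1) ^ (deg x * listDegree deg s) *
          substitute c r fun R => H S (y :: R)) hc s, substitute_mul_left, substitute_mul_left]
        · ring
        · intro S _ hS
          rw [hS, hc y x hy, substitute_mul_left]

/-- Substitution as a homomorphism. -/
noncomputable def substituteHom (hc : ∀ y x, c y x ≠ 0 → deg x = degY y) :
    ShuffleAlgebra K degY →ₐ[K] ShuffleAlgebra K deg :=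
  AlgHom.ofLinearMap
    { toFun := fun F l => substitute c l F
      map_add' := fun F F' => ShuffleAlgebra.ext fun l => substitute_add c l F F'
      map_smul' := fun a F => ShuffleAlgebra.ext fun l => substitute_mul_left c l a F }
    (ShuffleAlgebra.ext fun l => by
      rcases l with _ | ⟨x, l⟩
      · rfl
      · rw [ShuffleAlgebra.one_of_ne_nil (List.cons_ne_nil x l)]
        refine Finset.sum_eq_zero fun y _ => ?_
        have : (fun T => (1 : ShuffleAlgebra K degY) (y :: T)) = fun _ => 0 :=
          funext fun T => ShuffleAlgebra.one_of_ne_nil (List.cons_ne_nil y T)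
        rw [this, substitute_zero, mul_zero])
    (fun F F' => ShuffleAlgebra.ext fun l => by
      refine Eq.trans ?_ ((substitute_shuffleSum hc l fun s r => F' s * F r).trans ?_)
      · exact congrArg (substitute c l) (funext fun T => ShuffleAlgebra.mul_apply F F' T)
      · rw [ShuffleAlgebra.mul_apply]
        refine shuffleSum_congr deg l fun s r _ => ?_
        have h : (fun S => substitute c r fun R => F' S * F R) =
            fun S => substitute c r F * F' S := funext fun S =>
          (substitute_mul_left c r (F' S) F).trans (mul_comm _ _)
        rw [h]
        exact (substitute_mul_left c s (substitute c r F) F').trans (mul_comm _ _))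

theorem substituteHom_apply (hc : ∀ y x, c y x ≠ 0 → deg x = degY y) (F : ShuffleAlgebra K degY)
    (l : List X) : substituteHom hc F l = substitute c l F := rfl

theorem substituteHom_ofLetters [DecidableEq Y] (hc : ∀ y x, c y x ≠ 0 → deg x = degY y) (y : Y) :
    substituteHom hc (ShuffleAlgebra.ofLetters fun y' => if y' = y then 1 else 0) =
      ShuffleAlgebra.ofLetters (c y) := by
  refine ShuffleAlgebra.ext fun l => ?_
  rw [substituteHom_apply]
  rcases l with _ | ⟨x, _ | ⟨x', l⟩⟩
  · rfl
  · simp only [substitute]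
    rw [Finset.sum_eq_single y]
    · simp [ShuffleAlgebra.ofLetters]
    · intro y' _ hne
      simp [ShuffleAlgebra.ofLetters, hne]
    · simp
  · refine Finset.sum_eq_zero fun y₁ _ => ?_
    have : substitute c (x' :: l) (fun T => (ShuffleAlgebra.ofLetters
        (fun y' => if y' = y then 1 else 0) : ShuffleAlgebra K degY) (y₁ :: T)) = 0 := by
      refine Finset.sum_eq_zero fun y₂ _ => ?_
      have h : (fun T => (ShuffleAlgebra.ofLetters
        (fun y' => if y' = y then 1 else 0) : ShuffleAlgebra K degY) (y₁ :: y₂ :: T)) =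
          fun _ => 0 := rfl
      rw [h, substitute_zero, mul_zero]
    rw [this, mul_zero]

theorem substitute_ofFn {n : ℕ} (x : Fin n → X) (Φ : List Y → K) :
    substitute c (List.ofFn x) Φ =
      ∑ T : Fin n → Y, (∏ i, c (T i) (x i)) * Φ (List.ofFn T) := by
  induction n generalizing Φ with
  | zero => simp [substitute]
  | succ n ih =>
    rw [List.ofFn_succ, substitute, ← (Fin.consEquiv fun _ => Y).sum_comp, Fintype.sum_prod_type]
    refine Finset.sum_congr rfl fun y _ => ?_
    rw [ih, Finset.mul_sum]
    refine Finset.sum_congr rfl fun T _ => ?_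
    rw [Fin.prod_univ_succ, List.ofFn_succ]
    simp [Fin.consEquiv, mul_assoc]

end Substitution

/-! ### Linear forms on series -/

section SeriesForms

variable {K : Type u} [Field K]

variable (K) in
/-- Homogeneous series, with the operations of the Lawrence–Sullivan construction. -/
noncomputable def seriesBrackets : GradedBrackets K (Series K) where
  deg p :=
    { carrier := {f | ∀ W, f W ≠ 0 → wordDegree W = p}
      zero_mem' := fun _ h => absurd rfl h
      add_mem' := by
        intro f g hf hg W h
        by_cases h0 : f W = 0
        · exact hg W fun h1 => h (by simp [h0, h1])
        · exact hf W h0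
      smul_mem' := fun c f hf W h => hf W fun h0 => h (by simp [h0]) }
  br := (lawrenceSullivan K).br

theorem lawrenceSullivan_deg_le (p : ℤ) :
    (lawrenceSullivan K).deg p ≤ (seriesBrackets K).deg p := fun _ h => h.1

theorem commutator_mem_seriesBrackets {p q : ℤ} {f g : Series K} (hf : f ∈ (seriesBrackets K).deg p)
    (hg : g ∈ (seriesBrackets K).deg q) : commutator f g ∈ (seriesBrackets K).deg (p + q) := by
  intro W hW
  obtain ⟨i, -, hi⟩ := Finset.exists_ne_zero_of_sum_ne_zero hW
  have hsum := TensorSeries.wordDegree_take_add_drop W i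
  by_cases h : f (W.take i) * g (W.drop i) = 0
  · rw [h, zero_sub, neg_ne_zero] at hi
    have hi' := right_ne_zero_of_mul hi
    rw [← hsum, hg _ (left_ne_zero_of_mul hi'), hf _ (right_ne_zero_of_mul hi'), add_comm]
  · rw [← hsum, hf _ (left_ne_zero_of_mul h), hg _ (right_ne_zero_of_mul h)]

theorem letterSeries_mem_seriesBrackets (l : Letter) :
    letterSeries K l ∈ (seriesBrackets K).deg l.degree :=
  TensorSeries.letter_isHomogeneous (K := K) l

theorem neg_commutator_parity_mem {p q : ℤ} {f g : Series K} (hf : f ∈ (seriesBrackets K).deg p)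
    (hg : g ∈ (seriesBrackets K).deg q) :
    -commutator (parity f) g ∈ (seriesBrackets K).deg (p + q) :=
  Submodule.neg_mem _ (commutator_mem_seriesBrackets (fun W h => hf W (right_ne_zero_of_mul h)) hg)

theorem wordDegree_append (U V : List Letter) :
    wordDegree (U ++ V) = wordDegree U + wordDegree V := by simp [wordDegree]

variable [CharZero K]

theorem letterDifferential_mem (l : Letter) :
    letterDifferential K l ∈ (seriesBrackets K).deg (l.degree - 1) := by
  cases l
  · exact Submodule.smul_mem _ _ (commutator_mem_seriesBrackets
      (letterSeries_mem_seriesBrackets .a) (letterSeries_mem_seriesBrackets .a))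
  · exact Submodule.smul_mem _ _ (commutator_mem_seriesBrackets
      (letterSeries_mem_seriesBrackets .b) (letterSeries_mem_seriesBrackets .b))
  · exact (TensorSeries.dLetter_x_mem_lie (K := K)).1

theorem seriesDifferential_mem {p : ℤ} {f : Series K} (hf : f ∈ (seriesBrackets K).deg p) :
    seriesDifferential f ∈ (seriesBrackets K).deg (p - 1) := by
  intro W hW
  obtain ⟨i, -, hi⟩ := Finset.exists_ne_zero_of_sum_ne_zero hW
  obtain ⟨j, -, hj⟩ := Finset.exists_ne_zero_of_sum_ne_zero hi
  obtain ⟨l, -, hl⟩ := Finset.exists_ne_zero_of_sum_ne_zero hj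
  have h := right_ne_zero_of_mul hl
  have h1 := letterDifferential_mem l _ (left_ne_zero_of_mul h)
  have h2 := hf _ (right_ne_zero_of_mul h)
  rw [wordDegree_append] at h2
  have h3 : wordDegree (l :: W.drop (i + j)) = l.degree + wordDegree (W.drop (i + j)) := rfl
  have h4 := TensorSeries.wordDegree_take_add_drop W i
  have h5 := TensorSeries.wordDegree_take_add_drop (W.drop i) j
  rw [List.drop_drop] at h5
  omega

/-- Homogeneous series are closed under the operations for reasons of degree alone. This is why
lists of homogeneous series, rather than of Lie series, serve as arguments below. -/
theorem seriesBrackets_hasDegree : (seriesBrackets K).HasDegree := by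
  intro k p x hx
  rcases k with _ | _ | _ | k
  · exact Submodule.zero_mem _
  · have := seriesDifferential_mem (hx 0)
    convert this using 1
    swap
    · rfl
    congr 1
    simp
    ring
  · have := neg_commutator_parity_mem (hx 0) (hx 1)
    convert this using 1
    swap
    · rfl
    congr 1
    simp [Fin.sum_univ_two]
  · exact Submodule.zero_mem _

omit [CharZero K] in
theorem sum_letter (g : Letter → K) : ∑ l, g l = g .a + (g .b + g .x) := by
  change ∑ l ∈ {Letter.a, Letter.b, Letter.x}, g l = _
  rw [Finset.sum_insert (by simp), Finset.sum_insert (by simp), Finset.sum_singleton]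

theorem letterDifferential_nil (l : Letter) : letterDifferential K l [] = 0 :=
  TensorSeries.dLetter_nil l

theorem letterDifferential_singleton (l : Letter) (h : l ≠ .x) (y : Letter) :
    letterDifferential K l [y] = 0 := by
  by_contra h'
  have := letterDifferential_mem l _ h'
  cases l <;> cases y <;> simp [wordDegree, Letter.degree] at this h

theorem letterDifferential_x_pair {y z : Letter} (hy : y ≠ .x) (hz : z ≠ .x) :
    letterDifferential K .x [y, z] = 0 := by
  by_contra h'
  have := letterDifferential_mem .x _ h'
  cases y <;> cases z <;> simp [wordDegree, Letter.degree] at this hy hz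

theorem seriesDifferential_singleton (f : Series K) (y : Letter) :
    seriesDifferential f [y] = letterDifferential K .x [y] * f [.x] := by
  simp [seriesDifferential, Finset.sum_range_succ, letterDifferential_nil,
    letterDifferential_singleton, sum_letter, wordDegree]

omit [CharZero K] in
theorem letterDifferential_x_singleton (y : Letter) :
    letterDifferential K .x [y] = letterSeries K .b [y] - letterSeries K .a [y] := by
  simp [letterDifferential, commutator, Finset.sum_range_succ, letterSeries, wordDegree]

/-- The linear forms which correspond to the generators `e`, `w`, `t`, `dt`. -/
noncomputable def modelCoeff : Bool ⊕ (Unit ⊕ Unit) → Series K →ₗ[K] K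
  | .inl true => LinearMap.proj [.a] + LinearMap.proj [.b]
  | .inl false => (2 : K)⁻¹ • (LinearMap.proj [.a, .a] + LinearMap.proj [.a, .b] +
      (LinearMap.proj [.b, .a] + LinearMap.proj [.b, .b]))
  | .inr (.inl _) => LinearMap.proj [.b]
  | .inr (.inr _) => LinearMap.proj [.x]

omit [CharZero K] in
theorem modelCoeff_e (f : Series K) : modelCoeff (.inl true) f = f [.a] + f [.b] := rfl

omit [CharZero K] in
theorem modelCoeff_w (f : Series K) : modelCoeff (.inl false) f =
    (2 : K)⁻¹ * (f [.a, .a] + f [.a, .b] + (f [.b, .a] + f [.b, .b])) := rfl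

omit [CharZero K] in
theorem modelCoeff_t (u : Unit) (f : Series K) : modelCoeff (.inr (.inl u)) f = f [.b] := rfl

omit [CharZero K] in
theorem modelCoeff_dt (u : Unit) (f : Series K) : modelCoeff (.inr (.inr u)) f = f [.x] := rfl

omit [CharZero K] in
theorem commutator_singleton (f g : Series K) (y : Letter) : commutator f g [y] = 0 := by
  simp [commutator, Finset.sum_range_succ, wordDegree]
  ring

theorem seriesDifferential_pair (f : Series K) {y z : Letter} (hy : y ≠ .x) (hz : z ≠ .x) :
    seriesDifferential f [y, z] = letterDifferential K .x [y] * f [.x, z] -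
      letterDifferential K .x [z] * f [y, .x] + (letterDifferential K .a [y, z] * f [.a] +
        letterDifferential K .b [y, z] * f [.b]) := by
  have h : (-1 : K) ^ y.degree = -1 := by
    cases y
    · simp [Letter.degree]
    · simp [Letter.degree]
    · exact absurd rfl hy
  simp [seriesDifferential, Finset.sum_range_succ, letterDifferential_nil,
    letterDifferential_singleton, sum_letter, wordDegree, letterDifferential_x_pair hy hz, h]
  ring

theorem letterDifferential_a_pair (y z : Letter) : letterDifferential K .a [y, z] =
    if y = .a ∧ z = .a then -1 else 0 := by
  simp [letterDifferential, commutator, Finset.sum_range_succ, letterSeries, wordDegree]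
  cases y <;> cases z <;> simp [Letter.degree]
  norm_num

theorem letterDifferential_b_pair (y z : Letter) : letterDifferential K .b [y, z] =
    if y = .b ∧ z = .b then -1 else 0 := by
  simp [letterDifferential, commutator, Finset.sum_range_succ, letterSeries, wordDegree]
  cases y <;> cases z <;> simp [Letter.degree]
  norm_num

omit [CharZero K] in
theorem commutator_parity_pair (f g : Series K) {y z : Letter} (hy : y ≠ .x) (hz : z ≠ .x) :
    commutator (parity f) g [y, z] = -(f [y] * g [z] + g [y] * f [z]) := by
  have h : ∀ y, y ≠ Letter.x → y.degree = -1 := by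
    intro y hy
    cases y
    · rfl
    · rfl
    · exact absurd rfl hy
  simp [commutator, Finset.sum_range_succ, wordDegree, parity, h y hy, h z hz]
  ring

/-- Dual to `de = 0`: the linear part of `∂x` is `b - a`, on which the sum of the two coefficients
vanishes, and commutators have no words of length one. -/
theorem modelCoeff_e_bracket (l : List (Series K)) :
    modelCoeff (.inl true) (evalList (seriesBrackets K).br l) = 0 := by
  rcases l with _ | ⟨f, _ | ⟨g, _ | ⟨h, l⟩⟩⟩
  · exact map_zero _
  · change modelCoeff _ (seriesDifferential f) = 0
    rw [modelCoeff_e, seriesDifferential_singleton, seriesDifferential_singleton,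
      letterDifferential_x_singleton, letterDifferential_x_singleton]
    simp [letterSeries]
  · change modelCoeff _ (-commutator (parity f) g) = 0
    rw [modelCoeff_e, Pi.neg_apply, Pi.neg_apply, commutator_singleton, commutator_singleton]
    simp
  · exact map_zero _

theorem modelCoeff_dt_bracket (u : Unit) (l : List (Series K)) :
    modelCoeff (.inr (.inr u)) (evalList (seriesBrackets K).br l) = 0 := by
  rcases l with _ | ⟨f, _ | ⟨g, _ | ⟨h, l⟩⟩⟩
  · exact map_zero _
  · change modelCoeff _ (seriesDifferential f) = 0
    rw [modelCoeff_dt, seriesDifferential_singleton, letterDifferential_x_singleton]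
    simp [letterSeries]
  · change modelCoeff _ (-commutator (parity f) g) = 0
    rw [modelCoeff_dt, Pi.neg_apply, commutator_singleton, neg_zero]
  · exact map_zero _

theorem modelCoeff_t_bracket_one (u : Unit) (f : Series K) :
    modelCoeff (.inr (.inl u)) (evalList (seriesBrackets K).br [f]) =
      modelCoeff (.inr (.inr u)) f := by
  change modelCoeff _ (seriesDifferential f) = _
  rw [modelCoeff_t, modelCoeff_dt, seriesDifferential_singleton, letterDifferential_x_singleton]
  simp [letterSeries]

theorem modelCoeff_t_bracket (u : Unit) {l : List (Series K)} (hl : l.length ≠ 1) :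
    modelCoeff (.inr (.inl u)) (evalList (seriesBrackets K).br l) = 0 := by
  rcases l with _ | ⟨f, _ | ⟨g, _ | ⟨h, l⟩⟩⟩
  · exact map_zero _
  · exact absurd rfl hl
  · change modelCoeff _ (-commutator (parity f) g) = 0
    rw [modelCoeff_t, Pi.neg_apply, commutator_singleton, neg_zero]
  · exact map_zero _

/-- In the sum over the four words in `a, b`, the contributions of words containing `x` cancel
because the coefficients of `b - a` add up to zero. The quadratic parts `-a²` and `-b²` of `∂a` and
`∂b` remain, each counted with `½`. -/
theorem modelCoeff_w_bracket_one (f : Series K) :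
    modelCoeff (.inl false) (evalList (seriesBrackets K).br [f]) =
      -((2 : K)⁻¹ * modelCoeff (.inl true) f) := by
  change modelCoeff _ (seriesDifferential f) = _
  rw [modelCoeff_w, modelCoeff_e, seriesDifferential_pair, seriesDifferential_pair,
    seriesDifferential_pair, seriesDifferential_pair]
  · simp [letterDifferential_x_singleton, letterDifferential_a_pair, letterDifferential_b_pair,
      letterSeries]
    ring
  all_goals simp

/-- The sum over the four words factors as twice the product of the sums over the two letters. -/
theorem modelCoeff_w_bracket_two (f g : Series K) :
    modelCoeff (.inl false) (evalList (seriesBrackets K).br [f, g]) =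
      modelCoeff (.inl true) f * modelCoeff (.inl true) g := by
  change modelCoeff _ (-commutator (parity f) g) = _
  rw [modelCoeff_w, modelCoeff_e, modelCoeff_e]
  simp only [Pi.neg_apply]
  rw [commutator_parity_pair, commutator_parity_pair, commutator_parity_pair,
    commutator_parity_pair]
  · have : (2 : K) ≠ 0 := two_ne_zero
    field_simp
    ring
  all_goals simp

omit [CharZero K] in
theorem modelCoeff_w_bracket_nil :
    modelCoeff (.inl false) (evalList (seriesBrackets K).br []) = 0 := map_zero _

omit [CharZero K] in
theorem modelCoeff_w_bracket_three (f g h : Series K) (l : List (Series K)) :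
    modelCoeff (.inl false) (evalList (seriesBrackets K).br (f :: g :: h :: l)) = 0 := map_zero _

theorem modelDegree_of_modelCoeff_ne_zero (i : Bool ⊕ (Unit ⊕ Unit)) (f : (seriesBrackets K).Homog)
    (h : modelCoeff i ((seriesBrackets K).vec f) ≠ 0) :
    (seriesBrackets K).sdeg f = modelDegree i := by
  have h1 : ∀ W, (seriesBrackets K).vec f W ≠ 0 → wordDegree W = f.1 := f.2.2
  have h2 : ∀ W, modelDegree i = wordDegree W + 1 → (seriesBrackets K).vec f W ≠ 0 →
      (seriesBrackets K).sdeg f = modelDegree i := fun W hW h => by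
    rw [hW, h1 W h]; rfl
  by_contra hne
  have h3 : ∀ W, modelDegree i = wordDegree W + 1 → (seriesBrackets K).vec f W = 0 :=
    fun W hW => by
      by_contra h
      exact hne (h2 W hW h)
  apply h
  rcases i with (_ | _) | _ | _
  · rw [modelCoeff_w, h3 _ rfl, h3 _ rfl, h3 _ rfl, h3 _ rfl]; simp
  · rw [modelCoeff_e, h3 _ rfl, h3 _ rfl]; simp
  · exact h3 [.b] rfl
  · exact h3 [.x] rfl

end SeriesForms

/-! ### Evaluation of the model on series -/

section ModelEvaluation

variable {K : Type u} [Field K] [CharZero K]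

namespace ShuffleAlgebra

variable {X : Type*} {deg : X → ℤ} (c c' : X → K)

omit [CharZero K] in
theorem ofLetters_mul_ofLetters_of_length_ne_two {l : List X} (hl : l.length ≠ 2) :
    (ofLetters c * ofLetters c' : ShuffleAlgebra K deg) l = 0 := by
  rw [mul_apply]
  refine shuffleSum_eq_zero deg l fun s r h => ?_
  have h1 := h.length_eq
  rw [List.length_append] at h1
  rcases s with _ | ⟨x, _ | ⟨x', s⟩⟩
  · exact zero_mul _
  · rcases r with _ | ⟨y, _ | ⟨y', r⟩⟩
    · exact mul_zero _
    · exact absurd h1.symm hl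
    · exact mul_zero _
  · exact zero_mul _

omit [CharZero K] in
theorem ofLetters_mul_ofLetters_pair (x y : X) :
    (ofLetters c * ofLetters c' : ShuffleAlgebra K deg) [x, y] =
      c' x * c y + (-1) ^ (deg x * deg y) * (c' y * c x) := by
  simp [mul_apply, shuffleSum, listDegree]

end ShuffleAlgebra

/-- The evaluation of `Λ(e, w, t, dt)` on lists of homogeneous series. -/
noncomputable def seriesEval :
    FreeCGA K modelDegree →ₐ[K] ShuffleAlgebra K (seriesBrackets K).sdeg :=
  toShuffle (fun i => ShuffleAlgebra.ofLetters fun x => modelCoeff i ((seriesBrackets K).vec x))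
    fun i => ShuffleAlgebra.ofLetters_isHomogeneous (modelDegree_of_modelCoeff_ne_zero i)

theorem seriesEval_gen (i : Bool ⊕ (Unit ⊕ Unit)) : seriesEval (gen (K := K) modelDegree i) =
    ShuffleAlgebra.ofLetters fun x => modelCoeff i ((seriesBrackets K).vec x) :=
  toShuffle_gen _ _ _

theorem insertion_seriesEval_gen (i : Bool ⊕ (Unit ⊕ Unit)) (l : List (seriesBrackets K).Homog) :
    ShuffleAlgebra.insertion seriesBrackets_hasDegree.bracket
      (seriesEval (gen (K := K) modelDegree i)) l =
      modelCoeff i (evalList (seriesBrackets K).br (l.map (seriesBrackets K).vec)) := by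
  rw [seriesEval_gen, ShuffleAlgebra.insertion_ofLetters]
  rfl

/-- The four linear forms satisfy, dually to the brackets of the Lawrence–Sullivan construction, the
same equations as the generators `e, w, t, dt`. Hence `Λ(e, w, t, dt)` maps to functions on lists
compatibly with the differentials. -/
theorem seriesEval_cylGen (i : Bool ⊕ (Unit ⊕ Unit)) :
    seriesEval (cylGen (fun _ : Unit => (0 : ℤ)) (twoPointGen K) i : FreeCGA K modelDegree) =
      (-1 : K) ^ modelDegree i • ShuffleAlgebra.insertion seriesBrackets_hasDegree.bracket
        (seriesEval (gen modelDegree i)) := by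
  refine ShuffleAlgebra.ext fun l => ?_
  rw [ShuffleAlgebra.smul_apply, insertion_seriesEval_gen]
  rcases i with (_ | _) | u | u
  · have h : (cylGen (fun _ : Unit => (0 : ℤ)) (twoPointGen K) (.inl false) :
        FreeCGA K modelDegree) = (2 : K)⁻¹ • (gen modelDegree (.inl true) -
          gen modelDegree (.inl true) * gen modelDegree (.inl true)) := by
      change cylIncl K twoPointDegree (fun _ : Unit => 0) ((2 : K)⁻¹ • (gen twoPointDegree true -
        gen twoPointDegree true * gen twoPointDegree true)) = _
      rw [map_smul, map_sub, map_mul, cylIncl_gen]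
    have hs : (-1 : K) ^ modelDegree (.inl false) = -1 := by
      change (-1 : K) ^ (-1 : ℤ) = -1
      simp
    rw [h, hs, map_smul, map_sub, map_mul, seriesEval_gen, sub_eq_add_neg, ← neg_one_smul K,
      ShuffleAlgebra.smul_apply, ShuffleAlgebra.add_apply, ShuffleAlgebra.smul_apply]
    rcases l with _ | ⟨f, _ | ⟨g, _ | ⟨f', l⟩⟩⟩
    · rw [ShuffleAlgebra.ofLetters_mul_ofLetters_of_length_ne_two _ _ (by simp)]
      simp only [List.map_nil, modelCoeff_w_bracket_nil, ShuffleAlgebra.ofLetters_nil]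
      simp
    · rw [ShuffleAlgebra.ofLetters_mul_ofLetters_of_length_ne_two _ _ (by simp)]
      simp only [List.map_cons, List.map_nil, modelCoeff_w_bracket_one,
        ShuffleAlgebra.ofLetters_singleton]
      ring
    · rw [ShuffleAlgebra.ofLetters_mul_ofLetters_pair]
      simp only [List.map_cons, List.map_nil, modelCoeff_w_bracket_two,
        ShuffleAlgebra.ofLetters_cons_cons]
      -- If the form `e` does not vanish on `f`, then `f` has degree zero in the suspension and the
      -- exchange sign is trivial.
      by_cases hf : modelCoeff (.inl true) ((seriesBrackets K).vec f) = 0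
      · simp [hf]
      · have := modelDegree_of_modelCoeff_ne_zero _ _ hf
        rw [show (seriesBrackets K).sdeg f = 0 from this, zero_mul, zpow_zero]
        have : (2 : K) ≠ 0 := two_ne_zero
        field_simp
        ring
    · rw [ShuffleAlgebra.ofLetters_mul_ofLetters_of_length_ne_two _ _ (by simp)]
      simp only [List.map_cons, modelCoeff_w_bracket_three, ShuffleAlgebra.ofLetters_cons_cons]
      simp
  · have h : (cylGen (fun _ : Unit => (0 : ℤ)) (twoPointGen K) (.inl true) :
        FreeCGA K modelDegree) = 0 := map_zero _
    rw [h, map_zero, modelCoeff_e_bracket, mul_zero, ShuffleAlgebra.zero_apply]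
  · change seriesEval (gen modelDegree (.inr (.inr u))) l = _
    rw [seriesEval_gen]
    change _ = (-1 : K) ^ (0 : ℤ) * _
    rw [zpow_zero, one_mul]
    rcases l with _ | ⟨f, _ | ⟨g, l⟩⟩
    · rw [modelCoeff_t_bracket _ (by simp), ShuffleAlgebra.ofLetters_nil]
    · rw [List.map_singleton, modelCoeff_t_bracket_one, ShuffleAlgebra.ofLetters_singleton]
    · rw [modelCoeff_t_bracket _ (by simp), ShuffleAlgebra.ofLetters_cons_cons]
  · change seriesEval 0 l = _
    rw [map_zero, modelCoeff_dt_bracket, mul_zero, ShuffleAlgebra.zero_apply]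

theorem seriesEval_derivation {n : ℤ} {a : FreeCGA K modelDegree} (ha : a ∈ gr modelDegree n) :
    seriesEval (derivation modelDegree (cylGen (fun _ : Unit => (0 : ℤ)) (twoPointGen K)) a) =
      (-1 : K) ^ n • ShuffleAlgebra.insertion seriesBrackets_hasDegree.bracket
        (seriesEval a) := by
  refine map_derivation_eq_insertion seriesBrackets_hasDegree.sdeg_bracket _ (fun i => ?_)
    seriesEval_cylGen ha
  rw [seriesEval_gen]
  exact ShuffleAlgebra.ofLetters_isHomogeneous (modelDegree_of_modelCoeff_ne_zero i)

/-- The coefficients of elements of `Λ(e, w, t, dt)` as graded symmetric multilinear functions. -/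
noncomputable def modelCoefficients :
    FreeCGA K modelDegree →ₐ[K] ShuffleAlgebra K modelDegree :=
  toShuffle (fun i => ShuffleAlgebra.ofLetters fun y => if y = i then 1 else 0)
    fun i => ShuffleAlgebra.ofLetters_isHomogeneous fun y hy => by
      rw [ite_ne_right_iff] at hy
      rw [hy.1]

omit [CharZero K] in
theorem modelCoefficients_gen (i : Bool ⊕ (Unit ⊕ Unit)) :
    modelCoefficients (gen (K := K) modelDegree i) =
      ShuffleAlgebra.ofLetters fun y => if y = i then 1 else 0 :=
  toShuffle_gen _ _ _

/-- Both sides are algebra maps which agree on generators. This separates the finitely many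
coefficients of `a` from the linear forms on series, so that honest multilinear maps can be built
from the former. -/
theorem substitute_modelCoefficients (a : FreeCGA K modelDegree)
    (l : List (seriesBrackets K).Homog) :
    substitute (fun i x => modelCoeff i ((seriesBrackets K).vec x)) l (modelCoefficients a) =
      seriesEval a l := by
  have : (substituteHom (c := fun i x => modelCoeff i ((seriesBrackets K).vec x))
      fun i x => modelDegree_of_modelCoeff_ne_zero i x).comp modelCoefficients =
      seriesEval (K := K) :=
    algHom_ext fun i => by
      rw [AlgHom.comp_apply, modelCoefficients_gen, seriesEval_gen, substituteHom_ofLetters]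
  rw [← this]
  rfl

omit [CharZero K] in
theorem toShuffle_isHomogeneous {X : Type*} {deg : X → ℤ} {G : Type} {q : G → ℤ}
    {F : G → ShuffleAlgebra K deg} (hF : ∀ i, (F i).IsHomogeneous (q i)) {n : ℤ} {a : FreeCGA K q}
    (ha : a ∈ gr q n) : (toShuffle F hF a).IsHomogeneous n := by
  induction ha using gr_induction with
  | one => rw [map_one]; exact ShuffleAlgebra.one_isHomogeneous
  | zero => rw [map_zero]; exact fun l h => absurd rfl h
  | add n a b _ _ ha hb =>
    intro l h
    rw [map_add, ShuffleAlgebra.add_apply] at h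
    by_cases h0 : toShuffle F hF a l = 0
    · exact hb l fun h1 => h (by rw [h0, h1, add_zero])
    · exact ha l h0
  | smul n c a _ ha =>
    intro l h
    rw [map_smul, ShuffleAlgebra.smul_apply] at h
    exact ha l (right_ne_zero_of_mul h)
  | mul_gen n a i _ ha =>
    rw [map_mul, toShuffle_gen]
    exact ha.mul (hF i)

theorem seriesEval_isSymmetric (a : FreeCGA K modelDegree) : (seriesEval a).IsSymmetric :=
  isSymmetric_toShuffle _ (fun _ => ShuffleAlgebra.isSymmetric_ofLetters _) a

theorem modelCoefficients_isHomogeneous {n : ℤ} {a : FreeCGA K modelDegree}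
    (ha : a ∈ gr modelDegree n) : (modelCoefficients a).IsHomogeneous n :=
  toShuffle_isHomogeneous _ ha

omit [CharZero K] in
theorem exists_modelCoefficients_bound (a : FreeCGA K modelDegree) :
    ∃ N : ℕ, ∀ T, N ≤ T.length → modelCoefficients a T = 0 := by
  induction a using monomial_induction with
  | monomial l =>
    refine ⟨l.length + 1, fun T hT => ?_⟩
    exact toShuffle_apply_eq_zero (n := l.length) (fun i y hy => by
      rw [ite_ne_right_iff] at hy
      rw [hy.1]) (Submodule.subset_span ⟨l, rfl, rfl⟩) T (by omega)
  | add a b ha hb =>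
    obtain ⟨N, hN⟩ := ha
    obtain ⟨N', hN'⟩ := hb
    refine ⟨max N N', fun T hT => ?_⟩
    rw [map_add, ShuffleAlgebra.add_apply, hN T ((le_max_left _ _).trans hT),
      hN' T ((le_max_right _ _).trans hT), add_zero]
  | smul s a ha =>
    obtain ⟨N, hN⟩ := ha
    exact ⟨N, fun T hT => by rw [map_smul, ShuffleAlgebra.smul_apply, hN T hT, mul_zero]⟩

/-- The value on the empty list is the augmentation at the origin, that is, at the disjoint base
point. -/
theorem seriesEval_nil (a : FreeCGA K modelDegree) : seriesEval a [] =
    liftComm modelDegree (modelValue 0 0) (modelValue_eq_zero (0 : K) 0) a := by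
  induction a using induction with
  | one => rw [map_one, map_one]; rfl
  | add a b ha hb => rw [map_add, map_add, ShuffleAlgebra.add_apply, ha, hb]
  | smul c a ha => rw [map_smul, map_smul, ShuffleAlgebra.smul_apply, ha]; rfl
  | mul_gen a i ha =>
    rw [map_mul, map_mul, ShuffleAlgebra.mul_nil, ha, seriesEval_gen, liftComm_gen]
    rcases i with (_ | _) | _ | _ <;> rfl

/-- The letters `a` and `b` as homogeneous series. -/
noncomputable def endLetter (l : Letter) : (seriesBrackets K).Homog :=
  ⟨l.degree, letterSeries K l, letterSeries_mem_seriesBrackets l⟩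

theorem finsum_seriesEval_replicate {ε τ : K} {l : Letter} (hl : l.degree = -1)
    (h : ∀ i, modelCoeff i (letterSeries K l) = modelValue ε τ i) (a : FreeCGA K modelDegree) :
    ∑ᶠ n : ℕ, ((n ! : ℕ) : K)⁻¹ * seriesEval a (List.replicate n (endLetter l)) =
      liftComm modelDegree (modelValue ε τ) (modelValue_eq_zero ε τ) a := by
  have h0 : (seriesBrackets K).sdeg (endLetter l) = 0 := by
    simp [GradedBrackets.sdeg, endLetter, hl]
  let P : FreeCGA K modelDegree →ₐ[K] Polynomial K :=
    liftComm _ (fun i => Polynomial.C (modelValue ε τ i) * Polynomial.X) fun i hi => by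
      rw [modelValue_eq_zero ε τ i hi]; simp
  have hP : ∀ i, P (gen modelDegree i) = Polynomial.C (modelValue ε τ i) * Polynomial.X :=
    fun i => liftComm_gen _ _ _ i
  have h1 := egf_eq_of_gen h0 (f := seriesEval) (P := P) (fun i => by
    rw [seriesEval_gen, egf_ofLetters, hP, ← h]; rfl) a
  have h2 : (Polynomial.aeval (1 : K)).comp P =
      liftComm modelDegree (modelValue ε τ) (modelValue_eq_zero ε τ) :=
    algHom_ext fun i => by
      rw [AlgHom.comp_apply, hP, liftComm_gen]; simp
  rw [← h2, AlgHom.comp_apply, Polynomial.coe_aeval_eq_eval, eval_eq_finsum_egf h0 h1]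
  simp

theorem modelCoeff_a (i : Bool ⊕ (Unit ⊕ Unit)) :
    modelCoeff i (letterSeries K .a) = modelValue 1 0 i := by
  rcases i with (_ | _) | _ | _
  · rw [modelCoeff_w]; simp [letterSeries, modelValue]
  · rw [modelCoeff_e]; simp [letterSeries, modelValue]
  · rw [modelCoeff_t]; simp [letterSeries, modelValue]
  · rw [modelCoeff_dt]; simp [letterSeries, modelValue]

theorem modelCoeff_b (i : Bool ⊕ (Unit ⊕ Unit)) :
    modelCoeff i (letterSeries K .b) = modelValue 1 1 i := by
  rcases i with (_ | _) | _ | _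
  · rw [modelCoeff_w]; simp [letterSeries, modelValue]
  · rw [modelCoeff_e]; simp [letterSeries, modelValue]
  · rw [modelCoeff_t]; simp [letterSeries, modelValue]
  · rw [modelCoeff_dt]; simp [letterSeries, modelValue]

end ModelEvaluation

/-! ### Homotopic augmentations come from homotopic elements -/

section MorphismOfHomotopy

variable {K : Type u} [Field K] [CharZero K] {E : Type v} [AddCommGroup E] [Module K E]
  {L : MildLInfinityAlgebra K E} (h : FreeCGA K L.dualDegree →ₐ[K] FreeCGA K modelDegree)

/-- The values on lists of letters of the components of the morphism defined by `h`. -/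
noncomputable def modelVector (T : List (Bool ⊕ (Unit ⊕ Unit))) : E :=
  ∑ j : Fin (Module.finrank K (L.deg (listDegree modelDegree T - 1))),
    modelCoefficients (h (gen L.dualDegree ⟨listDegree modelDegree T - 1, j⟩)) T •
      L.basis ⟨listDegree modelDegree T - 1, j⟩

omit [CharZero K] in
theorem modelVector_mem (T : List (Bool ⊕ (Unit ⊕ Unit))) :
    modelVector h T ∈ L.deg (listDegree modelDegree T - 1) :=
  Submodule.sum_mem _ fun j _ => Submodule.smul_mem _ _ (L.basis_mem ⟨_, j⟩)

/-- The components of the morphism defined by `h`. -/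
noncomputable def modelMap (n : ℕ) : MultilinearMap K (fun _ : Fin n => Series K) E :=
  ∑ T : Fin n → Bool ⊕ (Unit ⊕ Unit),
    ((MultilinearMap.mkPiAlgebra K (Fin n) K).compLinearMap fun i => modelCoeff (T i)).smulRight
      (modelVector h (List.ofFn T))

omit [CharZero K] in
theorem modelMap_apply (n : ℕ) (x : Fin n → Series K) : modelMap h n x =
    ∑ T : Fin n → Bool ⊕ (Unit ⊕ Unit), (∏ i, modelCoeff (T i) (x i)) •
      modelVector h (List.ofFn T) := by
  rw [modelMap, MultilinearMap.sum_apply]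
  rfl

variable {h} (hdeg : ∀ n, ∀ a ∈ gr (K := K) L.dualDegree n, h a ∈ gr modelDegree n)

-- By construction the vector has coordinates only in degree `|T| - 1`; the other coefficients
-- vanish because `h` preserves degrees.
include hdeg in
theorem coord_modelVector (m : L.Index) (T : List (Bool ⊕ (Unit ⊕ Unit))) :
    L.basis.coord m (modelVector h T) = modelCoefficients (h (gen L.dualDegree m)) T := by
  classical
  by_cases hm : m.1 = listDegree modelDegree T - 1
  · obtain ⟨n, j⟩ := m
    obtain rfl : n = _ := hm
    rw [modelVector, map_sum, Finset.sum_eq_single j]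
    · simp
    · intro i _ hij
      rw [map_smul, Module.Basis.coord_apply, Module.Basis.repr_self,
        Finsupp.single_eq_of_ne (by simpa using Ne.symm hij), smul_zero]
    · simp
  · rw [L.coord_eq_zero (modelVector_mem h T) m hm]
    by_contra hne
    have h1 := modelCoefficients_isHomogeneous (hdeg _ _ (gen_mem m)) T (Ne.symm hne)
    exact hm (by rw [h1, MildLInfinityAlgebra.dualDegree]; ring)

include hdeg in
theorem coord_modelMap (m : L.Index) (n : ℕ) (x : Fin n → Series K) :
    L.basis.coord m (modelMap h n x) = ∑ T : Fin n → Bool ⊕ (Unit ⊕ Unit),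
      (∏ i, modelCoeff (T i) (x i)) * modelCoefficients (h (gen L.dualDegree m)) (List.ofFn T) := by
  rw [modelMap_apply, map_sum]
  refine Finset.sum_congr rfl fun T _ => ?_
  rw [map_smul, coord_modelVector hdeg, smul_eq_mul]

include hdeg in
theorem coord_modelMap_vec (m : L.Index) {n : ℕ} (x : Fin n → (seriesBrackets K).Homog) :
    L.basis.coord m (modelMap h n fun i => (seriesBrackets K).vec (x i)) =
      seriesEval (h (gen L.dualDegree m)) (List.ofFn x) := by
  rw [coord_modelMap hdeg, ← substitute_modelCoefficients]
  exact (substitute_ofFn (c := fun i x => modelCoeff i ((seriesBrackets K).vec x)) x _).symm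

include hdeg in
theorem coord_evalList_modelMap (m : L.Index) (l : List (seriesBrackets K).Homog) :
    L.basis.coord m (evalList (modelMap h) (l.map (seriesBrackets K).vec)) =
      seriesEval (h (gen L.dualDegree m)) l := by
  obtain ⟨n, x, rfl⟩ : ∃ n, ∃ x : Fin n → (seriesBrackets K).Homog, l = List.ofFn x :=
    ⟨_, l.get, (List.ofFn_get l).symm⟩
  rw [List.map_ofFn, evalList_ofFn]
  exact coord_modelMap_vec hdeg m x

theorem modelMap_mem {n : ℕ} {p : Fin n → ℤ} {x : Fin n → Series K}
    (hx : ∀ i, x i ∈ (lawrenceSullivan K).deg (p i)) :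
    modelMap h n x ∈ L.deg (∑ i, p i + n - 1) := by
  rw [modelMap_apply]
  refine Submodule.sum_mem _ fun T _ => ?_
  by_cases h0 : ∏ i, modelCoeff (T i) (x i) = 0
  · rw [h0, zero_smul]; exact Submodule.zero_mem _
  · have h1 : ∀ i, p i + 1 = modelDegree (T i) := fun i =>
      modelDegree_of_modelCoeff_ne_zero (T i) ⟨p i, x i, lawrenceSullivan_deg_le _ (hx i)⟩
        (Finset.prod_ne_zero_iff.1 h0 i (Finset.mem_univ i))
    have h2 : listDegree modelDegree (List.ofFn T) = ∑ i, p i + n := by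
      simp only [listDegree, List.map_ofFn, List.sum_ofFn, Function.comp_apply, ← h1,
        Finset.sum_add_distrib]
      simp
    rw [← h2]
    exact Submodule.smul_mem _ _ (modelVector_mem h _)

include hdeg in
theorem modelMap_comp_perm {n : ℕ} {p : Fin n → ℤ} {x : Fin n → Series K}
    (hx : ∀ i, x i ∈ (lawrenceSullivan K).deg (p i)) (σ : Equiv.Perm (Fin n)) :
    modelMap h n (x ∘ σ) =
      koszulSign K (fun i => p i + 1) (fun i => (σ.symm i : ℕ)) • modelMap h n x := by
  refine L.basis.ext_elem fun m => ?_
  let X : Fin n → (seriesBrackets K).Homog := fun i =>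
    ⟨p i, x i, lawrenceSullivan_deg_le _ (hx i)⟩
  have h1 := coord_modelMap_vec hdeg m (X ∘ σ)
  rw [(seriesEval_isSymmetric _).apply_perm X σ, ← coord_modelMap_vec hdeg m X, ← smul_eq_mul,
    ← map_smul] at h1
  exact h1

-- The left side is a bracket inserted into the image of a generator, hence the evaluation of `d (h
-- v)` up to sign. The right side is the evaluation of `h (d v)`, with the same sign, by the
-- substitution formula applied to `seriesEval ∘ h`.
include hdeg in
theorem modelMap_morphism
    (hd : ∀ m, h (L.dGen m) = derivation modelDegree
      (cylGen (fun _ : Unit => (0 : ℤ)) (twoPointGen K)) (h (gen L.dualDegree m)))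
    (h0 : ∀ m, seriesEval (h (gen L.dualDegree m)) [] = 0)
    {n : ℕ} {p : Fin n → ℤ} {x : Fin n → Series K}
    (hx : ∀ i, x i ∈ (lawrenceSullivan K).deg (p i)) :
    ∑ S : Finset (Fin n), koszulSign K (fun i => p i + 1) (fun i => if i ∈ S then 0 else 1) •
      modelMap h (Sᶜ.card + 1) (Matrix.vecCons ((lawrenceSullivan K).br S.card (subTuple x S))
        (subTuple x Sᶜ)) =
    ∑ m ∈ Finset.range (n + 1), ((m ! : ℕ) : K)⁻¹ • ∑ c : Fin n → Fin m,
      koszulSign K (fun i => p i + 1) (fun i => (c i : ℕ)) •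
        L.br m (fun j => modelMap h _ (subTuple x (Finset.univ.filter fun i => c i = j))) := by
  refine L.basis.ext_elem fun m => ?_
  let X : Fin n → (seriesBrackets K).Homog := fun i =>
    ⟨p i, x i, lawrenceSullivan_deg_le _ (hx i)⟩
  have h1 := sum_finset_bracket (lawrenceSullivan K) (modelMap h) (L.basis.coord m) p
    (deg := (seriesBrackets K).sdeg) (val := (seriesBrackets K).vec) X fun i => rfl
  have h2 := sum_partitions_bracket L.toGradedBrackets (modelMap h) (L.basis.coord m) p
    (deg := (seriesBrackets K).sdeg) (val := (seriesBrackets K).vec) X fun i => rfl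
  refine h1.trans (Eq.trans ?_ h2.symm)
  have h3 : ∀ s r : List (seriesBrackets K).Homog, L.basis.coord m (evalList (modelMap h)
      (evalList (lawrenceSullivan K).br (s.map (seriesBrackets K).vec) ::
        r.map (seriesBrackets K).vec)) =
      seriesEval (h (gen L.dualDegree m)) (seriesBrackets_hasDegree.bracket s :: r) :=
    fun s r => coord_evalList_modelMap hdeg m (seriesBrackets_hasDegree.bracket s :: r)
  simp only [h3]
  have h4 := congrArg (fun F => F (List.ofFn X))
    (seriesEval_derivation (hdeg _ _ (gen_mem (q := L.dualDegree) (K := K) m)))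
  rw [← hd, L.dGen_eq, map_smul, map_smul] at h4
  simp only [ShuffleAlgebra.smul_apply] at h4
  have h5 := mul_left_cancel₀ (neg_one_zpow_ne_zero (L.dualDegree m)) h4
  refine h5.symm.trans ?_
  exact map_formGen L.basis (fun k => (L.basis.coord m).compMultilinearMap (L.br k))
    (finite_support_of_locallyFinite L L L.br 2 L.br_deg L.mild m)
    (seriesEval.comp h) h0
    (fun T => evalList (modelMap h) (T.map (seriesBrackets K).vec))
    (fun i l => coord_evalList_modelMap hdeg i l) (List.ofFn X)

/-- The four forms read only words of length at most two. -/
theorem modelCoeff_eq_zero_of_mem_seriesTail {N : ℕ} (hN : 3 ≤ N) {f : Series K}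
    (hf : f ∈ seriesTail K N) (i : Bool ⊕ (Unit ⊕ Unit)) : modelCoeff i f = 0 := by
  have h1 : ∀ W : List Letter, W.length < 3 → f W = 0 := fun W hW => hf W (by omega)
  rcases i with (_ | _) | _ | _
  · rw [modelCoeff_w, h1 _ (by simp), h1 _ (by simp), h1 _ (by simp), h1 _ (by simp)]; simp
  · rw [modelCoeff_e, h1 _ (by simp), h1 _ (by simp), add_zero]
  · exact h1 _ (by simp)
  · exact h1 _ (by simp)

-- In each degree of the values there are finitely many generators, and each is sent to a
-- polynomial, which bounds the arity; the tail `3` is invisible to the linear forms.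
include hdeg in
theorem modelMap_locallyFinite : LocallyFinite (lawrenceSullivan K) (seriesTail K)
    L.toGradedBrackets (modelMap h) := by
  intro n
  choose N hN using fun j : Fin (Module.finrank K (L.deg n)) =>
    exists_modelCoefficients_bound (h (gen L.dualDegree ⟨n, j⟩))
  refine ⟨max 3 (Finset.univ.sup N), fun k p x hx hmem hk => L.basis.ext_elem fun m => ?_⟩
  rw [map_zero]
  by_cases hm : m.1 = n
  · obtain ⟨_, j⟩ := m
    obtain rfl : _ = n := hm
    refine (coord_modelMap hdeg _ k x).trans (Finset.sum_eq_zero fun T _ => ?_)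
    rcases hk with hk | ⟨i, hi⟩
    · rw [hN j _ ?_, mul_zero]
      rw [List.length_ofFn]
      exact ((Finset.le_sup (Finset.mem_univ j)).trans (le_max_right _ _)).trans hk
    · rw [Finset.prod_eq_zero (Finset.mem_univ i)
        (modelCoeff_eq_zero_of_mem_seriesTail (le_max_left _ _) hi (T i)), zero_mul]
  · exact L.coord_eq_zero hmem m hm

/-- The `L∞` morphism defined by a morphism of cochain algebras. -/
noncomputable def modelMorphism
    (hd : ∀ m, h (L.dGen m) = derivation modelDegree
      (cylGen (fun _ : Unit => (0 : ℤ)) (twoPointGen K)) (h (gen L.dualDegree m)))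
    (h0 : ∀ m, seriesEval (h (gen L.dualDegree m)) [] = 0) :
    LInfinityMorphism (lawrenceSullivan K) L.toGradedBrackets where
  map := modelMap h
  map_arity_zero := by
    ext x
    refine L.basis.ext_elem fun m => ?_
    have := coord_evalList_modelMap hdeg m []
    rw [h0] at this
    rw [MultilinearMap.zero_apply, map_zero]
    rw [Subsingleton.elim x ([] : List (Series K)).get]
    exact this
  map_deg _ _ _ hx := modelMap_mem hx
  map_symm _ _ _ hx σ := modelMap_comp_perm hdeg hx σ
  morphism _ _ _ hx := modelMap_morphism hdeg hd h0 hx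

include hdeg in
theorem coord_finsum_modelMap {ε τ : K} {l : Letter} (hl : l.degree = -1)
    (hc : ∀ i, modelCoeff i (letterSeries K l) = modelValue ε τ i)
    (hmem : letterSeries K l ∈ (lawrenceSullivan K).deg (-1)) (m : L.Index) :
    L.basis.coord m (∑ᶠ k : ℕ, ((k ! : ℕ) : K)⁻¹ • modelMap h k fun _ => letterSeries K l) =
      liftComm modelDegree (modelValue ε τ) (modelValue_eq_zero ε τ) (h (gen L.dualDegree m)) := by
  have hfin : {k : ℕ | modelMap h k (fun _ => letterSeries K l) ≠ 0}.Finite := by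
    obtain ⟨N, hN⟩ := modelMap_locallyFinite hdeg (-1)
    refine (Set.finite_lt_nat N).subset fun k hk => ?_
    by_contra hcon
    refine hk (hN k (fun _ => -1) _ (fun _ => hmem) ?_ (Or.inl (not_lt.1 hcon)))
    simpa using modelMap_mem (h := h) (x := fun _ : Fin k => letterSeries K l) fun _ => hmem
  rw [MildLInfinityAlgebra.coord_finsum hfin, ← finsum_seriesEval_replicate hl hc]
  refine finsum_congr fun k => ?_
  rw [← coord_evalList_modelMap hdeg, List.map_replicate, evalList_replicate]
  rfl

/-- The homotopy is lifted to `Λ(e, w, t, dt)` and the components of the morphism are read off. The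
letters `a` and `b` are the points `(e, t) = (1, 0)` and `(1, 1)`, so they go to the two ends of the
homotopy. -/
theorem homotopic_of_augmentationHomotopic (hL : L.cochains.IsCofibrant) {z₀ z₁ : E}
    {h₀ : z₀ ∈ L.deg (-1)} {h₁ : z₁ ∈ L.deg (-1)}
    (hz : AugmentationHomotopic (A := L.cochains) (L.augmentation h₀) (L.augmentation h₁)) :
    L.Homotopic z₀ z₁ := by
  obtain ⟨H, hH, hH0, hH1⟩ := hz
  -- The base point is assigned the Maurer–Cartan element `0`. Its augmentation kills all
  -- generators, so the lifted morphism has no component of arity zero.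
  have hzero : (0 : E) ∈ L.MC := by
    have : ∀ k : ℕ, L.br k (fun _ => 0) = 0 := by
      intro k
      rcases k with _ | k
      · rw [L.br_zero]; rfl
      · exact MultilinearMap.map_zero _
    refine ⟨Submodule.zero_mem _, ?_, ?_⟩
    · simp [this]
    · simp [this]
  obtain ⟨h, hh, hp⟩ := exists_model_lift hL
    ((MildLInfinityAlgebra.isAugmentation_iff hzero.1).2 hzero) hH
  have hdeg : ∀ n, ∀ a ∈ gr (K := K) L.dualDegree n, h a ∈ gr modelDegree n := hh.1
  have hd : ∀ m, h (L.dGen m) = derivation modelDegree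
      (cylGen (fun _ : Unit => (0 : ℤ)) (twoPointGen K)) (h (gen L.dualDegree m)) := by
    intro m
    refine Eq.trans ?_ (hh.2 (gen L.dualDegree m))
    exact congrArg h (derivation_gen (q := L.dualDegree)
      (fun m => ⟨L.dGen m, L.dGen_mem m⟩) m).symm
  have h0 : ∀ m, seriesEval (h (gen L.dualDegree m)) [] = 0 := by
    intro m
    rw [seriesEval_nil]
    refine groundDGA_algebraMap_injective ?_
    rw [algebraMap_liftComm_modelValue]
    refine (congrArg Prod.fst (hp (gen L.dualDegree m))).trans ?_
    change algebraMap K _ (L.augmentation hzero.1 (gen L.dualDegree m)) = _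
    rw [MildLInfinityAlgebra.augmentation_gen, map_zero]
    exact map_zero _
  refine ⟨modelMorphism hdeg hd h0, modelMap_locallyFinite hdeg, ?_, ?_⟩
  · refine L.basis.ext_elem fun m => ?_
    refine (coord_finsum_modelMap hdeg rfl modelCoeff_a (TensorSeries.letter_mem_lie .a) m).trans ?_
    rw [liftComm_modelValue_interval]
    refine (congrArg (fun c => intervalEval 0 c.2) (hp (gen L.dualDegree m))).trans ?_
    refine (DFunLike.congr_fun hH0 (gen L.dualDegree m)).trans ?_
    exact L.augmentation_gen h₀ m
  · refine L.basis.ext_elem fun m => ?_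
    refine (coord_finsum_modelMap hdeg rfl modelCoeff_b (TensorSeries.letter_mem_lie .b) m).trans ?_
    rw [liftComm_modelValue_interval]
    refine (congrArg (fun c => intervalEval 1 c.2) (hp (gen L.dualDegree m))).trans ?_
    refine (DFunLike.congr_fun hH1 (gen L.dualDegree m)).trans ?_
    exact L.augmentation_gen h₁ m

end MorphismOfHomotopy

/-! ### The main theorem -/

section Bijectivity

variable {K : Type u} [Field K] [CharZero K] {E : Type v} [AddCommGroup E] [Module K E]
  {F : Type w} [AddCommGroup F] [Module K F]
  {L : MildLInfinityAlgebra K E} {M : MildLInfinityAlgebra K F}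

theorem homotopic_iff (hL : L.cochains.IsCofibrant) {z₀ z₁ : E} (h₀ : z₀ ∈ L.deg (-1))
    (h₁ : z₁ ∈ L.deg (-1)) : L.Homotopic z₀ z₁ ↔
      AugmentationHomotopic (A := L.cochains) (L.augmentation h₀) (L.augmentation h₁) :=
  ⟨fun h => augmentationHomotopic_of_homotopic h h₀ h₁,
    fun h => homotopic_of_augmentationHomotopic hL h⟩

theorem LInfinityMorphism.mcMap_homotopic
    (g : LInfinityMorphism L.toGradedBrackets M.toGradedBrackets) (hg : g.IsMild)
    (hM : M.cochains.IsCofibrant) {z₀ z₁ : E} (h₀ : z₀ ∈ L.deg (-1)) (h₁ : z₁ ∈ L.deg (-1))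
    (h : L.Homotopic z₀ z₁) : M.Homotopic (g.mcMap z₀) (g.mcMap z₁) := by
  rw [homotopic_iff hM (g.mcMap_mem_deg h₀) (g.mcMap_mem_deg h₁), ← g.augmentation_comp hg h₀,
    ← g.augmentation_comp hg h₁]
  exact (augmentationHomotopic_of_homotopic h h₀ h₁).comp (g.cochainsMap_isDGMorphism hg)

/-- The Maurer–Cartan element which corresponds to the pullback of an augmentation. -/
theorem exists_pullback {f : L.cochains.carrier →ₐ[K] M.cochains.carrier} (hf : IsDGMorphism f)
    (z : M.MC) : ∃ y : L.MC, L.augmentation y.2.1 = (M.augmentation z.2.1).comp f := by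
  obtain ⟨y, hy, hyMC, h⟩ := MildLInfinityAlgebra.exists_augmentation_eq
    (((MildLInfinityAlgebra.isAugmentation_iff z.2.1).2 z.2).comp hf)
  exact ⟨⟨y, hyMC⟩, h⟩

/-- The map of homotopy classes induced by a morphism of cochain algebras. -/
noncomputable def pullbackClass (hL : L.cochains.IsCofibrant)
    {f : L.cochains.carrier →ₐ[K] M.cochains.carrier} (hf : IsDGMorphism f) :
    M.MCTilde → L.MCTilde :=
  Quot.map (fun z => (exists_pullback hf z).choose) fun z₀ z₁ h => by
    rw [homotopic_iff hL (exists_pullback hf z₀).choose.2.1 (exists_pullback hf z₁).choose.2.1,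
      (exists_pullback hf z₀).choose_spec, (exists_pullback hf z₁).choose_spec]
    exact (augmentationHomotopic_of_homotopic h z₀.2.1 z₁.2.1).comp hf

theorem pullbackClass_eq_mk (hL : L.cochains.IsCofibrant)
    {f : L.cochains.carrier →ₐ[K] M.cochains.carrier} (hf : IsDGMorphism f) (z : M.MC) (y : L.MC)
    (h : AugmentationHomotopic (A := L.cochains) ((M.augmentation z.2.1).comp f)
      (L.augmentation y.2.1)) :
    pullbackClass hL hf (Quot.mk _ z) = Quot.mk _ y := by
  refine Quot.sound ?_
  rw [homotopic_iff hL (exists_pullback hf z).choose.2.1 y.2.1,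
    (exists_pullback hf z).choose_spec]
  exact h

theorem exists_cochains_homotopy_inverse (hL : L.cochains.IsCofibrant)
    {f : M.cochains.carrier →ₐ[K] L.cochains.carrier} (hf : IsDGMorphism f)
    (hq : IsCohomologyIso f) :
    ∃ (h : L.cochains.carrier →ₐ[K] M.cochains.carrier), IsDGMorphism h ∧ IsCohomologyIso h ∧
      ∀ z : L.MC, AugmentationHomotopic (A := L.cochains)
        (((L.augmentation z.2.1).comp f).comp h) (L.augmentation z.2.1) := by
  obtain ⟨h, h1, h2, h3⟩ := exists_homotopy_inverse L.derivation_dGen M.derivation_dGen hL f hf hq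
  exact ⟨h, h1, h2, fun z => h3 _ ((MildLInfinityAlgebra.isAugmentation_iff z.2.1).2 z.2)⟩

theorem pullbackClass_comp (hL : L.cochains.IsCofibrant) (hM : M.cochains.IsCofibrant)
    {f : M.cochains.carrier →ₐ[K] L.cochains.carrier} (hf : IsDGMorphism f)
    {h : L.cochains.carrier →ₐ[K] M.cochains.carrier} (hh : IsDGMorphism h)
    (hfh : ∀ z : L.MC, AugmentationHomotopic (A := L.cochains)
        (((L.augmentation z.2.1).comp f).comp h) (L.augmentation z.2.1)) (c : L.MCTilde) :
    pullbackClass hL hh (pullbackClass hM hf c) = c := by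
  induction c using Quot.ind with
  | mk z =>
    refine pullbackClass_eq_mk hL hh _ z ?_
    rw [(exists_pullback hf z).choose_spec]
    exact hfh z

/-- With `h` inverse to `f` up to homotopy on one side, and `k` likewise for `h`, the induced maps
satisfy `h* f* = id` and `k* h* = id`. So `f*` and `h*` are injective, and `h* f* h* = h*` gives the
surjectivity of `f*`. -/
theorem pullbackClass_bijective (hL : L.cochains.IsCofibrant) (hM : M.cochains.IsCofibrant)
    {f : M.cochains.carrier →ₐ[K] L.cochains.carrier} (hf : IsDGMorphism f)
    (hq : IsCohomologyIso f) : Function.Bijective (pullbackClass hM hf) := by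
  obtain ⟨h, hh, hhq, hfh⟩ := exists_cochains_homotopy_inverse hL hf hq
  obtain ⟨k, hk, -, hhk⟩ := exists_cochains_homotopy_inverse hM hh hhq
  have h1 := pullbackClass_comp hL hM hf hh hfh
  have h2 := pullbackClass_comp hM hL hh hk hhk
  have h3 : Function.Injective (pullbackClass hL hh) := Function.LeftInverse.injective h2
  refine ⟨Function.LeftInverse.injective h1, fun c => ⟨pullbackClass hL hh c, h3 ?_⟩⟩
  exact h1 _

end Bijectivity

end MaurerCartan

theorem mainTheorem10 {K : Type u} [Field K] [CharZero K]
    {E : Type v} [AddCommGroup E] [Module K E] {F : Type w} [AddCommGroup F] [Module K F]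
    (L : MaurerCartan.MildLInfinityAlgebra K E) (M : MaurerCartan.MildLInfinityAlgebra K F)
    (g : MaurerCartan.LInfinityMorphism L.toGradedBrackets M.toGradedBrackets) (hg : g.IsMild)
    (hL : L.cochains.IsCofibrant) (hM : M.cochains.IsCofibrant)
    (hq : MaurerCartan.IsCohomologyIso g.cochainsMap) :
    ∃ (hMC : ∀ z ∈ L.MC, g.mcMap z ∈ M.MC)
      (hsim : ∀ z₀ z₁ : L.MC, L.Homotopic (z₀ : E) (z₁ : E) →
        M.Homotopic (g.mcMap z₀) (g.mcMap z₁)),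
      Function.Bijective
        (Quot.map (fun z : L.MC => (⟨g.mcMap z, hMC z z.2⟩ : M.MC)) hsim :
          L.MCTilde → M.MCTilde) := by
  refine ⟨fun z hz => g.mcMap_mem hg hz,
    fun z₀ z₁ h => g.mcMap_homotopic hg hM z₀.2.1 z₁.2.1 h, ?_⟩
  have hf := g.cochainsMap_isDGMorphism hg
  -- The map in the statement is the one induced by `C^∞(g)`: the representative chosen there has
  -- the same augmentation as `g.mcMap z`, hence equals it.
  refine (congrArg Function.Bijective (funext fun c => ?_)).mpr
    (MaurerCartan.pullbackClass_bijective hL hM hf hq)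
  induction c using Quot.ind with
  | mk z =>
    refine congrArg (Quot.mk _) (Subtype.ext ?_)
    refine MaurerCartan.MildLInfinityAlgebra.augmentation_injective
      (hz := g.mcMap_mem_deg z.2.1)
      (hz' := (MaurerCartan.exists_pullback hf z).choose.2.1) ?_
    exact (g.augmentation_comp hg z.2.1).symm.trans
      (MaurerCartan.exists_pullback hf z).choose_spec.symm
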